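/- Let $\mathbb K$ be $\mathbb R$ or $\mathbb C$ (smooth means holomorphic if $\mathbb K=\mathbb C$), let $W$ be a finite-dimensional vector space over $\mathbb K$ and $G\subset GL(W)$ a Lie subgroup (an embedded submanifold) with Lie algebra $g$. Let $V=\bigoplus_i V_i$ be a finite-dimensional $\mathbb Z$-graded vector space, $V^i=\bigoplus_{j\ge i}V_j$, and $J:V\to W$ an isomorphism. Put $\mathcal G=J^{-1}GJ$, $\mathfrak g=J^{-1}gJ\subset\mathfrak{gl}(V)$, let $\mathcal O$ be the $G$-orbit of the flag $\{J(V^i)\}_i$, and assume that $(G,\mathcal O)$ is compatible with respect to the grading: $\mathfrak g=\bigoplus_k\mathfrak g_k$, where $\mathfrak g_k$ consists of the elements of $\mathfrak g$ of degree $k$. Write $(x)_k$ for the degree $k$ component of $x\in\mathfrak{gl}(V)$, $\mathfrak g_+=\bigoplus_{k\ge0}\mathfrak g_k$, $\mathfrak g_{>0}=\bigoplus_{k>0}\mathfrak g_k$, and $\mathcal G_+$ (respectively $\mathcal G_0$) for the group of elements of $\mathcal G$ that preserve all $V^i$ (respectively all $V_i$). Let $t\mapsto\Lambda(t)=\{\Lambda_i(t)\}_i$,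 with $t$ in an open set $D\subset\mathbb K$, be a smooth curve in $\mathcal O$ that is compatible with respect to differentiation: if $\ell$ is a smooth curve of vectors with $\ell(t)\in\Lambda_i(t)$ for all $t$, then $\ell'(t)\in\Lambda_{i-1}(t)$. Let $\delta_t:\Lambda_i(t)/\Lambda_{i+1}(t)\to\Lambda_{i-1}(t)/\Lambda_i(t)$ be the induced maps $[\ell(t)]\mapsto[\ell'(t)]$. Let $\widehat P(t)$ be the set of isomorphisms $A:V\to W$ with $A(V^i)=\Lambda_i(t)$ for all $i$ and $A\circ J^{-1}\in G$. Let $\mathfrak m\subset\mathfrak g_{-1}$ be a line, and suppose that the curve has constant symbol $\mathfrak m$: for every $t\in D$ there is $A\in\widehat P(t)$ with $\mathbb K(A^{-1}\circ\delta_t\circ A)_{-1}=\mathfrak m$. Let $\widehat P_0(t)$ be the set of all such $A$; these sets are the fibres of $\widehat P_0$. Put $\mathfrak u_{-1}=\mathfrak m$, $\mathfrak u_k=\{X\in\mathfrak g_k:[X,\delta]\in\mathfrak u_{k-1}\ \forall\delta\in\mathfrak m\}$ for $k\ge0$, and $\mathfrak u_+(\mathfrak m)=\bigoplus_{k\ge0}\mathfrak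 u_k$. Let $U_+(\mathfrak m)$ be the group of those elements of $\mathcal G_+$ that map the curve of flags $s\mapsto\{e^{s\delta}V^i\}_i$, $\delta\in\mathfrak m$, near $s=0$ to itself up to reparametrization. Let $C^1_+=\operatorname{Hom}(\mathfrak m,\mathfrak g_+)$, and $\partial:\mathfrak g\to\operatorname{Hom}(\mathfrak m,\mathfrak g)$, $\partial x(\delta)=[\delta,x]$. A normalization condition is a graded subspace $\mathcal N$ of $C^1_+$ (that is, $\mathcal N=\bigoplus_{k>0}\mathcal N\cap\operatorname{Hom}(\mathfrak m,\mathfrak g_{k-1})$) complementary in $C^1_+$ to $\operatorname{Hom}(\mathfrak m,\mathfrak u_+(\mathfrak m))+(\operatorname{Im}\partial\cap C^1_+)$. A smooth (locally trivial) fibre subbundle $P$ of $\widehat P_0$ is called quasi-principal with symbol $\mathfrak u_+(\mathfrak m)$ if for each $\psi\in P(t)$, $t\in D$, the subspace $L_\psi=\{\psi^{-1}\circ X:X\in T_\psi P(t)\}$ of $\mathfrak{gl}(V)$, filtered by the degree, has associated graded space $\operatorname{gr}L_\psi=\mathfrak u_+(\mathfrak m)\subset\mathfrak{gl}(V)$.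 An Ehresmann connection on $P$ is a smooth rank $1$ distribution $\mathcal H$ on $P$ transversal to the fibres. Its structure function $c$ assigns to $\psi\in P$ the map $c(\psi)\in\operatorname{Hom}(\mathfrak m,\mathfrak g)$, $c(\psi)(\delta)=\psi^{-1}\circ\psi'$, where $\psi'$ is the velocity of an $\mathcal H$-horizontal curve through $\psi$ with $(\psi^{-1}\circ\psi')_{-1}=\delta$. Call $(P,\mathcal H)$ $\mathcal N$-normalized if $P$ is a quasi-principal subbundle of $\widehat P_0$ with symbol $\mathfrak u_+(\mathfrak m)$ and $\mathcal H$ is an Ehresmann connection on it for which the positive part $\delta\mapsto\sum_{k\ge0}(c(\psi)(\delta))_k$ of the structure function lies in $\mathcal N$ for all $\psi\in P$. Call $P$ complete if for all $t\in D$ and $\psi\in\widehat P_0(t)$ the set $\{x\in\mathfrak g_{>0}:\psi\circ e^x\in P(t)\}$ is non-empty and closed. **Theorem 4.1.** Let $\mathcal N$ be a normalization condition. Then there is an $\mathcal N$-normalized pair $(P,\mathcal H)$ with $P$ complete, and it is unique: $P'=P$ and $\mathcal H'=\mathcal H$ for every $\mathcal N$-normalized pair $(P',\mathcal H')$ with $P'$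 complete. Moreover, every $\mathcal N$-normalized pair $(P',\mathcal H')$, complete or not, satisfies $P'\subset P$ and $\mathcal H'=\mathcal H|_{P'}$. If, in addition, $\mathcal N$ is invariant under the action $(B.c)(\delta)=(\operatorname{Ad}B)\,c\bigl(((\operatorname{Ad}B^{-1})\delta)_{-1}\bigr)$ of $U_+(\mathfrak m)$, and $\mathcal G_+=\mathcal G_0\cdot\exp(\mathfrak g_{>0})$, then $P$ is a principal bundle with structure group $U_+(\mathfrak m)$, acting by $\psi\mapsto\psi\circ B$. -/

import Mathlib

open scoped ContDiff Topology

noncomputable section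

namespace FlagCurve

/-! ### Submanifolds of a normed space

`𝕜` is `ℝ` or `ℂ`; for `𝕜 = ℂ` smoothness means holomorphy. -/

section Submanifold

variable (𝕜 : Type*) [RCLike 𝕜] {E : Type*} [NormedAddCommGroup E] [NormedSpace 𝕜 E]

/-- `M` is an embedded `𝕜`-submanifold of `E`: near each of its points a smooth local
diffeomorphism of `E` straightens `M` to a linear subspace. -/
def IsSubmanifold (M : Set E) : Prop :=
  ∀ p ∈ M, ∃ e : OpenPartialHomeomorph E E, p ∈ e.source ∧
    ContDiffOn 𝕜 ∞ e e.source ∧ ContDiffOn 𝕜 ∞ e.symm e.target ∧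
    ∃ S : Submodule 𝕜 E, ∀ q ∈ e.source, q ∈ M ↔ e q ∈ S

/-- The tangent space of `M` at `p`, spanned by the velocities of the smooth curves in `M` through
`p` (for a submanifold these velocities already form a subspace). -/
def tangentAt (M : Set E) (p : E) : Submodule 𝕜 E :=
  Submodule.span 𝕜 {v | ∃ γ : 𝕜 → E, ContDiffAt 𝕜 ∞ γ 0 ∧ γ 0 = p ∧
    (∀ᶠ s in 𝓝 (0 : 𝕜), γ s ∈ M) ∧ deriv γ 0 = v}

end Submanifold

variable {𝕜 : Type*} [RCLike 𝕜]
variable {V : Type*} [NormedAddCommGroup V] [NormedSpace 𝕜 V]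
variable {W : Type*} [NormedAddCommGroup W] [NormedSpace 𝕜 W]

/-! ### The graded space `V` and the induced grading and filtration of `gl(V)` -/

section Grading

variable (𝒱 : ℤ → Submodule 𝕜 V)

/-- The filtration `V^i = ⨁_{j ≥ i} V_j`. -/
def filt (i : ℤ) : Submodule 𝕜 V := ⨆ j : ℤ, ⨆ _ : i ≤ j, 𝒱 j

/-- Endomorphisms of degree `k`: `x (V_i) ⊆ V_{i+k}`. -/
def homDeg (k : ℤ) : Submodule 𝕜 (V →L[𝕜] V) where
  carrier := {x | ∀ i, ∀ v ∈ 𝒱 i, x v ∈ 𝒱 (i + k)}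
  add_mem' hx hy i v hv := add_mem (hx i v hv) (hy i v hv)
  zero_mem' i _ _ := zero_mem (𝒱 (i + k))
  smul_mem' a _ hx i v hv := Submodule.smul_mem _ a (hx i v hv)

/-- Endomorphisms of filtration degree at least `k`: `x (V^i) ⊆ V^{i+k}`. -/
def homFilt (k : ℤ) : Submodule 𝕜 (V →L[𝕜] V) where
  carrier := {x | ∀ i, ∀ v ∈ filt 𝒱 i, x v ∈ filt 𝒱 (i + k)}
  add_mem' hx hy i v hv := add_mem (hx i v hv) (hy i v hv)
  zero_mem' i _ _ := zero_mem (filt 𝒱 (i + k))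
  smul_mem' a _ hx i v hv := Submodule.smul_mem _ a (hx i v hv)

variable [DirectSum.Decomposition 𝒱]

/-- The projection of `V` onto `V_j`. -/
def proj (j : ℤ) : V →ₗ[𝕜] V :=
  (𝒱 j).subtype ∘ₗ DirectSum.component 𝕜 ℤ (fun i => 𝒱 i) j ∘ₗ
    (DirectSum.decomposeLinearEquiv 𝒱).toLinearMap

/-- The projection of `V` onto `V^i` along `⨁_{j < i} V_j`. -/
def projGE (i : ℤ) : V →ₗ[𝕜] V :=
  DirectSum.toModule 𝕜 ℤ V (fun j => if i ≤ j then (𝒱 j).subtype else 0) ∘ₗ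
    (DirectSum.decomposeLinearEquiv 𝒱).toLinearMap

variable [FiniteDimensional 𝕜 V]

/-- Given operators `Q i` of `V`, the map sending `x` to the endomorphism that is `Q i ∘ x` on
`V_i` for every `i`. -/
def blockPart (Q : ℤ → V →ₗ[𝕜] V) : (V →L[𝕜] V) →ₗ[𝕜] (V →L[𝕜] V) where
  toFun x := LinearMap.toContinuousLinearMap
    (DirectSum.toModule 𝕜 ℤ V (fun i => Q i ∘ₗ x.toLinearMap ∘ₗ (𝒱 i).subtype) ∘ₗ
      (DirectSum.decomposeLinearEquiv 𝒱).toLinearMap)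
  map_add' x y := by
    rw [← map_add, ← LinearMap.add_comp]
    congr 2
    ext i v
    simp
  map_smul' a x := by
    rw [RingHom.id_apply, ← map_smul, ← LinearMap.smul_comp]
    congr 2
    ext i v
    simp

/-- `x ↦ (x)_k`, the component of degree `k` of an endomorphism. -/
def degPart (k : ℤ) : (V →L[𝕜] V) →ₗ[𝕜] (V →L[𝕜] V) :=
  blockPart 𝒱 fun i => proj 𝒱 (i + k)

/-- `x ↦ ∑_{k ≥ 0} (x)_k`, the part of non-negative degree of an endomorphism. -/
def nonnegPart : (V →L[𝕜] V) →ₗ[𝕜] (V →L[𝕜] V) :=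
  blockPart 𝒱 fun i => projGE 𝒱 i

/-- The associated graded subspace `gr L = ⨁_k {(x)_k : x ∈ L, x (V^i) ⊆ V^{i+k}}` of a subspace
`L` of `gl(V)`, viewed inside `gl(V)`. -/
def grSubspace (L : Submodule 𝕜 (V →L[𝕜] V)) : Submodule 𝕜 (V →L[𝕜] V) :=
  ⨆ k : ℤ, (L ⊓ homFilt 𝒱 k).map (degPart 𝒱 k)

end Grading

/-! ### The group -/

section Group

variable (J : V ≃L[𝕜] W) (G : Subgroup (W ≃L[𝕜] W))

/-- Invertible operators viewed as points of the normed space of operators. -/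
def opSet (S : Set (V ≃L[𝕜] W)) : Set (V →L[𝕜] W) :=
  (fun A : V ≃L[𝕜] W => (A : V →L[𝕜] W)) '' S

/-- `G` is a Lie subgroup of `GL(W)` (over `𝕜`). -/
def IsLieSubgroup : Prop := IsSubmanifold 𝕜 (opSet (G : Set (W ≃L[𝕜] W)))

/-- The group `𝒢 = J⁻¹ G J` of operators of `V`. -/
def modelGroup : Set (V ≃L[𝕜] V) := {B | (J.symm.trans B).trans J ∈ G}

/-- The Lie algebra `𝔤` of `𝒢`: its tangent space at the identity. -/
def modelLie : Submodule 𝕜 (V →L[𝕜] V) :=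
  tangentAt 𝕜 (opSet (modelGroup J G)) (ContinuousLinearMap.id 𝕜 V)

variable (𝒱 : ℤ → Submodule 𝕜 V)

/-- `𝔤_k`, the elements of degree `k` of `𝔤`. -/
def lieDeg (k : ℤ) : Submodule 𝕜 (V →L[𝕜] V) := modelLie J G ⊓ homDeg 𝒱 k

/-- The elements of `𝔤` of filtration degree at least `k`; `k = 0` gives `𝔤_+`, and `k = 1` gives
the sum of the `𝔤_j` with `j > 0`. -/
def lieFilt (k : ℤ) : Submodule 𝕜 (V →L[𝕜] V) := modelLie J G ⊓ homFilt 𝒱 k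

/-- `𝒢_+`, the elements of `𝒢` that preserve the filtration of `V`. -/
def modelPlus : Set (V ≃L[𝕜] V) :=
  {B | B ∈ modelGroup J G ∧ ∀ i, (filt 𝒱 i).map (B : V →L[𝕜] V).toLinearMap = filt 𝒱 i}

/-- `𝒢_+ = 𝒢_0 · exp(⨁_{k > 0} 𝔤_k)`, where `𝒢_0` consists of the elements of `𝒢` that preserve
every `V_i`. -/
def PlusSplits : Prop :=
  ∀ B ∈ modelPlus J G 𝒱, ∃ B₀ ∈ modelGroup J G,
    (∀ i, (𝒱 i).map (B₀ : V →L[𝕜] V).toLinearMap = 𝒱 i) ∧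
    ∃ x ∈ lieFilt J G 𝒱 1, (B : V →L[𝕜] V) = (B₀ : V →L[𝕜] V) ∘L NormedSpace.exp x

variable [DirectSum.Decomposition 𝒱] [FiniteDimensional 𝕜 V]

/-- `𝔤 = ⨁_k 𝔤_k`, i.e. `𝔤` contains the homogeneous components of its elements. -/
def IsGradedLie : Prop := ∀ x ∈ modelLie J G, ∀ k, degPart 𝒱 k x ∈ modelLie J G

end Group

/-! ### Curves of flags -/

section Curve

variable (𝒱 : ℤ → Submodule 𝕜 V) (J : V ≃L[𝕜] W) (G : Subgroup (W ≃L[𝕜] W))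
variable (D : Set 𝕜) (Λ : 𝕜 → ℤ → Submodule 𝕜 W)

/-- `t ↦ Λ(t)` is a smooth curve in the `G`-orbit `𝒪 = G / Stab` of the flag `f₀ = J(V^•)`, that is,
locally of the form `t ↦ g(t) f₀` with a smooth curve `g` in `G`. -/
def IsSmoothOrbitCurve : Prop :=
  ∀ t ∈ D, ∃ U : Set 𝕜, IsOpen U ∧ t ∈ U ∧ U ⊆ D ∧ ∃ g : 𝕜 → (W ≃L[𝕜] W),
    ContDiffOn 𝕜 ∞ (fun τ => (g τ : W →L[𝕜] W)) U ∧
    ∀ τ ∈ U, g τ ∈ G ∧ ∀ i, Λ τ i =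
      ((filt 𝒱 i).map (J : V →L[𝕜] W).toLinearMap).map (g τ : W →L[𝕜] W).toLinearMap

/-- Compatibility with respect to differentiation: smooth curves of vectors in `Λ_i` have their
velocities in `Λ_{i-1}`. -/
def IsCompatible : Prop :=
  ∀ i : ℤ, ∀ U : Set 𝕜, IsOpen U → U ⊆ D → ∀ l : 𝕜 → W, ContDiffOn 𝕜 ∞ l U →
    (∀ τ ∈ U, l τ ∈ Λ τ i) → ∀ τ ∈ U, deriv l τ ∈ Λ τ (i - 1)

/-- The fibre over `Λ(t)` of the bundle `P̂`: isomorphisms `A : V → W` with `A (V^i) = Λ_i(t)` and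
`A ∘ J⁻¹ ∈ G` (the latter implies that `A` conjugates `𝒢` to `G`). -/
def bigFiber (t : 𝕜) : Set (V ≃L[𝕜] W) :=
  {A | (∀ i, (filt 𝒱 i).map (A : V →L[𝕜] W).toLinearMap = Λ t i) ∧ J.symm.trans A ∈ G}

/-- `x` is the endomorphism `(A⁻¹ ∘ δ_t ∘ A)_{-1}` of degree `-1`, where
`δ_t : Λ_i(t)/Λ_{i+1}(t) → Λ_{i-1}(t)/Λ_i(t)` is the velocity of the curve at `t`: it sends the
class of `l(t)` to the class of `l'(t)`, for any smooth curve of vectors `l(τ) ∈ Λ_i(τ)`. -/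
def IsVelocityIn (t : 𝕜) (A : V ≃L[𝕜] W) (x : V →L[𝕜] V) : Prop :=
  x ∈ homDeg 𝒱 (-1) ∧ ∀ i, ∀ v ∈ 𝒱 i, ∀ l : 𝕜 → W, ContDiffAt 𝕜 ∞ l t → l t = A v →
    (∀ᶠ τ in 𝓝 t, l τ ∈ Λ τ i) → deriv l t - A (x v) ∈ Λ t i

/-- The symbol of the curve at `t`, a set of lines of degree `-1` endomorphisms. -/
def symbolAt (t : 𝕜) : Set (Submodule 𝕜 (V →L[𝕜] V)) :=
  {L | ∃ A ∈ bigFiber 𝒱 J G Λ t, ∃ x, IsVelocityIn 𝒱 Λ t A x ∧ L = Submodule.span 𝕜 {x}}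

variable (m : Submodule 𝕜 (V →L[𝕜] V))

/-- The fibre of the bundle `P̂₀` over `Λ(t)`. -/
def frameFiber (t : 𝕜) : Set (V ≃L[𝕜] W) :=
  {A | A ∈ bigFiber 𝒱 J G Λ t ∧ ∃ x, IsVelocityIn 𝒱 Λ t A x ∧ m = Submodule.span 𝕜 {x}}

end Curve

/-! ### Prolongation of the symbol and normalization conditions -/

section Algebra

variable (𝒱 : ℤ → Submodule 𝕜 V) (J : V ≃L[𝕜] W) (G : Subgroup (W ≃L[𝕜] W))
variable (m : Submodule 𝕜 (V →L[𝕜] V))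

/-- `prolong n` is `𝔲_{n-1}`: `𝔲_{-1} = 𝔪` and
`𝔲_k = {X ∈ 𝔤_k : [X, δ] ∈ 𝔲_{k-1} for all δ ∈ 𝔪}` for `k ≥ 0`. -/
def prolong : ℕ → Submodule 𝕜 (V →L[𝕜] V)
  | 0 => m
  | n + 1 =>
    { carrier := {X | X ∈ lieDeg J G 𝒱 (n : ℤ) ∧ ∀ δ ∈ m, X * δ - δ * X ∈ prolong n}
      add_mem' := fun {X Y} hX hY => ⟨add_mem hX.1 hY.1, fun δ hδ => by
        have h := add_mem (hX.2 δ hδ) (hY.2 δ hδ)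
        rwa [show (X + Y) * δ - δ * (X + Y) = X * δ - δ * X + (Y * δ - δ * Y) by
          rw [add_mul, mul_add]; abel]⟩
      zero_mem' := ⟨zero_mem _, fun δ _ => by simp⟩
      smul_mem' := fun a X hX => ⟨Submodule.smul_mem _ a hX.1, fun δ hδ => by
        have h := Submodule.smul_mem _ a (hX.2 δ hδ)
        rwa [smul_sub, ← smul_mul_assoc, ← mul_smul_comm] at h⟩ }

/-- `𝔲_+(𝔪) = ⨁_{k ≥ 0} 𝔲_k`. -/
def uPlus : Submodule 𝕜 (V →L[𝕜] V) := ⨆ n : ℕ, prolong 𝒱 J G m (n + 1)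

/-- `Hom(𝔪, S)`, as a subspace of `Hom(𝔪, gl(V))`. -/
def homInto (S : Submodule 𝕜 (V →L[𝕜] V)) : Submodule 𝕜 (m →ₗ[𝕜] (V →L[𝕜] V)) where
  carrier := {c | ∀ δ, c δ ∈ S}
  add_mem' hc hd δ := add_mem (hc δ) (hd δ)
  zero_mem' _ := zero_mem S
  smul_mem' a _ hc δ := Submodule.smul_mem _ a (hc δ)

/-- The coboundary operator `(∂x)(δ) = [δ, x]`. -/
def coboundary : (V →L[𝕜] V) →ₗ[𝕜] (m →ₗ[𝕜] (V →L[𝕜] V)) where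
  toFun x :=
    { toFun := fun δ => (δ : V →L[𝕜] V) * x - x * (δ : V →L[𝕜] V)
      map_add' := fun δ ε => by
        rw [Submodule.coe_add, add_mul, mul_add]; abel
      map_smul' := fun a δ => by
        rw [RingHom.id_apply, Submodule.coe_smul, smul_sub, smul_mul_assoc, mul_smul_comm] }
  map_add' x y := by
    ext1 δ
    simp only [LinearMap.coe_mk, AddHom.coe_mk, LinearMap.add_apply, mul_add, add_mul]
    abel
  map_smul' a x := by
    ext1 δ
    simp only [LinearMap.coe_mk, AddHom.coe_mk, LinearMap.smul_apply, RingHom.id_apply, smul_sub,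
      smul_mul_assoc, mul_smul_comm]

/-- `C¹_+ = ⨁_{k > 0} Hom(𝔪, 𝔤_{k-1}) = Hom(𝔪, 𝔤_+)`. -/
def cochainsPlus : Submodule 𝕜 (m →ₗ[𝕜] (V →L[𝕜] V)) := homInto m (lieFilt J G 𝒱 0)

/-- `Hom(𝔪, 𝔲_+(𝔪)) + (Im ∂ ∩ C¹_+)`, where `∂ : 𝔤 → C¹`. -/
def trivialCochains : Submodule 𝕜 (m →ₗ[𝕜] (V →L[𝕜] V)) :=
  homInto m (uPlus 𝒱 J G m) ⊔ ((modelLie J G).map (coboundary m) ⊓ cochainsPlus 𝒱 J G m)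

/-- `U_+(𝔪)`: the elements of `𝒢` that preserve the filtration `V^•` and map the curve of flags
`s ↦ e^{sδ} V^•` (near its point `s = 0`) to itself, up to reparametrization. -/
def symGroup : Set (V ≃L[𝕜] V) :=
  {B | B ∈ modelPlus J G 𝒱 ∧ ∀ δ ∈ m, ∃ σ : 𝕜 → 𝕜, ContDiffAt 𝕜 ∞ σ 0 ∧ σ 0 = 0 ∧
    ∀ᶠ s in 𝓝 (0 : 𝕜), ∀ i,
      ((filt 𝒱 i).map (NormedSpace.exp (s • δ)).toLinearMap).map (B : V →L[𝕜] V).toLinearMap =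
        (filt 𝒱 i).map (NormedSpace.exp (σ s • δ)).toLinearMap}

variable [DirectSum.Decomposition 𝒱] [FiniteDimensional 𝕜 V]

/-- A normalization condition: a graded subspace of `C¹_+` complementary to
`Hom(𝔪, 𝔲_+(𝔪)) + (Im ∂ ∩ C¹_+)`. -/
structure IsNormalization (N : Submodule 𝕜 (m →ₗ[𝕜] (V →L[𝕜] V))) : Prop where
  disjoint : N ⊓ trivialCochains 𝒱 J G m = ⊥
  span : N ⊔ trivialCochains 𝒱 J G m = cochainsPlus 𝒱 J G m
  graded : ∀ c ∈ N, ∀ k : ℤ, degPart 𝒱 k ∘ₗ c ∈ N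

/-- `c' = B.c` for the action `(B.c)(δ) = Ad B (c ((Ad B⁻¹ δ)_{-1}))` on cochains. -/
def IsActionOf (B : V ≃L[𝕜] V) (c c' : m →ₗ[𝕜] (V →L[𝕜] V)) : Prop :=
  ∀ δ : m, ∃ ε : m,
    (ε : V →L[𝕜] V) =
      degPart 𝒱 (-1) ((B.symm : V →L[𝕜] V) ∘L (δ : V →L[𝕜] V) ∘L (B : V →L[𝕜] V)) ∧
    c' δ = (B : V →L[𝕜] V) ∘L c ε ∘L (B.symm : V →L[𝕜] V)

/-- `N` is invariant under the action of `U_+(𝔪)`. -/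
def IsInvariant (N : Submodule 𝕜 (m →ₗ[𝕜] (V →L[𝕜] V))) : Prop :=
  ∀ B ∈ symGroup 𝒱 J G m, ∀ c ∈ N, ∀ c', IsActionOf 𝒱 m B c c' → c' ∈ N

end Algebra

/-! ### Bundles of moving frames -/

section Bundle

variable (𝒱 : ℤ → Submodule 𝕜 V) (J : V ≃L[𝕜] W) (G : Subgroup (W ≃L[𝕜] W))
variable (D : Set 𝕜) (Λ : 𝕜 → ℤ → Submodule 𝕜 W) (m : Submodule 𝕜 (V →L[𝕜] V))
variable (P : 𝕜 → Set (V ≃L[𝕜] W)) (H : 𝕜 → (V ≃L[𝕜] W) → Submodule 𝕜 (𝕜 × (V →L[𝕜] W)))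

/-- The total space over `U` of a family of sets of frames. -/
def totalSpace (U : Set 𝕜) : Set (𝕜 × (V →L[𝕜] W)) := {p | p.1 ∈ U ∧ p.2 ∈ opSet (P p.1)}

/-- `P` is a smooth, locally trivial fibre subbundle of `P̂₀` over the curve. -/
structure IsFiberSubbundle : Prop where
  subset : ∀ t ∈ D, P t ⊆ frameFiber 𝒱 J G Λ m t
  nonempty : ∀ t ∈ D, (P t).Nonempty
  fiber : ∀ t ∈ D, IsSubmanifold 𝕜 (opSet (P t))
  locTriv : ∀ t ∈ D, ∃ U : Set 𝕜, IsOpen U ∧ t ∈ U ∧ U ⊆ D ∧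
    ∃ φ χ : 𝕜 × (V →L[𝕜] W) → (V →L[𝕜] W),
      ContDiffOn 𝕜 ∞ φ (U ×ˢ opSet (P t)) ∧ ContDiffOn 𝕜 ∞ χ (totalSpace P U) ∧
      ∀ τ ∈ U, Set.MapsTo (fun a => φ (τ, a)) (opSet (P t)) (opSet (P τ)) ∧
        Set.MapsTo (fun a => χ (τ, a)) (opSet (P τ)) (opSet (P t)) ∧
        Set.InvOn (fun a => χ (τ, a)) (fun a => φ (τ, a)) (opSet (P t)) (opSet (P τ))

/-- `L_ψ = {ψ⁻¹ ∘ X : X ∈ T_ψ P(t)} ⊆ gl(V)`. -/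
def verticalSpace (t : 𝕜) (ψ : V ≃L[𝕜] W) : Submodule 𝕜 (V →L[𝕜] V) :=
  (tangentAt 𝕜 (opSet (P t)) (ψ : V →L[𝕜] W)).comap
    (ContinuousLinearMap.compL 𝕜 V V W (ψ : V →L[𝕜] W)).toLinearMap

/-- `H` is an Ehresmann connection on `P`: a smooth rank one distribution transversal to the
fibres, spanned by the horizontal lift `(1, h)` of the coordinate field on the base. -/
def IsEhresmann : Prop :=
  ∃ h : 𝕜 × (V →L[𝕜] W) → (V →L[𝕜] W), ContDiffOn 𝕜 ∞ h (totalSpace P D) ∧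
    ∀ t ∈ D, ∀ ψ ∈ P t,
      ((1 : 𝕜), h (t, ψ)) ∈ tangentAt 𝕜 (totalSpace P D) (t, (ψ : V →L[𝕜] W)) ∧
      H t ψ = Submodule.span 𝕜 {((1 : 𝕜), h (t, ψ))}

/-- `P` is complete in `P̂₀`: it meets each orbit `{ψ ∘ exp x : x ∈ ⨁_{k > 0} 𝔤_k}`, `ψ ∈ P̂₀(t)`, in
a non-empty closed subset. -/
def IsComplete : Prop :=
  ∀ t ∈ D, ∀ ψ ∈ frameFiber 𝒱 J G Λ m t,
    {x | x ∈ lieFilt J G 𝒱 1 ∧ (ψ : V →L[𝕜] W) ∘L NormedSpace.exp x ∈ opSet (P t)}.Nonempty ∧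
    IsClosed {x | x ∈ lieFilt J G 𝒱 1 ∧ (ψ : V →L[𝕜] W) ∘L NormedSpace.exp x ∈ opSet (P t)}

/-- The fibres of the bundle `P` are the orbits of the free right action `ψ ↦ ψ ∘ B` of
`U_+(𝔪)`. -/
def IsPrincipal : Prop :=
  ∀ t ∈ D, ∀ ψ ∈ P t, P t = {ψ' | ∃ B ∈ symGroup 𝒱 J G m, ψ' = B.trans ψ}

variable [DirectSum.Decomposition 𝒱] [FiniteDimensional 𝕜 V]

/-- `P` is a quasi-principal subbundle of `P̂₀` with symbol `𝔰`. -/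
def IsQuasiPrincipal (𝔰 : Submodule 𝕜 (V →L[𝕜] V)) : Prop :=
  IsFiberSubbundle 𝒱 J G D Λ m P ∧
    ∀ t ∈ D, ∀ ψ ∈ P t, grSubspace 𝒱 (verticalSpace P t ψ) = 𝔰

/-- `c` is the value at `ψ ∈ P(t)` of the structure function: `c(δ) = ψ⁻¹ ∘ ψ'` for the velocity
`ψ'` of a horizontal curve through `ψ` with `(ψ⁻¹ ∘ ψ')_{-1} = δ`. -/
def IsStructureFunctionAt (t : 𝕜) (ψ : V ≃L[𝕜] W) (c : m →ₗ[𝕜] (V →L[𝕜] V)) : Prop :=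
  ∀ δ : m, ∃ v ∈ H t ψ, degPart 𝒱 (-1) ((ψ.symm : W →L[𝕜] V) ∘L v.2) = δ ∧
    c δ = (ψ.symm : W →L[𝕜] V) ∘L v.2

/-- The positive part of the structure function of `(P, H)` takes values in `N`. -/
def SatisfiesNormalization (N : Submodule 𝕜 (m →ₗ[𝕜] (V →L[𝕜] V))) : Prop :=
  ∀ t ∈ D, ∀ ψ ∈ P t, ∃ c, IsStructureFunctionAt 𝒱 m H t ψ c ∧ nonnegPart 𝒱 ∘ₗ c ∈ N

/-- `P` is a quasi-principal subbundle of `P̂₀` with symbol `𝔲_+(𝔪)`, and `H` is an Ehresmann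
connection on it that satisfies the normalization condition `N`. -/
structure IsNormalized (N : Submodule 𝕜 (m →ₗ[𝕜] (V →L[𝕜] V))) : Prop where
  quasiPrincipal : IsQuasiPrincipal 𝒱 J G D Λ m P (uPlus 𝒱 J G m)
  ehresmann : IsEhresmann D P H
  normalized : SatisfiesNormalization 𝒱 D m P H N

end Bundle

end FlagCurve

end

/-! Everything takes place in the total space S of P̂₀, a subset of 𝕜 × Hom(V, W). Locally over D it
is the product of the base with a group, `lineSet`: the elements of 𝒢_+ whose part of degree 0
preserves the line 𝔪. The product structure needs a smooth adapted frame. For any section A of P̂,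
compatibility gives A⁻¹A' degree at least -1, and constancy of the symbol puts its part of degree -1
into the cone over a single orbit of 𝒢_+, acting through parts of degree 0. Such a curve lifts
smoothly to the group even when the orbit is not embedded (`IsSmoothAction.exists_lift`); correcting
A by the lift gives the adapted section (`exists_isFrameSection`).

The normalization is done one degree at a time. Put R_0 = S, and let R_{k+1} consist of the points ψ
of R_k at which some velocity (1, ψ ∘ c) tangent to R_k has components of degrees 0, …, k in 𝒩,
where 𝒩 is identified with its values at a generator δ of 𝔪. Right translation by e^x, with x of
degree at least k+1, keeps the components of c below k and adds l[δ, x_{k+1}] to the component of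
degree k, where c_{-1} = lδ; vertical vectors change that component by 𝔲_k. Hence ψ e^x lies in
R_{k+1} exactly if c_k + l[δ, x_{k+1}] ∈ 𝒩 + 𝔲_k (`IsReduction.rmul_mem_reduce_iff`). That 𝒩 and the
trivial cochains span makes this solvable; that they meet in 0 makes x_{k+1} unique modulo 𝔲_{k+1}.
With a complement s_j of 𝔲_j in 𝔤_j fixed, each point of S is moved to R_k by exactly one e^v with v
in s_1 ⊕ … ⊕ s_k. Uniqueness lets smooth local formulas for v be glued
(`IsReduction.exists_isReduction_reduce`). Degrees are bounded, so the tower becomes normalized in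
all degrees after finitely many steps. Its last stage is P, with vertical spaces of graded type
𝔲_+(𝔪). Since s_j is chosen to contain the part of 𝒩 of degree j, the tangent velocity with
components in the s_j is unique and automatically normalized; it is the connection.

Uniqueness is built into the construction: a normalized pair supplies normalized velocities tangent
to itself, so it lies in every R_k (`subset_tower`). If it is moreover complete, then its fibres are
open in those of P because the vertical spaces have equal graded spaces, and closedness together
with connectedness of 𝔤_{>0} gives equality (`IsReduction.framesIn_eq`).

For the principal bundle, U_+(𝔪) is compared with the universal prolongation 𝔪 ⊕ 𝔲_+(𝔪). A symmetry
B has (Ad B⁻¹)δ in it (`conj_mem_of_mem_symGroup`), and an element B of 𝒢_+ with (Ad B)δ in it is a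
symmetry (`mem_symGroup_of_conj_mem`). The first fact makes every stage stable under U_+(𝔪) when 𝒩
is invariant (`rmul_mem_tower`). Transitivity follows by splitting the element between two frames of
a fibre into a part of degree 0 and an exponential, and peeling the exponential off degree by
degree. -/

set_option linter.unusedSectionVars false

noncomputable section

namespace FlagCurve

/-! ### Graded and filtered endomorphisms -/

section GradedAlgebra

variable {𝕜 : Type*} [RCLike 𝕜]
variable {V : Type*} [NormedAddCommGroup V] [NormedSpace 𝕜 V]
variable (𝒱 : ℤ → Submodule 𝕜 V)

theorem homFilt_mul {a b : ℤ} {x y : V →L[𝕜] V} (hx : x ∈ homFilt 𝒱 a) (hy : y ∈ homFilt 𝒱 b) :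
    x * y ∈ homFilt 𝒱 (a + b) := fun i v hv => by
  have := hx _ _ (hy i v hv)
  rwa [add_assoc, add_comm b a] at this

theorem filt_antitone : Antitone (filt 𝒱) := fun _ _ hij =>
  iSup_mono fun _ => iSup_mono' fun h => ⟨hij.trans h, le_rfl⟩

theorem homFilt_antitone : Antitone (homFilt 𝒱) := fun _ _ hab _ hx i v hv =>
  filt_antitone 𝒱 (by lia) (hx i v hv)

theorem le_filt {i j : ℤ} (h : i ≤ j) : 𝒱 j ≤ filt 𝒱 i := le_iSup₂_of_le j h le_rfl

theorem homFilt_iff {k : ℤ} {x : V →L[𝕜] V} :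
    x ∈ homFilt 𝒱 k ↔ ∀ i, ∀ v ∈ 𝒱 i, x v ∈ filt 𝒱 (i + k) := by
  refine ⟨fun h i v hv => h i v (le_filt 𝒱 le_rfl hv), fun h i => ?_⟩
  have : filt 𝒱 i ≤ (filt 𝒱 (i + k)).comap x.toLinearMap :=
    iSup₂_le fun j hj v hv => filt_antitone 𝒱 (by lia) (h j v hv)
  exact this

theorem homDeg_le_homFilt (k : ℤ) : homDeg 𝒱 k ≤ homFilt 𝒱 k := fun _ hx =>
  (homFilt_iff 𝒱).2 fun i v hv => le_filt 𝒱 le_rfl (hx i v hv)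

theorem homDeg_mul {a b : ℤ} {x y : V →L[𝕜] V} (hx : x ∈ homDeg 𝒱 a) (hy : y ∈ homDeg 𝒱 b) :
    x * y ∈ homDeg 𝒱 (a + b) := fun i v hv => by
  have := hx _ _ (hy i v hv)
  rwa [add_assoc, add_comm b a] at this

theorem one_mem_homDeg : (1 : V →L[𝕜] V) ∈ homDeg 𝒱 0 := fun i v hv => by simpa using hv

theorem homFilt_comm {a b : ℤ} {x y : V →L[𝕜] V} (hx : x ∈ homFilt 𝒱 a) (hy : y ∈ homFilt 𝒱 b) :
    x * y - y * x ∈ homFilt 𝒱 (a + b) :=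
  sub_mem (homFilt_mul 𝒱 hx hy) (by rw [add_comm]; exact homFilt_mul 𝒱 hy hx)

variable [DirectSum.Decomposition 𝒱]

theorem proj_mem (j : ℤ) (v : V) : proj 𝒱 j v ∈ 𝒱 j := (DirectSum.decompose 𝒱 v j).2

theorem proj_of_mem {j : ℤ} {v : V} (h : v ∈ 𝒱 j) : proj 𝒱 j v = v :=
  DirectSum.decompose_of_mem_same 𝒱 h

theorem proj_of_mem_ne {i j : ℤ} {v : V} (h : v ∈ 𝒱 i) (hij : i ≠ j) : proj 𝒱 j v = 0 :=
  DirectSum.decompose_of_mem_ne 𝒱 h hij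

theorem ext_proj {v w : V} (h : ∀ j, proj 𝒱 j v = proj 𝒱 j w) : v = w :=
  (DirectSum.decompose 𝒱).injective (DFinsupp.ext fun j => Subtype.ext (h j))

theorem mem_of_forall_proj {S : Submodule 𝕜 V} {v : V} (h : ∀ j, proj 𝒱 j v ∈ S) : v ∈ S := by
  classical
  rw [← DirectSum.sum_support_decompose 𝒱 v]
  exact Submodule.sum_mem _ fun j _ => h j

theorem ext_grading {F : Type*} [AddCommGroup F] [Module 𝕜 F] {f g : V →ₗ[𝕜] F}
    (h : ∀ i, ∀ v ∈ 𝒱 i, f v = g v) : f = g := by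
  ext v
  exact LinearMap.mem_eqLocus.1 (mem_of_forall_proj 𝒱 (S := LinearMap.eqLocus f g)
    fun j => h j _ (proj_mem 𝒱 j v))

theorem ext_grading_clm {F : Type*} [NormedAddCommGroup F] [NormedSpace 𝕜 F] {f g : V →L[𝕜] F}
    (h : ∀ i, ∀ v ∈ 𝒱 i, f v = g v) : f = g :=
  ContinuousLinearMap.coe_inj.1 (ext_grading 𝒱 h)

theorem mem_filt_iff {i : ℤ} {v : V} : v ∈ filt 𝒱 i ↔ ∀ j < i, proj 𝒱 j v = 0 := by
  constructor
  · intro hv j hj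
    have : filt 𝒱 i ≤ LinearMap.ker (proj 𝒱 j) :=
      iSup₂_le fun k hk w hw => proj_of_mem_ne 𝒱 hw (by lia)
    exact this hv
  · refine fun h => mem_of_forall_proj 𝒱 fun j => ?_
    by_cases hj : j < i
    · rw [h j hj]; exact zero_mem _
    · exact le_filt 𝒱 (not_lt.1 hj) (proj_mem 𝒱 j v)

theorem projGE_of_mem {i j : ℤ} {v : V} (h : v ∈ 𝒱 j) :
    projGE 𝒱 i v = if i ≤ j then v else 0 := by
  have : DirectSum.decompose 𝒱 v = DirectSum.of (fun j => 𝒱 j) j ⟨v, h⟩ :=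
    DirectSum.decompose_of_mem 𝒱 h
  simp only [projGE, LinearMap.comp_apply, LinearEquiv.coe_coe,
    DirectSum.decomposeLinearEquiv_apply, this]
  rw [← DirectSum.lof_eq_of 𝕜, DirectSum.toModule_lof]
  split_ifs <;> rfl

theorem proj_projGE (i j : ℤ) (v : V) :
    proj 𝒱 j (projGE 𝒱 i v) = if i ≤ j then proj 𝒱 j v else 0 := by
  have : proj 𝒱 j ∘ₗ projGE 𝒱 i = if i ≤ j then proj 𝒱 j else 0 := by
    refine ext_grading 𝒱 fun k v hv => ?_
    rw [LinearMap.comp_apply, projGE_of_mem 𝒱 hv]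
    by_cases hkj : k = j
    · subst hkj; split_ifs <;> simp
    · split_ifs <;> simp [proj_of_mem_ne 𝒱 hv hkj]
  rw [← LinearMap.comp_apply, this]; split_ifs <;> rfl

variable [FiniteDimensional 𝕜 V]

theorem blockPart_apply (Q : ℤ → V →ₗ[𝕜] V) (x : V →L[𝕜] V) {i : ℤ} {v : V} (hv : v ∈ 𝒱 i) :
    blockPart 𝒱 Q x v = Q i (x v) := by
  have : DirectSum.decompose 𝒱 v = DirectSum.of (fun j => 𝒱 j) i ⟨v, hv⟩ :=
    DirectSum.decompose_of_mem 𝒱 hv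
  simp only [blockPart, LinearMap.coe_mk, AddHom.coe_mk, LinearMap.coe_toContinuousLinearMap',
    LinearMap.comp_apply, LinearEquiv.coe_coe, DirectSum.decomposeLinearEquiv_apply, this]
  rw [← DirectSum.lof_eq_of 𝕜, DirectSum.toModule_lof]
  rfl

theorem degPart_apply (k : ℤ) (x : V →L[𝕜] V) {i : ℤ} {v : V} (hv : v ∈ 𝒱 i) :
    degPart 𝒱 k x v = proj 𝒱 (i + k) (x v) := blockPart_apply 𝒱 _ x hv

theorem nonnegPart_apply (x : V →L[𝕜] V) {i : ℤ} {v : V} (hv : v ∈ 𝒱 i) :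
    nonnegPart 𝒱 x v = projGE 𝒱 i (x v) := blockPart_apply 𝒱 _ x hv

theorem degPart_mem (k : ℤ) (x : V →L[𝕜] V) : degPart 𝒱 k x ∈ homDeg 𝒱 k := fun i v hv => by
  rw [degPart_apply 𝒱 k x hv]; exact proj_mem 𝒱 _ _

theorem degPart_of_mem {k : ℤ} {x : V →L[𝕜] V} (hx : x ∈ homDeg 𝒱 k) : degPart 𝒱 k x = x :=
  ext_grading_clm 𝒱 fun i v hv => by
    rw [degPart_apply 𝒱 k x hv, proj_of_mem 𝒱 (hx i v hv)]

theorem degPart_of_mem_ne {j k : ℤ} {x : V →L[𝕜] V} (hx : x ∈ homDeg 𝒱 j) (hjk : j ≠ k) :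
    degPart 𝒱 k x = 0 :=
  ext_grading_clm 𝒱 fun i v hv => by
    rw [degPart_apply 𝒱 k x hv, proj_of_mem_ne 𝒱 (hx i v hv) (by lia)]; rfl

theorem degPart_degPart (j k : ℤ) (x : V →L[𝕜] V) :
    degPart 𝒱 j (degPart 𝒱 k x) = if k = j then degPart 𝒱 k x else 0 := by
  split_ifs with h
  · subst h; exact degPart_of_mem 𝒱 (degPart_mem 𝒱 _ x)
  · exact degPart_of_mem_ne 𝒱 (degPart_mem 𝒱 _ x) h

theorem ext_degPart {x y : V →L[𝕜] V} (h : ∀ k, degPart 𝒱 k x = degPart 𝒱 k y) : x = y :=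
  ext_grading_clm 𝒱 fun i v hv => ext_proj 𝒱 fun j => by
    have := DFunLike.congr_fun (h (j - i)) v
    rwa [degPart_apply 𝒱 _ x hv, degPart_apply 𝒱 _ y hv, add_sub_cancel] at this

/-- Filtration degree is read off from the vanishing of low components. All arguments on leading
terms pass through this form. -/
theorem mem_homFilt_iff {k : ℤ} {x : V →L[𝕜] V} :
    x ∈ homFilt 𝒱 k ↔ ∀ j < k, degPart 𝒱 j x = 0 := by
  rw [homFilt_iff]
  constructor
  · refine fun h j hj => ext_grading_clm 𝒱 fun i v hv => ?_
    rw [degPart_apply 𝒱 j x hv, (mem_filt_iff 𝒱).1 (h i v hv) _ (by lia)]; rfl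
  · refine fun h i v hv => (mem_filt_iff 𝒱).2 fun j hj => ?_
    have := DFunLike.congr_fun (h (j - i) (by lia)) v
    rwa [degPart_apply 𝒱 _ x hv, add_sub_cancel] at this

theorem degPart_of_homFilt {j k : ℤ} {x : V →L[𝕜] V} (hx : x ∈ homFilt 𝒱 k) (h : j < k) :
    degPart 𝒱 j x = 0 := (mem_homFilt_iff 𝒱).1 hx j h

theorem homFilt_succ {k : ℤ} {x : V →L[𝕜] V} (hx : x ∈ homFilt 𝒱 k) (h : degPart 𝒱 k x = 0) :
    x ∈ homFilt 𝒱 (k + 1) := by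
  rw [mem_homFilt_iff] at hx ⊢
  intro j hj
  rcases (Int.lt_add_one_iff.1 hj).lt_or_eq with h' | rfl
  exacts [hx j h', h]

theorem sub_degPart_mem {k : ℤ} {x : V →L[𝕜] V} (hx : x ∈ homFilt 𝒱 k) :
    x - degPart 𝒱 k x ∈ homFilt 𝒱 (k + 1) :=
  homFilt_succ 𝒱 (sub_mem hx (homDeg_le_homFilt 𝒱 k (degPart_mem 𝒱 k x)))
    (by rw [map_sub, degPart_degPart, if_pos rfl, sub_self])

/-- Outside a bounded range of degrees the components of an endomorphism vanish. -/
theorem exists_depth : ∃ n : ℕ, ∀ k : ℤ, (n : ℤ) ≤ |k| → ∀ x, degPart 𝒱 k x = 0 := by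
  classical
  have hfin : {i | 𝒱 i ≠ ⊥}.Finite :=
    WellFoundedGT.finite_ne_bot_of_iSupIndep
      (DirectSum.Decomposition.isInternal 𝒱).submodule_iSupIndep
  obtain ⟨a, ha⟩ := (hfin.image (fun i => |i|)).bddAbove
  have key : ∀ i, |a| < |i| → 𝒱 i = ⊥ := fun i hi => by
    by_contra h
    exact absurd (ha ⟨i, h, rfl⟩) (not_le.2 ((le_abs_self a).trans_lt hi))
  -- All nonzero `𝒱 i` have |i| ≤ |a|, and a shift by more than 2|a| moves such an i out of this
  -- range.
  refine ⟨(2 * |a| + 1).toNat, fun k hk x => ext_grading_clm 𝒱 fun i v hv => ?_⟩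
  rw [degPart_apply 𝒱 k x hv]
  by_cases hi : |a| < |i|
  · rw [key i hi, Submodule.mem_bot] at hv
    simp [hv]
  · have h1 : |a| < |i + k| := by
      have h2 := abs_sub_abs_le_abs_sub k (-i)
      rw [abs_neg, sub_neg_eq_add, add_comm k i] at h2
      have h3 := Int.self_le_toNat (2 * |a| + 1)
      lia
    have := proj_mem 𝒱 (i + k) (x v)
    rw [key _ h1, Submodule.mem_bot] at this
    rw [this]; rfl

theorem mem_of_forall_degPart {S : Submodule 𝕜 (V →L[𝕜] V)} {x : V →L[𝕜] V}
    (h : ∀ k, degPart 𝒱 k x ∈ S) : x ∈ S := by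
  obtain ⟨n, hn⟩ := exists_depth 𝒱
  have : x = ∑ k ∈ Finset.Icc (-(n : ℤ)) n, degPart 𝒱 k x := by
    refine ext_degPart 𝒱 fun j => ?_
    rw [map_sum]
    simp only [degPart_degPart, Finset.sum_ite_eq', Finset.mem_Icc]
    split_ifs with hj
    · rfl
    · exact hn j (by rw [le_abs]; lia) x
  rw [this]
  exact Submodule.sum_mem _ fun k _ => h k

theorem homFilt_eq_bot_of_le {n : ℕ} (hn : ∀ k : ℤ, (n : ℤ) ≤ |k| → ∀ x, degPart 𝒱 k x = 0)
    {k : ℤ} (hk : (n : ℤ) ≤ k) {x : V →L[𝕜] V} (hx : x ∈ homFilt 𝒱 k) : x = 0 := by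
  refine ext_degPart 𝒱 fun j => ?_
  rw [map_zero]
  rcases lt_or_ge j k with h | h
  · exact degPart_of_homFilt 𝒱 hx h
  · exact hn j (by rw [le_abs]; lia) x

theorem mem_homFilt_of_le {n : ℕ} (hn : ∀ k : ℤ, (n : ℤ) ≤ |k| → ∀ x, degPart 𝒱 k x = 0)
    (x : V →L[𝕜] V) : x ∈ homFilt 𝒱 (-n) :=
  (mem_homFilt_iff 𝒱).2 fun j hj => hn j (by rw [le_abs]; lia) x

/-- Replacing a factor by its leading part costs a term with one factor of higher filtration degree,
so leading parts multiply. -/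
theorem degPart_mul {a b : ℤ} {x y : V →L[𝕜] V} (hx : x ∈ homFilt 𝒱 a) (hy : y ∈ homFilt 𝒱 b) :
    degPart 𝒱 (a + b) (x * y) = degPart 𝒱 a x * degPart 𝒱 b y := by
  have h1 : x * y - degPart 𝒱 a x * degPart 𝒱 b y ∈ homFilt 𝒱 (a + b + 1) := by
    have e : x * y - degPart 𝒱 a x * degPart 𝒱 b y =
        (x - degPart 𝒱 a x) * y + degPart 𝒱 a x * (y - degPart 𝒱 b y) := by noncomm_ring
    rw [e]
    have h2 := homFilt_mul 𝒱 (sub_degPart_mem 𝒱 hx) hy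
    have h3 := homFilt_mul 𝒱 (homDeg_le_homFilt 𝒱 a (degPart_mem 𝒱 a x)) (sub_degPart_mem 𝒱 hy)
    exact add_mem (by rwa [add_right_comm] at h2) (by rwa [← add_assoc] at h3)
  have h2 := degPart_of_homFilt 𝒱 h1 (lt_add_one _)
  rw [map_sub, degPart_of_mem 𝒱 (homDeg_mul 𝒱 (degPart_mem 𝒱 a x) (degPart_mem 𝒱 b y)),
    sub_eq_zero] at h2
  exact h2

theorem degPart_nonnegPart (k : ℤ) (x : V →L[𝕜] V) :
    degPart 𝒱 k (nonnegPart 𝒱 x) = if 0 ≤ k then degPart 𝒱 k x else 0 :=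
  ext_grading_clm 𝒱 fun i v hv => by
    rw [degPart_apply 𝒱 k _ hv, nonnegPart_apply 𝒱 x hv, proj_projGE]
    split_ifs with h1 h2 h2
    · rw [degPart_apply 𝒱 k x hv]
    · lia
    · lia
    · rfl

theorem nonnegPart_mem (x : V →L[𝕜] V) : nonnegPart 𝒱 x ∈ homFilt 𝒱 0 :=
  (mem_homFilt_iff 𝒱).2 fun j hj => by rw [degPart_nonnegPart, if_neg (not_le.2 hj)]

theorem degPart_neg_one_add_nonnegPart {x : V →L[𝕜] V} (hx : x ∈ homFilt 𝒱 (-1)) :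
    degPart 𝒱 (-1) x + nonnegPart 𝒱 x = x :=
  ext_degPart 𝒱 fun k => by
    rw [map_add, degPart_degPart, degPart_nonnegPart]
    split_ifs with h1 h2 h2
    · lia
    · rw [h1, add_zero]
    · rw [zero_add]
    · rw [degPart_of_homFilt 𝒱 hx (by lia), zero_add]

theorem degPart_comm {a b : ℤ} {x y : V →L[𝕜] V} (hx : x ∈ homFilt 𝒱 a) (hy : y ∈ homFilt 𝒱 b) :
    degPart 𝒱 (a + b) (x * y - y * x) =
      degPart 𝒱 a x * degPart 𝒱 b y - degPart 𝒱 b y * degPart 𝒱 a x := by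
  rw [map_sub, degPart_mul 𝒱 hx hy, add_comm a b, degPart_mul 𝒱 hy hx]

end GradedAlgebra

/-! ### Tangent spaces, local retracts and submanifolds -/

section Calculus

variable {𝕜 : Type*} [RCLike 𝕜]
variable {E : Type*} [NormedAddCommGroup E] [NormedSpace 𝕜 E]
variable {F : Type*} [NormedAddCommGroup F] [NormedSpace 𝕜 F]

/-- A projection turns membership in a subspace into the equation π x = x, which can be
differentiated and continued analytically. -/
theorem exists_projection [FiniteDimensional 𝕜 E] (S : Submodule 𝕜 E) :
    ∃ π : E →L[𝕜] E, (∀ x, π x ∈ S) ∧ ∀ x ∈ S, π x = x := by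
  obtain ⟨f, hf⟩ := S.subtype.exists_leftInverse_of_injective (by simp)
  refine ⟨LinearMap.toContinuousLinearMap (S.subtype ∘ₗ f), fun x => (f x).2, fun x hx => ?_⟩
  exact congrArg Subtype.val (LinearMap.congr_fun hf ⟨x, hx⟩)

theorem mem_tangentAt_of_curve {M : Set E} {γ : 𝕜 → E} {v : E} (hγ : ContDiffAt 𝕜 ∞ γ 0)
    (hM : ∀ᶠ s in 𝓝 (0 : 𝕜), γ s ∈ M) (hv : HasDerivAt γ v 0) : v ∈ tangentAt 𝕜 M (γ 0) :=
  Submodule.subset_span ⟨γ, hγ, rfl, hM, hv.deriv⟩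

theorem tangentAt_map {M : Set E} {M' : Set F} {f : E → F} {p : E} (hf : ContDiffAt 𝕜 ∞ f p)
    (hM : ∀ᶠ q in 𝓝[M] p, f q ∈ M') {v : E} (hv : v ∈ tangentAt 𝕜 M p) :
    fderiv 𝕜 f p v ∈ tangentAt 𝕜 M' (f p) := by
  have : tangentAt 𝕜 M p ≤ (tangentAt 𝕜 M' (f p)).comap (fderiv 𝕜 f p).toLinearMap := by
    refine Submodule.span_le.2 ?_
    rintro _ ⟨γ, hγ, rfl, hγM, rfl⟩
    have h1 : HasDerivAt (f ∘ γ) (fderiv 𝕜 f (γ 0) (deriv γ 0)) 0 :=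
      ((hf.differentiableAt (by simp)).hasFDerivAt).comp_hasDerivAt 0
        (hγ.differentiableAt (by simp)).hasDerivAt
    refine mem_tangentAt_of_curve (γ := f ∘ γ) (hf.comp 0 hγ) ?_ h1
    exact (tendsto_nhdsWithin_iff.2 ⟨hγ.continuousAt, hγM⟩).eventually hM
  exact this hv

theorem tangentAt_mono {M M' : Set E} {p : E} (h : ∀ᶠ q in 𝓝[M] p, q ∈ M') :
    tangentAt 𝕜 M p ≤ tangentAt 𝕜 M' p := fun v hv => by
  simpa using tangentAt_map (𝕜 := 𝕜) (f := id) contDiffAt_id h hv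

/-- Composition with curves in `M` determines a derivative within a set in tangent directions,
although unique differentiability may fail. Only these values of `fderivWithin` are used below. -/
theorem fderivWithin_eq_of_tangentAt {M M' : Set E} (hMM' : M ⊆ M') {p : E} {f g : E → F}
    {f' g' : E →L[𝕜] F} (hf : HasFDerivWithinAt f f' M' p) (hg : HasFDerivWithinAt g g' M' p)
    (h : ∀ᶠ q in 𝓝[M] p, f q = g q) {v : E} (hv : v ∈ tangentAt 𝕜 M p) : f' v = g' v := by
  have : tangentAt 𝕜 M p ≤ LinearMap.eqLocus f'.toLinearMap g'.toLinearMap := by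
    refine Submodule.span_le.2 ?_
    rintro _ ⟨γ, hγ, rfl, hγM, rfl⟩
    have hd := (hγ.differentiableAt (by simp)).hasDerivAt
    have hmaps : Set.MapsTo γ (γ ⁻¹' M) M' := fun s hs => hMM' hs
    have hN : γ ⁻¹' M ∈ 𝓝 (0 : 𝕜) := hγM
    have h1 := (hf.comp_hasDerivWithinAt 0 hd.hasDerivWithinAt hmaps).hasDerivAt hN
    have h2 := (hg.comp_hasDerivWithinAt 0 hd.hasDerivWithinAt hmaps).hasDerivAt hN
    exact h1.unique (h2.congr_of_eventuallyEq
      ((tendsto_nhdsWithin_iff.2 ⟨hγ.continuousAt, hγM⟩).eventually h))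
  exact this hv

/-- A set is a local smooth retract of its ambient space. -/
def IsLocalRetract (𝕜 : Type*) [RCLike 𝕜] {E : Type*} [NormedAddCommGroup E] [NormedSpace 𝕜 E]
    (M : Set E) : Prop :=
  ∀ p ∈ M, ∃ O : Set E, IsOpen O ∧ p ∈ O ∧ ∃ r : E → E, ContDiffOn 𝕜 ∞ r O ∧
    (∀ q ∈ O, r q ∈ M) ∧ ∀ q ∈ O, q ∈ M → r q = q

/-- The smooth inverse function theorem, with a chart that is smooth on its whole source. -/
theorem exists_chart [CompleteSpace E] {f : E → F} {O : Set E} (hO : IsOpen O)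
    (hf : ContDiffOn 𝕜 ∞ f O) {a : E} (ha : a ∈ O) (f' : E ≃L[𝕜] F)
    (hf' : HasFDerivAt f (f' : E →L[𝕜] F) a) :
    ∃ e : OpenPartialHomeomorph E F, a ∈ e.source ∧ e.source ⊆ O ∧ (∀ x, e x = f x) ∧
      ContDiffOn 𝕜 ∞ e e.source ∧ ContDiffOn 𝕜 ∞ e.symm e.target := by
  have hat : ∀ x ∈ O, ContDiffAt 𝕜 ∞ f x := fun x hx => hf.contDiffAt (hO.mem_nhds hx)
  have hcont : ContinuousOn (fderiv 𝕜 f) O := hf.continuousOn_fderiv_of_isOpen hO (by simp)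
  -- The chart is cut down to the points with invertible derivative, so that the inverse is smooth
  -- on all of the target and not only near the image of `a`.
  have hopen : IsOpen (O ∩ fderiv 𝕜 f ⁻¹' (Set.range ((↑) : (E ≃L[𝕜] F) → E →L[𝕜] F))) :=
    hcont.isOpen_inter_preimage hO ContinuousLinearEquiv.isOpen
  let e := ((hat a ha).toOpenPartialHomeomorph f hf' (by simp)).restrOpen _ hopen
  have hsub : e.source ⊆ O ∩ fderiv 𝕜 f ⁻¹' (Set.range ((↑) : (E ≃L[𝕜] F) → E →L[𝕜] F)) :=
    fun x hx => hx.2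
  refine ⟨e, ⟨(hat a ha).mem_toOpenPartialHomeomorph_source hf' (by simp), ha, f', hf'.fderiv.symm⟩,
    fun x hx => (hsub hx).1, fun x => rfl, fun x hx => (hat x (hsub hx).1).contDiffWithinAt,
    fun y hy => ?_⟩
  have hy' := e.map_target hy
  obtain ⟨g, hg⟩ := (hsub hy').2
  refine ContDiffAt.contDiffWithinAt (e.contDiffAt_symm hy (f₀' := g) ?_ (hat _ (hsub hy').1))
  rw [hg]
  exact ((hat _ (hsub hy').1).differentiableAt (by simp)).hasFDerivAt

/-- The derivative π of the retraction r at p is idempotent, and x ↦ π(r x - p) + (1 - π)(x - r x)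
has derivative 1 at p, so it is a chart. It sends points of `M` into the range of π; conversely a
value in that range forces (1 - π)(x - r x) = 0, which near p implies x = r x. -/
theorem IsLocalRetract.isSubmanifold [CompleteSpace E] {M : Set E} (hM : IsLocalRetract 𝕜 M) :
    IsSubmanifold 𝕜 M := by
  intro p hp
  obtain ⟨O, hO, hpO, r, hr, hrM, hrid⟩ := hM p hp
  have hrp : r p = p := hrid p hpO hp
  have hat : ContDiffAt 𝕜 ∞ r p := hr.contDiffAt (hO.mem_nhds hpO)
  set π := fderiv 𝕜 r p with hπ
  have hstrict : HasStrictFDerivAt r π p := hat.hasStrictFDerivAt (by simp)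
  have hid : π ∘L π = π := by
    have h1 : HasFDerivAt (r ∘ r) (π ∘L π) p := by
      refine HasFDerivAt.comp p ?_ hstrict.hasFDerivAt
      rw [hrp]; exact hstrict.hasFDerivAt
    have h2 : r ∘ r =ᶠ[𝓝 p] r := by
      have : ∀ᶠ q in 𝓝 p, r q ∈ O :=
        hat.continuousAt.eventually_mem (hO.mem_nhds (hrp.symm ▸ hpO))
      filter_upwards [this, hO.mem_nhds hpO] with q hq hqO
      exact hrid _ hq (hrM q hqO)
    exact (h1.congr_of_eventuallyEq h2.symm).unique hstrict.hasFDerivAt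
  have hid' : ∀ x, π (π x) = π x := fun x => DFunLike.congr_fun hid x
  let f : E → E := fun x => π (r x - p) + (x - r x - π (x - r x))
  have hf : ContDiffOn 𝕜 ∞ f O := by
    have h1 := hr.sub (contDiffOn_const (c := p))
    have h2 := contDiffOn_id.sub hr
    exact (π.contDiff.comp_contDiffOn h1).add (h2.sub (π.contDiff.comp_contDiffOn h2))
  have hf' : HasFDerivAt f ((ContinuousLinearEquiv.refl 𝕜 E : E ≃L[𝕜] E) : E →L[𝕜] E) p := by
    have h1 := hstrict.hasFDerivAt.sub_const p
    have h2 := (hasFDerivAt_id (𝕜 := 𝕜) p).sub hstrict.hasFDerivAt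
    refine ((π.hasFDerivAt.comp p h1).add (h2.sub (π.hasFDerivAt.comp p h2))).congr_fderiv ?_
    ext x
    simp [hid']
  obtain ⟨e, hpe, heO, hef, he, hes⟩ := exists_chart hO hf hpO _ hf'
  have hfp : f p = 0 := by simp [f, hrp]
  -- near `p` the only point `x` with `x - r x ∈ range π` is `x = r x`
  obtain ⟨N, hN, hpN, hNr⟩ : ∃ N : Set E, IsOpen N ∧ p ∈ N ∧
      ∀ x ∈ N, π (x - r x) = x - r x → x = r x := by
    have h1 := hstrict.isLittleO.def (c := 1 / 2) (by norm_num)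
    have h2 : Filter.Tendsto (fun x => (r x, x)) (𝓝 p) (𝓝 (p, p)) := by
      have := hat.continuousAt.prodMk (continuousAt_id (x := p))
      rwa [ContinuousAt, hrp] at this
    have h3 := h2.eventually h1
    have h4 : ∀ᶠ q in 𝓝 p, r q ∈ O :=
      hat.continuousAt.eventually_mem (hO.mem_nhds (hrp.symm ▸ hpO))
    obtain ⟨N, hN, hNo, hpN⟩ := eventually_nhds_iff.1 (h3.and (h4.and (hO.mem_nhds hpO)))
    refine ⟨N, hNo, hpN, fun x hx hxx => ?_⟩
    obtain ⟨h5, h6, h7⟩ := hN x hx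
    have h8 : r (r x) = r x := hrid _ h6 (hrM x h7)
    have h9 : π (r x - x) = r x - x := by rw [← neg_sub, map_neg, hxx]
    simp only [h8, sub_self, h9, zero_sub, norm_neg] at h5
    have : ‖r x - x‖ = 0 := by linarith [norm_nonneg (r x - x)]
    exact (sub_eq_zero.1 (norm_eq_zero.1 this)).symm
  refine ⟨e.restrOpen N hN, ⟨hpe, hpN⟩, he.mono fun x hx => hx.1, hes.mono fun x hx => hx.1,
    LinearMap.range π.toLinearMap, fun q hq => ?_⟩
  have hqO : q ∈ O := heO hq.1
  have hq2 : (e.restrOpen N hN) q = f q := hef q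
  rw [hq2]
  constructor
  · intro hqM
    exact ⟨q - p, by simp [f, hrid q hqO hqM]⟩
  · rintro ⟨y, hy⟩
    have hy' : π y = f q := hy
    have h1 : π (f q) = f q := by rw [← hy', hid']
    simp only [f, map_add, map_sub, hid'] at h1
    have h2 : π (q - r q) = q - r q := by
      rw [← sub_eq_zero] at h1 ⊢
      rw [← h1]
      simp only [map_sub]
      abel
    rw [hNr q hq.2 h2]
    exact hrM q hqO

/-- A smooth function on a local retract extends to a neighbourhood of each of its points. -/
theorem IsLocalRetract.exists_extension {M : Set E} (hM : IsLocalRetract 𝕜 M) {f : E → F}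
    (hf : ContDiffOn 𝕜 ∞ f M) {p : E} (hp : p ∈ M) :
    ∃ O : Set E, IsOpen O ∧ p ∈ O ∧ ∃ g : E → F, ContDiffOn 𝕜 ∞ g O ∧ ∀ q ∈ O, q ∈ M → g q = f q := by
  obtain ⟨O, hO, hpO, r, hr, hrM, hrid⟩ := hM p hp
  exact ⟨O, hO, hpO, f ∘ r, hf.comp hr hrM, fun q hq hqM => by
    rw [Function.comp_apply, hrid q hq hqM]⟩

/-- A map into a submanifold whose derivative covers the tangent space is open onto the
submanifold. -/
theorem IsSubmanifold.nhdsWithin_le_map [FiniteDimensional 𝕜 E] [CompleteSpace F]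
    {M : Set E} (hM : IsSubmanifold 𝕜 M) {f : F → E} {f' : F →L[𝕜] E} {a : F}
    (hf : HasStrictFDerivAt f f' a) (hfM : ∀ᶠ x in 𝓝 a, f x ∈ M)
    (ht : tangentAt 𝕜 M (f a) ≤ LinearMap.range f'.toLinearMap) :
    𝓝[M] (f a) ≤ Filter.map f (𝓝 a) := by
  have : CompleteSpace E := FiniteDimensional.complete 𝕜 E
  obtain ⟨e, hpe, he, hes, S, hS⟩ := hM _ hfM.self_of_nhds
  have hpS : e (f a) ∈ S := (hS _ hpe).1 hfM.self_of_nhds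
  obtain ⟨π, hπS, hπ⟩ := exists_projection S
  let π' : E →L[𝕜] S := π.codRestrict S hπS
  have hed : HasStrictFDerivAt e (fderiv 𝕜 e (f a)) (f a) :=
    (he.contDiffAt (e.open_source.mem_nhds hpe)).hasStrictFDerivAt (by simp)
  have hg : HasStrictFDerivAt (fun x => π' (e (f x))) (π' ∘L fderiv 𝕜 e (f a) ∘L f') a :=
    π'.hasStrictFDerivAt.comp a (hed.comp a hf)
  have hsurj : (π' ∘L fderiv 𝕜 e (f a) ∘L f').range = ⊤ := by
    refine LinearMap.range_eq_top.2 fun w => ?_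
    have hpt : e (f a) ∈ e.target := e.map_source hpe
    have hsd : ContDiffAt 𝕜 ∞ e.symm (e (f a)) := hes.contDiffAt (e.open_target.mem_nhds hpt)
    -- A straight line in the chart is a curve in `M`. Its velocity is a tangent vector, hence in
    -- the range of `f'` by `ht`, and this yields a preimage of w.
    have hline : HasDerivAt (fun s : 𝕜 => e (f a) + s • (w : E)) (w : E) 0 := by
      simpa using ((hasDerivAt_id (0 : 𝕜)).smul_const (w : E)).const_add (e (f a))
    have hlc : ContDiff 𝕜 ∞ (fun s : 𝕜 => e (f a) + s • (w : E)) := by fun_prop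
    have hl0 : e (f a) + (0 : 𝕜) • (w : E) = e (f a) := by simp
    have h1 : HasDerivAt (fun s : 𝕜 => e.symm (e (f a) + s • (w : E)))
        (fderiv 𝕜 e.symm (e (f a)) w) 0 := by
      have := (hsd.differentiableAt (by simp)).hasFDerivAt
      exact HasFDerivAt.comp_hasDerivAt_of_eq (0 : 𝕜) this hline hl0.symm
    have h2 : ∀ᶠ s in 𝓝 (0 : 𝕜), e.symm (e (f a) + s • (w : E)) ∈ M := by
      have : ∀ᶠ s in 𝓝 (0 : 𝕜), e (f a) + s • (w : E) ∈ e.target := by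
        apply hlc.continuous.continuousAt.eventually_mem
        rw [hl0]; exact e.open_target.mem_nhds hpt
      filter_upwards [this] with s hs
      rw [hS _ (e.map_target hs), e.right_inv hs]
      exact add_mem hpS (Submodule.smul_mem _ _ w.2)
    have h3 := mem_tangentAt_of_curve
      (ContDiffAt.comp (0 : 𝕜) (by rw [hl0]; exact hsd) hlc.contDiffAt) h2 h1
    rw [Function.comp_apply, hl0] at h3
    change _ ∈ tangentAt 𝕜 M (e.symm (e (f a))) at h3
    rw [e.left_inv hpe] at h3
    obtain ⟨x, hx⟩ := ht h3
    refine ⟨x, ?_⟩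
    have h4 : fderiv 𝕜 e (f a) (fderiv 𝕜 e.symm (e (f a)) w) = w := by
      have h5 : HasFDerivAt e (fderiv 𝕜 e (f a)) (e.symm (e (f a))) := by
        rw [e.left_inv hpe]; exact hed.hasFDerivAt
      have h6 := h5.comp _ (hsd.differentiableAt (by simp)).hasFDerivAt
      have h7 : e ∘ e.symm =ᶠ[𝓝 (e (f a))] id := by
        filter_upwards [e.open_target.mem_nhds hpt] with y hy using e.right_inv hy
      have h8 := (h6.congr_of_eventuallyEq h7.symm).unique (hasFDerivAt_id _)
      exact DFunLike.congr_fun h8 (w : E)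
    have hx' : f' x = fderiv 𝕜 e.symm (e (f a)) w := hx
    refine Subtype.ext ?_
    change π (fderiv 𝕜 e (f a) (f' x)) = w
    rw [hx', h4, hπ _ w.2]
  have hmap := hg.map_nhds_eq_of_surj hsurj
  intro N hN
  have hcf : ∀ᶠ x in 𝓝 a, f x ∈ e.source :=
    hf.hasFDerivAt.continuousAt.eventually_mem (e.open_source.mem_nhds hpe)
  have h1 : (fun x => π' (e (f x))) '' {x | f x ∈ N ∧ f x ∈ M ∧ f x ∈ e.source} ∈
      𝓝 (π' (e (f a))) := by
    rw [← hmap]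
    exact Filter.image_mem_map (Filter.Eventually.and hN (hfM.and hcf))
  have h2 : ContinuousAt (fun q => π' (e q)) (f a) :=
    π'.continuous.continuousAt.comp hed.hasFDerivAt.continuousAt
  have h3 := h2 h1
  rw [Filter.mem_map] at h3
  rw [mem_nhdsWithin_iff_exists_mem_nhds_inter]
  refine ⟨_, Filter.inter_mem h3 (e.open_source.mem_nhds hpe), ?_⟩
  rintro q ⟨⟨⟨x, ⟨hxN, hxM, hxs⟩, hxq⟩, hqs⟩, hqM⟩
  have h5 : e (f x) = e q := by
    have := congrArg Subtype.val hxq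
    change π (e (f x)) = π (e q) at this
    rwa [hπ _ ((hS _ hxs).1 hxM), hπ _ ((hS _ hqs).1 hqM)] at this
  rw [← e.injOn hxs hqs h5]
  exact hxN

end Calculus

/-! ### Matrix groups that are exponential near the identity -/

section LieGroup

variable {𝕜 : Type*} [RCLike 𝕜]
variable {A : Type*} [NormedRing A] [NormedAlgebra 𝕜 A] [CompleteSpace A]

local notation "exp" => NormedSpace.exp

section

variable (𝕜)
include 𝕜

theorem exp_add_of_commute {x y : A} (h : Commute x y) : exp (x + y) = exp x * exp y := by
  let := NormedAlgebra.restrictScalars ℚ 𝕜 A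
  exact NormedSpace.exp_add_of_commute h

theorem exp_mul_exp_neg (x : A) : exp x * exp (-x) = 1 := by
  rw [← exp_add_of_commute 𝕜 (Commute.neg_right (Commute.refl x)), add_neg_cancel,
    NormedSpace.exp_zero]

theorem exp_neg_mul_exp (x : A) : exp (-x) * exp x = 1 := by
  simpa using exp_mul_exp_neg 𝕜 (-x)

theorem exp_nsmul' (n : ℕ) (x : A) : exp (n • x) = exp x ^ n := by
  let := NormedAlgebra.restrictScalars ℚ 𝕜 A
  exact NormedSpace.exp_nsmul n x

theorem contDiff_exp {n : WithTop ℕ∞} : ContDiff 𝕜 n (NormedSpace.exp : A → A) :=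
  contDiff_iff_contDiffAt.2 fun x => (NormedSpace.exp_analytic x).contDiffAt

theorem continuous_exp : Continuous (NormedSpace.exp : A → A) :=
  (contDiff_exp 𝕜 (n := 0)).continuous

end

theorem hasDerivAt_exp_smul_zero (x : A) : HasDerivAt (fun s : 𝕜 => exp (s • x)) x 0 := by
  simpa using hasDerivAt_exp_smul_const (𝕂 := 𝕜) x 0

section

variable (𝕜 A)
include 𝕜

theorem exists_log : ∃ (L : A → A) (O : Set A), IsOpen O ∧ (1 : A) ∈ O ∧ ContDiffOn 𝕜 ∞ L O ∧
    L 1 = 0 ∧ (∀ B ∈ O, exp (L B) = B) ∧ ∀ᶠ x in 𝓝 (0 : A), L (exp x) = x := by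
  have h : HasFDerivAt (NormedSpace.exp : A → A)
      ((ContinuousLinearEquiv.refl 𝕜 A : A ≃L[𝕜] A) : A →L[𝕜] A) 0 :=
    hasFDerivAt_exp_zero
  obtain ⟨e, h0, -, hef, -, hes⟩ := exists_chart isOpen_univ (contDiff_exp 𝕜).contDiffOn
    (Set.mem_univ (0 : A)) _ h
  have h1 : (1 : A) = e 0 := by rw [hef, NormedSpace.exp_zero]
  refine ⟨e.symm, e.target, e.open_target, h1 ▸ e.map_source h0, hes, ?_, fun B hB => ?_, ?_⟩
  · rw [h1, e.left_inv h0]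
  · rw [← hef, e.right_inv hB]
  · filter_upwards [e.open_source.mem_nhds h0] with x hx
    rw [← hef, e.left_inv hx]

theorem exists_exp_injOn : ∃ U ∈ 𝓝 (0 : A), Set.InjOn (NormedSpace.exp : A → A) U := by
  obtain ⟨L, O, -, -, -, -, -, h⟩ := exists_log 𝕜 A
  exact ⟨_, h, fun x hx y hy hxy => by
    have hx' : L (exp x) = x := hx
    rw [hxy] at hx'
    exact hx'.symm.trans hy⟩

end

/-- If the exponential of a small element lies in a closed subalgebra, so does the element. -/
theorem mem_subalgebra_of_exp_mem (S : Subalgebra 𝕜 A) (hS : IsClosed (S : Set A)) :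
    ∀ᶠ x in 𝓝 (0 : A), exp x ∈ S → x ∈ S := by
  have : CompleteSpace S := hS.completeSpace_coe
  obtain ⟨U, hU, hinj⟩ := exists_exp_injOn 𝕜 A
  -- The exponential of the subalgebra itself already covers a neighbourhood of 1 in it; injectivity
  -- of exp near 0 in `A` then identifies the two logarithms.
  have hmap : Filter.map (NormedSpace.exp : S → S) (𝓝 0) = 𝓝 1 := by
    have h : HasStrictFDerivAt (NormedSpace.exp : S → S) (1 : S →L[𝕜] S) 0 :=
      hasStrictFDerivAt_exp_zero
    simpa using h.map_nhds_eq_of_surj (LinearMap.range_eq_top.2 fun x => ⟨x, rfl⟩)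
  have hval : ∀ s : S, ((exp s : S) : A) = exp (s : A) := fun s => by
    let := NormedAlgebra.restrictScalars ℚ 𝕜 A
    let := NormedAlgebra.restrictScalars ℚ 𝕜 S
    exact NormedSpace.map_exp (S.val) continuous_subtype_val s
  have hU' : (fun s : S => (s : A)) ⁻¹' U ∈ 𝓝 (0 : S) :=
    continuous_subtype_val.continuousAt (by simpa using hU)
  have h1 : (NormedSpace.exp : S → S) '' ((fun s : S => (s : A)) ⁻¹' U) ∈ 𝓝 (1 : S) := by
    rw [← hmap]; exact Filter.image_mem_map hU'
  obtain ⟨N, hN, hNS⟩ := mem_nhds_induced _ _ _ |>.1 (show _ ∈ 𝓝 (1 : S) from h1)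
  have h2 : ∀ᶠ x in 𝓝 (0 : A), exp x ∈ N :=
    (continuous_exp 𝕜).continuousAt.eventually_mem (by simpa using hN)
  filter_upwards [h2, hU] with x hx hxU hxS
  obtain ⟨s, hs, hsx⟩ := hNS (show (⟨exp x, hxS⟩ : S) ∈ Subtype.val ⁻¹' N from hx)
  have h3 : exp (s : A) = exp x := by rw [← hval, hsx]
  rw [← hinj hs hxU h3]
  exact s.2

/-- A group `H` of invertible elements of `A` that near `1` is the exponential image of the
subspace `h`. -/
structure IsExpGroup (H : Set A) (h : Submodule 𝕜 A) : Prop where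
  one_mem : 1 ∈ H
  mul_mem : ∀ a ∈ H, ∀ b ∈ H, a * b ∈ H
  inv_mem : ∀ a ∈ H, ∃ b ∈ H, a * b = 1 ∧ b * a = 1
  exp_mem : ∀ x ∈ h, exp x ∈ H
  near_one : ∀ U ∈ 𝓝 (0 : A), ∀ᶠ B in 𝓝[H] 1, ∃ x ∈ U, x ∈ h ∧ exp x = B

section Submanifold

variable {M : Set A} (hone : (1 : A) ∈ M) (hmul : ∀ a ∈ M, ∀ b ∈ M, a * b ∈ M)

include hone hmul in
-- Products of curves add velocities at 1 and linear reparametrizations scale them, so no span is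
-- needed.
theorem exists_curve_of_mem_tangentAt_one {x : A} (hx : x ∈ tangentAt 𝕜 M 1) :
    ∃ γ : 𝕜 → A, ContDiffAt 𝕜 ∞ γ 0 ∧ γ 0 = 1 ∧ (∀ᶠ s in 𝓝 (0 : 𝕜), γ s ∈ M) ∧
      HasDerivAt γ x 0 := by
  induction hx using Submodule.span_induction with
  | mem x hx =>
    obtain ⟨γ, h1, h2, h3, rfl⟩ := hx
    exact ⟨γ, h1, h2, h3, (h1.differentiableAt (by simp)).hasDerivAt⟩
  | zero => exact ⟨fun _ => 1, contDiffAt_const, rfl, by simp [hone], hasDerivAt_const _ _⟩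
  | add x y _ _ hx hy =>
    obtain ⟨γ, h1, h2, h3, h4⟩ := hx
    obtain ⟨γ', h1', h2', h3', h4'⟩ := hy
    refine ⟨fun s => γ s * γ' s, h1.mul h1', by simp [h2, h2'], ?_, ?_⟩
    · filter_upwards [h3, h3'] with s hs hs' using hmul _ hs _ hs'
    · exact (h4.mul h4').congr_deriv (by simp [h2, h2'])
  | smul a x _ hx =>
    obtain ⟨γ, h1, h2, h3, h4⟩ := hx
    have h0 : a * (0 : 𝕜) = 0 := mul_zero a
    have hl : ContDiff 𝕜 ∞ fun s : 𝕜 => a * s := contDiff_const.mul contDiff_id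
    refine ⟨fun s => γ (a * s), ContDiffAt.comp (0 : 𝕜) (by rwa [h0]) hl.contDiffAt,
      by simp [h2], ?_, ?_⟩
    · have := hl.continuous.tendsto 0
      rw [h0] at this
      exact this.eventually h3
    · have h5 : HasDerivAt (fun s : 𝕜 => a * s) a 0 := by
        simpa using (hasDerivAt_id (0 : 𝕜)).const_mul a
      exact HasDerivAt.scomp_of_eq (0 : 𝕜) h4 h5 h0.symm

omit [CompleteSpace A] in
include hone hmul in
theorem pow_mem_of_mul_mem {a : A} (ha : a ∈ M) (n : ℕ) : a ^ n ∈ M := by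
  induction n with
  | zero => simpa using hone
  | succ n ih => rw [pow_succ]; exact hmul _ ih _ ha

include hone hmul in
-- If γ is a curve in `M` with velocity y at 1, then γ(1/n)^n → exp y, because n log γ(1/n) tends to
-- y. In the chart at 1 the set is relatively closed, which settles small y; in general exp x is a
-- power of exp(x/n).
theorem exp_mem_of_mem_tangentAt_one [FiniteDimensional 𝕜 A] (hM : IsSubmanifold 𝕜 M) {x : A}
    (hx : x ∈ tangentAt 𝕜 M 1) : exp x ∈ M := by
  obtain ⟨e, he1, he, -, S, hS⟩ := hM 1 hone
  have key : ∀ y ∈ tangentAt 𝕜 M 1, exp y ∈ e.source → exp y ∈ M := by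
    intro y hy hye
    obtain ⟨γ, h1, h2, h3, h4⟩ := exists_curve_of_mem_tangentAt_one hone hmul hy
    obtain ⟨L, O, hO, h1O, hL, hL1, hexp, hLexp⟩ := exists_log 𝕜 A
    have hLd : HasFDerivAt L (ContinuousLinearMap.id 𝕜 A) 1 := by
      have h5 : DifferentiableAt 𝕜 L 1 :=
        (hL.contDiffAt (hO.mem_nhds h1O)).differentiableAt (by simp)
      have h6 : HasFDerivAt (NormedSpace.exp : A → A) (1 : A →L[𝕜] A) 0 := hasFDerivAt_exp_zero
      have h7 : HasFDerivAt (L ∘ NormedSpace.exp) (fderiv 𝕜 L 1 ∘L 1) 0 :=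
        HasFDerivAt.comp (0 : A) (by simpa using h5.hasFDerivAt) h6
      have h8 : L ∘ NormedSpace.exp =ᶠ[𝓝 0] id := hLexp
      have h9 := (h7.congr_of_eventuallyEq h8.symm).unique (hasFDerivAt_id _)
      have h10 : fderiv 𝕜 L 1 = ContinuousLinearMap.id 𝕜 A := h9
      rw [← h10]; exact h5.hasFDerivAt
    have hl : HasDerivAt (L ∘ γ) y 0 := by
      have := HasFDerivAt.comp_hasDerivAt_of_eq (0 : 𝕜) hLd h4 h2.symm
      simpa using this
    have hlim : Filter.Tendsto (fun n : ℕ => (n : 𝕜) • L (γ ((n : 𝕜)⁻¹))) Filter.atTop (𝓝 y) := by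
      have h5 := hasDerivAt_iff_tendsto_slope_zero.1 hl
      have h6 : Filter.Tendsto (fun n : ℕ => (n : 𝕜)⁻¹) Filter.atTop (𝓝[≠] 0) := by
        refine tendsto_nhdsWithin_iff.2 ⟨tendsto_inv_atTop_nhds_zero_nat, ?_⟩
        filter_upwards [Filter.eventually_gt_atTop 0] with n hn
        simpa using hn.ne'
      have h7 := h5.comp h6
      refine h7.congr fun n => ?_
      simp [h2, hL1]
    have hlim' : Filter.Tendsto (fun n : ℕ => γ ((n : 𝕜)⁻¹) ^ n) Filter.atTop (𝓝 (exp y)) := by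
      refine (((continuous_exp 𝕜).tendsto y).comp hlim).congr' ?_
      have h5 : ∀ᶠ s in 𝓝 (0 : 𝕜), γ s ∈ O := by
        apply h1.continuousAt.eventually_mem
        rw [h2]; exact hO.mem_nhds h1O
      filter_upwards [(tendsto_inv_atTop_nhds_zero_nat (𝕜 := 𝕜)).eventually h5] with n hn
      rw [Function.comp_apply, Nat.cast_smul_eq_nsmul, exp_nsmul' 𝕜, hexp _ hn]
    rw [hS _ hye]
    have hc : Filter.Tendsto (fun n : ℕ => e (γ ((n : 𝕜)⁻¹) ^ n)) Filter.atTop (𝓝 (e (exp y))) :=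
      (e.continuousAt hye).tendsto.comp hlim'
    refine S.closed_of_finiteDimensional.mem_of_tendsto hc ?_
    filter_upwards [hlim'.eventually (e.open_source.mem_nhds hye),
      (tendsto_inv_atTop_nhds_zero_nat (𝕜 := 𝕜)).eventually h3] with n hn hn'
    exact (hS _ hn).1 (pow_mem_of_mul_mem hone hmul hn' n)
  have hsmall : ∀ᶠ n : ℕ in Filter.atTop, exp ((n : 𝕜)⁻¹ • x) ∈ e.source := by
    have h5 : Filter.Tendsto (fun n : ℕ => exp ((n : 𝕜)⁻¹ • x)) Filter.atTop (𝓝 1) := by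
      have := ((continuous_exp 𝕜).tendsto ((0 : 𝕜) • x)).comp
        ((tendsto_inv_atTop_nhds_zero_nat (𝕜 := 𝕜)).smul_const x)
      rw [zero_smul, NormedSpace.exp_zero] at this
      exact this
    exact h5.eventually (e.open_source.mem_nhds he1)
  obtain ⟨n, hn, hn0⟩ := (hsmall.and (Filter.eventually_gt_atTop 0)).exists
  have h6 := key _ (Submodule.smul_mem _ _ hx) hn
  have h7 : exp x = exp ((n : 𝕜)⁻¹ • x) ^ n := by
    rw [← exp_nsmul' 𝕜, ← Nat.cast_smul_eq_nsmul 𝕜, smul_smul,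
      mul_inv_cancel₀ (by exact_mod_cast hn0.ne'), one_smul]
  rw [h7]
  exact pow_mem_of_mul_mem hone hmul h6 n

include hone hmul in
-- The exponential restricted to the tangent space at 1 has the whole tangent space as range of its
-- derivative, so it is open onto `M` at 0.
theorem IsSubmanifold.isExpGroup [FiniteDimensional 𝕜 A] (hM : IsSubmanifold 𝕜 M)
    (hinv : ∀ a ∈ M, ∃ b ∈ M, a * b = 1 ∧ b * a = 1) : IsExpGroup M (tangentAt 𝕜 M 1) where
  one_mem := hone
  mul_mem := hmul
  inv_mem := hinv
  exp_mem _ hx := exp_mem_of_mem_tangentAt_one hone hmul hM hx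
  near_one := by
    intro U hU
    let g := tangentAt 𝕜 M 1
    have h1 : HasStrictFDerivAt (fun x : g => exp (x : A)) g.subtypeL 0 := by
      have : HasStrictFDerivAt (NormedSpace.exp : A → A) (1 : A →L[𝕜] A) (g.subtypeL 0) := by
        simpa using hasStrictFDerivAt_exp_zero
      exact this.comp (0 : g) g.subtypeL.hasStrictFDerivAt
    have hz : exp ((0 : g) : A) = 1 := by simp
    have h2 := hM.nhdsWithin_le_map h1
      (Filter.Eventually.of_forall fun x : g => exp_mem_of_mem_tangentAt_one hone hmul hM x.2) (by
        rw [hz]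
        exact fun x hx => ⟨⟨x, hx⟩, rfl⟩)
    rw [hz] at h2
    have h3 : (fun x : g => (x : A)) ⁻¹' U ∈ 𝓝 (0 : g) :=
      continuous_subtype_val.continuousAt (by simpa using hU)
    filter_upwards [h2 (Filter.image_mem_map h3)] with B hB
    obtain ⟨x, hx, rfl⟩ := hB
    exact ⟨x, hx, x.2, rfl⟩

end Submanifold

namespace IsExpGroup

variable {H : Set A} {h : Submodule 𝕜 A} (hH : IsExpGroup H h)
include hH

theorem exists_log : ∃ (L : A → A) (O : Set A), IsOpen O ∧ (1 : A) ∈ O ∧ ContDiffOn 𝕜 ∞ L O ∧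
    L 1 = 0 ∧ (∀ B ∈ O, exp (L B) = B) ∧ (∀ B ∈ O, B ∈ H → L B ∈ h) ∧
    ∀ᶠ x in 𝓝 (0 : A), L (exp x) = x := by
  obtain ⟨L, O, hO, h1O, hL, hL1, hexp, hLexp⟩ := FlagCurve.exists_log 𝕜 A
  have h1 := hH.near_one _ hLexp
  rw [eventually_nhdsWithin_iff, eventually_nhds_iff] at h1
  obtain ⟨N, hN, hNo, h1N⟩ := h1
  refine ⟨L, O ∩ N, hO.inter hNo, ⟨h1O, h1N⟩, hL.mono Set.inter_subset_left, hL1,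
    fun B hB => hexp B hB.1, fun B hB hBH => ?_, hLexp⟩
  obtain ⟨x, hx, hxh, rfl⟩ := hN B hB.2 hBH
  have : L (exp x) = x := hx
  rwa [this]

/-- Near b the retraction is B ↦ b exp(π(log(b⁻¹B))), with π a projection onto the Lie algebra. -/
theorem isLocalRetract [FiniteDimensional 𝕜 A] : IsLocalRetract 𝕜 H := by
  intro b hb
  obtain ⟨b', hb', hbb', hb'b⟩ := hH.inv_mem b hb
  obtain ⟨L, O, hO, h1O, hL, hL1, hexp, hLh, -⟩ := hH.exists_log
  obtain ⟨π, hπh, hπ⟩ := exists_projection h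
  have hc : ContDiff 𝕜 ∞ fun B : A => b' * B := contDiff_const.mul contDiff_id
  refine ⟨(fun B => b' * B) ⁻¹' O, hO.preimage hc.continuous, by simpa [hb'b] using h1O,
    fun B => b * exp (π (L (b' * B))), ?_, fun B _ => hH.mul_mem _ hb _ (hH.exp_mem _ (hπh _)),
    fun B hB hBH => ?_⟩
  · exact contDiffOn_const.mul ((contDiff_exp 𝕜).comp_contDiffOn
      (π.contDiff.comp_contDiffOn (hL.comp hc.contDiffOn fun B hB => hB)))
  · change b * exp (π (L (b' * B))) = B
    rw [hπ _ (hLh _ hB (hH.mul_mem _ hb' _ hBH)), hexp _ hB, ← mul_assoc, hbb', one_mul]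

theorem tangentAt_one [FiniteDimensional 𝕜 A] : tangentAt 𝕜 H 1 = h := by
  apply le_antisymm
  · intro x hx
    obtain ⟨γ, h1, h2, h3, h4⟩ := exists_curve_of_mem_tangentAt_one hH.one_mem hH.mul_mem hx
    obtain ⟨L, O, hO, h1O, hL, hL1, hexp, hLh, hLexp⟩ := hH.exists_log
    have hγO : ∀ᶠ s in 𝓝 (0 : 𝕜), γ s ∈ O := by
      apply h1.continuousAt.eventually_mem
      rw [h2]; exact hO.mem_nhds h1O
    obtain ⟨π, hπh, hπ⟩ := exists_projection h
    have h5 : DifferentiableAt 𝕜 (L ∘ γ) 0 :=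
      DifferentiableAt.comp (0 : 𝕜) (by
        rw [h2]; exact (hL.contDiffAt (hO.mem_nhds h1O)).differentiableAt (by simp))
        h4.differentiableAt
    have h6 : HasDerivAt (L ∘ γ) (π (deriv (L ∘ γ) 0)) 0 := by
      refine (π.hasFDerivAt.comp_hasDerivAt (0 : 𝕜) h5.hasDerivAt).congr_of_eventuallyEq ?_
      filter_upwards [hγO, h3] with s hs hsM
      exact (hπ _ (hLh _ hs hsM)).symm
    have h7 : HasFDerivAt (NormedSpace.exp : A → A) (1 : A →L[𝕜] A) 0 := hasFDerivAt_exp_zero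
    have h8 := HasFDerivAt.comp_hasDerivAt_of_eq (0 : 𝕜) h7 h6 (by simp [h2, hL1])
    have h9 : NormedSpace.exp ∘ (L ∘ γ) =ᶠ[𝓝 0] γ := by
      filter_upwards [hγO] with s hs using hexp _ hs
    rw [h4.unique (h8.congr_of_eventuallyEq h9.symm)]
    exact hπh _
  · intro x hx
    have h1 := mem_tangentAt_of_curve (𝕜 := 𝕜) (M := H) (γ := fun s : 𝕜 => exp (s • x))
      ((contDiff_exp 𝕜).comp (contDiff_id.smul contDiff_const)).contDiffAt
      (Filter.Eventually.of_forall fun s => hH.exp_mem _ (h.smul_mem s hx))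
      (hasDerivAt_exp_smul_zero x)
    simpa using h1

theorem conj_mem [FiniteDimensional 𝕜 A] {a b : A} (ha : a ∈ H) (hb : b ∈ H) (hab : a * b = 1)
    {x : A} (hx : x ∈ h) : a * x * b ∈ h := by
  rw [← hH.tangentAt_one] at hx ⊢
  have hc : ContDiff 𝕜 ∞ fun y : A => a * y * b :=
    (contDiff_const.mul contDiff_id).mul contDiff_const
  have h1 := tangentAt_map (𝕜 := 𝕜) (M := H) (M' := H) (p := 1) hc.contDiffAt
    (eventually_nhdsWithin_of_forall fun y hy => hH.mul_mem _ (hH.mul_mem _ ha _ hy) _ hb) hx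
  have h2 : HasFDerivAt (fun y : A => a * y * b)
      ((ContinuousLinearMap.mul 𝕜 A).flip b ∘L ContinuousLinearMap.mul 𝕜 A a) 1 :=
    ((ContinuousLinearMap.mul 𝕜 A).flip b ∘L ContinuousLinearMap.mul 𝕜 A a).hasFDerivAt
  rw [h2.fderiv, mul_one, hab] at h1
  exact h1

/-- The bracket is the velocity at s = 0 of the curve Ad(exp(sx)) y, which stays in the subspace. -/
theorem lie_mem [FiniteDimensional 𝕜 A] {x y : A} (hx : x ∈ h) (hy : y ∈ h) :
    x * y - y * x ∈ h := by
  obtain ⟨π, hπh, hπ⟩ := exists_projection h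
  have h1 : HasDerivAt (fun s : 𝕜 => exp (s • x) * y * exp (s • -x)) (x * y - y * x) 0 := by
    have := ((hasDerivAt_exp_smul_zero (𝕜 := 𝕜) x).mul_const y).mul
      (hasDerivAt_exp_smul_zero (𝕜 := 𝕜) (-x))
    exact this.congr_deriv (by simp [sub_eq_add_neg])
  have h2 : (fun s : 𝕜 => exp (s • x) * y * exp (s • -x)) =
      fun s => π (exp (s • x) * y * exp (s • -x)) := by
    funext s
    refine (hπ _ (hH.conj_mem (hH.exp_mem _ (h.smul_mem s hx)) (hH.exp_mem _
      (h.smul_mem s (h.neg_mem hx))) ?_ hy)).symm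
    rw [smul_neg]; exact exp_mul_exp_neg 𝕜 _
  have h3 := π.hasFDerivAt.comp_hasDerivAt (0 : 𝕜) h1
  have h4 : HasDerivAt (fun s : 𝕜 => exp (s • x) * y * exp (s • -x)) (π (x * y - y * x)) 0 := by
    rw [h2]; exact h3
  rw [h1.unique h4]
  exact hπh _

/-- The left logarithmic derivative of a curve in `H` lies in `h`. -/
theorem mul_mem_of_mem_tangentAt [FiniteDimensional 𝕜 A] {a b : A} (hb : b ∈ H)
    (hba : b * a = 1) {z : A} (hz : z ∈ tangentAt 𝕜 H a) : b * z ∈ h := by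
  rw [← hH.tangentAt_one]
  have h1 := tangentAt_map (𝕜 := 𝕜) (M := H) (M' := H) (p := a) (f := fun y => b * y)
    (contDiff_const.mul contDiff_id).contDiffAt
    (eventually_nhdsWithin_of_forall fun y hy => hH.mul_mem _ hb _ hy) hz
  have h2 : HasFDerivAt (fun y : A => b * y) (ContinuousLinearMap.mul 𝕜 A b) a :=
    (ContinuousLinearMap.mul 𝕜 A b).hasFDerivAt
  rw [h2.fderiv, hba] at h1
  exact h1

/-- The right logarithmic derivative of a curve in `H` lies in `h`. -/
theorem mul_mem_of_mem_tangentAt' [FiniteDimensional 𝕜 A] {a b : A} (hb : b ∈ H)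
    (hab : a * b = 1) {z : A} (hz : z ∈ tangentAt 𝕜 H a) : z * b ∈ h := by
  rw [← hH.tangentAt_one]
  have h1 := tangentAt_map (𝕜 := 𝕜) (M := H) (M' := H) (p := a) (f := fun y => y * b)
    (contDiff_id.mul contDiff_const).contDiffAt
    (eventually_nhdsWithin_of_forall fun y hy => hH.mul_mem _ hy _ hb) hz
  have h2 : HasFDerivAt (fun y : A => y * b) ((ContinuousLinearMap.mul 𝕜 A).flip b) a :=
    ((ContinuousLinearMap.mul 𝕜 A).flip b).hasFDerivAt
  rw [h2.fderiv, hab] at h1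
  exact h1

end IsExpGroup

end LieGroup

local notation "exp" => NormedSpace.exp

/-! ### Exponentials of operators of positive degree -/

section Unipotent

variable {𝕜 : Type*} [RCLike 𝕜]
variable {V : Type*} [NormedAddCommGroup V] [NormedSpace 𝕜 V] [CompleteSpace V]
variable (𝒱 : ℤ → Submodule 𝕜 V)

theorem homFilt_pow {z : V →L[𝕜] V} (hz : z ∈ homFilt 𝒱 1) (n : ℕ) : z ^ n ∈ homFilt 𝒱 n := by
  induction n with
  | zero => exact homDeg_le_homFilt 𝒱 0 (by simpa using one_mem_homDeg 𝒱)
  | succ n ih => rw [pow_succ]; exact_mod_cast homFilt_mul 𝒱 ih hz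

theorem pow_sub_pow_mem {z z' : V →L[𝕜] V} (hz : z ∈ homFilt 𝒱 1) (hz' : z' ∈ homFilt 𝒱 1) {j : ℤ}
    (h : z - z' ∈ homFilt 𝒱 j) (n : ℕ) : z ^ (n + 1) - z' ^ (n + 1) ∈ homFilt 𝒱 (j + n) := by
  induction n with
  | zero => simpa using h
  | succ n ih =>
    have e : z ^ (n + 1 + 1) - z' ^ (n + 1 + 1) =
        z ^ (n + 1) * (z - z') + (z ^ (n + 1) - z' ^ (n + 1)) * z' := by
      rw [pow_succ z (n + 1), pow_succ z' (n + 1)]; noncomm_ring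
    rw [e]
    have h1 := homFilt_mul 𝒱 (homFilt_pow 𝒱 hz (n + 1)) h
    have h2 := homFilt_mul 𝒱 ih hz'
    refine add_mem (homFilt_antitone 𝒱 ?_ h1) (homFilt_antitone 𝒱 ?_ h2) <;> push_cast <;> lia

variable [FiniteDimensional 𝕜 V]

/-- In the exponential series the terms of order at least 2 gain at least one degree over z - z',
and the filtration subspaces are closed. To leading order exp is thus the identity, which drives
every induction on degree below. -/
theorem exp_sub_exp_mem {z z' : V →L[𝕜] V} (hz : z ∈ homFilt 𝒱 1) (hz' : z' ∈ homFilt 𝒱 1) {j : ℤ}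
    (h : z - z' ∈ homFilt 𝒱 j) : exp z - exp z' - (z - z') ∈ homFilt 𝒱 (j + 1) := by
  have h1 := (NormedSpace.exp_series_hasSum_exp' (𝕂 := 𝕜) z).sub
    (NormedSpace.exp_series_hasSum_exp' (𝕂 := 𝕜) z')
  have h2 := (hasSum_nat_add_iff' 2).2 h1
  have h3 : exp z - exp z' - (z - z') = exp z - exp z' - ∑ i ∈ Finset.range 2,
      (((i.factorial : 𝕜)⁻¹ • z ^ i) - ((i.factorial : 𝕜)⁻¹ • z' ^ i)) := by
    simp [Finset.sum_range_succ]
  rw [h3]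
  refine (homFilt 𝒱 (j + 1)).closed_of_finiteDimensional.mem_of_tendsto h2
    (Filter.Eventually.of_forall fun s => Submodule.sum_mem _ fun n _ => ?_)
  rw [← smul_sub]
  refine Submodule.smul_mem _ _ (homFilt_antitone 𝒱 ?_ (pow_sub_pow_mem 𝒱 hz hz' h (n + 1)))
  push_cast; lia

theorem exp_sub_one_mem {z : V →L[𝕜] V} {j : ℤ} (hj : 1 ≤ j) (hz : z ∈ homFilt 𝒱 j) :
    exp z - 1 - z ∈ homFilt 𝒱 (j + 1) := by
  simpa using exp_sub_exp_mem 𝒱 (homFilt_antitone 𝒱 hj hz) (zero_mem _) (j := j) (by simpa using hz)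

theorem exp_sub_one_mem' {z : V →L[𝕜] V} {j : ℤ} (hj : 1 ≤ j) (hz : z ∈ homFilt 𝒱 j) :
    exp z - 1 ∈ homFilt 𝒱 j := by
  have := add_mem (homFilt_antitone 𝒱 (by lia) (exp_sub_one_mem 𝒱 hj hz)) hz
  rwa [sub_add_cancel] at this

theorem sub_mem_of_exp_sub_exp_mem {z z' : V →L[𝕜] V} (hz : z ∈ homFilt 𝒱 1)
    (hz' : z' ∈ homFilt 𝒱 1) {j : ℤ} (hj : 1 ≤ j) (h : exp z - exp z' ∈ homFilt 𝒱 j) :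
    z - z' ∈ homFilt 𝒱 j := by
  induction j, hj using Int.leInduction with
  | base => exact sub_mem hz hz'
  | succ j hj ih =>
    have h1 := ih (homFilt_antitone 𝒱 (by lia) h)
    have h2 := sub_mem h (exp_sub_exp_mem 𝒱 hz hz' h1)
    rwa [sub_sub_cancel] at h2

variable [DirectSum.Decomposition 𝒱]

theorem eq_of_exp_eq {z z' : V →L[𝕜] V} (hz : z ∈ homFilt 𝒱 1)
    (hz' : z' ∈ homFilt 𝒱 1) (h : exp z = exp z') : z = z' := by
  obtain ⟨n, hn⟩ := exists_depth 𝒱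
  have h1 := sub_mem_of_exp_sub_exp_mem 𝒱 hz hz' (j := n + 1) (by lia)
    (by rw [h, sub_self]; exact zero_mem _)
  exact sub_eq_zero.1 (homFilt_eq_bot_of_le 𝒱 hn (by lia) h1)

/-- The logarithm of a unipotent endomorphism, as the stationary value of an iteration. -/
def unipLog (B : V →L[𝕜] V) : V →L[𝕜] V :=
  (fun z => B - exp z + z)^[(exists_depth 𝒱).choose] 0

/-- Each application of z ↦ B - exp z + z raises the degree of the error by one, since exp agrees
with the identity to leading order. The iteration is therefore exact once the degree exceeds the
depth. -/
theorem unipLog_iterate {B : V →L[𝕜] V} (hB : B - 1 ∈ homFilt 𝒱 1) (n : ℕ) :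
    (fun z => B - exp z + z)^[n] 0 ∈ homFilt 𝒱 1 ∧
      (fun z => B - exp z + z)^[n + 1] 0 - (fun z => B - exp z + z)^[n] 0 ∈
        homFilt 𝒱 (n + 1) := by
  have hT : ∀ z ∈ homFilt 𝒱 1, B - exp z + z ∈ homFilt 𝒱 1 := fun z hz => by
    have h1 := sub_mem hB (homFilt_antitone 𝒱 (by lia) (exp_sub_one_mem 𝒱 le_rfl hz))
    rwa [show B - 1 - (exp z - 1 - z) = B - exp z + z by abel] at h1
  induction n with
  | zero => simpa using hB
  | succ n ih =>
    obtain ⟨h1, h2⟩ := ih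
    rw [Function.iterate_succ_apply'] at h2 ⊢
    refine ⟨hT _ h1, ?_⟩
    rw [Function.iterate_succ_apply', Function.iterate_succ_apply']
    set z := (fun z => B - exp z + z)^[n] 0 with hz
    have h3 := exp_sub_exp_mem 𝒱 (hT _ h1) h1 h2
    rw [← Submodule.neg_mem_iff] at h3
    push_cast
    rwa [show -(exp (B - exp z + z) - exp z - (B - exp z + z - z)) =
      B - exp (B - exp z + z) + (B - exp z + z) - (B - exp z + z) by abel] at h3

theorem unipLog_mem {B : V →L[𝕜] V} (hB : B - 1 ∈ homFilt 𝒱 1) : unipLog 𝒱 B ∈ homFilt 𝒱 1 :=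
  (unipLog_iterate 𝒱 hB _).1

theorem exp_unipLog {B : V →L[𝕜] V} (hB : B - 1 ∈ homFilt 𝒱 1) : exp (unipLog 𝒱 B) = B := by
  have h1 := (unipLog_iterate 𝒱 hB (exists_depth 𝒱).choose).2
  have h2 := homFilt_eq_bot_of_le 𝒱 (exists_depth 𝒱).choose_spec (by lia) h1
  rw [Function.iterate_succ_apply'] at h2
  change B - exp (unipLog 𝒱 B) + unipLog 𝒱 B - unipLog 𝒱 B = 0 at h2
  rw [add_sub_cancel_right, sub_eq_zero] at h2
  exact h2.symm

theorem unipLog_exp {z : V →L[𝕜] V} (hz : z ∈ homFilt 𝒱 1) : unipLog 𝒱 (exp z) = z := by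
  have h := exp_sub_one_mem' 𝒱 le_rfl hz
  exact eq_of_exp_eq 𝒱 (unipLog_mem 𝒱 h) hz (exp_unipLog 𝒱 h)

/-- A fixed finite number of iterations of an analytic expression is analytic everywhere, also far
from 1. This permits the identity theorem to be used with this logarithm. -/
theorem analyticAt_unipLog (B : V →L[𝕜] V) : AnalyticAt 𝕜 (unipLog 𝒱) B := by
  suffices ∀ n : ℕ, AnalyticAt 𝕜 (fun B : V →L[𝕜] V => (fun z => B - exp z + z)^[n] 0) B from
    this _
  intro n
  induction n with
  | zero => exact analyticAt_const
  | succ n ih =>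
    simp only [Function.iterate_succ_apply']
    exact (analyticAt_id.sub ((NormedSpace.exp_analytic _).comp ih)).add ih

theorem continuous_unipLog : Continuous (unipLog 𝒱) :=
  continuous_iff_continuousAt.2 fun B => (analyticAt_unipLog 𝒱 B).continuousAt

/-- The unipotent elements `exp x`, `x` of positive degree in the Lie algebra of a group, are closed
under products. -/
theorem exists_exp_mul_exp_eq {M : Set (V →L[𝕜] V)} {g : Submodule 𝕜 (V →L[𝕜] V)}
    (hM : IsExpGroup M g) {x y : V →L[𝕜] V} (hx : x ∈ g) (hx1 : x ∈ homFilt 𝒱 1) (hy : y ∈ g)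
    (hy1 : y ∈ homFilt 𝒱 1) : ∃ z ∈ g, z ∈ homFilt 𝒱 1 ∧ exp x * exp y = exp z := by
  have hprod : ∀ s : 𝕜, exp (s • x) * exp (s • y) - 1 ∈ homFilt 𝒱 1 := fun s => by
    have h1 := exp_sub_one_mem' 𝒱 le_rfl (Submodule.smul_mem _ s hx1)
    have h2 := exp_sub_one_mem' 𝒱 le_rfl (Submodule.smul_mem _ s hy1)
    have h3 := homFilt_antitone 𝒱 (show (1 : ℤ) ≤ 1 + 1 by lia) (homFilt_mul 𝒱 h1 h2)
    have h4 := add_mem (add_mem h3 h1) h2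
    rwa [show (exp (s • x) - 1) * (exp (s • y) - 1) + (exp (s • x) - 1) + (exp (s • y) - 1) =
      exp (s • x) * exp (s • y) - 1 by noncomm_ring] at h4
  obtain ⟨π, hπg, hπ⟩ := exists_projection g
  -- For small s the logarithm of e^{sx}e^{sy} lies in `g`, because the group is exponential near 1.
  -- The equation π z = z is analytic in s, so it persists up to s = 1; no Baker-Campbell-Hausdorff
  -- series is involved.
  let z : 𝕜 → V →L[𝕜] V := fun s => unipLog 𝒱 (exp (s • x) * exp (s • y))
  have hex : ∀ x : V →L[𝕜] V, AnalyticOnNhd 𝕜 (fun s : 𝕜 => exp (s • x)) Set.univ :=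
    fun x s _ => AnalyticAt.comp (f := fun s : 𝕜 => s • x)
      (NormedSpace.exp_analytic (𝕂 := 𝕜) (s • x)) (analyticAt_id.smul analyticAt_const)
  have hz : AnalyticOnNhd 𝕜 z Set.univ := fun s hs =>
    AnalyticAt.comp (f := fun s : 𝕜 => exp (s • x) * exp (s • y)) (analyticAt_unipLog 𝒱 _)
      ((hex x s hs).mul (hex y s hs))
  have hz0 : z 0 = 0 := by
    have := unipLog_exp 𝒱 (zero_mem (homFilt 𝒱 1))
    rw [NormedSpace.exp_zero] at this
    simpa [z] using this
  have hπz : AnalyticOnNhd 𝕜 (fun s => π (z s)) Set.univ := fun s hs =>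
    (π.analyticAt _).comp (hz s hs)
  have heq : (fun s => π (z s)) =ᶠ[𝓝 0] z := by
    obtain ⟨U, hU, hinj⟩ := exists_exp_injOn 𝕜 (V →L[𝕜] V)
    have h1 := hM.near_one U hU
    have hc : Filter.Tendsto (fun s : 𝕜 => exp (s • x) * exp (s • y)) (𝓝 0) (𝓝[M] 1) := by
      refine tendsto_nhdsWithin_iff.2 ⟨?_, Filter.Eventually.of_forall fun s => ?_⟩
      · have h := ((hex x 0 trivial).mul (hex y 0 trivial)).continuousAt.tendsto
        simp only [Pi.mul_apply, zero_smul, NormedSpace.exp_zero, mul_one] at h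
        exact h
      · exact hM.mul_mem _ (hM.exp_mem _ (g.smul_mem s hx)) _ (hM.exp_mem _ (g.smul_mem s hy))
    have h2 : ∀ᶠ s in 𝓝 (0 : 𝕜), z s ∈ U := by
      apply (hz 0 trivial).continuousAt.eventually_mem
      rwa [hz0]
    filter_upwards [hc.eventually h1, h2] with s hs hsU
    obtain ⟨w, hwU, hwg, hw⟩ := hs
    have : w = z s := hinj hwU hsU (by rw [hw, exp_unipLog 𝒱 (hprod s)])
    rw [← this, hπ _ hwg]
  have h1 := congrFun (hπz.eq_of_eventuallyEq hz heq) 1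
  refine ⟨z 1, by rw [← h1]; exact hπg _, unipLog_mem 𝒱 (hprod 1), ?_⟩
  have := exp_unipLog 𝒱 (hprod 1)
  simp only [one_smul] at this
  simp [z, this]

/-- The product of exp x - 1 and exp y - 1 has degree at least 2j ≥ j+1, so under multiplication of
exponentials leading terms add. -/
theorem exists_exp_mul_exp_eq_of_homFilt {M : Set (V →L[𝕜] V)} {g : Submodule 𝕜 (V →L[𝕜] V)}
    (hM : IsExpGroup M g) {x y : V →L[𝕜] V} {j : ℤ} (hj : 1 ≤ j) (hx : x ∈ g)
    (hx1 : x ∈ homFilt 𝒱 j) (hy : y ∈ g) (hy1 : y ∈ homFilt 𝒱 j) :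
    ∃ z ∈ g, z ∈ homFilt 𝒱 j ∧ exp x * exp y = exp z ∧ z - (x + y) ∈ homFilt 𝒱 (j + 1) := by
  obtain ⟨z, hz, hz1, hxyz⟩ := exists_exp_mul_exp_eq 𝒱 hM hx (homFilt_antitone 𝒱 hj hx1) hy
    (homFilt_antitone 𝒱 hj hy1)
  have h1 := exp_sub_one_mem' 𝒱 hj hx1
  have h2 := exp_sub_one_mem' 𝒱 hj hy1
  have h3 : exp z - 1 - (x + y) ∈ homFilt 𝒱 (j + 1) := by
    rw [← hxyz, show exp x * exp y - 1 - (x + y) = (exp x - 1) * (exp y - 1) +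
      ((exp x - 1 - x) + (exp y - 1 - y)) by noncomm_ring]
    exact add_mem (homFilt_antitone 𝒱 (by lia) (homFilt_mul 𝒱 h1 h2))
      (add_mem (exp_sub_one_mem 𝒱 hj hx1) (exp_sub_one_mem 𝒱 hj hy1))
  have h4 : z ∈ homFilt 𝒱 j := by
    have := sub_mem_of_exp_sub_exp_mem 𝒱 hz1 (zero_mem _) hj (z' := 0) (by
      have := add_mem (homFilt_antitone 𝒱 (by lia) h3) (add_mem hx1 hy1)
      simpa using this)
    simpa using this
  refine ⟨z, hz, h4, hxyz, ?_⟩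
  have := sub_mem h3 (exp_sub_one_mem 𝒱 hj h4)
  rwa [show exp z - 1 - (x + y) - (exp z - 1 - z) = z - (x + y) by abel] at this

/-- Take x = log(e^{-w}e^{w'}); since e^{-w} is 1 modulo positive degree, its leading term is that
of w' - w. This trades a change of the exponent for a right translation. -/
theorem exists_exp_eq_exp_mul {M : Set (V →L[𝕜] V)} {g : Submodule 𝕜 (V →L[𝕜] V)}
    (hM : IsExpGroup M g) {w w' : V →L[𝕜] V} {j : ℤ} (hj : 1 ≤ j) (hw : w ∈ g)
    (hw1 : w ∈ homFilt 𝒱 1) (hw' : w' ∈ g) (hw'1 : w' ∈ homFilt 𝒱 1)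
    (h : w' - w ∈ homFilt 𝒱 j) :
    ∃ x ∈ g, x ∈ homFilt 𝒱 j ∧ exp w' = exp w * exp x ∧ x - (w' - w) ∈ homFilt 𝒱 (j + 1) := by
  obtain ⟨x, hx, hx1, hwx⟩ := exists_exp_mul_exp_eq 𝒱 hM (g.neg_mem hw)
    (neg_mem hw1) hw' hw'1
  have h1 := exp_sub_exp_mem 𝒱 hw'1 hw1 h
  have h2 : exp w' - exp w ∈ homFilt 𝒱 j := by
    have := add_mem (homFilt_antitone 𝒱 (by lia) h1) h
    rwa [sub_add_cancel] at this
  have h3 : exp x - 1 - (w' - w) ∈ homFilt 𝒱 (j + 1) := by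
    have h4 := exp_sub_one_mem' 𝒱 le_rfl (neg_mem hw1)
    have e : exp x - 1 - (w' - w) =
        (exp (-w) - 1) * (exp w' - exp w) + (exp w' - exp w - (w' - w)) := by
      rw [← hwx, sub_mul, mul_sub, exp_neg_mul_exp 𝕜, one_mul]; abel
    rw [e]
    exact add_mem (homFilt_antitone 𝒱 (by lia) (homFilt_mul 𝒱 h4 h2)) h1
  have h4 : x ∈ homFilt 𝒱 j := by
    have := sub_mem_of_exp_sub_exp_mem 𝒱 hx1 (zero_mem _) hj (z' := 0) (by
      have := add_mem (homFilt_antitone 𝒱 (by lia) h3) h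
      simpa using this)
    simpa using this
  refine ⟨x, hx, h4, by rw [← hwx, ← mul_assoc, exp_mul_exp_neg 𝕜, one_mul], ?_⟩
  have := sub_mem h3 (exp_sub_one_mem 𝒱 hj h4)
  rwa [show exp x - 1 - (w' - w) - (exp x - 1 - x) = x - (w' - w) by abel] at this

end Unipotent

/-! ### The group 𝒢 = J⁻¹GJ as an exponential group -/

section Model

variable {𝕜 : Type*} [RCLike 𝕜]

theorem IsSubmanifold.image {E F : Type*} [NormedAddCommGroup E] [NormedSpace 𝕜 E]
    [NormedAddCommGroup F] [NormedSpace 𝕜 F] {M : Set E} (hM : IsSubmanifold 𝕜 M)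
    (Φ : E ≃L[𝕜] F) : IsSubmanifold 𝕜 (Φ '' M) := by
  rintro _ ⟨p, hp, rfl⟩
  obtain ⟨e, hpe, he, hes, S, hS⟩ := hM p hp
  refine ⟨(Φ.symm.toHomeomorph.toOpenPartialHomeomorph.trans e).trans
    Φ.toHomeomorph.toOpenPartialHomeomorph, by simpa using hpe, ?_, ?_,
    S.map (Φ : E →L[𝕜] F).toLinearMap, ?_⟩
  · refine Φ.contDiff.comp_contDiffOn (he.comp Φ.symm.contDiff.contDiffOn fun x hx => ?_)
    simpa using hx
  · refine Φ.contDiff.comp_contDiffOn (hes.comp Φ.symm.contDiff.contDiffOn fun x hx => ?_)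
    simpa using hx
  · intro q hq
    have hq' : Φ.symm q ∈ e.source := by simpa using hq
    have h1 : q ∈ Φ '' M ↔ Φ.symm q ∈ M :=
      ⟨by rintro ⟨x, hx, rfl⟩; simpa using hx, fun h => ⟨_, h, by simp⟩⟩
    rw [h1, hS _ hq']
    constructor
    · exact fun h => ⟨_, h, rfl⟩
    · rintro ⟨y, hy, hyq⟩
      have : y = e (Φ.symm q) := Φ.injective hyq
      rwa [← this]

variable {V : Type*} [NormedAddCommGroup V] [NormedSpace 𝕜 V] [FiniteDimensional 𝕜 V]
variable [CompleteSpace V]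
variable {W : Type*} [NormedAddCommGroup W] [NormedSpace 𝕜 W]
variable (J : V ≃L[𝕜] W) (G : Subgroup (W ≃L[𝕜] W))

theorem one_mem_modelGroup : ContinuousLinearEquiv.refl 𝕜 V ∈ modelGroup J G := by
  have : (J.symm.trans (ContinuousLinearEquiv.refl 𝕜 V)).trans J = 1 := by
    ext x; exact J.apply_symm_apply x
  change _ ∈ G
  rw [this]
  exact G.one_mem

theorem trans_mem_modelGroup {A B : V ≃L[𝕜] V} (hA : A ∈ modelGroup J G)
    (hB : B ∈ modelGroup J G) : A.trans B ∈ modelGroup J G := by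
  have : (J.symm.trans (A.trans B)).trans J =
      ((J.symm.trans B).trans J) * ((J.symm.trans A).trans J) := by
    ext x
    change J (B (A (J.symm x))) = J (B (J.symm (J (A (J.symm x)))))
    simp
  change _ ∈ G
  rw [this]
  exact G.mul_mem hB hA

theorem symm_mem_modelGroup {A : V ≃L[𝕜] V} (hA : A ∈ modelGroup J G) :
    A.symm ∈ modelGroup J G := by
  have : (J.symm.trans A.symm).trans J = ((J.symm.trans A).trans J)⁻¹ := by
    rw [eq_inv_iff_mul_eq_one]
    ext x
    change J (A.symm (J.symm (J (A (J.symm x))))) = x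
    simp
  change _ ∈ G
  rw [this]
  exact G.inv_mem hA

theorem isExpGroup_modelGroup (hG : IsLieSubgroup G) :
    IsExpGroup (opSet (modelGroup J G)) (modelLie J G) := by
  refine IsSubmanifold.isExpGroup ⟨_, one_mem_modelGroup J G, rfl⟩ ?_ ?_ ?_
  · rintro _ ⟨A, hA, rfl⟩ _ ⟨B, hB, rfl⟩
    exact ⟨B.trans A, trans_mem_modelGroup J G hB hA, rfl⟩
  · have h := IsSubmanifold.image hG (ContinuousLinearEquiv.arrowCongr J.symm J.symm)
    have hset : opSet (modelGroup J G) =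
        ContinuousLinearEquiv.arrowCongr J.symm J.symm '' opSet (G : Set (W ≃L[𝕜] W)) := ?_
    · rw [hset]; exact h
    ext x
    constructor
    · rintro ⟨A, hA, rfl⟩
      exact ⟨_, ⟨_, hA, rfl⟩, by ext; simp⟩
    · rintro ⟨_, ⟨g, hg, rfl⟩, rfl⟩
      refine ⟨(J.trans g).trans J.symm, ?_, by ext; simp⟩
      have : (J.symm.trans ((J.trans g).trans J.symm)).trans J = g := by ext; simp
      change _ ∈ G
      rw [this]
      exact hg
  · rintro _ ⟨A, hA, rfl⟩
    exact ⟨_, ⟨A.symm, symm_mem_modelGroup J G hA, rfl⟩, by ext; simp, by ext; simp⟩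

end Model

/-! ### Frame manifolds, partial normalizations and their tangent vectors -/

section Tower

variable {𝕜 : Type*} [RCLike 𝕜]
variable {V : Type*} [NormedAddCommGroup V] [NormedSpace 𝕜 V]
variable {W : Type*} [NormedAddCommGroup W] [NormedSpace 𝕜 W]

/-- The right action of operators of `V` on pairs of a parameter and a frame. -/
def rmul (p : 𝕜 × (V →L[𝕜] W)) (x : V →L[𝕜] V) : 𝕜 × (V →L[𝕜] W) := (p.1, p.2 ∘L x)

theorem rmul_rmul (p : 𝕜 × (V →L[𝕜] W)) (x y : V →L[𝕜] V) :
    rmul (rmul p x) y = rmul p (x * y) := rfl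

theorem rmul_one (p : 𝕜 × (V →L[𝕜] W)) : rmul p 1 = p := rfl

theorem contDiff_rmul :
    ContDiff 𝕜 ∞ fun z : (𝕜 × (V →L[𝕜] W)) × (V →L[𝕜] V) => rmul z.1 z.2 :=
  (contDiff_fst.comp contDiff_fst).prodMk
    ((contDiff_snd.comp contDiff_fst).clm_comp contDiff_snd)

variable (𝒱 : ℤ → Submodule 𝕜 V) (J : V ≃L[𝕜] W) (G : Subgroup (W ≃L[𝕜] W))
variable (m : Submodule 𝕜 (V →L[𝕜] V))

theorem lieFilt_antitone : Antitone (lieFilt J G 𝒱) := fun _ _ h _ hx =>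
  ⟨hx.1, homFilt_antitone 𝒱 h hx.2⟩

theorem lieDeg_le_lieFilt (k : ℤ) : lieDeg J G 𝒱 k ≤ lieFilt J G 𝒱 k := fun _ hx =>
  ⟨hx.1, homDeg_le_homFilt 𝒱 k hx.2⟩

theorem prolong_le_lieDeg (n : ℕ) : prolong 𝒱 J G m (n + 1) ≤ lieDeg J G 𝒱 n := fun _ hx => hx.1

variable [DirectSum.Decomposition 𝒱] [FiniteDimensional 𝕜 V]

theorem degPart_mem_lieDeg {J : V ≃L[𝕜] W} {G : Subgroup (W ≃L[𝕜] W)} (hgr : IsGradedLie J G 𝒱)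
    {x : V →L[𝕜] V} (hx : x ∈ modelLie J G) (k : ℤ) : degPart 𝒱 k x ∈ lieDeg J G 𝒱 k :=
  ⟨hgr x hx k, degPart_mem 𝒱 k x⟩

/-- The algebraic data of the normalization procedure: `N` consists of the values at `δ` of the
normalized cochains and `s j` is a complement to `𝔲_j` in `𝔤_j` that contains the part of degree
`j` of `N`. -/
structure IsNormalForm (δ : V →L[𝕜] V) (N : Submodule 𝕜 (V →L[𝕜] V))
    (s : ℕ → Submodule 𝕜 (V →L[𝕜] V)) : Prop where
  span : m = Submodule.span 𝕜 {δ}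
  mem_lie : δ ∈ lieDeg J G 𝒱 (-1)
  ne_zero : δ ≠ 0
  graded : ∀ n ∈ N, ∀ k : ℤ, degPart 𝒱 k n ∈ N
  le_slice : ∀ n ∈ N, ∀ j : ℕ, degPart 𝒱 j n ∈ s j
  slice_le : ∀ j : ℕ, s j ≤ lieDeg J G 𝒱 j
  disjoint : ∀ j, ∀ x ∈ s j, x ∈ prolong 𝒱 J G m (j + 1) → x = 0
  disjoint_normal : ∀ j : ℕ, ∀ x ∈ lieDeg J G 𝒱 (j + 1), ∀ u ∈ prolong 𝒱 J G m (j + 1),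
    δ * x - x * δ + u ∈ N → δ * x - x * δ + u = 0
  exists_projection : ∃ q : (V →L[𝕜] V) →L[𝕜] (V →L[𝕜] V), ∀ x ∈ modelLie J G,
    q x ∈ lieFilt J G 𝒱 0 ∧ degPart 𝒱 0 (q x) ∈ prolong 𝒱 J G m 1 ∧
      ∀ j : ℕ, degPart 𝒱 j (x - q x) ∈ s j
  exists_solution : ∀ j : ℕ, ∃ r : (V →L[𝕜] V) →L[𝕜] (V →L[𝕜] V), (∀ z, r z ∈ s (j + 1)) ∧
    ∀ z ∈ lieDeg J G 𝒱 j, ∃ n ∈ N, ∃ u ∈ prolong 𝒱 J G m (j + 1),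
      z = n + u + (δ * r z - r z * δ)

/-- The elements of positive degree at most `k` with components in the slices `s j`. -/
def sliceSum (s : ℕ → Submodule 𝕜 (V →L[𝕜] V)) (k : ℕ) : Submodule 𝕜 (V →L[𝕜] V) where
  carrier := {w | (∀ j : ℕ, 1 ≤ j → j ≤ k → degPart 𝒱 j w ∈ s j) ∧
    ∀ i : ℤ, i < 1 ∨ (k : ℤ) < i → degPart 𝒱 i w = 0}
  add_mem' {x y} hx hy := ⟨fun j h1 h2 => by rw [map_add]; exact add_mem (hx.1 j h1 h2) (hy.1 j h1 h2),
    fun i h => by rw [map_add, hx.2 i h, hy.2 i h, add_zero]⟩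
  zero_mem' := ⟨fun j _ _ => by rw [map_zero]; exact zero_mem _, fun i _ => map_zero _⟩
  smul_mem' a x hx := ⟨fun j h1 h2 => by rw [map_smul]; exact Submodule.smul_mem _ a (hx.1 j h1 h2),
    fun i h => by rw [map_smul, hx.2 i h, smul_zero]⟩

variable {𝒱 J G m} {δ : V →L[𝕜] V} {N : Submodule 𝕜 (V →L[𝕜] V)}
variable {s : ℕ → Submodule 𝕜 (V →L[𝕜] V)}

theorem sliceSum_le_homFilt (k : ℕ) : sliceSum 𝒱 s k ≤ homFilt 𝒱 1 := fun _ hw =>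
  (mem_homFilt_iff 𝒱).2 fun i hi => hw.2 i (Or.inl hi)

theorem IsNormalForm.sliceSum_le (hN : IsNormalForm 𝒱 J G m δ N s) (k : ℕ) :
    sliceSum 𝒱 s k ≤ lieFilt J G 𝒱 1 := fun w hw => by
  refine ⟨mem_of_forall_degPart 𝒱 fun i => ?_, sliceSum_le_homFilt k hw⟩
  by_cases h : i < 1 ∨ (k : ℤ) < i
  · rw [hw.2 i h]; exact zero_mem _
  · obtain ⟨j, rfl⟩ : ∃ j : ℕ, (j : ℤ) = i := ⟨i.toNat, by lia⟩
    exact (hN.slice_le j (hw.1 j (by lia) (by lia))).1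

theorem sliceSum_mono {k l : ℕ} (h : k ≤ l) : sliceSum 𝒱 s k ≤ sliceSum 𝒱 s l := fun w hw => by
  refine ⟨fun j h1 h2 => ?_, fun i hi => hw.2 i (by lia)⟩
  by_cases hj : j ≤ k
  · exact hw.1 j h1 hj
  · rw [hw.2 j (by lia)]; exact zero_mem _

theorem mem_sliceSum_of_mem (hs : ∀ j : ℕ, s j ≤ homDeg 𝒱 j) {k : ℕ} (hk : 1 ≤ k)
    {x : V →L[𝕜] V} (hx : x ∈ s k) : x ∈ sliceSum 𝒱 s k := by
  refine ⟨fun j _ _ => ?_, fun i hi => degPart_of_mem_ne 𝒱 (hs k hx) (by lia)⟩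
  by_cases h : j = k
  · subst h; rwa [degPart_of_mem 𝒱 (hs _ hx)]
  · rw [degPart_of_mem_ne 𝒱 (hs k hx) (by lia)]; exact zero_mem _

theorem eq_zero_of_mem_sliceSum {k : ℕ} {w : V →L[𝕜] V} (hw : w ∈ sliceSum 𝒱 s k)
    (h : w ∈ homFilt 𝒱 (k + 1)) : w = 0 := by
  refine ext_degPart 𝒱 fun i => ?_
  rw [map_zero]
  by_cases hi : (k : ℤ) < i
  · exact hw.2 i (Or.inr hi)
  · exact degPart_of_homFilt 𝒱 h (by lia)

theorem sub_degPart_mem_sliceSum {k : ℕ} {w : V →L[𝕜] V} (hw : w ∈ sliceSum 𝒱 s (k + 1)) :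
    w - degPart 𝒱 (k + 1 : ℕ) w ∈ sliceSum 𝒱 s k := by
  refine ⟨fun j h1 h2 => ?_, fun i hi => ?_⟩
  · rw [map_sub, degPart_degPart, if_neg (by lia), sub_zero]
    exact hw.1 j h1 (by lia)
  · rw [map_sub, degPart_degPart]
    split_ifs with h
    · rw [h, sub_self]
    · rw [hw.2 i (by lia), sub_zero]

variable (𝒱 J G m) in
/-- The infinitesimal description of the total space of `P̂₀`. -/
structure IsFrameManifold (δ : V →L[𝕜] V) (S : Set (𝕜 × (V →L[𝕜] W))) : Prop where
  exists_equiv : ∀ p ∈ S, ∃ ψ : V ≃L[𝕜] W, p.2 = ψ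
  mul_exp : ∀ p ∈ S, ∀ x ∈ lieFilt J G 𝒱 1, rmul p (exp x) ∈ S
  retract : IsLocalRetract 𝕜 S
  lift : ∀ p ∈ S, ∃ O : Set (𝕜 × (V →L[𝕜] W)), IsOpen O ∧ p ∈ O ∧
    ∃ Ω : 𝕜 × (V →L[𝕜] W) → (V →L[𝕜] V), ContDiffOn 𝕜 ∞ Ω O ∧
      ∀ q ∈ O, q ∈ S → ((1 : 𝕜), q.2 ∘L Ω q) ∈ tangentAt 𝕜 S q
  tangent : ∀ p ∈ S, ∀ a : 𝕜, ∀ c : V →L[𝕜] V, (a, p.2 ∘L c) ∈ tangentAt 𝕜 S p →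
    c ∈ lieFilt J G 𝒱 (-1) ∧ (∃ l : 𝕜, degPart 𝒱 (-1) c = l • δ ∧ (a ≠ 0 → l ≠ 0)) ∧
      (a = 0 → c ∈ homFilt 𝒱 0 ∧ degPart 𝒱 0 c ∈ prolong 𝒱 J G m 1)
  vertical : ∀ p ∈ S, ∀ x ∈ lieFilt J G 𝒱 0, degPart 𝒱 0 x ∈ prolong 𝒱 J G m 1 →
    ((0 : 𝕜), p.2 ∘L x) ∈ tangentAt 𝕜 S p

variable (𝒱 J G m) in
/-- The set `R` is the partial normalization of order `k` of the frame manifold `S`, and the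
element `p` of `S` is moved to `R` by `exp (v p)`. -/
structure IsReduction (N : Submodule 𝕜 (V →L[𝕜] V)) (s : ℕ → Submodule 𝕜 (V →L[𝕜] V))
    (S R : Set (𝕜 × (V →L[𝕜] W))) (k : ℕ)
    (v : 𝕜 × (V →L[𝕜] W) → (V →L[𝕜] V)) : Prop where
  subset : R ⊆ S
  smooth : ContDiffOn 𝕜 ∞ v S
  mem_slice : ∀ p ∈ S, v p ∈ sliceSum 𝒱 s k
  mem_iff : ∀ p ∈ S, ∀ w ∈ sliceSum 𝒱 s k, rmul p (exp w) ∈ R ↔ w = v p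
  mul_exp : ∀ p ∈ R, ∀ x ∈ lieFilt J G 𝒱 (k + 1), rmul p (exp x) ∈ R
  lead : ∀ p ∈ R, ∀ j : ℕ, 1 ≤ j → j ≤ k → ∀ x ∈ lieFilt J G 𝒱 j, rmul p (exp x) ∈ R →
    degPart 𝒱 j x ∈ prolong 𝒱 J G m (j + 1)
  normal : ∀ p ∈ R, ∃ c : V →L[𝕜] V, ((1 : 𝕜), p.2 ∘L c) ∈ tangentAt 𝕜 R p ∧
    ∀ j < k, degPart 𝒱 j c ∈ N

variable {S R : Set (𝕜 × (V →L[𝕜] W))} {k : ℕ} {v : 𝕜 × (V →L[𝕜] W) → (V →L[𝕜] V)}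

theorem HasDerivAt.mem_submodule {E : Type*} [NormedAddCommGroup E] [NormedSpace 𝕜 E]
    [FiniteDimensional 𝕜 E] {K : Submodule 𝕜 E} {f : 𝕜 → E} {f' : E} {a : 𝕜}
    (hf : HasDerivAt f f' a) (h : ∀ᶠ t in 𝓝 a, f t ∈ K) : f' ∈ K := by
  obtain ⟨π, hπK, hπ⟩ := exists_projection K
  have h1 := (π.hasFDerivAt.comp_hasDerivAt a hf).congr_of_eventuallyEq
    (h.mono fun t ht => (hπ _ ht).symm)
  rw [hf.unique h1]
  exact hπK _

theorem fderivWithin_mem_submodule {E F : Type*} [NormedAddCommGroup E] [NormedSpace 𝕜 E]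
    [NormedAddCommGroup F] [NormedSpace 𝕜 F] [FiniteDimensional 𝕜 F] {M : Set E}
    {K : Submodule 𝕜 F} {f : E → F} {f' : E →L[𝕜] F} {p : E} (hf : HasFDerivWithinAt f f' M p)
    (h : ∀ q ∈ M, f q ∈ K) {ξ : E} (hξ : ξ ∈ tangentAt 𝕜 M p) : f' ξ ∈ K := by
  obtain ⟨π, hπK, hπ⟩ := exists_projection K
  have h1 := fderivWithin_eq_of_tangentAt subset_rfl hf (π.hasFDerivAt.comp_hasFDerivWithinAt p hf)
    (eventually_nhdsWithin_of_forall fun q hq => (hπ _ (h q hq)).symm) hξ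
  rw [h1]
  exact hπK _

theorem hasFDerivWithinAt_of_contDiffOn {E F : Type*} [NormedAddCommGroup E] [NormedSpace 𝕜 E]
    [NormedAddCommGroup F] [NormedSpace 𝕜 F] {M : Set E} {f : E → F} (hf : ContDiffOn 𝕜 ∞ f M)
    {p : E} (hp : p ∈ M) : HasFDerivWithinAt f (fderivWithin 𝕜 f M p) M p :=
  ((hf p hp).differentiableWithinAt (by simp)).hasFDerivWithinAt

namespace IsFrameManifold

variable (hS : IsFrameManifold 𝒱 J G m δ S)
include hS

variable [CompleteSpace V]

/-- The map q ↦ q exp(v q) carries `S` into `R` and fixes p, and its derivative at p is ξ ↦ ξ + p ∘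
dv(ξ). The local retraction is used to extend v smoothly off `S` before differentiating. -/
theorem add_fderivWithin_mem_tangentAt (hv : ContDiffOn 𝕜 ∞ v S)
    (hR : ∀ p ∈ S, rmul p (exp (v p)) ∈ R) {p : 𝕜 × (V →L[𝕜] W)} (hp : p ∈ S) (h0 : v p = 0)
    {ξ : 𝕜 × (V →L[𝕜] W)} (hξ : ξ ∈ tangentAt 𝕜 S p) :
    ξ + (0, p.2 ∘L fderivWithin 𝕜 v S p ξ) ∈ tangentAt 𝕜 R p := by
  obtain ⟨O, hO, hpO, g, hg, hgv⟩ := hS.retract.exists_extension hv hp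
  have hgp : g p = 0 := by rw [hgv p hpO hp, h0]
  have hga : ContDiffAt 𝕜 ∞ g p := hg.contDiffAt (hO.mem_nhds hpO)
  have hgd := (hga.differentiableAt (by simp)).hasFDerivAt
  let F : 𝕜 × (V →L[𝕜] W) → 𝕜 × (V →L[𝕜] W) := fun q => rmul q (exp (g q))
  have hF : ContDiffAt 𝕜 ∞ F p :=
    contDiff_rmul.contDiffAt.comp p (contDiffAt_id.prodMk ((contDiff_exp 𝕜).contDiffAt.comp p hga))
  have hFR : ∀ᶠ q in 𝓝[S] p, F q ∈ R := by
    filter_upwards [self_mem_nhdsWithin, mem_nhdsWithin_of_mem_nhds (hO.mem_nhds hpO)] with q hq hqO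
    change rmul q (exp (g q)) ∈ R
    rw [hgv q hqO hq]
    exact hR q hq
  have h1 := tangentAt_map hF hFR hξ
  have hFp : F p = p := by
    change rmul p (exp (g p)) = p
    rw [hgp, NormedSpace.exp_zero, rmul_one]
  rw [hFp] at h1
  have hexp : HasFDerivAt (fun q => exp (g q)) (fderiv 𝕜 g p) p := by
    have h2 : HasFDerivAt (NormedSpace.exp : (V →L[𝕜] V) → _)
        (1 : (V →L[𝕜] V) →L[𝕜] (V →L[𝕜] V)) (g p) := by
      rw [hgp]; exact hasFDerivAt_exp_zero
    exact h2.comp p hgd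
  have h3 := (hasFDerivAt_fst (𝕜 := 𝕜) (p := p)).prodMk
    ((hasFDerivAt_snd (𝕜 := 𝕜) (p := p)).clm_comp hexp)
  have h3' : fderiv 𝕜 F p = _ := h3.fderiv
  have h4 : fderivWithin 𝕜 v S p ξ = fderiv 𝕜 g p ξ := by
    refine fderivWithin_eq_of_tangentAt subset_rfl (hasFDerivWithinAt_of_contDiffOn hv hp)
      hgd.hasFDerivWithinAt ?_ hξ
    filter_upwards [self_mem_nhdsWithin, mem_nhdsWithin_of_mem_nhds (hO.mem_nhds hpO)] with q hq hqO
    exact (hgv q hqO hq).symm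
  rw [h3'] at h1
  convert h1 using 1
  refine Prod.ext (by simp) ?_
  simp [hgp, h4, ContinuousLinearMap.one_def, add_comm]

end IsFrameManifold

namespace IsReduction

variable (hN : IsNormalForm 𝒱 J G m δ N s) (hS : IsFrameManifold 𝒱 J G m δ S)
  (hR : IsReduction 𝒱 J G m N s S R k v)
  (hM : IsExpGroup (opSet (modelGroup J G)) (modelLie J G))

include hR in
theorem rmul_exp_mem {p : 𝕜 × (V →L[𝕜] W)} (hp : p ∈ S) : rmul p (exp (v p)) ∈ R :=
  (hR.mem_iff p hp _ (hR.mem_slice p hp)).2 rfl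

include hR in
theorem mem_iff_eq_zero {p : 𝕜 × (V →L[𝕜] W)} (hp : p ∈ S) : p ∈ R ↔ v p = 0 := by
  have := hR.mem_iff p hp 0 (zero_mem _)
  rw [NormedSpace.exp_zero, rmul_one] at this
  rw [this, eq_comm]

variable [CompleteSpace V]

include hR hM hN hS in
-- With w the correction at p e^x, the product e^x e^w = e^z leads from p back to `R`, so the
-- leading part of z, which is that of x + w, lies in the prolongation. In degrees below j only w
-- contributes, and its component lies both in the slice and in the prolongation, hence vanishes.
theorem apply_rmul_exp {p : 𝕜 × (V →L[𝕜] W)} (hp : p ∈ R) {j : ℕ} (hj : 1 ≤ j) (hjk : j ≤ k)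
    {x : V →L[𝕜] V} (hx : x ∈ lieFilt J G 𝒱 j) :
    v (rmul p (exp x)) ∈ homFilt 𝒱 j ∧
      degPart 𝒱 j x + degPart 𝒱 j (v (rmul p (exp x))) ∈ prolong 𝒱 J G m (j + 1) := by
  have hp' : rmul p (exp x) ∈ S :=
    hS.mul_exp p (hR.subset hp) x (lieFilt_antitone 𝒱 J G (by lia) hx)
  have h1 := hR.rmul_exp_mem hp'
  have hw := hR.mem_slice _ hp'
  set w := v (rmul p (exp x))
  rw [rmul_rmul] at h1
  have hwl := hN.sliceSum_le k hw
  have key : ∀ i : ℕ, 1 ≤ i → i ≤ j → w ∈ homFilt 𝒱 i →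
      degPart 𝒱 i x + degPart 𝒱 i w ∈ prolong 𝒱 J G m (i + 1) := by
    intro i hi hij hwi
    obtain ⟨z, hz, hz1, hxz, hz2⟩ := exists_exp_mul_exp_eq_of_homFilt 𝒱 hM
      (show (1 : ℤ) ≤ i by lia) hx.1 (homFilt_antitone 𝒱 (by lia) hx.2) hwl.1 hwi
    rw [hxz] at h1
    have h2 := hR.lead p hp i hi (hij.trans hjk) z ⟨hz, hz1⟩ h1
    have h3 := degPart_of_homFilt 𝒱 hz2 (lt_add_one _)
    rw [map_sub, map_add, sub_eq_zero] at h3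
    rwa [h3] at h2
  have hwj : ∀ i : ℕ, 1 ≤ i → i ≤ j → w ∈ homFilt 𝒱 i := by
    intro i hi
    induction i, hi using Nat.le_induction with
    | base => exact fun _ => by exact_mod_cast hwl.2
    | succ i hi ih =>
      intro hij
      have h2 := key i hi (by lia) (ih (by lia))
      rw [degPart_of_homFilt 𝒱 hx.2 (by lia), zero_add] at h2
      have h3 := hN.disjoint i _ (hw.1 i hi (by lia)) h2
      exact_mod_cast homFilt_succ 𝒱 (ih (by lia)) h3
  exact ⟨hwj j hj le_rfl, key j hj le_rfl (hwj j hj le_rfl)⟩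

include hR hS in
theorem tangent_add_mem {p : 𝕜 × (V →L[𝕜] W)} (hp : p ∈ R) {ξ : 𝕜 × (V →L[𝕜] W)}
    (hξ : ξ ∈ tangentAt 𝕜 S p) : ξ + (0, p.2 ∘L fderivWithin 𝕜 v S p ξ) ∈ tangentAt 𝕜 R p :=
  hS.add_fderivWithin_mem_tangentAt hR.smooth (fun _ => hR.rmul_exp_mem) (hR.subset hp)
    ((hR.mem_iff_eq_zero (hR.subset hp)).1 hp) hξ

include hR in
theorem tangentAt_le {p : 𝕜 × (V →L[𝕜] W)} : tangentAt 𝕜 R p ≤ tangentAt 𝕜 S p :=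
  tangentAt_mono (eventually_nhdsWithin_of_forall hR.subset)

include hR in
theorem fderivWithin_mem_slice {p : 𝕜 × (V →L[𝕜] W)} (hp : p ∈ R) {ξ : 𝕜 × (V →L[𝕜] W)}
    (hξ : ξ ∈ tangentAt 𝕜 S p) : fderivWithin 𝕜 v S p ξ ∈ sliceSum 𝒱 s k :=
  fderivWithin_mem_submodule (hasFDerivWithinAt_of_contDiffOn hR.smooth (hR.subset hp))
    hR.mem_slice hξ

include hR in
theorem fderivWithin_eq_zero {p : 𝕜 × (V →L[𝕜] W)} (hp : p ∈ R) {ξ : 𝕜 × (V →L[𝕜] W)}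
    (hξ : ξ ∈ tangentAt 𝕜 R p) : fderivWithin 𝕜 v S p ξ = 0 :=
  fderivWithin_eq_of_tangentAt hR.subset
    (hasFDerivWithinAt_of_contDiffOn hR.smooth (hR.subset hp))
    (hasFDerivWithinAt_const (0 : V →L[𝕜] V) p S)
    (eventually_nhdsWithin_of_forall fun _ hq => (hR.mem_iff_eq_zero (hR.subset hq)).1 hq) hξ

include hR hS in
theorem hasDerivAt_apply_rmul_exp {p : 𝕜 × (V →L[𝕜] W)} (hp : p ∈ R) {x : V →L[𝕜] V}
    (hx : x ∈ lieFilt J G 𝒱 1) : HasDerivAt (fun t : 𝕜 => v (rmul p (exp (t • x))))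
      (fderivWithin 𝕜 v S p (0, p.2 ∘L x)) 0 := by
  have h1 : HasDerivAt (fun t : 𝕜 => rmul p (exp (t • x))) (0, p.2 ∘L x) 0 :=
    (hasDerivAt_const _ _).prodMk
      ((ContinuousLinearMap.compL 𝕜 V V W p.2).hasFDerivAt.comp_hasDerivAt (0 : 𝕜)
        (hasDerivAt_exp_smul_zero x))
  have h0 : rmul p (exp ((0 : 𝕜) • x)) = p := by
    rw [zero_smul, NormedSpace.exp_zero, rmul_one]
  have h2 := hasFDerivWithinAt_of_contDiffOn hR.smooth (hR.subset hp)
  have h3 : HasDerivWithinAt (fun t : 𝕜 => rmul p (exp (t • x))) (0, p.2 ∘L x) Set.univ 0 :=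
    h1.hasDerivWithinAt
  rw [← h0] at h2
  have h4 := h2.comp_hasDerivWithinAt (0 : 𝕜) h3 (fun t _ =>
    hS.mul_exp p (hR.subset hp) _ (Submodule.smul_mem _ t hx))
  rw [h0] at h4
  exact h4.hasDerivAt Filter.univ_mem

include hR hS hN hM in
-- Both assertions of `apply_rmul_exp` are linear conditions along the curve t ↦ p exp(tx), so they
-- pass to the derivative at t = 0.
theorem fderivWithin_vertical {p : 𝕜 × (V →L[𝕜] W)} (hp : p ∈ R) {j : ℕ} (hj : 1 ≤ j)
    (hjk : j ≤ k) {x : V →L[𝕜] V} (hx : x ∈ lieFilt J G 𝒱 j) :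
    fderivWithin 𝕜 v S p (0, p.2 ∘L x) ∈ homFilt 𝒱 j ∧
      degPart 𝒱 j x + degPart 𝒱 j (fderivWithin 𝕜 v S p (0, p.2 ∘L x)) ∈
        prolong 𝒱 J G m (j + 1) := by
  have h1 := hR.hasDerivAt_apply_rmul_exp hS hp (lieFilt_antitone 𝒱 J G (by lia) hx)
  have h2 := fun t : 𝕜 => hR.apply_rmul_exp hN hS hM hp hj hjk (Submodule.smul_mem _ t hx)
  refine ⟨HasDerivAt.mem_submodule h1 (Filter.Eventually.of_forall fun t => (h2 t).1), ?_⟩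
  let d := LinearMap.toContinuousLinearMap (degPart 𝒱 (j : ℤ))
  have h3 : HasDerivAt (fun t : 𝕜 => d (t • x) + d (v (rmul p (exp (t • x)))))
      (d x + d (fderivWithin 𝕜 v S p (0, p.2 ∘L x))) 0 := by
    refine HasDerivAt.add ?_ (d.hasFDerivAt.comp_hasDerivAt (0 : 𝕜) h1)
    refine d.hasFDerivAt.comp_hasDerivAt (0 : 𝕜) ?_
    simpa using (hasDerivAt_id (0 : 𝕜)).smul_const x
  exact HasDerivAt.mem_submodule h3 (Filter.Eventually.of_forall fun t => (h2 t).2)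

include hR hS hN hM in
/-- The leading components of the vertical vectors tangent to a reduction. -/
theorem degPart_mem_of_tangent {p : 𝕜 × (V →L[𝕜] W)} (hp : p ∈ R) {z : V →L[𝕜] V}
    (hz : ((0 : 𝕜), p.2 ∘L z) ∈ tangentAt 𝕜 R p) {j : ℕ} (hjk : j ≤ k) (hzj : z ∈ homFilt 𝒱 j) :
    degPart 𝒱 j z ∈ prolong 𝒱 J G m (j + 1) := by
  have h1 := hS.tangent p (hR.subset hp) 0 z (hR.tangentAt_le hz)
  rcases Nat.eq_zero_or_pos j with rfl | hj
  · exact (h1.2.2 rfl).2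
  · have h2 := (hR.fderivWithin_vertical hN hS hM hp hj hjk (x := z) ⟨h1.1.1, hzj⟩).2
    rwa [hR.fderivWithin_eq_zero hp hz, map_zero, add_zero] at h2

include hR hS hN hM in
-- The leading component of a vertical tangent vector lies in the prolongation; if it also lies in
-- the slice it is zero, and the degree rises. This is the source of all uniqueness of velocities.
theorem mem_homFilt_of_tangent {p : 𝕜 × (V →L[𝕜] W)} (hp : p ∈ R) {z : V →L[𝕜] V}
    (hz : ((0 : 𝕜), p.2 ∘L z) ∈ tangentAt 𝕜 R p) {l : ℕ} (hl : l ≤ k + 1)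
    (h : ∀ j < l, degPart 𝒱 j z ∈ s j) : z ∈ homFilt 𝒱 l := by
  induction l with
  | zero => exact_mod_cast ((hS.tangent p (hR.subset hp) 0 z (hR.tangentAt_le hz)).2.2 rfl).1
  | succ l ih =>
    have h1 := ih (by lia) fun j hj => h j (by lia)
    have h2 := hR.degPart_mem_of_tangent hN hS hM hp hz (by lia) h1
    exact_mod_cast homFilt_succ 𝒱 h1 (hN.disjoint l _ (h l (by lia)) h2)

include hR hS hN hM in
-- For u of degree k in 𝔲_k the derivative of v along u has degree at least k, with component of
-- degree k in s_k ∩ 𝔲_k = 0, and has no components above k. It vanishes, so u remains tangent after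
-- reduction.
theorem vertical_mem_tangentAt {p : 𝕜 × (V →L[𝕜] W)} (hp : p ∈ R) {u : V →L[𝕜] V}
    (hu : u ∈ prolong 𝒱 J G m (k + 1)) : ((0 : 𝕜), p.2 ∘L u) ∈ tangentAt 𝕜 R p := by
  have hul := prolong_le_lieDeg 𝒱 J G m k hu
  have h0 : ((0 : 𝕜), p.2 ∘L u) ∈ tangentAt 𝕜 S p := by
    refine hS.vertical p (hR.subset hp) u
      (lieFilt_antitone 𝒱 J G (by lia) (lieDeg_le_lieFilt 𝒱 J G k hul)) ?_
    rcases Nat.eq_zero_or_pos k with rfl | hk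
    · rw [degPart_of_mem 𝒱 (by exact_mod_cast hul.2)]; exact hu
    · rw [degPart_of_mem_ne 𝒱 hul.2 (by lia)]; exact zero_mem _
  have h1 := hR.tangent_add_mem hS hp h0
  suffices fderivWithin 𝕜 v S p (0, p.2 ∘L u) = 0 by
    rw [this] at h1
    simpa using h1
  have h2 := hR.fderivWithin_mem_slice hp h0
  refine eq_zero_of_mem_sliceSum h2 ?_
  rcases Nat.eq_zero_or_pos k with rfl | hk
  · exact_mod_cast sliceSum_le_homFilt 0 h2
  · obtain ⟨h3, h4⟩ := hR.fderivWithin_vertical hN hS hM hp hk le_rfl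
      (lieDeg_le_lieFilt 𝒱 J G k hul)
    rw [degPart_of_mem 𝒱 hul.2] at h4
    have h5 := (Submodule.add_mem_iff_right _ hu).1 h4
    exact homFilt_succ 𝒱 h3 (hN.disjoint k _ (h2.1 k hk le_rfl) h5)

end IsReduction

end Tower

/-! ### The inductive step: normalizing the component of degree k -/

section Step

variable {𝕜 : Type*} [RCLike 𝕜]
variable {V : Type*} [NormedAddCommGroup V] [NormedSpace 𝕜 V]
variable {W : Type*} [NormedAddCommGroup W] [NormedSpace 𝕜 W]
variable {𝒱 : ℤ → Submodule 𝕜 V} {J : V ≃L[𝕜] W} {G : Subgroup (W ≃L[𝕜] W)}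
variable {m : Submodule 𝕜 (V →L[𝕜] V)}
variable [DirectSum.Decomposition 𝒱] [FiniteDimensional 𝕜 V]
variable {δ : V →L[𝕜] V} {N : Submodule 𝕜 (V →L[𝕜] V)}
variable {s : ℕ → Submodule 𝕜 (V →L[𝕜] V)}
variable {S R : Set (𝕜 × (V →L[𝕜] W))} {k : ℕ} {v : 𝕜 × (V →L[𝕜] W) → (V →L[𝕜] V)}

theorem IsNormalForm.mem_prolong_succ (hN : IsNormalForm 𝒱 J G m δ N s) {j : ℕ} {x : V →L[𝕜] V}
    (hx : x ∈ lieDeg J G 𝒱 (j + 1)) :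
    x ∈ prolong 𝒱 J G m (j + 1 + 1) ↔ δ * x - x * δ ∈ prolong 𝒱 J G m (j + 1) := by
  have hδ : δ ∈ m := by rw [hN.span]; exact Submodule.mem_span_singleton_self δ
  constructor
  · intro h
    rw [← neg_sub]
    exact neg_mem (h.2 δ hδ)
  · refine fun h => ⟨by exact_mod_cast hx, fun ε hε => ?_⟩
    rw [hN.span] at hε
    obtain ⟨a, rfl⟩ := Submodule.mem_span_singleton.1 hε
    rw [mul_smul_comm, smul_mul_assoc, ← smul_sub, ← neg_sub]
    exact Submodule.smul_mem _ _ (neg_mem h)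

/-- After the commutator, what remains of Ad(e^{-x})c is quadratic in x or comes from the remainder
of the exponential. Even with c of degree -1 it has degree at least k+1, so in degree k only the
bracket of c_{-1} with x_{k+1} enters. -/
theorem exp_conj_sub_mem [CompleteSpace V] {x c : V →L[𝕜] V} (hx : x ∈ homFilt 𝒱 (k + 1))
    (hc : c ∈ homFilt 𝒱 (-1)) :
    exp (-x) * c * exp x - (c + (c * x - x * c)) ∈ homFilt 𝒱 (k + 1) := by
  have h1 := exp_sub_one_mem 𝒱 (j := k + 1) (by lia) hx
  have h2 := exp_sub_one_mem 𝒱 (j := k + 1) (by lia) (neg_mem hx)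
  have hone : (1 : V →L[𝕜] V) ∈ homFilt 𝒱 0 := homDeg_le_homFilt 𝒱 0 (one_mem_homDeg 𝒱)
  have hx0 := homFilt_antitone 𝒱 (show (0 : ℤ) ≤ k + 1 by lia) hx
  have h3 : exp x ∈ homFilt 𝒱 0 := by
    have := add_mem (homFilt_antitone 𝒱 (show (0 : ℤ) ≤ k + 1 by lia)
      (exp_sub_one_mem' 𝒱 (j := k + 1) (by lia) hx)) hone
    rwa [sub_add_cancel] at this
  have e : exp (-x) * c * exp x - (c + (c * x - x * c)) =
      (exp (-x) - 1 - -x) * c * exp x + (1 - x) * c * (exp x - 1 - x) - x * c * x := by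
    noncomm_ring
  rw [e]
  refine sub_mem (add_mem (homFilt_antitone 𝒱 ?_ (homFilt_mul 𝒱 (homFilt_mul 𝒱 h2 hc) h3))
    (homFilt_antitone 𝒱 ?_ (homFilt_mul 𝒱 (homFilt_mul 𝒱 (sub_mem hone hx0) hc) h1)))
    (homFilt_antitone 𝒱 ?_ (homFilt_mul 𝒱 (homFilt_mul 𝒱 hx hc) hx)) <;> lia

variable (𝒱 N R k) in
/-- The elements of `R` with a velocity whose components of degree at most `k` are
normalized. -/
def reduce : Set (𝕜 × (V →L[𝕜] W)) :=
  {p | p ∈ R ∧ ∃ c : V →L[𝕜] V, ((1 : 𝕜), p.2 ∘L c) ∈ tangentAt 𝕜 R p ∧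
    ∀ j ≤ k, degPart 𝒱 (j : ℤ) c ∈ N}

theorem reduce_subset : reduce 𝒱 N R k ⊆ R := fun _ hp => hp.1

namespace IsReduction

variable [CompleteSpace V]
variable (hN : IsNormalForm 𝒱 J G m δ N s) (hS : IsFrameManifold 𝒱 J G m δ S)
  (hR : IsReduction 𝒱 J G m N s S R k v)
  (hM : IsExpGroup (opSet (modelGroup J G)) (modelLie J G))
include hN hS hR hM

/-- Two velocities over the same base vector differ by a vertical vector, and one with components in
the slices has none of low degree. -/
theorem sub_mem_of_slice {p : 𝕜 × (V →L[𝕜] W)} (hp : p ∈ R) {c c' : V →L[𝕜] V}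
    (hc : ((1 : 𝕜), p.2 ∘L c) ∈ tangentAt 𝕜 R p) (hc' : ((1 : 𝕜), p.2 ∘L c') ∈ tangentAt 𝕜 R p)
    {l : ℕ} (hl : l ≤ k + 1) (hcs : ∀ j < l, degPart 𝒱 (j : ℤ) c ∈ s j)
    (hcs' : ∀ j < l, degPart 𝒱 (j : ℤ) c' ∈ s j) :
    ((0 : 𝕜), p.2 ∘L (c - c')) ∈ tangentAt 𝕜 R p ∧ c - c' ∈ homFilt 𝒱 l := by
  have h1 : ((0 : 𝕜), p.2 ∘L (c - c')) ∈ tangentAt 𝕜 R p := by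
    have := sub_mem hc hc'
    rwa [Prod.mk_sub_mk, sub_self, ← ContinuousLinearMap.comp_sub] at this
  refine ⟨h1, hR.mem_homFilt_of_tangent hN hS hM hp h1 hl fun j hj => ?_⟩
  rw [map_sub]
  exact sub_mem (hcs j hj) (hcs' j hj)

/-- A velocity with components in the slices is normalized. -/
theorem mem_normal_of_slice {p : 𝕜 × (V →L[𝕜] W)} (hp : p ∈ R) {c : V →L[𝕜] V}
    (hc : ((1 : 𝕜), p.2 ∘L c) ∈ tangentAt 𝕜 R p) (hcs : ∀ j < k, degPart 𝒱 (j : ℤ) c ∈ s j) :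
    ∀ j < k, degPart 𝒱 (j : ℤ) c ∈ N := by
  obtain ⟨c', hc', hcN⟩ := hR.normal p hp
  have h1 := (hR.sub_mem_of_slice hN hS hM hp hc hc' (Nat.le_succ k) hcs fun j hj => by
    have := hN.le_slice _ (hcN j hj) j
    rwa [degPart_degPart, if_pos rfl] at this).2
  intro j hj
  have h2 := degPart_of_homFilt 𝒱 h1 (j := j) (by exact_mod_cast hj)
  rw [map_sub, sub_eq_zero] at h2
  rw [h2]
  exact hcN j hj

/-- Velocities normalized below degree k differ by a vertical vector of degree at least k, whose
leading part is in 𝔲_k; conversely any element of 𝔲_k may be subtracted. So a single velocity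
decides membership. -/
theorem mem_reduce_iff {p : 𝕜 × (V →L[𝕜] W)} (hp : p ∈ R) {c : V →L[𝕜] V}
    (hc : ((1 : 𝕜), p.2 ∘L c) ∈ tangentAt 𝕜 R p) (hcN : ∀ j < k, degPart 𝒱 (j : ℤ) c ∈ N) :
    p ∈ reduce 𝒱 N R k ↔ ∃ n ∈ N, ∃ u ∈ prolong 𝒱 J G m (k + 1),
      degPart 𝒱 (k : ℤ) c = n + u := by
  have hslice : ∀ c : V →L[𝕜] V, ∀ j : ℕ, degPart 𝒱 (j : ℤ) c ∈ N → degPart 𝒱 (j : ℤ) c ∈ s j := by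
    intro c j h
    have := hN.le_slice _ h j
    rwa [degPart_degPart, if_pos rfl] at this
  constructor
  · rintro ⟨-, c', hc', hcN'⟩
    obtain ⟨h1, h2⟩ := hR.sub_mem_of_slice hN hS hM hp hc hc' (Nat.le_succ k)
      (fun j hj => hslice _ j (hcN j hj)) (fun j hj => hslice _ j (hcN' j hj.le))
    have h3 := hR.degPart_mem_of_tangent hN hS hM hp h1 le_rfl h2
    exact ⟨_, hcN' k le_rfl, _, h3, by rw [map_sub]; abel⟩
  · rintro ⟨n, hn, u, hu, hcu⟩
    have hud := (prolong_le_lieDeg 𝒱 J G m k hu).2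
    refine ⟨hp, c - u, ?_, fun j hj => ?_⟩
    · have := sub_mem hc (hR.vertical_mem_tangentAt hN hS hM hp hu)
      rwa [Prod.mk_sub_mk, sub_zero, ← ContinuousLinearMap.comp_sub] at this
    · rw [map_sub]
      rcases hj.lt_or_eq with hj | rfl
      · rw [degPart_of_mem_ne 𝒱 hud (by lia), sub_zero]
        exact hcN j hj
      · rw [hcu, degPart_of_mem 𝒱 hud, add_sub_cancel_right]
        exact hn

/-- At p e^x the transported velocity is Ad(e^{-x})c. It agrees with c below degree k and acquires
l[δ, x_{k+1}] in degree k: here the coboundary operator enters the geometry. -/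
theorem rmul_mem_reduce_iff {p : 𝕜 × (V →L[𝕜] W)} (hp : p ∈ R) {c : V →L[𝕜] V}
    (hc : ((1 : 𝕜), p.2 ∘L c) ∈ tangentAt 𝕜 R p) (hcN : ∀ j < k, degPart 𝒱 (j : ℤ) c ∈ N)
    {l : 𝕜} (hl : degPart 𝒱 (-1) c = l • δ) {x : V →L[𝕜] V} (hx : x ∈ lieFilt J G 𝒱 (k + 1)) :
    rmul p (exp x) ∈ reduce 𝒱 N R k ↔ ∃ n ∈ N, ∃ u ∈ prolong 𝒱 J G m (k + 1),
      degPart 𝒱 (k : ℤ) c + l • (δ * degPart 𝒱 (k + 1) x - degPart 𝒱 (k + 1) x * δ) = n + u := by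
  have hcf := (hS.tangent p (hR.subset hp) 1 c (hR.tangentAt_le hc)).1.2
  have hp' := hR.mul_exp p hp x hx
  let F : 𝕜 × (V →L[𝕜] W) →L[𝕜] 𝕜 × (V →L[𝕜] W) :=
    (ContinuousLinearMap.fst 𝕜 𝕜 (V →L[𝕜] W)).prod
      ((ContinuousLinearMap.compL 𝕜 V V W).flip (exp x) ∘L
        ContinuousLinearMap.snd 𝕜 𝕜 (V →L[𝕜] W))
  have hFR : ∀ q ∈ R, F q ∈ R := fun q hq => hR.mul_exp q hq x hx
  have h1 := tangentAt_map (F.contDiff.contDiffAt) (eventually_nhdsWithin_of_forall hFR) hc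
  rw [F.fderiv] at h1
  have hc' : ((1 : 𝕜), (rmul p (exp x)).2 ∘L (exp (-x) * c * exp x)) ∈
      tangentAt 𝕜 R (rmul p (exp x)) := by
    have e : ((1 : 𝕜), (rmul p (exp x)).2 ∘L (exp (-x) * c * exp x)) = F (1, p.2 ∘L c) := by
      refine Prod.ext rfl ?_
      change p.2 ∘L (exp x * (exp (-x) * c * exp x)) = p.2 ∘L (c * exp x)
      rw [← mul_assoc, ← mul_assoc, exp_mul_exp_neg 𝕜, one_mul]
    rw [e]
    exact h1
  have h2 := exp_conj_sub_mem hx.2 hcf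
  have h3 := homFilt_comm 𝒱 hcf hx.2
  have h4 : ∀ j < k, degPart 𝒱 (j : ℤ) (exp (-x) * c * exp x) = degPart 𝒱 (j : ℤ) c := by
    intro j hj
    have h5 := degPart_of_homFilt 𝒱 h2 (j := j) (by lia)
    rw [map_sub, map_add, degPart_of_homFilt 𝒱 h3 (by lia), add_zero, sub_eq_zero] at h5
    exact h5
  have h6 := degPart_of_homFilt 𝒱 h2 (j := k) (by lia)
  have h7 := degPart_comm 𝒱 hcf hx.2
  rw [show (-1 : ℤ) + (k + 1) = k by ring] at h7
  rw [map_sub, map_add, h7, sub_eq_zero, hl, smul_mul_assoc, mul_smul_comm, ← smul_sub] at h6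
  rw [hR.mem_reduce_iff hN hS hM hp' hc' (fun j hj => by rw [h4 j hj]; exact hcN j hj), h6]

/-- Two normalized points leave l[δ, x_{k+1}] in 𝒩 + 𝔲_k. The 𝒩-part is then a trivial cochain,
hence zero, so [δ, x_{k+1}] lies in 𝔲_k, which means x_{k+1} ∈ 𝔲_{k+1}. -/
theorem rmul_mem_reduce_iff_mem {p : 𝕜 × (V →L[𝕜] W)} (hp : p ∈ reduce 𝒱 N R k)
    {x : V →L[𝕜] V} (hx : x ∈ lieFilt J G 𝒱 (k + 1)) (hgr : IsGradedLie J G 𝒱) :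
    rmul p (exp x) ∈ reduce 𝒱 N R k ↔
      degPart 𝒱 (k + 1) x ∈ prolong 𝒱 J G m (k + 1 + 1) := by
  obtain ⟨hpR, c, hc, hcN⟩ := hp
  obtain ⟨-, ⟨l, hl, hl0⟩, -⟩ := hS.tangent p (hR.subset hpR) 1 c (hR.tangentAt_le hc)
  have hl0 := hl0 one_ne_zero
  have hxd := degPart_mem_lieDeg 𝒱 hgr hx.1 (k + 1)
  rw [hR.rmul_mem_reduce_iff hN hS hM hpR hc (fun j hj => hcN j hj.le) hl hx,
    hN.mem_prolong_succ hxd]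
  set y := degPart 𝒱 (k + 1 : ℤ) x
  constructor
  · rintro ⟨n, hn, u, hu, h⟩
    have h1 : δ * y - y * δ + l⁻¹ • (-u) = l⁻¹ • (n - degPart 𝒱 (k : ℤ) c) := by
      have : l • (δ * y - y * δ) = n - degPart 𝒱 (k : ℤ) c + u := by
        rw [← add_sub_right_comm, ← h]; abel
      rw [← inv_smul_smul₀ hl0 (δ * y - y * δ), this, ← smul_add]
      congr 1; abel
    have h2 := hN.disjoint_normal k y hxd (l⁻¹ • (-u)) (Submodule.smul_mem _ _ (neg_mem hu)) (by
      rw [h1]; exact Submodule.smul_mem _ _ (sub_mem hn (hcN k le_rfl)))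
    rw [eq_neg_of_add_eq_zero_left h2]
    exact neg_mem (Submodule.smul_mem _ _ (neg_mem hu))
  · intro h
    exact ⟨_, hcN k le_rfl, _, Submodule.smul_mem _ l h, rfl⟩

/-- A local lift in `S` is first changed by a vertical vector to bring its components into the
slices, and then pushed to `R` by the derivative of q ↦ q exp(v q). The second correction is a value
of dv, so it lies in the slices too. -/
theorem exists_connection {p : 𝕜 × (V →L[𝕜] W)} (hp : p ∈ S) :
    ∃ O : Set (𝕜 × (V →L[𝕜] W)), IsOpen O ∧ p ∈ O ∧ ∃ f : 𝕜 × (V →L[𝕜] W) → (V →L[𝕜] V),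
      ContDiffOn 𝕜 ∞ f (S ∩ O) ∧ ∀ q ∈ O, q ∈ R →
        ((1 : 𝕜), q.2 ∘L f q) ∈ tangentAt 𝕜 R q ∧ ∀ j : ℕ, degPart 𝒱 (j : ℤ) (f q) ∈ s j := by
  obtain ⟨O, hO, hpO, Ω, hΩ, hΩS⟩ := hS.lift p hp
  obtain ⟨O', hO', hpO', g, hg, hgv⟩ := hS.retract.exists_extension hR.smooth hp
  obtain ⟨π, hπ⟩ := hN.exists_projection
  let c₀ : 𝕜 × (V →L[𝕜] W) → (V →L[𝕜] V) := fun q => Ω q - π (Ω q)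
  let X : 𝕜 × (V →L[𝕜] W) → 𝕜 × (V →L[𝕜] W) := fun q => (1, q.2 ∘L c₀ q)
  have hc₀ : ContDiffOn 𝕜 ∞ c₀ O := hΩ.sub (π.contDiff.comp_contDiffOn hΩ)
  have hX : ContDiffOn 𝕜 ∞ X O := contDiffOn_const.prodMk (contDiffOn_snd.clm_comp hc₀)
  have hΩg : ∀ q ∈ O, q ∈ S → Ω q ∈ modelLie J G := fun q hqO hq =>
    (hS.tangent q hq 1 _ (hΩS q hqO hq)).1.1
  have hXS : ∀ q ∈ O, q ∈ S → X q ∈ tangentAt 𝕜 S q := fun q hqO hq => by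
    obtain ⟨h1, h2, -⟩ := hπ _ (hΩg q hqO hq)
    have := sub_mem (hΩS q hqO hq) (hS.vertical q hq _ h1 h2)
    rwa [Prod.mk_sub_mk, sub_zero, ← ContinuousLinearMap.comp_sub] at this
  -- The derivative within `S` is replaced by that of a smooth extension, which depends smoothly on
  -- the point.
  have heq : ∀ q ∈ O ∩ O', q ∈ S → fderivWithin 𝕜 v S q (X q) = fderiv 𝕜 g q (X q) := by
    intro q hqO hq
    have hd := ((hg.contDiffAt (hO'.mem_nhds hqO.2)).differentiableAt (by simp)).hasFDerivAt
    refine fderivWithin_eq_of_tangentAt subset_rfl (hasFDerivWithinAt_of_contDiffOn hR.smooth hq)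
      hd.hasFDerivWithinAt ?_ (hXS q hqO.1 hq)
    filter_upwards [self_mem_nhdsWithin, mem_nhdsWithin_of_mem_nhds (hO'.mem_nhds hqO.2)]
      with y hy hyO using (hgv y hyO hy).symm
  refine ⟨O ∩ O', hO.inter hO', ⟨hpO, hpO'⟩, fun q => c₀ q + fderivWithin 𝕜 v S q (X q), ?_,
    fun q hqO hqR => ⟨?_, fun j => ?_⟩⟩
  · have h1 : ContDiffOn 𝕜 ∞ (fun q => c₀ q + fderiv 𝕜 g q (X q)) (O ∩ O') := by
      refine (hc₀.mono Set.inter_subset_left).add (ContDiffOn.clm_apply ?_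
        (hX.mono Set.inter_subset_left))
      exact (hg.fderiv_of_isOpen hO' (by simp)).mono Set.inter_subset_right
    exact (h1.mono Set.inter_subset_right).congr fun q hq => by rw [heq q hq.2 hq.1]
  · have h1 := hR.tangent_add_mem hS hqR (hXS q hqO.1 (hR.subset hqR))
    convert h1 using 1
    refine Prod.ext (by simp [X]) ?_
    simp [X, ContinuousLinearMap.comp_add]
  · rw [map_add]
    refine add_mem ((hπ _ (hΩg q hqO.1 (hR.subset hqR))).2.2 j) ?_
    have h1 := hR.fderivWithin_mem_slice hqR (hXS q hqO.1 (hR.subset hqR))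
    by_cases hj : 1 ≤ j ∧ j ≤ k
    · exact h1.1 j hj.1 hj.2
    · rw [h1.2 j (by lia)]; exact zero_mem _

/-- The choice x_{k+1} = -l⁻¹ r(c_k) solves the normalization equation at p e^v. The correction is
added to the exponent instead of being multiplied on the right, so that the sum stays in the slices;
both have the same leading term. -/
theorem rmul_exp_mem_reduce {p : 𝕜 × (V →L[𝕜] W)} (hp : p ∈ S) {c : V →L[𝕜] V}
    (hc : ((1 : 𝕜), (rmul p (exp (v p))).2 ∘L c) ∈ tangentAt 𝕜 R (rmul p (exp (v p))))
    (hcs : ∀ j : ℕ, degPart 𝒱 (j : ℤ) c ∈ s j) (hgr : IsGradedLie J G 𝒱)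
    {l : 𝕜} (hl : degPart 𝒱 (-1) c = l • δ) {r : (V →L[𝕜] V) →L[𝕜] (V →L[𝕜] V)}
    (hrs : ∀ z, r z ∈ s (k + 1))
    (hr : ∀ z ∈ lieDeg J G 𝒱 k, ∃ n ∈ N, ∃ u ∈ prolong 𝒱 J G m (k + 1),
      z = n + u + (δ * r z - r z * δ)) :
    rmul p (exp (v p - l⁻¹ • r (degPart 𝒱 (k : ℤ) c))) ∈ reduce 𝒱 N R k := by
  have hp1 := hR.rmul_exp_mem hp
  obtain ⟨hcl, ⟨l', hl', hl0⟩, -⟩ := hS.tangent _ (hR.subset hp1) 1 c (hR.tangentAt_le hc)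
  have hll : l' = l := smul_left_injective 𝕜 hN.ne_zero (hl'.symm.trans hl)
  have hl0 : l ≠ 0 := hll ▸ hl0 one_ne_zero
  set z := degPart 𝒱 (k : ℤ) c
  have hvl := hN.sliceSum_le k (hR.mem_slice p hp)
  have hrz := hN.slice_le _ (hrs z)
  have hxl : -(l⁻¹ • r z) ∈ lieFilt J G 𝒱 (k + 1) := by
    have := lieDeg_le_lieFilt 𝒱 J G _ hrz
    exact neg_mem (Submodule.smul_mem _ _ (by exact_mod_cast this))
  have hxl1 := lieFilt_antitone 𝒱 J G (show (1 : ℤ) ≤ k + 1 by lia) hxl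
  have hwl : v p - l⁻¹ • r z ∈ lieFilt J G 𝒱 1 := by
    rw [sub_eq_add_neg]; exact add_mem hvl hxl1
  obtain ⟨x, hx, hxf, hxe, hxd⟩ := exists_exp_eq_exp_mul 𝒱 hM (j := k + 1) (by lia) hvl.1 hvl.2
    hwl.1 hwl.2 (by rw [sub_sub_cancel_left]; exact hxl.2)
  rw [sub_sub_cancel_left] at hxd
  have hxk := degPart_of_homFilt 𝒱 hxd (lt_add_one _)
  have hrz' : r z ∈ homDeg 𝒱 (k + 1) := by exact_mod_cast hrz.2
  rw [map_sub, map_neg, map_smul, degPart_of_mem 𝒱 hrz', sub_eq_zero] at hxk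
  rw [hxe, ← rmul_rmul, hR.rmul_mem_reduce_iff hN hS hM hp1 hc
    (hR.mem_normal_of_slice hN hS hM hp1 hc fun j _ => hcs j) hl ⟨hx, hxf⟩, hxk]
  obtain ⟨n, hn, u, hu, hnu⟩ := hr z (degPart_mem_lieDeg 𝒱 hgr hcl.1 k)
  refine ⟨n, hn, u, hu, ?_⟩
  have : l • (δ * -(l⁻¹ • r z) - -(l⁻¹ • r z) * δ) = -(δ * r z - r z * δ) := by
    rw [mul_neg, neg_mul, mul_smul_comm, smul_mul_assoc, ← neg_sub', ← smul_sub, smul_neg,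
      smul_inv_smul₀ hl0]
  rw [this, ← sub_eq_add_neg, sub_eq_iff_eq_add]
  exact hnu

/-- Dropping the component of degree k+1 keeps the point in `R`, so both truncations equal v p. The
difference is then an element of s_{k+1}, and by the comparison of two normalized points also of
𝔲_{k+1}. -/
theorem eq_of_rmul_exp_mem_reduce (hgr : IsGradedLie J G 𝒱) {p : 𝕜 × (V →L[𝕜] W)} (hp : p ∈ S)
    {w w' : V →L[𝕜] V} (hw : w ∈ sliceSum 𝒱 s (k + 1)) (hw' : w' ∈ sliceSum 𝒱 s (k + 1))
    (hpw : rmul p (exp w) ∈ reduce 𝒱 N R k) (hpw' : rmul p (exp w') ∈ reduce 𝒱 N R k) :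
    w = w' := by
  have key : ∀ w ∈ sliceSum 𝒱 s (k + 1), rmul p (exp w) ∈ R →
      w - degPart 𝒱 (k + 1 : ℕ) w = v p := by
    intro w hw hpw
    have h0 := sub_degPart_mem_sliceSum hw
    have h0l := hN.sliceSum_le _ h0
    have hwl := hN.sliceSum_le _ hw
    obtain ⟨x, hx, hxf, hxe, -⟩ := exists_exp_eq_exp_mul 𝒱 hM (j := k + 1) (by lia) hwl.1 hwl.2
      h0l.1 h0l.2 (by
        rw [sub_sub_cancel_left]
        exact_mod_cast neg_mem (homDeg_le_homFilt 𝒱 _ (degPart_mem 𝒱 (k + 1 : ℕ) w)))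
    rw [← hR.mem_iff p hp _ h0, hxe, ← rmul_rmul]
    exact hR.mul_exp _ hpw x ⟨hx, hxf⟩
  have hd : w' - w = degPart 𝒱 (k + 1 : ℕ) (w' - w) := by
    have h1 := key w hw hpw.1
    rw [← key w' hw' hpw'.1] at h1
    rw [map_sub]
    exact sub_eq_sub_iff_add_eq_add.2 ((sub_eq_sub_iff_add_eq_add.1 h1).symm.trans (add_comm _ _))
  have hwl := hN.sliceSum_le _ hw
  have hwl' := hN.sliceSum_le _ hw'
  have hdf : w' - w ∈ homFilt 𝒱 (k + 1) := by
    rw [hd]; exact_mod_cast homDeg_le_homFilt 𝒱 _ (degPart_mem 𝒱 (k + 1 : ℕ) (w' - w))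
  obtain ⟨x, hx, hxf, hxe, hxd⟩ := exists_exp_eq_exp_mul 𝒱 hM (j := k + 1) (by lia) hwl.1 hwl.2
    hwl'.1 hwl'.2 hdf
  rw [hxe, ← rmul_rmul, hR.rmul_mem_reduce_iff_mem hN hS hM hpw ⟨hx, hxf⟩ hgr] at hpw'
  have hxk := degPart_of_homFilt 𝒱 hxd (lt_add_one _)
  rw [map_sub, sub_eq_zero] at hxk
  rw [hxk] at hpw'
  have h0 := hN.disjoint (k + 1) _ ((sub_mem hw' hw).1 (k + 1) (by lia) le_rfl)
    (by exact_mod_cast hpw')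
  rw [h0, sub_eq_zero] at hd
  exact hd.symm

/-- Local smooth solutions of the normalization equation agree by uniqueness, so the pointwise
chosen v' is smooth on all of `S`. -/
theorem exists_isReduction_reduce (hgr : IsGradedLie J G 𝒱) :
    ∃ v', IsReduction 𝒱 J G m N s S (reduce 𝒱 N R k) (k + 1) v' := by
  obtain ⟨r, hrs, hr⟩ := hN.exists_solution k
  obtain ⟨ℓ, -, hℓ⟩ := exists_dual_vector 𝕜 δ (norm_ne_zero_iff.2 hN.ne_zero)
  have hs : ∀ j : ℕ, s j ≤ homDeg 𝒱 j := fun j => (hN.slice_le j).trans inf_le_right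
  let d (j : ℤ) := LinearMap.toContinuousLinearMap (degPart 𝒱 j)
  -- A functional with ℓ(δ) = ‖δ‖ recovers the factor l in c_{-1} = lδ smoothly from c.
  let lam : (V →L[𝕜] V) → 𝕜 := fun c => (‖δ‖ : 𝕜)⁻¹ * ℓ (d (-1) c)
  have hδn : (‖δ‖ : 𝕜) ≠ 0 := by simpa using hN.ne_zero
  have hlam : ∀ c l, degPart 𝒱 (-1) c = l • δ → lam c = l := fun c l h => by
    change (‖δ‖ : 𝕜)⁻¹ * ℓ (degPart 𝒱 (-1) c) = l
    rw [h, map_smul, hℓ, smul_eq_mul]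
    field_simp
  let p₁ : 𝕜 × (V →L[𝕜] W) → 𝕜 × (V →L[𝕜] W) := fun p => rmul p (exp (v p))
  have hp₁ : ContDiffOn 𝕜 ∞ p₁ S := contDiff_rmul.comp_contDiffOn
    (contDiffOn_id.prodMk ((contDiff_exp 𝕜).comp_contDiffOn hR.smooth))
  have hp₁R : ∀ p ∈ S, p₁ p ∈ R := fun p => hR.rmul_exp_mem
  -- The connection f is evaluated at the point p₁ q already normalized to order k; it is defined
  -- only near p₁ p, so F is local.
  have local_formula : ∀ p ∈ S, ∃ F : 𝕜 × (V →L[𝕜] W) → (V →L[𝕜] V), ContDiffWithinAt 𝕜 ∞ F S p ∧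
      ∀ᶠ q in 𝓝[S] p, F q - v q ∈ s (k + 1) ∧ rmul q (exp (F q)) ∈ reduce 𝒱 N R k := by
    intro p hp
    obtain ⟨O, hO, hpO, f, hf, hfR⟩ := hR.exists_connection hN hS hM (hR.subset (hp₁R p hp))
    have hfp : ContDiffWithinAt 𝕜 ∞ f S (p₁ p) :=
      (hf (p₁ p) ⟨hR.subset (hp₁R p hp), hpO⟩).mono_of_mem_nhdsWithin
        (Filter.inter_mem self_mem_nhdsWithin (mem_nhdsWithin_of_mem_nhds (hO.mem_nhds hpO)))
    have hfp₁ : ContDiffWithinAt 𝕜 ∞ (fun q => f (p₁ q)) S p :=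
      hfp.comp p (hp₁ p hp) fun q hq => hR.subset (hp₁R q hq)
    have hlam0 : ∀ q ∈ S, p₁ q ∈ O → ∃ l : 𝕜, l ≠ 0 ∧ degPart 𝒱 (-1) (f (p₁ q)) = l • δ := by
      intro q hq hqO
      obtain ⟨-, ⟨l, hl, hl0⟩, -⟩ := hS.tangent _ (hR.subset (hp₁R q hq)) 1 _
        (hR.tangentAt_le (hfR _ hqO (hp₁R q hq)).1)
      exact ⟨l, hl0 one_ne_zero, hl⟩
    refine ⟨fun q => v q - (lam (f (p₁ q)))⁻¹ • r (degPart 𝒱 (k : ℤ) (f (p₁ q))), ?_, ?_⟩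
    · have h1 : ContDiffWithinAt 𝕜 ∞ (fun q => lam (f (p₁ q))) S p :=
        contDiffWithinAt_const.mul
          ((ℓ ∘L d (-1)).contDiff.contDiffAt.comp_contDiffWithinAt p hfp₁)
      obtain ⟨l, hl0, hl⟩ := hlam0 p hp hpO
      refine (hR.smooth p hp).sub ((h1.inv (by rwa [hlam _ l hl])).smul ?_)
      exact (r ∘L d k).contDiff.contDiffAt.comp_contDiffWithinAt p hfp₁
    · have h1 : ∀ᶠ q in 𝓝[S] p, p₁ q ∈ O :=
        (hp₁ p hp).continuousWithinAt.eventually_mem (hO.mem_nhds hpO)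
      filter_upwards [h1, self_mem_nhdsWithin] with q hqO hq
      obtain ⟨l, -, hl⟩ := hlam0 q hq hqO
      rw [hlam _ l hl]
      refine ⟨?_, hR.rmul_exp_mem_reduce hN hS hM hq (hfR _ hqO (hp₁R q hq)).1
        (hfR _ hqO (hp₁R q hq)).2 hgr hl hrs hr⟩
      rw [sub_sub_cancel_left]
      exact neg_mem (Submodule.smul_mem _ _ (hrs _))
  have hex : ∀ p ∈ S, ∃ w, w - v p ∈ s (k + 1) ∧ rmul p (exp w) ∈ reduce 𝒱 N R k := by
    intro p hp
    obtain ⟨F, -, hF⟩ := local_formula p hp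
    exact ⟨_, hF.self_of_nhdsWithin hp⟩
  choose! v' hv's hv' using hex
  have hslice : ∀ p ∈ S, ∀ w, w - v p ∈ s (k + 1) → w ∈ sliceSum 𝒱 s (k + 1) := by
    intro p hp w hw
    have := add_mem (mem_sliceSum_of_mem hs (by lia) hw)
      (sliceSum_mono (Nat.le_succ k) (hR.mem_slice p hp))
    rwa [sub_add_cancel] at this
  have hsm : ContDiffOn 𝕜 ∞ v' S := by
    intro p hp
    obtain ⟨F, hF, hFe⟩ := local_formula p hp
    refine hF.congr_of_eventuallyEq_of_mem ?_ hp
    filter_upwards [hFe, self_mem_nhdsWithin] with q hq hqS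
    exact hR.eq_of_rmul_exp_mem_reduce hN hS hM hgr hqS (hslice q hqS _ (hv's q hqS))
      (hslice q hqS _ hq.1) (hv' q hqS) hq.2
  have hv'0 : ∀ p ∈ reduce 𝒱 N R k, v' p = 0 := fun p hp => by
    have hpS := hR.subset hp.1
    refine hR.eq_of_rmul_exp_mem_reduce hN hS hM hgr hpS (hslice p hpS _ (hv's p hpS))
      (zero_mem _) (hv' p hpS) ?_
    rwa [NormedSpace.exp_zero, rmul_one]
  refine ⟨v', reduce_subset.trans hR.subset, hsm, fun p hp => hslice p hp _ (hv's p hp),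
    fun p hp w hw => ⟨fun h => ?_, fun h => h ▸ hv' p hp⟩, fun p hp x hx => ?_,
    fun p hp j hj1 hjk x hx hpx => ?_, fun p hp => ?_⟩
  · exact hR.eq_of_rmul_exp_mem_reduce hN hS hM hgr hp hw (hslice p hp _ (hv's p hp)) h (hv' p hp)
  · push_cast at hx
    rw [hR.rmul_mem_reduce_iff_mem hN hS hM hp (lieFilt_antitone 𝒱 J G (by lia) hx) hgr,
      degPart_of_homFilt 𝒱 hx.2 (by lia)]
    exact zero_mem _
  · rcases hjk.lt_or_eq with hj | rfl
    · exact hR.lead p hp.1 j hj1 (by lia) x hx hpx.1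
    · have := (hR.rmul_mem_reduce_iff_mem hN hS hM hp (by exact_mod_cast hx) hgr).1 hpx
      exact_mod_cast this
  · obtain ⟨hpR, c, hc, hcN⟩ := id hp
    have hpS := hR.subset hpR
    have hcS := hR.tangentAt_le hc
    have h1 := hS.add_fderivWithin_mem_tangentAt hsm hv' hpS (hv'0 p hp) hcS
    refine ⟨c + fderivWithin 𝕜 v' S p (1, p.2 ∘L c), ?_, fun j hj => ?_⟩
    · convert h1 using 1
      refine Prod.ext (by simp) ?_
      simp [ContinuousLinearMap.comp_add]
    -- The values of v' - v lie in s_{k+1} and dv vanishes on vectors tangent to `R`. Hence dv'(c)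
    -- is homogeneous of degree k+1 and does not disturb the components of degree at most k.
    · have h2 := (hasFDerivWithinAt_of_contDiffOn hsm hpS).sub
        (hasFDerivWithinAt_of_contDiffOn hR.smooth hpS)
      have h3 := fderivWithin_mem_submodule h2 (fun q hq => hs _ (hv's q hq)) hcS
      rw [sub_apply, hR.fderivWithin_eq_zero hpR hc, sub_zero] at h3
      rw [map_add, degPart_of_mem_ne 𝒱 h3 (by lia), add_zero]
      exact hcN j (by lia)

end IsReduction

variable (𝒱 N S) in
/-- The successive partial normalizations of a frame manifold. -/
def tower : ℕ → Set (𝕜 × (V →L[𝕜] W))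
  | 0 => S
  | k + 1 => reduce 𝒱 N (tower k) k

section

variable [CompleteSpace V]
variable (hN : IsNormalForm 𝒱 J G m δ N s) (hS : IsFrameManifold 𝒱 J G m δ S)
  (hM : IsExpGroup (opSet (modelGroup J G)) (modelLie J G)) (hgr : IsGradedLie J G 𝒱)
include hN hS hM hgr

theorem exists_isReduction_tower (k : ℕ) :
    ∃ v, IsReduction 𝒱 J G m N s S (tower 𝒱 N S k) k v := by
  induction k with
  | zero =>
    refine ⟨0, subset_rfl, contDiffOn_const, fun _ _ => zero_mem _, fun p hp w hw => ?_,
      fun p hp x hx => hS.mul_exp p hp x (by simpa using hx),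
      fun p hp j h1 h2 => by lia, fun p hp => ?_⟩
    · have : w = 0 := eq_zero_of_mem_sliceSum hw (by simpa using sliceSum_le_homFilt 0 hw)
      subst this
      rw [NormedSpace.exp_zero, rmul_one]
      exact ⟨fun _ => rfl, fun _ => hp⟩
    · obtain ⟨O, hO, hpO, Ω, -, hΩ⟩ := hS.lift p hp
      exact ⟨Ω p, hΩ p hpO hp, fun j hj => by lia⟩
  | succ k ih =>
    obtain ⟨v, hv⟩ := ih
    exact hv.exists_isReduction_reduce hN hS hM hgr

omit hN hS hM hgr [CompleteSpace V] in
-- A velocity tangent to R' is tangent to every stage containing R', and being normalized it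
-- certifies membership in the next one. Thus the tower contains every normalized subset, whether
-- complete or not.
theorem subset_tower {R' : Set (𝕜 × (V →L[𝕜] W))} (hR' : R' ⊆ S)
    (h : ∀ p ∈ R', ∃ c : V →L[𝕜] V, ((1 : 𝕜), p.2 ∘L c) ∈ tangentAt 𝕜 R' p ∧
      ∀ j : ℕ, degPart 𝒱 (j : ℤ) c ∈ N) (k : ℕ) : R' ⊆ tower 𝒱 N S k := by
  induction k with
  | zero => exact hR'
  | succ k ih =>
    intro p hp
    obtain ⟨c, hc, hcN⟩ := h p hp
    exact ⟨ih hp, c, tangentAt_mono (eventually_nhdsWithin_of_forall ih) hc, fun j _ => hcN j⟩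

/-- Existence of the complete normalization of a frame manifold. -/
theorem exists_isReduction_normal : ∃ (R : Set (𝕜 × (V →L[𝕜] W))) (n : ℕ)
    (v : 𝕜 × (V →L[𝕜] W) → (V →L[𝕜] V)), IsReduction 𝒱 J G m N s S R n v ∧
    (∀ k : ℤ, (n : ℤ) ≤ |k| → ∀ x, degPart 𝒱 k x = 0) ∧ R = tower 𝒱 N S n := by
  obtain ⟨n, hn⟩ := exists_depth 𝒱
  obtain ⟨v, hv⟩ := exists_isReduction_tower hN hS hM hgr n
  exact ⟨_, n, v, hv, hn, rfl⟩

end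

end Step

/-! ### Linear algebra of normalization conditions -/

section NormalForm

variable {𝕜 : Type*} [RCLike 𝕜]
variable {V : Type*} [NormedAddCommGroup V] [NormedSpace 𝕜 V]
variable {W : Type*} [NormedAddCommGroup W] [NormedSpace 𝕜 W]
variable (𝒱 : ℤ → Submodule 𝕜 V) (J : V ≃L[𝕜] W) (G : Subgroup (W ≃L[𝕜] W))
variable (m : Submodule 𝕜 (V →L[𝕜] V))
variable [DirectSum.Decomposition 𝒱] [FiniteDimensional 𝕜 V]

theorem degPart_mul_of_mem_left {a : ℤ} {y : V →L[𝕜] V} (hy : y ∈ homDeg 𝒱 a) (k : ℤ)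
    (x : V →L[𝕜] V) : degPart 𝒱 (a + k) (y * x) = y * degPart 𝒱 k x := by
  have : x ∈ LinearMap.eqLocus (degPart 𝒱 (a + k) ∘ₗ LinearMap.mulLeft 𝕜 y)
      (LinearMap.mulLeft 𝕜 y ∘ₗ degPart 𝒱 k) := by
    refine mem_of_forall_degPart 𝒱 fun l => ?_
    change degPart 𝒱 (a + k) (y * degPart 𝒱 l x) = y * degPart 𝒱 k (degPart 𝒱 l x)
    have h := homDeg_mul 𝒱 hy (degPart_mem 𝒱 l x)
    rw [degPart_degPart]
    split_ifs with hl
    · subst hl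
      exact degPart_of_mem 𝒱 h
    · rw [mul_zero]
      exact degPart_of_mem_ne 𝒱 h (by lia)
  exact this

theorem degPart_mul_of_mem_right {a : ℤ} {y : V →L[𝕜] V} (hy : y ∈ homDeg 𝒱 a) (k : ℤ)
    (x : V →L[𝕜] V) : degPart 𝒱 (a + k) (x * y) = degPart 𝒱 k x * y := by
  have : x ∈ LinearMap.eqLocus (degPart 𝒱 (a + k) ∘ₗ LinearMap.mulRight 𝕜 y)
      (LinearMap.mulRight 𝕜 y ∘ₗ degPart 𝒱 k) := by
    refine mem_of_forall_degPart 𝒱 fun l => ?_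
    change degPart 𝒱 (a + k) (degPart 𝒱 l x * y) = degPart 𝒱 k (degPart 𝒱 l x) * y
    have h := homDeg_mul 𝒱 (degPart_mem 𝒱 l x) hy
    rw [degPart_degPart]
    split_ifs with hl
    · subst hl
      exact degPart_of_mem 𝒱 (by rwa [add_comm] at h)
    · rw [zero_mul]
      exact degPart_of_mem_ne 𝒱 h (by lia)
  exact this

theorem degPart_comm_of_mem {a : ℤ} {y : V →L[𝕜] V} (hy : y ∈ homDeg 𝒱 a) (k : ℤ)
    (x : V →L[𝕜] V) :
    degPart 𝒱 (a + k) (y * x - x * y) = y * degPart 𝒱 k x - degPart 𝒱 k x * y := by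
  rw [map_sub, degPart_mul_of_mem_left 𝒱 hy, degPart_mul_of_mem_right 𝒱 hy]

variable {J G} in
theorem mem_uPlus_iff {x : V →L[𝕜] V} : x ∈ uPlus 𝒱 J G m ↔
    x ∈ homFilt 𝒱 0 ∧ ∀ j : ℕ, degPart 𝒱 j x ∈ prolong 𝒱 J G m (j + 1) := by
  constructor
  · intro hx
    induction hx using Submodule.iSup_induction' with
    | mem n x hx =>
      have hd := (prolong_le_lieDeg 𝒱 J G m n hx).2
      refine ⟨homFilt_antitone 𝒱 (by lia) (homDeg_le_homFilt 𝒱 _ hd), fun j => ?_⟩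
      by_cases h : j = n
      · subst h; rwa [degPart_of_mem 𝒱 hd]
      · rw [degPart_of_mem_ne 𝒱 hd (by lia)]; exact zero_mem _
    | zero => exact ⟨zero_mem _, fun j => by rw [map_zero]; exact zero_mem _⟩
    | add x y _ _ h1 h2 =>
      exact ⟨add_mem h1.1 h2.1, fun j => by rw [map_add]; exact add_mem (h1.2 j) (h2.2 j)⟩
  · rintro ⟨h0, h⟩
    refine mem_of_forall_degPart 𝒱 fun k => ?_
    rcases lt_or_ge k 0 with hk | hk
    · rw [degPart_of_homFilt 𝒱 h0 hk]; exact zero_mem _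
    · obtain ⟨j, rfl⟩ := Int.eq_ofNat_of_zero_le hk
      exact Submodule.mem_iSup_of_mem j (h j)

theorem uPlus_le_lieFilt : uPlus 𝒱 J G m ≤ lieFilt J G 𝒱 0 :=
  iSup_le fun n => ((prolong_le_lieDeg 𝒱 J G m n).trans (lieDeg_le_lieFilt 𝒱 J G n)).trans
    (lieFilt_antitone 𝒱 J G (by lia))

/-- A complement of b in the whole space is chosen to contain a and then intersected with L. It is
applied with b = 𝔲_j, L = 𝔤_j and a the part of 𝒩 of degree j, so that normalized components lie in
the slices. -/
theorem exists_complement {E : Type*} [AddCommGroup E] [Module 𝕜 E] {L b a : Submodule 𝕜 E}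
    (hab : a ⊓ b = ⊥) (ha : a ≤ L) (hb : b ≤ L) : ∃ s : Submodule 𝕜 E, a ≤ s ∧ s ≤ L ∧
      (∀ x ∈ s, x ∈ b → x = 0) ∧
      ∃ q : E →ₗ[𝕜] E, (∀ x, q x ∈ b) ∧ ∀ x ∈ L, x - q x ∈ s := by
  obtain ⟨c, hac, hc⟩ := (disjoint_iff.2 hab).exists_isCompl
  refine ⟨c ⊓ L, le_inf hac ha, inf_le_right, fun x hx hxb => ?_,
    b.subtype ∘ₗ b.projectionOnto c hc.symm, fun x => Submodule.coe_mem _,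
    fun x hx => ?_⟩
  · exact (Submodule.mem_bot 𝕜).1 (hc.inf_eq_bot ▸ ⟨hx.1, hxb⟩)
  · refine ⟨?_, L.sub_mem hx (hb (Submodule.coe_mem _))⟩
    have h1 : x - (b.projectionOnto c hc.symm x : E) ∈ LinearMap.ker (b.projectionOnto c hc.symm) := by
      rw [LinearMap.mem_ker, map_sub, sub_eq_zero]
      exact (Submodule.projectionOnto_apply_left hc.symm _).symm
    rwa [Submodule.ker_projectionOnto] at h1

theorem exists_rightInverse_on {E F : Type*} [AddCommGroup E] [Module 𝕜 E] [AddCommGroup F]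
    [Module 𝕜 F] (φ : E →ₗ[𝕜] F) :
    ∃ g : F →ₗ[𝕜] E, ∀ y ∈ LinearMap.range φ, φ (g y) = y := by
  obtain ⟨g, hg⟩ := φ.rangeRestrict.exists_rightInverse_of_surjective φ.range_rangeRestrict
  obtain ⟨g', hg'⟩ := g.exists_extend
  refine ⟨g', fun y hy => ?_⟩
  have h1 : g' y = g ⟨y, hy⟩ := LinearMap.congr_fun hg' ⟨y, hy⟩
  rw [h1]
  exact congrArg Subtype.val (LinearMap.congr_fun hg ⟨y, hy⟩)

variable {𝒱 J G m}

/-- Evaluation of cochains at an element of `m`. -/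
def evalAt {δ : V →L[𝕜] V} (hδ : δ ∈ m) : (m →ₗ[𝕜] (V →L[𝕜] V)) →ₗ[𝕜] (V →L[𝕜] V) :=
  LinearMap.applyₗ ⟨δ, hδ⟩

theorem evalAt_apply {δ : V →L[𝕜] V} (hδ : δ ∈ m) (c : m →ₗ[𝕜] (V →L[𝕜] V)) :
    evalAt hδ c = c ⟨δ, hδ⟩ := rfl

variable {δ : V →L[𝕜] V} (hδ : δ ∈ m) (hspan : m = Submodule.span 𝕜 {δ}) (h0 : δ ≠ 0)
include hspan

/-- As 𝔪 is a line, a cochain is the same as its value at δ; from here on cochains are handled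
through these values. -/
theorem mem_homInto_iff {S : Submodule 𝕜 (V →L[𝕜] V)} {c : m →ₗ[𝕜] (V →L[𝕜] V)} :
    c ∈ homInto m S ↔ evalAt hδ c ∈ S := by
  refine ⟨fun h => h _, fun h ε => ?_⟩
  have hε : (ε : V →L[𝕜] V) ∈ Submodule.span 𝕜 {δ} := hspan ▸ ε.2
  obtain ⟨a, ha⟩ := Submodule.mem_span_singleton.1 hε
  have : ε = a • (⟨δ, hδ⟩ : m) := Subtype.ext ha.symm
  rw [this, map_smul]
  exact S.smul_mem a h

theorem evalAt_injective : Function.Injective (evalAt hδ) := by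
  refine (injective_iff_map_eq_zero _).2 fun c hc => ?_
  have := (mem_homInto_iff hδ hspan (S := ⊥)).2 ((Submodule.mem_bot 𝕜).2 hc)
  exact LinearMap.ext fun ε => this ε

include h0 in
theorem evalAt_surjective : Function.Surjective (evalAt hδ) := by
  subst hspan
  intro z
  refine ⟨(LinearMap.toSpanSingleton 𝕜 _ z) ∘ₗ (LinearEquiv.coord 𝕜 _ δ h0).toLinearMap, ?_⟩
  rw [evalAt_apply]
  have := LinearEquiv.coord_self 𝕜 _ δ h0
  simp only [LinearMap.comp_apply, LinearEquiv.coe_coe, LinearMap.toSpanSingleton_apply]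
  rw [this, one_smul]

theorem mem_of_evalAt_mem {N : Submodule 𝕜 (m →ₗ[𝕜] (V →L[𝕜] V))} {c : m →ₗ[𝕜] (V →L[𝕜] V)}
    (h : evalAt hδ c ∈ N.map (evalAt hδ)) : c ∈ N := by
  obtain ⟨c', hc', h⟩ := h
  rwa [← evalAt_injective hδ hspan h]

include h0 in
/-- A normalization condition gives rise to the data of the normalization procedure. -/
theorem IsNormalization.exists_isNormalForm {N : Submodule 𝕜 (m →ₗ[𝕜] (V →L[𝕜] V))}
    (hN : IsNormalization 𝒱 J G m N)
    (hgr : IsGradedLie J G 𝒱) (hmdeg : m ≤ lieDeg J G 𝒱 (-1)) :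
    ∃ s, IsNormalForm 𝒱 J G m δ (N.map (evalAt hδ)) s := by
  have hNle : ∀ n ∈ N.map (evalAt hδ), n ∈ lieFilt J G 𝒱 0 := by
    rintro _ ⟨c, hc, rfl⟩
    have : c ∈ cochainsPlus 𝒱 J G m := hN.span ▸ Submodule.mem_sup_left hc
    exact this _
  have hgraded : ∀ n ∈ N.map (evalAt hδ), ∀ k : ℤ, degPart 𝒱 k n ∈ N.map (evalAt hδ) := by
    rintro _ ⟨c, hc, rfl⟩ k
    exact ⟨_, hN.graded c hc k, rfl⟩
  have hdisj : ∀ n ∈ N.map (evalAt hδ), ∀ x ∈ modelLie J G, ∀ u ∈ uPlus 𝒱 J G m,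
      n = δ * x - x * δ + u → n = 0 := by
    rintro _ ⟨c, hc, rfl⟩ x hx u hu h
    obtain ⟨d, rfl⟩ := evalAt_surjective hδ hspan h0 u
    have hd : d ∈ homInto m (uPlus 𝒱 J G m) := (mem_homInto_iff hδ hspan).2 hu
    have hc0 : c ∈ cochainsPlus 𝒱 J G m := hN.span ▸ Submodule.mem_sup_left hc
    have e : c = coboundary m x + d := evalAt_injective hδ hspan h
    -- Only coboundaries inside C¹_+ count as trivial cochains. This one is, being the difference of
    -- c and a cochain with values in 𝔲_+.
    have h1 : coboundary m x ∈ cochainsPlus 𝒱 J G m := by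
      rw [eq_sub_of_add_eq e.symm]
      exact sub_mem hc0 fun ε => uPlus_le_lieFilt 𝒱 J G m (hd ε)
    have h2 : c ∈ trivialCochains 𝒱 J G m := by
      rw [e, add_comm]
      exact Submodule.add_mem_sup hd ⟨⟨x, hx, rfl⟩, h1⟩
    have h3 : c ∈ N ⊓ trivialCochains 𝒱 J G m := ⟨hc, h2⟩
    rw [hN.disjoint, Submodule.mem_bot] at h3
    rw [h3, map_zero]
  have hδd := hmdeg hδ
  have hle : ∀ j : ℕ, prolong 𝒱 J G m (j + 1) ≤ uPlus 𝒱 J G m := fun j =>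
    le_iSup (fun n : ℕ => prolong 𝒱 J G m (n + 1)) j
  have key : ∀ j : ℕ, ∃ s : Submodule 𝕜 (V →L[𝕜] V), N.map (evalAt hδ) ⊓ homDeg 𝒱 j ≤ s ∧
      s ≤ lieDeg J G 𝒱 j ∧ (∀ x ∈ s, x ∈ prolong 𝒱 J G m (j + 1) → x = 0) ∧
      ∃ q : (V →L[𝕜] V) →ₗ[𝕜] (V →L[𝕜] V), (∀ x, q x ∈ prolong 𝒱 J G m (j + 1)) ∧
        ∀ x ∈ lieDeg J G 𝒱 j, x - q x ∈ s := fun j =>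
    exists_complement (eq_bot_iff.2 fun x hx => (Submodule.mem_bot 𝕜).2
        (hdisj x hx.1.1 0 (zero_mem _) x (hle j hx.2) (by simp)))
      (fun x hx => ⟨(hNle x hx.1).1, hx.2⟩) (prolong_le_lieDeg 𝒱 J G m j)
  choose s hsN hsl hsd q hqu hqs using key
  refine ⟨s, hspan, hδd, h0, hgraded, fun n hn j => hsN j ⟨hgraded n hn j, degPart_mem 𝒱 _ _⟩,
    hsl, hsd, fun j x hx u hu h => hdisj _ h x hx.1 u (hle j hu) rfl, ?_, fun j => ?_⟩
  · obtain ⟨n, hn⟩ := exists_depth 𝒱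
    -- The projections onto 𝔲_j along s_j are assembled over all non-negative degrees; the depth
    -- bound makes the sum finite.
    let Q : (V →L[𝕜] V) →ₗ[𝕜] (V →L[𝕜] V) := ∑ j ∈ Finset.range n, q j ∘ₗ degPart 𝒱 (j : ℤ)
    have hQ : ∀ x, Q x ∈ uPlus 𝒱 J G m := fun x => by
      simp only [Q, LinearMap.sum_apply]
      exact sum_mem fun j _ => hle j (hqu j _)
    have hQj : ∀ x, ∀ j : ℕ, degPart 𝒱 (j : ℤ) (Q x) = q j (degPart 𝒱 (j : ℤ) x) := fun x j => by
      simp only [Q, LinearMap.sum_apply, map_sum, LinearMap.comp_apply]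
      have : ∀ i ∈ Finset.range n, degPart 𝒱 (j : ℤ) (q i (degPart 𝒱 (i : ℤ) x)) =
          if i = j then q j (degPart 𝒱 (j : ℤ) x) else 0 := fun i _ => by
        have hd := (prolong_le_lieDeg 𝒱 J G m i (hqu i (degPart 𝒱 (i : ℤ) x))).2
        split_ifs with h
        · subst h; exact degPart_of_mem 𝒱 hd
        · exact degPart_of_mem_ne 𝒱 hd (by lia)
      rw [Finset.sum_congr rfl this, Finset.sum_ite_eq']
      split_ifs with h
      · rfl
      · rw [hn _ (by rw [Finset.mem_range] at h; rw [le_abs]; lia), map_zero]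
    refine ⟨LinearMap.toContinuousLinearMap Q, fun x hx => ?_⟩
    change Q x ∈ _ ∧ degPart 𝒱 0 (Q x) ∈ _ ∧ ∀ j : ℕ, degPart 𝒱 j (x - Q x) ∈ s j
    have h1 := ((mem_uPlus_iff 𝒱 m).1 (hQ x)).2 0
    refine ⟨uPlus_le_lieFilt 𝒱 J G m (hQ x), by exact_mod_cast h1, fun j => ?_⟩
    rw [map_sub, hQj]
    exact hqs j _ (degPart_mem_lieDeg 𝒱 hgr hx j)
  -- The solution operator is a linear right inverse of (n + u, x) ↦ n + u + [δ, x] on (𝒩 + 𝔲_j) ×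
  -- s_{j+1}. Every element of degree j is in the range because 𝒩 and the trivial cochains span
  -- C¹_+.
  · let ad : (V →L[𝕜] V) →ₗ[𝕜] (V →L[𝕜] V) := LinearMap.mulLeft 𝕜 δ - LinearMap.mulRight 𝕜 δ
    let K := N.map (evalAt hδ) ⊔ prolong 𝒱 J G m (j + 1)
    let φ : K × s (j + 1) →ₗ[𝕜] (V →L[𝕜] V) :=
      K.subtype.coprod (ad ∘ₗ (s (j + 1)).subtype)
    obtain ⟨g, hg⟩ := exists_rightInverse_on φ
    let r : (V →L[𝕜] V) →ₗ[𝕜] (V →L[𝕜] V) :=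
      (s (j + 1)).subtype ∘ₗ LinearMap.snd 𝕜 K (s (j + 1)) ∘ₗ g
    refine ⟨LinearMap.toContinuousLinearMap r, fun z => (g z).2.2, fun z hz => ?_⟩
    have hzφ : z ∈ LinearMap.range φ := by
      obtain ⟨c, rfl⟩ := evalAt_surjective hδ hspan h0 z
      have hc : c ∈ cochainsPlus 𝒱 J G m := (mem_homInto_iff hδ hspan).2
        (lieFilt_antitone 𝒱 J G (by lia) (lieDeg_le_lieFilt 𝒱 J G j hz))
      rw [← hN.span] at hc
      obtain ⟨n, hn, t, ht, rfl⟩ := Submodule.mem_sup.1 hc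
      obtain ⟨u, hu, _, ⟨⟨x, hx, rfl⟩, -⟩, rfl⟩ := Submodule.mem_sup.1 ht
      have h1 : degPart 𝒱 j (evalAt hδ (n + (u + coboundary m x))) =
          degPart 𝒱 j (evalAt hδ n) + (degPart 𝒱 j (evalAt hδ u) +
            (δ * degPart 𝒱 (j + 1) x - degPart 𝒱 (j + 1) x * δ)) := by
        have h2 := degPart_comm_of_mem 𝒱 hδd.2 (j + 1) x
        rw [show (-1 : ℤ) + (j + 1) = j by ring] at h2
        rw [map_add, map_add, map_add, map_add, ← h2]
        rfl
      rw [degPart_of_mem 𝒱 hz.2] at h1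
      have hxd := degPart_mem_lieDeg 𝒱 hgr hx (j + 1)
      -- The 𝔲_{j+1}-part y of x_{j+1} is removed to land in the slice; its coboundary lies in 𝔲_j
      -- and is absorbed there.
      have hy := hqs (j + 1) (degPart 𝒱 (j + 1) x) (by exact_mod_cast hxd)
      have hyu := (hqu (j + 1) (degPart 𝒱 (j + 1) x)).2 δ hδ
      have hud := ((mem_uPlus_iff 𝒱 m).1 ((mem_homInto_iff hδ hspan).1 hu)).2 j
      set y := q (j + 1) (degPart 𝒱 (j + 1) x)
      set x' := degPart 𝒱 (j + 1) x
      refine ⟨(⟨degPart 𝒱 j (evalAt hδ n) + (degPart 𝒱 j (evalAt hδ u) - (y * δ - δ * y)),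
        Submodule.add_mem_sup (hgraded _ ⟨n, hn, rfl⟩ j) (sub_mem hud hyu)⟩, ⟨x' - y, hy⟩), ?_⟩
      rw [h1]
      change degPart 𝒱 j (evalAt hδ n) + (degPart 𝒱 j (evalAt hδ u) - (y * δ - δ * y)) +
        (δ * (x' - y) - (x' - y) * δ) = _
      noncomm_ring
    obtain ⟨n, hn, u, hu, hnu⟩ := Submodule.mem_sup.1 (g z).1.2
    refine ⟨n, hn, u, hu, ?_⟩
    have h1 : ((g z).1 : V →L[𝕜] V) + (δ * r z - r z * δ) = z := hg z hzφ
    rw [hnu]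
    exact h1.symm

end NormalForm

/-! ### Exponentials in subalgebras and products -/

section ExpHom

variable (𝕜 : Type*) [RCLike 𝕜] {A B : Type*} [NormedRing A] [NormedAlgebra 𝕜 A] [CompleteSpace A]
  [NormedRing B] [NormedAlgebra 𝕜 B]
include 𝕜

theorem map_exp {F : Type*} [FunLike F A B] [RingHomClass F A B] (f : F) (hf : Continuous f)
    (x : A) : f (exp x) = exp (f x) := by
  let := NormedAlgebra.restrictScalars ℚ 𝕜 A
  let := NormedAlgebra.restrictScalars ℚ 𝕜 B
  exact NormedSpace.map_exp f hf x

variable {𝕜}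

theorem Subalgebra.coe_exp {S : Subalgebra 𝕜 A} (hS : IsClosed (S : Set A)) (x : S) :
    ((exp x : S) : A) = exp (x : A) := by
  have : CompleteSpace S := hS.completeSpace_coe
  exact map_exp 𝕜 S.val continuous_subtype_val x

theorem exp_mem_subalgebra {S : Subalgebra 𝕜 A} (hS : IsClosed (S : Set A)) {x : A} (hx : x ∈ S) :
    exp x ∈ S := by
  rw [← Subalgebra.coe_exp hS ⟨x, hx⟩]
  exact Subtype.coe_prop _

variable (𝕜) in
theorem exp_prodMk {A B : Type*} [NormedRing A] [NormedAlgebra 𝕜 A] [CompleteSpace A]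
    [NormedRing B] [NormedAlgebra 𝕜 B] [CompleteSpace B] (x : A) (y : B) :
    exp (x, y) = (exp x, exp y) :=
  Prod.ext (map_exp 𝕜 (RingHom.fst A B) continuous_fst (x, y))
    (map_exp 𝕜 (RingHom.snd A B) continuous_snd (x, y))

theorem exp_mem_prod [FiniteDimensional 𝕜 A] (T : Subalgebra 𝕜 (A × A)) {x y : A}
    (h : (x, y) ∈ T) : (exp x, exp y) ∈ T := by
  rw [← exp_prodMk 𝕜]
  exact exp_mem_subalgebra (Submodule.closed_of_finiteDimensional (Subalgebra.toSubmodule T)) h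

theorem eventually_mem_prod [FiniteDimensional 𝕜 A] (T : Subalgebra 𝕜 (A × A)) :
    ∀ᶠ z in 𝓝 ((0, 0) : A × A), (exp z.1, exp z.2) ∈ T → z ∈ T := by
  have := mem_subalgebra_of_exp_mem (𝕜 := 𝕜) T
    (Submodule.closed_of_finiteDimensional (Subalgebra.toSubmodule T))
  filter_upwards [this] with z hz h
  exact hz (by rw [show z = (z.1, z.2) from rfl, exp_prodMk 𝕜]; exact h)

/-- Left multiplication by an invertible a is injective on the finite-dimensional subalgebra, hence
onto, so it attains 1 there. -/
theorem mem_subalgebra_of_mul_eq_one [FiniteDimensional 𝕜 A] {S : Subalgebra 𝕜 A} {a b : A}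
    (ha : a ∈ S) (hba : b * a = 1) : b ∈ S := by
  have hinj : Function.Injective (LinearMap.mulLeft 𝕜 (⟨a, ha⟩ : S)) := fun x y h => by
    have h1 : a * (x : A) = a * (y : A) := congrArg Subtype.val h
    have h2 := congrArg (b * ·) h1
    simp only [← mul_assoc, hba, one_mul] at h2
    exact Subtype.ext h2
  obtain ⟨c, hc⟩ := LinearMap.surjective_of_injective hinj 1
  have h1 : a * (c : A) = 1 := congrArg Subtype.val hc
  have h2 := congrArg (b * ·) h1
  simp only [← mul_assoc, hba, one_mul, mul_one] at h2
  rw [← h2]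
  exact c.2

theorem IsExpGroup.inter_subalgebra [FiniteDimensional 𝕜 A] {H : Set A} {h : Submodule 𝕜 A}
    (hH : IsExpGroup H h) (S : Subalgebra 𝕜 A) :
    IsExpGroup (H ∩ S) (h ⊓ Subalgebra.toSubmodule S) where
  one_mem := ⟨hH.one_mem, S.one_mem⟩
  mul_mem a ha b hb := ⟨hH.mul_mem a ha.1 b hb.1, S.mul_mem ha.2 hb.2⟩
  inv_mem a ha := by
    obtain ⟨b, hb, hab, hba⟩ := hH.inv_mem a ha.1
    exact ⟨b, ⟨hb, mem_subalgebra_of_mul_eq_one ha.2 hba⟩, hab, hba⟩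
  exp_mem x hx := ⟨hH.exp_mem x hx.1, exp_mem_subalgebra
    (Submodule.closed_of_finiteDimensional (Subalgebra.toSubmodule S)) hx.2⟩
  near_one U hU := by
    have h1 := mem_subalgebra_of_exp_mem (𝕜 := 𝕜) S
      (Submodule.closed_of_finiteDimensional (Subalgebra.toSubmodule S))
    have h2 := hH.near_one _ (Filter.inter_mem hU h1)
    have h3 : ∀ᶠ b in 𝓝[H ∩ S] (1 : A), _ := nhdsWithin_mono _ Set.inter_subset_left h2
    filter_upwards [h3, self_mem_nhdsWithin] with b ⟨x, hxU, hxh, hxb⟩ hb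
    exact ⟨x, hxU.1, ⟨hxh, hxU.2 (hxb ▸ hb.2)⟩, hxb⟩

end ExpHom

/-! ### The group 𝒢_+ and the stabilizer of the line spanned by δ -/

section FilteredGroup

variable {𝕜 : Type*} [RCLike 𝕜]
variable {V : Type*} [NormedAddCommGroup V] [NormedSpace 𝕜 V]
variable {W : Type*} [NormedAddCommGroup W] [NormedSpace 𝕜 W]
variable (𝒱 : ℤ → Submodule 𝕜 V) (J : V ≃L[𝕜] W) (G : Subgroup (W ≃L[𝕜] W))

theorem one_mem_homFilt : (1 : V →L[𝕜] V) ∈ homFilt 𝒱 0 := fun i v hv => by simpa using hv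

/-- The algebra of the operators that preserve the filtration. -/
def filtAlgebra : Subalgebra 𝕜 (V →L[𝕜] V) where
  __ := homFilt 𝒱 0
  mul_mem' ha hb := by simpa using homFilt_mul 𝒱 ha hb
  one_mem' := one_mem_homFilt 𝒱
  algebraMap_mem' r := by
    rw [Algebra.algebraMap_eq_smul_one]
    exact Submodule.smul_mem _ r (one_mem_homFilt 𝒱)

/-- The set of operators underlying `𝒢_+`. -/
def plusSet : Set (V →L[𝕜] V) := opSet (modelGroup J G) ∩ filtAlgebra 𝒱

variable [FiniteDimensional 𝕜 V] [CompleteSpace V]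

theorem mem_homFilt_zero_iff_map (B : V ≃L[𝕜] V) : (B : V →L[𝕜] V) ∈ homFilt 𝒱 0 ↔
    ∀ i, (filt 𝒱 i).map (B : V →L[𝕜] V).toLinearMap = filt 𝒱 i := by
  constructor
  · intro h i
    refine Submodule.eq_of_le_of_finrank_eq ?_
      (Submodule.equivMapOfInjective _ B.injective (filt 𝒱 i)).finrank_eq.symm
    rintro _ ⟨v, hv, rfl⟩
    simpa using h i v hv
  · intro h i v hv
    rw [add_zero, ← h i]
    exact ⟨v, hv, rfl⟩

theorem opSet_modelPlus : opSet (modelPlus J G 𝒱) = plusSet 𝒱 J G := by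
  ext B
  constructor
  · rintro ⟨B, ⟨hB, hf⟩, rfl⟩
    exact ⟨⟨B, hB, rfl⟩, (mem_homFilt_zero_iff_map 𝒱 B).2 hf⟩
  · rintro ⟨⟨B, hB, rfl⟩, hf⟩
    exact ⟨B, ⟨hB, (mem_homFilt_zero_iff_map 𝒱 B).1 hf⟩, rfl⟩

variable {𝒱 J G} in
theorem isExpGroup_plusSet (hM : IsExpGroup (opSet (modelGroup J G)) (modelLie J G)) :
    IsExpGroup (plusSet 𝒱 J G) (lieFilt J G 𝒱 0) :=
  hM.inter_subalgebra (filtAlgebra 𝒱)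

variable [DirectSum.Decomposition 𝒱]

theorem degPart_zero_mul {x y : V →L[𝕜] V} (hx : x ∈ homFilt 𝒱 0) (hy : y ∈ homFilt 𝒱 0) :
    degPart 𝒱 0 (x * y) = degPart 𝒱 0 x * degPart 𝒱 0 y := by
  simpa using degPart_mul 𝒱 (a := 0) (b := 0) hx hy

theorem degPart_zero_one : degPart 𝒱 0 (1 : V →L[𝕜] V) = 1 :=
  degPart_of_mem 𝒱 (one_mem_homDeg 𝒱)

/-- The projection to the part of degree `0`, a homomorphism on filtered operators. -/
def degZero : filtAlgebra 𝒱 →ₐ[𝕜] (V →L[𝕜] V) :=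
  AlgHom.ofLinearMap (degPart 𝒱 0 ∘ₗ (Subalgebra.toSubmodule (filtAlgebra 𝒱)).subtype)
    (degPart_zero_one 𝒱) fun x y => degPart_zero_mul 𝒱 x.2 y.2

theorem isClosed_filtAlgebra : IsClosed (filtAlgebra 𝒱 : Set (V →L[𝕜] V)) :=
  Submodule.closed_of_finiteDimensional (homFilt 𝒱 0)

theorem exp_mem_homFilt_zero {x : V →L[𝕜] V} (hx : x ∈ homFilt 𝒱 0) : exp x ∈ homFilt 𝒱 0 :=
  exp_mem_subalgebra (isClosed_filtAlgebra 𝒱) hx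

theorem degPart_zero_exp {x : V →L[𝕜] V} (hx : x ∈ homFilt 𝒱 0) :
    degPart 𝒱 0 (exp x) = exp (degPart 𝒱 0 x) := by
  have : CompleteSpace (filtAlgebra 𝒱) := (isClosed_filtAlgebra 𝒱).completeSpace_coe
  have h := map_exp 𝕜 (degZero 𝒱)
    ((degZero 𝒱).toLinearMap.continuous_of_finiteDimensional) ⟨x, hx⟩
  rw [← show ((exp (⟨x, hx⟩ : filtAlgebra 𝒱) : filtAlgebra 𝒱) : V →L[𝕜] V) = exp x from
    Subalgebra.coe_exp (isClosed_filtAlgebra 𝒱) ⟨x, hx⟩]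
  exact h

/-- The pairs `(x, y)` of filtered operators whose parts of degree `0` are intertwined by `δ`. -/
def intertwiner (δ : V →L[𝕜] V) : Subalgebra 𝕜 ((V →L[𝕜] V) × (V →L[𝕜] V)) where
  carrier := {z | z.1 ∈ homFilt 𝒱 0 ∧ z.2 ∈ homFilt 𝒱 0 ∧
    degPart 𝒱 0 z.1 * δ = δ * degPart 𝒱 0 z.2}
  mul_mem' {z z'} h h' := by
    refine ⟨(filtAlgebra 𝒱).mul_mem h.1 h'.1, (filtAlgebra 𝒱).mul_mem h.2.1 h'.2.1, ?_⟩
    rw [Prod.fst_mul, Prod.snd_mul, degPart_zero_mul 𝒱 h.1 h'.1, degPart_zero_mul 𝒱 h.2.1 h'.2.1,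
      mul_assoc, h'.2.2, ← mul_assoc, h.2.2, mul_assoc]
  add_mem' {z z'} h h' := by
    refine ⟨add_mem h.1 h'.1, add_mem h.2.1 h'.2.1, ?_⟩
    rw [Prod.fst_add, Prod.snd_add, map_add, map_add, add_mul, mul_add, h.2.2, h'.2.2]
  algebraMap_mem' r := by
    refine ⟨(filtAlgebra 𝒱).algebraMap_mem r, (filtAlgebra 𝒱).algebraMap_mem r, ?_⟩
    change degPart 𝒱 0 (algebraMap 𝕜 _ r) * δ = δ * degPart 𝒱 0 (algebraMap 𝕜 _ r)
    rw [Algebra.algebraMap_eq_smul_one, map_smul, degPart_zero_one, smul_mul_assoc,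
      mul_smul_comm, one_mul, mul_one]

/-- The elements of `𝒢_+` whose part of degree `0` preserves the line spanned by `δ`. -/
def lineSet (δ : V →L[𝕜] V) : Set (V →L[𝕜] V) :=
  {B | B ∈ plusSet 𝒱 J G ∧ ∃ l : 𝕜, degPart 𝒱 0 B * δ = l • (δ * degPart 𝒱 0 B)}

/-- The Lie algebra of `lineSet`. -/
def lineLie (m : Submodule 𝕜 (V →L[𝕜] V)) : Submodule 𝕜 (V →L[𝕜] V) :=
  lieFilt J G 𝒱 0 ⊓ (prolong 𝒱 J G m 1).comap (degPart 𝒱 0)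

variable {𝒱 J G} {m : Submodule 𝕜 (V →L[𝕜] V)} {δ : V →L[𝕜] V}

theorem degPart_zero_mul_eq_one {a b : V →L[𝕜] V} (ha : a ∈ homFilt 𝒱 0) (hb : b ∈ homFilt 𝒱 0)
    (hab : a * b = 1) : degPart 𝒱 0 a * degPart 𝒱 0 b = 1 := by
  rw [← degPart_zero_mul 𝒱 ha hb, hab, degPart_zero_one]

theorem mem_lineLie_iff (hspan : m = Submodule.span 𝕜 {δ}) (hgr : IsGradedLie J G 𝒱)
    {x : V →L[𝕜] V} : x ∈ lineLie 𝒱 J G m ↔ x ∈ lieFilt J G 𝒱 0 ∧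
      ∃ a : 𝕜, degPart 𝒱 0 x * δ - δ * degPart 𝒱 0 x = a • δ := by
  have hδ : δ ∈ m := by rw [hspan]; exact Submodule.mem_span_singleton_self δ
  refine and_congr_right fun hx => ⟨fun h => ?_, fun ⟨a, ha⟩ => ?_⟩
  · have h1 : degPart 𝒱 0 x * δ - δ * degPart 𝒱 0 x ∈ m := h.2 δ hδ
    rw [hspan] at h1
    obtain ⟨a, ha⟩ := Submodule.mem_span_singleton.1 h1
    exact ⟨a, ha.symm⟩
  · refine ⟨by exact_mod_cast degPart_mem_lieDeg 𝒱 hgr hx.1 0, fun ε hε => ?_⟩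
    rw [hspan] at hε
    obtain ⟨c, rfl⟩ := Submodule.mem_span_singleton.1 hε
    rw [mul_smul_comm, smul_mul_assoc, ← smul_sub, ha]
    exact m.smul_mem c (m.smul_mem a hδ)

theorem exp_add_smul_one (x : V →L[𝕜] V) (a : 𝕜) :
    exp (x + a • (1 : V →L[𝕜] V)) = exp a • exp x := by
  rw [exp_add_of_commute 𝕜 (Commute.smul_right (Commute.one_right x) a)]
  have h : exp (a • (1 : V →L[𝕜] V)) = exp a • (1 : V →L[𝕜] V) := by
    rw [← Algebra.algebraMap_eq_smul_one, ← Algebra.algebraMap_eq_smul_one]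
    exact (map_exp 𝕜 (algebraMap 𝕜 (V →L[𝕜] V)) (continuous_algebraMap 𝕜 _) a).symm
  rw [h, mul_smul_comm, mul_one]

/-- Preserving a line is not a linear condition on B, but B₀δ = lδB₀ says that (B, lB) lies in a
subalgebra. With l = e^a its logarithm is (x, x + a), and membership of this pair is the Lie algebra
condition. -/
theorem mem_intertwiner_smul_iff {x : V →L[𝕜] V} {a : 𝕜} :
    (x, x + a • (1 : V →L[𝕜] V)) ∈ intertwiner 𝒱 δ ↔ x ∈ homFilt 𝒱 0 ∧
      degPart 𝒱 0 x * δ - δ * degPart 𝒱 0 x = a • δ := by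
  change x ∈ homFilt 𝒱 0 ∧ x + a • (1 : V →L[𝕜] V) ∈ homFilt 𝒱 0 ∧
    degPart 𝒱 0 x * δ = δ * degPart 𝒱 0 (x + a • (1 : V →L[𝕜] V)) ↔ _
  rw [map_add, map_smul, degPart_zero_one, mul_add, mul_smul_comm, mul_one, sub_eq_iff_eq_add']
  exact ⟨fun h => ⟨h.1, h.2.2⟩, fun h => ⟨h.1, add_mem h.1
    (Submodule.smul_mem _ _ (one_mem_homFilt 𝒱)), h.2⟩⟩

set_option maxHeartbeats 1000000 in
-- The factor l is the quotient ℓ(B₀δ)/ℓ(δB₀), continuous near B = 1 with value 1. So a = log l is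
-- small together with x = log B, and the logarithm lemma for subalgebras applies to the pair (x, x
-- + a).
theorem eventually_exp_mem_lineLie
    (hM : IsExpGroup (opSet (modelGroup J G)) (modelLie J G))
    (hspan : m = Submodule.span 𝕜 {δ}) (h0 : δ ≠ 0) (hgr : IsGradedLie J G 𝒱)
    {U : Set (V →L[𝕜] V)} (hU : U ∈ 𝓝 0) :
    ∀ᶠ B in 𝓝[lineSet 𝒱 J G δ] 1, ∃ x ∈ U, x ∈ lineLie 𝒱 J G m ∧ exp x = B := by
  obtain ⟨ℓ, -, hℓ⟩ := exists_dual_vector 𝕜 δ (norm_ne_zero_iff.2 h0)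
  have hδn : (‖δ‖ : 𝕜) ≠ 0 := by simpa using h0
  let d := LinearMap.toContinuousLinearMap (degPart 𝒱 (0 : ℤ))
  let lam : (V →L[𝕜] V) → 𝕜 := fun B => ℓ (d B * δ) / ℓ (δ * d B)
  have hd1 : d 1 = 1 := degPart_zero_one 𝒱
  have hne : ℓ (δ * d 1) ≠ 0 := by rw [hd1, mul_one, hℓ]; exact hδn
  have hden : Continuous fun B : V →L[𝕜] V => ℓ (δ * d B) :=
    ℓ.continuous.comp (continuous_const.mul d.continuous)
  have hnum : Continuous fun B : V →L[𝕜] V => ℓ (d B * δ) :=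
    ℓ.continuous.comp (d.continuous.mul continuous_const)
  have hlam : ContinuousAt lam 1 := hnum.continuousAt.div hden.continuousAt hne
  have hlam1 : lam 1 = 1 := by
    change ℓ (d 1 * δ) / ℓ (δ * d 1) = 1
    rw [hd1, mul_one, one_mul, hℓ, div_self hδn]
  obtain ⟨L, O, hO, h1O, hL, hL1, hexp, -⟩ := FlagCurve.exists_log 𝕜 𝕜
  have hLa : ContinuousAt (fun B => L (lam B)) 1 := by
    refine ContinuousAt.comp ?_ hlam
    rw [hlam1]
    exact (hL.contDiffAt (hO.mem_nhds h1O)).continuousAt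
  have h1 := eventually_mem_prod (intertwiner 𝒱 δ)
  have hc : ContinuousAt (fun z : (V →L[𝕜] V) × 𝕜 => (z.1, z.1 + z.2 • (1 : V →L[𝕜] V)))
      (0, 0) := by fun_prop
  have h2 := hc.eventually (p := fun z => (exp z.1, exp z.2) ∈ intertwiner 𝒱 δ → z ∈ intertwiner 𝒱 δ)
    (by simpa using h1)
  rw [nhds_prod_eq] at h2
  obtain ⟨pa, hpa, pb, hpb, hp⟩ := Filter.eventually_prod_iff.1 h2
  have h3 := (isExpGroup_plusSet (𝒱 := 𝒱) hM).near_one _ (Filter.inter_mem hU hpa)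
  have h3' : ∀ᶠ b in 𝓝[lineSet 𝒱 J G δ] 1, _ := nhdsWithin_mono _ (fun B hB => hB.1) h3
  have h4 : ∀ᶠ b in 𝓝 (1 : V →L[𝕜] V), pb (L (lam b)) := hLa.eventually (by
    change ∀ᶠ y in 𝓝 (L (lam 1)), pb y
    rw [hlam1, hL1]; exact hpb)
  have h5 : ∀ᶠ b in 𝓝 (1 : V →L[𝕜] V), lam b ∈ O :=
    hlam.eventually_mem (by rw [hlam1]; exact hO.mem_nhds h1O)
  have h6 : ∀ᶠ b in 𝓝 (1 : V →L[𝕜] V), ℓ (δ * d b) ≠ 0 := hden.continuousAt.eventually_ne hne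
  filter_upwards [h3', self_mem_nhdsWithin, mem_nhdsWithin_of_mem_nhds h4,
    mem_nhdsWithin_of_mem_nhds h5, mem_nhdsWithin_of_mem_nhds h6]
    with b ⟨x, hxU, hxl, hxb⟩ hb hb4 hb5 hb6
  refine ⟨x, hxU.1, ?_, hxb⟩
  obtain ⟨l, hl⟩ := hb.2
  have hll : lam b = l := by
    change ℓ (degPart 𝒱 0 b * δ) / ℓ (δ * degPart 𝒱 0 b) = l
    rw [hl, map_smul, smul_eq_mul]
    exact mul_div_cancel_right₀ _ hb6
  have h7 : exp (L l) = l := by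
    rw [← hll]; exact hexp _ hb5
  have h8 := hp hxU.2 hb4 (by
    rw [exp_add_smul_one, hxb, hll, h7]
    refine ⟨hb.1.2, Submodule.smul_mem _ _ hb.1.2, ?_⟩
    rw [map_smul, mul_smul_comm, hl])
  rw [hll] at h8
  exact (mem_lineLie_iff hspan hgr).2 ⟨hxl, _, (mem_intertwiner_smul_iff.1 h8).2⟩

theorem mul_mem_lineSet (hM : IsExpGroup (opSet (modelGroup J G)) (modelLie J G))
    {a b : V →L[𝕜] V} (ha : a ∈ lineSet 𝒱 J G δ) (hb : b ∈ lineSet 𝒱 J G δ) :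
    a * b ∈ lineSet 𝒱 J G δ := by
  obtain ⟨l, hl⟩ := ha.2
  obtain ⟨l', hl'⟩ := hb.2
  refine ⟨(isExpGroup_plusSet (𝒱 := 𝒱) hM).mul_mem a ha.1 b hb.1, l' * l, ?_⟩
  rw [degPart_zero_mul 𝒱 ha.1.2 hb.1.2, mul_assoc, hl', mul_smul_comm, ← mul_assoc, hl,
    smul_mul_assoc, mul_assoc, smul_smul]

theorem exists_inv_mem_lineSet (hM : IsExpGroup (opSet (modelGroup J G)) (modelLie J G))
    (h0 : δ ≠ 0) {a : V →L[𝕜] V} (ha : a ∈ lineSet 𝒱 J G δ) :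
    ∃ b ∈ lineSet 𝒱 J G δ, a * b = 1 ∧ b * a = 1 := by
  obtain ⟨b, hb, hab, hba⟩ := (isExpGroup_plusSet (𝒱 := 𝒱) hM).inv_mem a ha.1
  obtain ⟨l, hl⟩ := ha.2
  refine ⟨b, ⟨hb, ?_⟩, hab, hba⟩
  have h1 := degPart_zero_mul_eq_one ha.1.2 hb.2 hab
  have h2 := degPart_zero_mul_eq_one hb.2 ha.1.2 hba
  set a₀ := degPart 𝒱 0 a
  set b₀ := degPart 𝒱 0 b
  have h3 : δ * b₀ = l • (b₀ * δ) := by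
    have := congrArg (fun z => b₀ * z * b₀) hl
    simp only [mul_smul_comm, smul_mul_assoc] at this
    rw [show b₀ * (a₀ * δ) * b₀ = (b₀ * a₀) * (δ * b₀) by noncomm_ring,
      show b₀ * (δ * a₀) * b₀ = b₀ * δ * (a₀ * b₀) by noncomm_ring, h1, h2, one_mul, mul_one] at this
    exact this
  have hl0 : l ≠ 0 := by
    rintro rfl
    rw [zero_smul] at h3
    exact h0 (by rw [← mul_one δ, ← h2, ← mul_assoc, h3, zero_mul])
  exact ⟨l⁻¹, by rw [h3, smul_smul, inv_mul_cancel₀ hl0, one_smul]⟩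

theorem exp_mem_lineSet (hM : IsExpGroup (opSet (modelGroup J G)) (modelLie J G))
    (hspan : m = Submodule.span 𝕜 {δ}) (hgr : IsGradedLie J G 𝒱) {x : V →L[𝕜] V}
    (hx : x ∈ lineLie 𝒱 J G m) : exp x ∈ lineSet 𝒱 J G δ := by
  obtain ⟨hx0, a, ha⟩ := (mem_lineLie_iff hspan hgr).1 hx
  refine ⟨(isExpGroup_plusSet (𝒱 := 𝒱) hM).exp_mem x hx0, exp a, ?_⟩
  have h1 := exp_mem_prod (intertwiner 𝒱 δ) ((mem_intertwiner_smul_iff (x := x) (a := a)).2 ⟨hx0.2, ha⟩)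
  rw [exp_add_smul_one] at h1
  have h2 := h1.2.2
  simp only [map_smul, mul_smul_comm] at h2
  exact h2

theorem isExpGroup_lineSet (hM : IsExpGroup (opSet (modelGroup J G)) (modelLie J G))
    (hspan : m = Submodule.span 𝕜 {δ}) (h0 : δ ≠ 0) (hgr : IsGradedLie J G 𝒱) :
    IsExpGroup (lineSet 𝒱 J G δ) (lineLie 𝒱 J G m) where
  one_mem := ⟨(isExpGroup_plusSet (𝒱 := 𝒱) hM).one_mem, 1, by
    rw [degPart_zero_one, one_mul, mul_one, one_smul]⟩
  mul_mem _ ha _ hb := mul_mem_lineSet hM ha hb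
  inv_mem _ ha := exists_inv_mem_lineSet hM h0 ha
  exp_mem _ hx := exp_mem_lineSet hM hspan hgr hx
  near_one U hU := eventually_exp_mem_lineLie hM hspan h0 hgr hU

end FilteredGroup

/-! ### Lifting smooth curves from an orbit to the group -/

section OrbitLift

variable {𝕜 : Type*} [RCLike 𝕜]
variable {A : Type*} [NormedRing A] [NormedAlgebra 𝕜 A] [CompleteSpace A] [FiniteDimensional 𝕜 A]
variable {Y : Type*} [NormedAddCommGroup Y] [NormedSpace 𝕜 Y] [FiniteDimensional 𝕜 Y]

variable (𝕜) in
/-- `R` is a smooth linear action of the group `H` on `Y`. -/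
structure IsSmoothAction (H : Set A) (R : A → Y →L[𝕜] Y) : Prop where
  one : R 1 = 1
  mul : ∀ a ∈ H, ∀ b ∈ H, R (a * b) = R a * R b
  smooth : ∀ a ∈ H, ContDiffAt 𝕜 ∞ R a

variable {H : Set A} {h : Submodule 𝕜 A} {R : A → Y →L[𝕜] Y}

variable (h R) in
/-- The tangent space of the orbit of `y`. -/
def orbitTangent (y : Y) : Submodule 𝕜 Y :=
  h.map ((ContinuousLinearMap.apply 𝕜 Y y) ∘L fderiv 𝕜 R 1).toLinearMap

namespace IsSmoothAction

variable (hH : IsExpGroup H h) (hR : IsSmoothAction 𝕜 H R)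
include hH hR

theorem hasDerivAt {γ : 𝕜 → A} {γ' b : A} (hγ : HasDerivAt γ γ' 0) (hγH : ∀ᶠ s in 𝓝 0, γ s ∈ H)
    (ha : γ 0 ∈ H) (hb : b ∈ H) (hab : γ 0 * b = 1) (hba : b * γ 0 = 1) (y : Y) :
    HasDerivAt (fun s => R (γ s) y) (fderiv 𝕜 R 1 (γ' * b) (R (γ 0) y)) 0 := by
  have h1 : HasDerivAt (fun s => γ s * b) (γ' * b) 0 := hγ.mul_const b
  have h2 : HasFDerivAt R (fderiv 𝕜 R 1) (γ 0 * b) := by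
    rw [hab]
    exact ((hR.smooth 1 hH.one_mem).differentiableAt (by simp)).hasFDerivAt
  have h3 := h2.comp_hasDerivAt (0 : 𝕜) h1
  have h4 := (ContinuousLinearMap.apply 𝕜 Y (R (γ 0) y)).hasFDerivAt.comp_hasDerivAt (0 : 𝕜) h3
  refine h4.congr_of_eventuallyEq (hγH.mono fun s hs => ?_)
  have h5 : R (γ s) = R (γ s * b) * R (γ 0) := by
    rw [← hR.mul _ (hH.mul_mem _ hs _ hb) _ ha, mul_assoc, hba, mul_one]
  exact DFunLike.congr_fun h5 y

theorem mem_orbitTangent_of_curve {γ : 𝕜 → A} (hγ : ContDiffAt 𝕜 ∞ γ 0)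
    (hγH : ∀ᶠ s in 𝓝 0, γ s ∈ H) (y : Y) :
    ∃ v ∈ orbitTangent h R (R (γ 0) y), HasDerivAt (fun s => R (γ s) y) v 0 := by
  obtain ⟨b, hb, hab, hba⟩ := hH.inv_mem _ hγH.self_of_nhds
  have h1 := (hγ.differentiableAt (by simp)).hasDerivAt
  exact ⟨_, ⟨_, hH.mul_mem_of_mem_tangentAt' hb hab (mem_tangentAt_of_curve hγ hγH h1), rfl⟩,
    hR.hasDerivAt hH h1 hγH hγH.self_of_nhds hb hab hba y⟩

theorem map_orbitTangent_le {a : A} (ha : a ∈ H) (y : Y) :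
    (orbitTangent h R y).map (R a).toLinearMap ≤ orbitTangent h R (R a y) := by
  rintro _ ⟨_, ⟨x, hx, rfl⟩, rfl⟩
  have hexp : ∀ s : 𝕜, exp (s • x) ∈ H := fun s => hH.exp_mem _ (h.smul_mem s hx)
  have h1 : ContDiffAt 𝕜 ∞ (fun s : 𝕜 => a * exp (s • x)) 0 := by
    refine (contDiff_const.mul ((contDiff_exp 𝕜).comp ?_)).contDiffAt
    exact contDiff_id.smul contDiff_const
  obtain ⟨v, hv, hd⟩ := hR.mem_orbitTangent_of_curve hH h1
    (Filter.Eventually.of_forall fun s => hH.mul_mem a ha _ (hexp s)) y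
  have h0 : a * exp ((0 : 𝕜) • x) = a := by rw [zero_smul, NormedSpace.exp_zero, mul_one]
  rw [h0] at hv
  have h2 := hR.hasDerivAt hH (γ := fun s : 𝕜 => exp (s • x)) (b := 1)
    (hasDerivAt_exp_smul_zero x) (Filter.Eventually.of_forall hexp) (hexp 0) hH.one_mem
    (by simp) (by simp) y
  have h3 := (R a).hasFDerivAt.comp_hasDerivAt (0 : 𝕜) h2
  have h4 : HasDerivAt (fun s : 𝕜 => R (a * exp (s • x)) y)
      (R a (fderiv 𝕜 R 1 (x * 1) (R (exp ((0 : 𝕜) • x)) y))) 0 := by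
    refine h3.congr_of_eventuallyEq (Filter.Eventually.of_forall fun s => ?_)
    exact DFunLike.congr_fun (hR.mul a ha _ (hexp s)) y
  rw [zero_smul, NormedSpace.exp_zero, hR.one, mul_one] at h4
  have h5 := hd.unique h4
  change R a (fderiv 𝕜 R 1 x y) ∈ _
  rw [h5] at hv
  exact hv

theorem apply_injective {a : A} (ha : a ∈ H) : Function.Injective (R a) := by
  obtain ⟨b, hb, hab, hba⟩ := hH.inv_mem a ha
  intro x y hxy
  have h1 : R b * R a = 1 := by rw [← hR.mul b hb a ha, hba, hR.one]
  have h2 := congrArg (R b) hxy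
  change (R b * R a) x = (R b * R a) y at h2
  rwa [h1] at h2

/-- The action of a and of its inverse map orbit tangents injectively into orbit tangents. Constancy
of the dimension turns inclusions of tangent spaces in the orbit chart into equalities. -/
theorem finrank_orbitTangent {a : A} (ha : a ∈ H) (y : Y) :
    Module.finrank 𝕜 (orbitTangent h R (R a y)) = Module.finrank 𝕜 (orbitTangent h R y) := by
  have key : ∀ c ∈ H, ∀ z, Module.finrank 𝕜 (orbitTangent h R z) ≤
      Module.finrank 𝕜 (orbitTangent h R (R c z)) := fun c hc z => by
    rw [(Submodule.equivMapOfInjective _ (hR.apply_injective hH hc) (orbitTangent h R z)).finrank_eq]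
    exact Submodule.finrank_mono (hR.map_orbitTangent_le hH hc z)
  obtain ⟨b, hb, hab, hba⟩ := hH.inv_mem a ha
  refine le_antisymm ?_ (key a ha y)
  have h1 := key b hb (R a y)
  have h2 : R b (R a y) = y := by
    change (R b * R a) y = y
    rw [← hR.mul b hb a ha, hba, hR.one]; rfl
  rwa [h2] at h1

/-- A chart around `y₀` whose inverse is `w ↦ R (exp (g (π w))) (y₀ + (w - π w))`, where `π` is a
projection to the tangent space of the orbit; the chart maps tangent vectors of the orbit to the
range of `π`. -/
theorem exists_orbit_chart (y₀ : Y) : ∃ (g : Y →L[𝕜] A) (π : Y →L[𝕜] Y)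
    (e : OpenPartialHomeomorph Y Y), (∀ w, g w ∈ h) ∧ (0 : Y) ∈ e.source ∧
      (∀ w, e w = R (exp (g (π w))) (y₀ + (w - π w))) ∧ ContDiffOn 𝕜 ∞ e.symm e.target ∧
      ∀ a ∈ H, R a y₀ ∈ e.target → ∀ v ∈ orbitTangent h R (R a y₀),
        π (fderiv 𝕜 e.symm (R a y₀) v) = fderiv 𝕜 e.symm (R a y₀) v := by
  have : CompleteSpace Y := FiniteDimensional.complete 𝕜 Y
  obtain ⟨π, hπT, hπ⟩ := exists_projection (orbitTangent h R y₀)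
  let φ : h →ₗ[𝕜] Y := ((ContinuousLinearMap.apply 𝕜 Y y₀) ∘L fderiv 𝕜 R 1).toLinearMap ∘ₗ h.subtype
  obtain ⟨g₀, hg₀⟩ := exists_rightInverse_on φ
  let g : Y →L[𝕜] A := LinearMap.toContinuousLinearMap (h.subtype ∘ₗ g₀)
  have hgh : ∀ w, g w ∈ h := fun w => (g₀ w).2
  have hg : ∀ w ∈ orbitTangent h R y₀, fderiv 𝕜 R 1 (g w) y₀ = w := by
    rintro w ⟨x, hx, hxw⟩
    exact hg₀ w ⟨⟨x, hx⟩, hxw⟩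
  have hexp : ∀ w, exp (g (π w)) ∈ H := fun w => hH.exp_mem _ (hgh _)
  let Φ : Y → Y := fun w => R (exp (g (π w))) (y₀ + (w - π w))
  have hRg : ContDiff 𝕜 ∞ fun w => R (exp (g (π w))) := contDiff_iff_contDiffAt.2 fun w =>
    (hR.smooth _ (hexp w)).comp w
      (((contDiff_exp 𝕜).comp (g.contDiff.comp π.contDiff)).contDiffAt)
  have hΦ : ContDiff 𝕜 ∞ Φ := hRg.clm_apply
    (contDiff_const.add (contDiff_id.sub π.contDiff))
  have hdir : ∀ w u, HasDerivAt (fun s : 𝕜 => Φ (w + s • u)) (fderiv 𝕜 Φ w u) 0 := fun w u => by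
    have h1 : HasDerivAt (fun s : 𝕜 => w + s • u) u 0 := by
      simpa using ((hasDerivAt_id (0 : 𝕜)).smul_const u).const_add w
    have h2 : HasFDerivAt Φ (fderiv 𝕜 Φ w) (w + (0 : 𝕜) • u) := by
      rw [zero_smul, add_zero]
      exact ((hΦ.differentiable (by simp)) w).hasFDerivAt
    exact h2.comp_hasDerivAt (0 : 𝕜) h1
  have hcurve : ∀ w u, ContDiffAt 𝕜 ∞ (fun s : 𝕜 => exp (g (π (w + s • u)))) 0 := fun w u =>
    ((contDiff_exp 𝕜).comp (g.contDiff.comp (π.contDiff.comp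
      (contDiff_const.add (contDiff_id.smul contDiff_const))))).contDiffAt
  -- Moving w along the range of π leaves w - π w fixed, so Φ moves inside a single orbit.
  have hDT : ∀ w, ∀ u ∈ orbitTangent h R y₀, fderiv 𝕜 Φ w u ∈ orbitTangent h R (Φ w) := by
    intro w u hu
    obtain ⟨v, hv, hd⟩ := hR.mem_orbitTangent_of_curve hH (hcurve w u)
      (Filter.Eventually.of_forall fun s => hexp _) (y₀ + (w - π w))
    have h1 : (fun s : 𝕜 => Φ (w + s • u)) =
        fun s => R (exp (g (π (w + s • u)))) (y₀ + (w - π w)) := by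
      funext s
      change R _ (y₀ + (w + s • u - π (w + s • u))) = _
      have h3 : w + s • u - π (w + s • u) = w - π w := by
        rw [map_add, map_smul, hπ u hu, add_sub_add_right_eq_sub]
      rw [h3]
    have h2 := hdir w u
    rw [h1] at h2
    rw [h2.unique hd]
    rw [zero_smul, add_zero] at hv
    exact hv
  have hπ1 : ∀ v, π (v - π v) = 0 := fun v => by rw [map_sub, hπ _ (hπT v), sub_self]
  have hD0 : fderiv 𝕜 Φ 0 = ContinuousLinearMap.id 𝕜 Y := by
    have hT : ∀ u ∈ orbitTangent h R y₀, fderiv 𝕜 Φ 0 u = u := by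
      intro u hu
      have h1 : HasDerivAt (fun s : 𝕜 => exp (g (π (0 + s • u)))) (g u) 0 := by
        have := hasDerivAt_exp_smul_zero (𝕜 := 𝕜) (g u)
        refine this.congr_of_eventuallyEq (Filter.Eventually.of_forall fun s => ?_)
        change exp (g (π (0 + s • u))) = exp (s • g u)
        rw [zero_add, map_smul, hπ u hu, map_smul]
      have h0 : exp (g (π (0 + (0 : 𝕜) • u))) = 1 := by simp
      have h2 := hR.hasDerivAt hH h1 (Filter.Eventually.of_forall fun s => hexp _) (hexp _)
        hH.one_mem (by simp) (by simp) y₀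
      rw [h0, hR.one, mul_one] at h2
      have h3 : (fun s : 𝕜 => Φ (0 + s • u)) = fun s => R (exp (g (π (0 + s • u)))) y₀ := by
        funext s
        change R _ (y₀ + (0 + s • u - π (0 + s • u))) = _
        rw [zero_add, map_smul, hπ u hu, sub_self, add_zero]
      have h4 := hdir 0 u
      rw [h3] at h4
      rw [h4.unique h2]
      exact hg u hu
    have hS : ∀ v, fderiv 𝕜 Φ 0 (v - π v) = v - π v := by
      intro v
      have h3 : (fun s : 𝕜 => Φ (0 + s • (v - π v))) = fun s => y₀ + s • (v - π v) := by
        funext s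
        change R _ (y₀ + (0 + s • (v - π v) - π (0 + s • (v - π v)))) = _
        rw [zero_add, map_smul, hπ1, smul_zero, sub_zero, map_zero, NormedSpace.exp_zero, hR.one]
        rfl
      have h4 := hdir 0 (v - π v)
      rw [h3] at h4
      refine h4.unique ?_
      simpa using ((hasDerivAt_id (0 : 𝕜)).smul_const (v - π v)).const_add y₀
    ext v
    have h1 : v = π v + (v - π v) := by abel
    rw [h1, map_add, hT _ (hπT v), hS v]
    rfl
  have hd0 : HasFDerivAt Φ ((ContinuousLinearEquiv.refl 𝕜 Y : Y ≃L[𝕜] Y) : Y →L[𝕜] Y) 0 := by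
    have := ((hΦ.differentiable (by simp)) 0).hasFDerivAt
    rw [hD0] at this
    exact this
  obtain ⟨e, h0, -, heΦ, he, hes⟩ := exists_chart isOpen_univ hΦ.contDiffOn (Set.mem_univ (0 : Y))
    _ hd0
  refine ⟨g, π, e, hgh, h0, heΦ, hes, fun a ha hat v hv => ?_⟩
  set z := R a y₀
  set w := e.symm z
  have hws : w ∈ e.source := e.map_target hat
  have hwz : Φ w = z := by rw [← heΦ]; exact e.right_inv hat
  have hD' := ((hes.contDiffAt (e.open_target.mem_nhds hat)).differentiableAt (by simp)).hasFDerivAt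
  have hD := ((hΦ.differentiable (by simp)) w).hasFDerivAt
  have hleft : ∀ u, fderiv 𝕜 e.symm z (fderiv 𝕜 Φ w u) = u := fun u => by
    have h1 : HasFDerivAt (e.symm ∘ Φ) (fderiv 𝕜 e.symm z ∘L fderiv 𝕜 Φ w) w := by
      rw [← hwz] at hD' ⊢
      exact hD'.comp w hD
    have h2 : HasFDerivAt (e.symm ∘ Φ) (ContinuousLinearMap.id 𝕜 Y) w := by
      refine (hasFDerivAt_id w).congr_of_eventuallyEq ?_
      filter_upwards [e.open_source.mem_nhds hws] with q hq
      rw [Function.comp_apply, ← heΦ, e.left_inv hq, id]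
    exact DFunLike.congr_fun (h1.unique h2) u
  have hinj : Function.Injective (fderiv 𝕜 Φ w) := fun u u' huu => by
    rw [← hleft u, huu, hleft]
  have hmap : (orbitTangent h R y₀).map (fderiv 𝕜 Φ w).toLinearMap = orbitTangent h R z := by
    refine Submodule.eq_of_le_of_finrank_eq ?_ ?_
    · rintro _ ⟨u, hu, rfl⟩
      rw [← hwz]
      exact hDT w u hu
    · rw [(Submodule.equivMapOfInjective _ hinj (orbitTangent h R y₀)).finrank_eq.symm]
      exact (hR.finrank_orbitTangent hH ha y₀).symm
  rw [← hmap] at hv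
  obtain ⟨u, hu, rfl⟩ := hv
  change π (fderiv 𝕜 e.symm z (fderiv 𝕜 Φ w u)) = fderiv 𝕜 e.symm z (fderiv 𝕜 Φ w u)
  rw [hleft, hπ u hu]

/-- In the orbit chart the transverse coordinate z ↦ z - π z has zero derivative along b ↦ R b y₀,
since orbit tangents go into the range of π. It is therefore locally constant on the group, though
not on the orbit with the topology of the ambient space. -/
theorem eventually_slice_eq {y₀ : Y} {π : Y →L[𝕜] Y} {e : OpenPartialHomeomorph Y Y}
    (hes : ContDiffOn 𝕜 ∞ e.symm e.target)
    (he : ∀ a ∈ H, R a y₀ ∈ e.target → ∀ v ∈ orbitTangent h R (R a y₀),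
      π (fderiv 𝕜 e.symm (R a y₀) v) = fderiv 𝕜 e.symm (R a y₀) v)
    {a : A} (ha : a ∈ H) (hat : R a y₀ ∈ e.target) : ∀ᶠ b in 𝓝[H] a,
      e.symm (R b y₀) - π (e.symm (R b y₀)) = e.symm (R a y₀) - π (e.symm (R a y₀)) := by
  obtain ⟨ρ, hρh, hρ⟩ := exists_projection h
  let F : A → Y := fun x => R (exp (ρ x) * a) y₀
  have hexp : ∀ x, exp (ρ x) * a ∈ H := fun x => hH.mul_mem _ (hH.exp_mem _ (hρh x)) _ ha
  have hE : ContDiff 𝕜 ∞ fun x => exp (ρ x) * a :=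
    ((contDiff_exp 𝕜).comp ρ.contDiff).mul contDiff_const
  have hF : ContDiff 𝕜 ∞ F := contDiff_iff_contDiffAt.2 fun x =>
    ((hR.smooth _ (hexp x)).comp x hE.contDiffAt).clm_apply contDiffAt_const
  have hF0 : F 0 = R a y₀ := by
    change R (exp (ρ 0) * a) y₀ = _
    rw [map_zero, NormedSpace.exp_zero, one_mul]
  have hU : F ⁻¹' e.target ∈ 𝓝 (0 : A) :=
    hF.continuous.continuousAt (e.open_target.mem_nhds (by rwa [hF0]))
  obtain ⟨r, hr, hrU⟩ := Metric.mem_nhds_iff.1 hU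
  let f : A → Y := fun x => e.symm (F x) - π (e.symm (F x))
  have hdiff : ∀ x ∈ Metric.ball (0 : A) r, HasFDerivAt f
      ((ContinuousLinearMap.id 𝕜 Y - π) ∘L fderiv 𝕜 e.symm (F x) ∘L fderiv 𝕜 F x) x := by
    intro x hx
    have h1 := ((hes.contDiffAt (e.open_target.mem_nhds (hrU hx))).differentiableAt
      (by simp)).hasFDerivAt
    have h2 := ((hF.differentiable (by simp)) x).hasFDerivAt
    exact (ContinuousLinearMap.id 𝕜 Y - π).hasFDerivAt.comp x (h1.comp x h2)
  have hzero : ∀ x ∈ Metric.ball (0 : A) r, fderiv 𝕜 f x = 0 := by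
    intro x hx
    rw [(hdiff x hx).fderiv]
    ext u
    have h1 : HasDerivAt (fun s : 𝕜 => x + s • u) u 0 := by
      simpa using ((hasDerivAt_id (0 : 𝕜)).smul_const u).const_add x
    have h2 : HasFDerivAt F (fderiv 𝕜 F x) (x + (0 : 𝕜) • u) := by
      rw [zero_smul, add_zero]
      exact ((hF.differentiable (by simp)) x).hasFDerivAt
    have h3 := h2.comp_hasDerivAt (0 : 𝕜) h1
    obtain ⟨v, hv, hd⟩ := hR.mem_orbitTangent_of_curve hH
      (γ := fun s : 𝕜 => exp (ρ (x + s • u)) * a)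
      (hE.contDiffAt.comp (0 : 𝕜) (contDiff_const.add (contDiff_id.smul contDiff_const)).contDiffAt)
      (Filter.Eventually.of_forall fun s => hexp _) y₀
    have h4 : fderiv 𝕜 F x u = v := h3.unique hd
    simp only [zero_smul, add_zero] at hv
    have h5 := he _ (hexp x) (hrU hx) v hv
    change fderiv 𝕜 e.symm (F x) (fderiv 𝕜 F x u) - π (fderiv 𝕜 e.symm (F x) (fderiv 𝕜 F x u)) = 0
    rw [h4, sub_eq_zero]
    exact h5.symm
  have hconst : ∀ x ∈ Metric.ball (0 : A) r, f x = f 0 := fun x hx => by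
    let := NormedSpace.restrictScalars ℝ 𝕜 A
    exact Metric.isOpen_ball.is_const_of_fderiv_eq_zero (convex_ball (0 : A) r).isPreconnected
      (fun x hx => (hdiff x hx).differentiableAt.differentiableWithinAt) hzero hx
      (Metric.mem_ball_self hr)
  obtain ⟨a', ha', haa', ha'a⟩ := hH.inv_mem a ha
  have h1 := hH.near_one _ (Metric.ball_mem_nhds (0 : A) hr)
  have hc : Filter.Tendsto (fun b => b * a') (𝓝[H] a) (𝓝[H] 1) := by
    refine tendsto_nhdsWithin_of_tendsto_nhds_of_eventually_within _ ?_
      (eventually_nhdsWithin_of_forall fun b hb => hH.mul_mem _ hb _ ha')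
    rw [← haa']
    exact ((continuous_id.mul continuous_const).tendsto a).mono_left nhdsWithin_le_nhds
  filter_upwards [hc.eventually h1] with b ⟨x, hxr, hxh, hxb⟩
  have h2 := hconst x hxr
  have h3 : F x = R b y₀ := by
    change R (exp (ρ x) * a) y₀ = _
    rw [hρ x hxh, hxb, mul_assoc, ha'a, mul_one]
  simp only [f, hF0, h3] at h2
  exact h2

/-- Smooth curves in an orbit lift to the group. -/
theorem exists_lift {y : 𝕜 → Y} {U : Set 𝕜} (hU : IsOpen U) (hy : ContDiffOn 𝕜 ∞ y U) {t : 𝕜}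
    (ht : t ∈ U) (hyo : ∀ τ ∈ U, ∃ a ∈ H, y τ = R a (y t)) :
    ∃ O : Set 𝕜, IsOpen O ∧ t ∈ O ∧ O ⊆ U ∧ ∃ ξ : 𝕜 → A, ContDiffOn 𝕜 ∞ ξ O ∧
      ∀ τ ∈ O, ξ τ ∈ h ∧ y τ = R (exp (ξ τ)) (y t) := by
  obtain ⟨g, π, e, hgh, h0, he, hes, hT⟩ := hR.exists_orbit_chart hH (y t)
  have he0 : e 0 = y t := by
    rw [he, map_zero, map_zero, NormedSpace.exp_zero, hR.one, sub_zero, add_zero]; rfl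
  have hcont : ContinuousOn y U := hy.continuousOn
  have hV : IsOpen (U ∩ y ⁻¹' e.target) := hcont.isOpen_inter_preimage hU e.open_target
  have htV : t ∈ U ∩ y ⁻¹' e.target := ⟨ht, by
    change y t ∈ e.target
    rw [← he0]; exact e.map_source h0⟩
  obtain ⟨r, hr, hrV⟩ := Metric.isOpen_iff.1 hV t htV
  let σ : Y → Y := fun z => e.symm z - π (e.symm z)
  -- The orbit may return to the chart infinitely often. The group is second countable, so it does
  -- so in at most countably many slices; along the curve the transverse coordinate is continuous on
  -- a connected ball with countably many values, hence constant.
  have hcount : {s | ∃ a ∈ H, R a (y t) ∈ e.target ∧ s = σ (R a (y t))}.Countable := by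
    have : ∀ a ∈ {a | a ∈ H ∧ R a (y t) ∈ e.target},
        {b | σ (R b (y t)) = σ (R a (y t))} ∈ 𝓝[{a | a ∈ H ∧ R a (y t) ∈ e.target}] a := fun a ha =>
      nhdsWithin_mono a (fun b hb => hb.1) (hR.eventually_slice_eq hH hes hT ha.1 ha.2)
    have : SecondCountableTopology A := by
      have := FiniteDimensional.proper 𝕜 A
      infer_instance
    obtain ⟨C, hC, hCc, hcov⟩ := TopologicalSpace.countable_cover_nhdsWithin
      (f := fun a => {b | σ (R b (y t)) = σ (R a (y t))}) ‹_›
    refine (hCc.image fun a => σ (R a (y t))).mono ?_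
    rintro _ ⟨a, ha, hat, rfl⟩
    obtain ⟨c, hc, hac⟩ := Set.mem_iUnion₂.1 (hcov ⟨ha, hat⟩)
    exact ⟨c, hc, hac.symm⟩
  have hσ : ContinuousOn (fun τ => σ (y τ)) (Metric.ball t r) := by
    have h1 : ContinuousOn (fun τ => e.symm (y τ)) (Metric.ball t r) :=
      e.symm.continuousOn.comp (hcont.mono fun τ hτ => (hrV hτ).1) fun τ hτ => (hrV hτ).2
    exact h1.sub (π.continuous.comp_continuousOn h1)
  have hpre : IsPreconnected (Metric.ball t r) := by
    let := NormedSpace.restrictScalars ℝ 𝕜 𝕜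
    exact (convex_ball t r).isPreconnected
  have hsub : ((fun τ => σ (y τ)) '' Metric.ball t r).Subsingleton := by
    refine hcount.isTotallyDisconnected _ ?_ (hpre.image _ hσ)
    rintro _ ⟨τ, hτ, rfl⟩
    obtain ⟨a, ha, hya⟩ := hyo τ (hrV hτ).1
    refine ⟨a, ha, ?_, ?_⟩
    · rw [← hya]; exact (hrV hτ).2
    · rw [← hya]
  have hmem : ∀ τ ∈ Metric.ball t r, e.symm (y τ) - π (e.symm (y τ)) = 0 := fun τ hτ => by
    have h1 : σ (y τ) = σ (y t) := hsub ⟨τ, hτ, rfl⟩ ⟨t, Metric.mem_ball_self hr, rfl⟩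
    have h2 : e.symm (y t) = 0 := by rw [← he0, e.left_inv h0]
    have h3 : σ (y t) = 0 := by
      change e.symm (y t) - π (e.symm (y t)) = 0
      rw [h2, map_zero, sub_zero]
    exact h1.trans h3
  refine ⟨Metric.ball t r, Metric.isOpen_ball, Metric.mem_ball_self hr, fun τ hτ => (hrV hτ).1,
    fun τ => g (π (e.symm (y τ))), ?_, fun τ hτ => ⟨hgh _, ?_⟩⟩
  · exact g.contDiff.comp_contDiffOn (π.contDiff.comp_contDiffOn
      (hes.comp (hy.mono fun τ hτ => (hrV hτ).1) fun τ hτ => (hrV hτ).2))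
  · have h1 := he (e.symm (y τ))
    rw [e.right_inv (hrV hτ).2, hmem τ hτ, add_zero] at h1
    exact h1

end IsSmoothAction

end OrbitLift

/-! ### Local triviality of the bundle of adapted frames -/

section FrameSection

variable {𝕜 : Type*} [RCLike 𝕜]
variable {V : Type*} [NormedAddCommGroup V] [NormedSpace 𝕜 V]
variable {W : Type*} [NormedAddCommGroup W] [NormedSpace 𝕜 W]

theorem comp_inverse_comp {ψ : V →L[𝕜] W} {e : V ≃L[𝕜] W} (h : ψ = e) {X : Type*}
    [NormedAddCommGroup X] [NormedSpace 𝕜 X] (c : X →L[𝕜] W) : ψ ∘L (ψ.inverse ∘L c) = c := by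
  ext x
  simp [h]

theorem contDiffAt_inverse [CompleteSpace V] {ψ : V →L[𝕜] W} {e : V ≃L[𝕜] W} (h : ψ = e) :
    ContDiffAt 𝕜 ∞ ContinuousLinearMap.inverse ψ := by
  rw [h]; exact contDiffAt_map_inverse e

variable (𝒱 : ℤ → Submodule 𝕜 V) (J : V ≃L[𝕜] W) (G : Subgroup (W ≃L[𝕜] W))
variable (m : Submodule 𝕜 (V →L[𝕜] V))
variable [DirectSum.Decomposition 𝒱] [FiniteDimensional 𝕜 V]

/-- The operator `A⁻¹ A'` of a moving frame. -/
def frameVelocity (A : 𝕜 → V ≃L[𝕜] W) (τ : 𝕜) : V →L[𝕜] V :=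
  ((A τ).symm : W →L[𝕜] V) ∘L deriv (fun τ => (A τ : V →L[𝕜] W)) τ

/-- `A` is a smooth section over `O` of the bundle of frames with total space `S`. -/
structure IsFrameSection (δ : V →L[𝕜] V) (S : Set (𝕜 × (V →L[𝕜] W))) (O : Set 𝕜)
    (A : 𝕜 → V ≃L[𝕜] W) : Prop where
  isOpen : IsOpen O
  smooth : ContDiffOn 𝕜 ∞ (fun τ => (A τ : V →L[𝕜] W)) O
  mem_iff : ∀ q : 𝕜 × (V →L[𝕜] W), q.1 ∈ O →
    (q ∈ S ↔ ((A q.1).symm : W →L[𝕜] V) ∘L q.2 ∈ lineSet 𝒱 J G δ)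
  mem_lie : ∀ τ ∈ O, frameVelocity A τ ∈ lieFilt J G 𝒱 (-1)
  symbol : ∀ τ ∈ O, ∃ l : 𝕜, l ≠ 0 ∧ degPart 𝒱 (-1) (frameVelocity A τ) = l • δ

variable {𝒱 J G m} {δ : V →L[𝕜] V} {S : Set (𝕜 × (V →L[𝕜] W))} {O : Set 𝕜} {A : 𝕜 → V ≃L[𝕜] W}

theorem exists_equiv_of_mem_lineSet {B : V →L[𝕜] V} (hB : B ∈ lineSet 𝒱 J G δ) :
    ∃ e : V ≃L[𝕜] V, B = e := by
  obtain ⟨e, -, he⟩ := hB.1.1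
  exact ⟨e, he.symm⟩

namespace IsFrameSection

variable (hA : IsFrameSection 𝒱 J G δ S O A)
include hA

theorem mk_mem {τ : 𝕜} (hτ : τ ∈ O) {B : V →L[𝕜] V} (hB : B ∈ lineSet 𝒱 J G δ) :
    (τ, (A τ : V →L[𝕜] W) ∘L B) ∈ S := by
  rw [hA.mem_iff _ hτ]
  convert hB using 1
  ext x
  simp

theorem exists_of_mem {q : 𝕜 × (V →L[𝕜] W)} (hq : q.1 ∈ O) (hqS : q ∈ S) :
    ∃ B ∈ lineSet 𝒱 J G δ, q.2 = (A q.1 : V →L[𝕜] W) ∘L B := by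
  refine ⟨_, (hA.mem_iff q hq).1 hqS, ?_⟩
  ext x
  simp

theorem exists_equiv {q : 𝕜 × (V →L[𝕜] W)} (hq : q.1 ∈ O) (hqS : q ∈ S) :
    ∃ ψ : V ≃L[𝕜] W, q.2 = ψ := by
  obtain ⟨B, hB, hqB⟩ := hA.exists_of_mem hq hqS
  obtain ⟨e, rfl⟩ := exists_equiv_of_mem_lineSet hB
  exact ⟨e.trans (A q.1), by rw [hqB]; rfl⟩

variable [CompleteSpace V]

theorem contDiffOn_symm : ContDiffOn 𝕜 ∞ (fun τ => ((A τ).symm : W →L[𝕜] V)) O := by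
  have h1 : ContDiffOn 𝕜 ∞ (fun τ => ContinuousLinearMap.inverse (A τ : V →L[𝕜] W)) O :=
    fun τ hτ => ContDiffAt.comp_contDiffWithinAt (g := ContinuousLinearMap.inverse) τ
      (contDiffAt_inverse (e := A τ) rfl) (hA.smooth τ hτ)
  simpa using h1

theorem contDiffOn_coord :
    ContDiffOn 𝕜 ∞ (fun q : 𝕜 × (V →L[𝕜] W) => ((A q.1).symm : W →L[𝕜] V) ∘L q.2)
      (O ×ˢ Set.univ) :=
  (hA.contDiffOn_symm.comp contDiffOn_fst fun _ h => h.1).clm_comp contDiffOn_snd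

variable (hK : IsExpGroup (lineSet 𝒱 J G δ) (lineLie 𝒱 J G m))
include hK

theorem rmul_mem {p : 𝕜 × (V →L[𝕜] W)} (hp : p.1 ∈ O) (hpS : p ∈ S) {B : V →L[𝕜] V}
    (hB : B ∈ lineSet 𝒱 J G δ) : rmul p B ∈ S :=
  (hA.mem_iff (rmul p B) hp).2 (hK.mul_mem _ ((hA.mem_iff p hp).1 hpS) _ hB)

theorem exists_retract {p : 𝕜 × (V →L[𝕜] W)} (hp : p.1 ∈ O) (hpS : p ∈ S) :
    ∃ N : Set (𝕜 × (V →L[𝕜] W)), IsOpen N ∧ p ∈ N ∧ ∃ r : 𝕜 × (V →L[𝕜] W) → 𝕜 × (V →L[𝕜] W),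
      ContDiffOn 𝕜 ∞ r N ∧ (∀ q ∈ N, r q ∈ S) ∧ ∀ q ∈ N, q ∈ S → r q = q := by
  let f : 𝕜 × (V →L[𝕜] W) → (V →L[𝕜] V) := fun q => ((A q.1).symm : W →L[𝕜] V) ∘L q.2
  obtain ⟨N, hN, hpN, r, hr, hrm, hrid⟩ := hK.isLocalRetract _ ((hA.mem_iff p hp).1 hpS)
  have hf : ContDiffOn 𝕜 ∞ f (O ×ˢ Set.univ) := hA.contDiffOn_coord
  have hO : IsOpen (O ×ˢ (Set.univ : Set (V →L[𝕜] W))) := hA.isOpen.prod isOpen_univ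
  refine ⟨O ×ˢ Set.univ ∩ f ⁻¹' N, hf.continuousOn.isOpen_inter_preimage hO hN,
    ⟨⟨hp, trivial⟩, hpN⟩, fun q => (q.1, (A q.1 : V →L[𝕜] W) ∘L r (f q)), ?_, fun q hq => ?_,
    fun q hq hqS => ?_⟩
  · refine contDiffOn_fst.prodMk (ContDiffOn.clm_comp ?_ ?_)
    · exact hA.smooth.comp contDiffOn_fst fun q hq => hq.1.1
    · exact hr.comp (hf.mono Set.inter_subset_left) fun q hq => hq.2
  · exact hA.mk_mem hq.1.1 (hrm _ hq.2)
  · have h1 : r (f q) = f q := hrid _ hq.2 ((hA.mem_iff q hq.1.1).1 hqS)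
    refine Prod.ext rfl ?_
    change (A q.1 : V →L[𝕜] W) ∘L r (f q) = q.2
    rw [h1]
    ext x
    simp [f]

/-- Keeping the group coordinate B constant gives the curve τ ↦ A(τ)B in `S`, whose velocity is this
vector. -/
theorem lift_mem_tangentAt {q : 𝕜 × (V →L[𝕜] W)} (hq : q.1 ∈ O) (hqS : q ∈ S) :
    ((1 : 𝕜), deriv (fun τ => (A τ : V →L[𝕜] W)) q.1 ∘L (((A q.1).symm : W →L[𝕜] V) ∘L q.2)) ∈
      tangentAt 𝕜 S q := by
  obtain ⟨B, hB, hqB⟩ := hA.exists_of_mem hq hqS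
  have h0 : ((A q.1).symm : W →L[𝕜] V) ∘L q.2 = B := by rw [hqB]; ext x; simp
  rw [h0]
  have h1 : HasDerivAt (fun s : 𝕜 => q.1 + s) 1 0 := (hasDerivAt_id (0 : 𝕜)).const_add q.1
  have hAd := hA.smooth.contDiffAt (hA.isOpen.mem_nhds hq)
  have hAt : ContDiffAt 𝕜 ∞ (fun s : 𝕜 => (A (q.1 + s) : V →L[𝕜] W)) 0 := by
    have h2 : ContDiffAt 𝕜 ∞ (fun τ => (A τ : V →L[𝕜] W)) (q.1 + 0) := by rwa [add_zero]
    exact h2.comp (0 : 𝕜) (contDiff_const.add contDiff_id).contDiffAt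
  have hd : HasDerivAt (fun s : 𝕜 => (A (q.1 + s) : V →L[𝕜] W))
      (deriv (fun τ => (A τ : V →L[𝕜] W)) q.1) 0 := by
    have h2 : HasDerivAt (fun τ => (A τ : V →L[𝕜] W))
        (deriv (fun τ => (A τ : V →L[𝕜] W)) q.1) (q.1 + 0) := by
      rw [add_zero]; exact (hAd.differentiableAt (by simp)).hasDerivAt
    exact (h2.scomp (0 : 𝕜) h1).congr_deriv (one_smul _ _)
  have h3 := mem_tangentAt_of_curve (M := S)
    (γ := fun s : 𝕜 => (q.1 + s, (A (q.1 + s) : V →L[𝕜] W) ∘L B))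
    ((contDiff_const.add contDiff_id).contDiffAt.prodMk (hAt.clm_comp contDiffAt_const)) ?_
    (h1.prodMk (((ContinuousLinearMap.compL 𝕜 V V W).flip B).hasFDerivAt.comp_hasDerivAt (0 : 𝕜) hd))
  · have h4 : (q.1 + 0, (A (q.1 + 0) : V →L[𝕜] W) ∘L B) = q := by
      rw [add_zero, ← hqB]
    rw [h4] at h3
    exact h3
  · have h5 : ∀ᶠ s : 𝕜 in 𝓝 0, q.1 + s ∈ O := by
      refine h1.continuousAt.eventually_mem ?_
      rw [add_zero]
      exact hA.isOpen.mem_nhds hq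
    exact h5.mono fun s hs => hA.mk_mem hs hB

theorem mem_lineLie_of_vertical {p : 𝕜 × (V →L[𝕜] W)} (hp : p.1 ∈ O) (hpS : p ∈ S)
    {c : V →L[𝕜] V} (hc : ((0 : 𝕜), p.2 ∘L c) ∈ tangentAt 𝕜 S p) : c ∈ lineLie 𝒱 J G m := by
  let f : 𝕜 × (V →L[𝕜] W) → (V →L[𝕜] V) := fun q => ((A q.1).symm : W →L[𝕜] V) ∘L q.2
  have hpO : O ×ˢ (Set.univ : Set (V →L[𝕜] W)) ∈ 𝓝 p :=
    (hA.isOpen.prod isOpen_univ).mem_nhds ⟨hp, trivial⟩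
  have hf : ContDiffAt 𝕜 ∞ f p := hA.contDiffOn_coord.contDiffAt hpO
  have h1 := tangentAt_map (M' := lineSet 𝒱 J G δ) hf (by
    filter_upwards [self_mem_nhdsWithin, mem_nhdsWithin_of_mem_nhds hpO] with q hqS hqO
    exact (hA.mem_iff q hqO.1).1 hqS) hc
  have h2 : fderiv 𝕜 f p ((0 : 𝕜), p.2 ∘L c) = f p * c := by
    have h3 : HasDerivAt (fun s : 𝕜 => p + s • ((0 : 𝕜), p.2 ∘L c)) ((0 : 𝕜), p.2 ∘L c) 0 := by
      simpa using ((hasDerivAt_id (0 : 𝕜)).smul_const ((0 : 𝕜), p.2 ∘L c)).const_add p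
    have h4 : HasFDerivAt f (fderiv 𝕜 f p) (p + (0 : 𝕜) • ((0 : 𝕜), p.2 ∘L c)) := by
      rw [zero_smul, add_zero]; exact (hf.differentiableAt (by simp)).hasFDerivAt
    have h5 := h4.comp_hasDerivAt (0 : 𝕜) h3
    have h6 : HasDerivAt (fun s : 𝕜 => f p + s • (f p * c)) (f p * c) 0 := by
      simpa using ((hasDerivAt_id (0 : 𝕜)).smul_const (f p * c)).const_add (f p)
    refine h5.unique (h6.congr_of_eventuallyEq (Filter.Eventually.of_forall fun s => ?_))
    change ((A (p.1 + s • (0 : 𝕜))).symm : W →L[𝕜] V) ∘L (p.2 + s • (p.2 ∘L c)) = _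
    rw [smul_zero, add_zero, ContinuousLinearMap.comp_add, ContinuousLinearMap.comp_smul]
    rfl
  rw [h2] at h1
  obtain ⟨b, hb, hab, hba⟩ := hK.inv_mem _ ((hA.mem_iff p hp).1 hpS)
  have h3 := hK.mul_mem_of_mem_tangentAt hb hba h1
  have h4 : b * (f p * c) = c := by
    have hba' : b * f p = 1 := hba
    rw [← mul_assoc, hba', one_mul]
  rwa [h4] at h3

theorem vertical_mem_tangentAt {p : 𝕜 × (V →L[𝕜] W)} (hp : p.1 ∈ O) (hpS : p ∈ S)
    {x : V →L[𝕜] V} (hx : x ∈ lineLie 𝒱 J G m) : ((0 : 𝕜), p.2 ∘L x) ∈ tangentAt 𝕜 S p := by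
  have h1 : HasDerivAt (fun s : 𝕜 => rmul p (exp (s • x))) (0, p.2 ∘L x) 0 :=
    (hasDerivAt_const _ _).prodMk
      ((ContinuousLinearMap.compL 𝕜 V V W p.2).hasFDerivAt.comp_hasDerivAt (0 : 𝕜)
        (hasDerivAt_exp_smul_zero x))
  have h2 : ContDiff 𝕜 ∞ fun s : 𝕜 => rmul p (exp (s • x)) :=
    contDiff_rmul.comp (contDiff_const.prodMk ((contDiff_exp 𝕜).comp
      (contDiff_id.smul contDiff_const)))
  have h3 := mem_tangentAt_of_curve (M := S) h2.contDiffAt (Filter.Eventually.of_forall fun s =>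
    hA.rmul_mem hK hp hpS (hK.exp_mem _ (Submodule.smul_mem _ s hx))) h1
  simp only [zero_smul, NormedSpace.exp_zero, rmul_one] at h3
  exact h3

end IsFrameSection

theorem homFilt_conj {B b c : V →L[𝕜] V} {k : ℤ} (hB : B ∈ homFilt 𝒱 0) (hb : b ∈ homFilt 𝒱 0)
    (hc : c ∈ homFilt 𝒱 k) : b * c * B ∈ homFilt 𝒱 k ∧
      degPart 𝒱 k (b * c * B) = degPart 𝒱 0 b * degPart 𝒱 k c * degPart 𝒱 0 B := by
  have h1 := homFilt_mul 𝒱 hb hc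
  have h2 := degPart_mul 𝒱 hb hc
  have h3 := homFilt_mul 𝒱 h1 hB
  have h4 := degPart_mul 𝒱 h1 hB
  rw [zero_add, add_zero] at h3 h4
  rw [zero_add] at h2
  exact ⟨h3, by rw [h4, h2]⟩

variable [CompleteSpace V]

/-- In the trivialization by A the velocities at the frame A B with base component a are
a·Ad(B⁻¹)(A⁻¹A') plus the Lie algebra of the line stabilizer. Conjugation by B rescales the part of
degree -1, which stays on the line of δ. -/
theorem isFrameManifold_of_sections (hM : IsExpGroup (opSet (modelGroup J G)) (modelLie J G))
    (hK : IsExpGroup (lineSet 𝒱 J G δ) (lineLie 𝒱 J G m))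
    (hS : ∀ p ∈ S, ∃ O A, p.1 ∈ O ∧ IsFrameSection 𝒱 J G δ S O A) :
    IsFrameManifold 𝒱 J G m δ S where
  exists_equiv p hp := by
    obtain ⟨O, A, hpO, hA⟩ := hS p hp
    exact hA.exists_equiv hpO hp
  mul_exp p hp x hx := by
    obtain ⟨O, A, hpO, hA⟩ := hS p hp
    refine hA.rmul_mem hK hpO hp (hK.exp_mem x ⟨lieFilt_antitone 𝒱 J G (by lia) hx, ?_⟩)
    change degPart 𝒱 0 x ∈ prolong 𝒱 J G m 1
    rw [degPart_of_homFilt 𝒱 hx.2 (by lia)]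
    exact zero_mem _
  retract p hp := by
    obtain ⟨O, A, hpO, hA⟩ := hS p hp
    exact hA.exists_retract hK hpO hp
  lift p hp := by
    obtain ⟨O, A, hpO, hA⟩ := hS p hp
    obtain ⟨ψ, hψ⟩ := hA.exists_equiv hpO hp
    have hopen : IsOpen (Set.range fun e : V ≃L[𝕜] W => (e : V →L[𝕜] W)) :=
      ContinuousLinearEquiv.isOpen
    refine ⟨O ×ˢ Set.range fun e : V ≃L[𝕜] W => (e : V →L[𝕜] W), hA.isOpen.prod hopen,
      ⟨hpO, ψ, hψ.symm⟩, fun q => q.2.inverse ∘L (deriv (fun τ => (A τ : V →L[𝕜] W)) q.1 ∘L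
        (((A q.1).symm : W →L[𝕜] V) ∘L q.2)), ?_, fun q hq hqS => ?_⟩
    · refine ContDiffOn.clm_comp ?_ (ContDiffOn.clm_comp ?_ ?_)
      · rintro q ⟨-, e, he⟩
        exact (contDiffAt_inverse he.symm).comp_contDiffWithinAt q contDiffWithinAt_snd
      · exact (hA.smooth.deriv_of_isOpen hA.isOpen (by simp)).comp contDiffOn_fst fun q hq => hq.1
      · exact hA.contDiffOn_coord.mono fun q hq => ⟨hq.1, trivial⟩
    · obtain ⟨e, he⟩ := hA.exists_equiv hq.1 hqS
      rw [comp_inverse_comp he]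
      exact hA.lift_mem_tangentAt hK hq.1 hqS
  tangent p hp a c hc := by
    obtain ⟨O, A, hpO, hA⟩ := hS p hp
    obtain ⟨B, hB, hpB⟩ := hA.exists_of_mem hpO hp
    obtain ⟨b, hb, hBb, hbB⟩ := hK.inv_mem B hB
    obtain ⟨l, hl0, hl⟩ := hA.symbol _ hpO
    have hw := hA.mem_lie _ hpO
    obtain ⟨r, hr⟩ := hb.2
    have h1 := hA.lift_mem_tangentAt hK hpO hp
    set w := frameVelocity A p.1 with hwd
    have h2 : deriv (fun τ => (A τ : V →L[𝕜] W)) p.1 ∘L (((A p.1).symm : W →L[𝕜] V) ∘L p.2) =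
        p.2 ∘L (b * w * B) := by
      rw [hpB]
      have h3 : (A p.1 : V →L[𝕜] W) ∘L B ∘L (b * w * B) = (A p.1 : V →L[𝕜] W) ∘L (w * B) := by
        have : B ∘L (b * w * B) = w * B := by
          change B * (b * w * B) = w * B
          rw [← mul_assoc, ← mul_assoc, hBb, one_mul]
        rw [this]
      rw [ContinuousLinearMap.comp_assoc, h3]
      ext x
      simp [hwd, frameVelocity]
    rw [h2] at h1
    have h3 : ((0 : 𝕜), p.2 ∘L (c - a • (b * w * B))) ∈ tangentAt 𝕜 S p := by
      have := sub_mem hc (Submodule.smul_mem _ a h1)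
      rw [Prod.smul_mk, Prod.mk_sub_mk, smul_eq_mul, mul_one, sub_self] at this
      rwa [ContinuousLinearMap.comp_sub, ContinuousLinearMap.comp_smul]
    have h4 := hA.mem_lineLie_of_vertical hK hpO hp h3
    obtain ⟨h5, h6⟩ := homFilt_conj hB.1.2 hb.1.2 hw.2
    have h7 : b * w * B ∈ modelLie J G := hM.conj_mem hb.1.1 hB.1.1 hbB hw.1
    have h8 : c = c - a • (b * w * B) + a • (b * w * B) := by abel
    have hbB0 := degPart_zero_mul_eq_one hb.1.2 hB.1.2 hbB
    have hr0 : r ≠ 0 ∨ δ = 0 := by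
      by_cases h : r = 0
      · right
        rw [h, zero_smul] at hr
        have hBb0 := degPart_zero_mul_eq_one hB.1.2 hb.1.2 hBb
        rw [← one_mul δ, ← hBb0, mul_assoc, hr, mul_zero]
      · exact Or.inl h
    refine ⟨?_, ?_, fun ha => ?_⟩
    · rw [h8]
      exact add_mem (lieFilt_antitone 𝒱 J G (by lia) h4.1) (Submodule.smul_mem _ a ⟨h7, h5⟩)
    · rw [h8, map_add, map_smul, h6, hl, degPart_of_homFilt 𝒱 h4.1.2 (by lia), zero_add,
        mul_smul_comm, hr, smul_mul_assoc, smul_mul_assoc, mul_assoc, hbB0, mul_one]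
      -- The case δ = 0 is not excluded here; any nonzero factor then serves, and 1 is taken.
      rcases hr0 with hr0 | hd
      · exact ⟨a * (l * r), by rw [smul_smul, smul_smul, mul_assoc], fun ha =>
          mul_ne_zero ha (mul_ne_zero hl0 hr0)⟩
      · exact ⟨1, by rw [hd]; simp, fun _ => one_ne_zero⟩
    · rw [ha, zero_smul, sub_zero] at h4
      exact ⟨h4.1.2, h4.2⟩
  vertical p hp x hx hx0 := by
    obtain ⟨O, A, hpO, hA⟩ := hS p hp
    exact hA.vertical_mem_tangentAt hK hpO hp ⟨hx, hx0⟩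

end FrameSection

/-! ### Lifting curves from the cone over an orbit -/

section ScaledLift

variable {𝕜 : Type*} [RCLike 𝕜]

theorem isExpGroup_units : IsExpGroup ({0}ᶜ : Set 𝕜) (⊤ : Submodule 𝕜 𝕜) where
  one_mem := one_ne_zero
  mul_mem _ ha _ hb := mul_ne_zero ha hb
  inv_mem a ha := ⟨a⁻¹, inv_ne_zero ha, mul_inv_cancel₀ ha, inv_mul_cancel₀ ha⟩
  exp_mem x _ := fun h => by
    have := exp_mul_exp_neg 𝕜 x
    rw [h, zero_mul] at this
    exact zero_ne_one this
  near_one U hU := by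
    obtain ⟨L, O, hO, h1O, hL, hL1, hexp, -⟩ := FlagCurve.exists_log 𝕜 𝕜
    have hc : ContinuousAt L 1 := (hL.contDiffAt (hO.mem_nhds h1O)).continuousAt
    filter_upwards [mem_nhdsWithin_of_mem_nhds (hc.preimage_mem_nhds (by rwa [hL1])),
      mem_nhdsWithin_of_mem_nhds (hO.mem_nhds h1O)] with b hb hbO
    exact ⟨L b, hb, trivial, hexp b hbO⟩

variable {A B : Type*} [NormedRing A] [NormedAlgebra 𝕜 A] [CompleteSpace A]
  [NormedRing B] [NormedAlgebra 𝕜 B] [CompleteSpace B]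

theorem IsExpGroup.prod {H : Set A} {h : Submodule 𝕜 A} (hH : IsExpGroup H h) {K : Set B}
    {k : Submodule 𝕜 B} (hK : IsExpGroup K k) : IsExpGroup (H ×ˢ K) (h.prod k) where
  one_mem := ⟨hH.one_mem, hK.one_mem⟩
  mul_mem a ha b hb := ⟨hH.mul_mem _ ha.1 _ hb.1, hK.mul_mem _ ha.2 _ hb.2⟩
  inv_mem a ha := by
    obtain ⟨b, hb, h1, h2⟩ := hH.inv_mem _ ha.1
    obtain ⟨c, hc, h3, h4⟩ := hK.inv_mem _ ha.2
    exact ⟨(b, c), ⟨hb, hc⟩, Prod.ext h1 h3, Prod.ext h2 h4⟩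
  exp_mem x hx := by
    have : exp x = (exp x.1, exp x.2) := exp_prodMk 𝕜 x.1 x.2
    rw [this]
    exact ⟨hH.exp_mem _ hx.1, hK.exp_mem _ hx.2⟩
  near_one U hU := by
    have hU' : U ∈ 𝓝 (0 : A) ×ˢ 𝓝 (0 : B) := by rw [← nhds_prod_eq]; exact hU
    obtain ⟨U₁, hU₁, U₂, hU₂, hUU⟩ := Filter.mem_prod_iff.1 hU'
    have h1 := (hH.near_one _ hU₁).prod_mk (hK.near_one _ hU₂)
    rw [← nhdsWithin_prod_eq] at h1
    filter_upwards [h1] with b ⟨⟨x, hx, hxh, hxb⟩, ⟨y, hy, hyk, hyb⟩⟩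
    refine ⟨(x, y), hUU ⟨hx, hy⟩, ⟨hxh, hyk⟩, ?_⟩
    rw [exp_prodMk 𝕜, hxb, hyb]

variable {Y : Type*} [NormedAddCommGroup Y] [NormedSpace 𝕜 Y] [FiniteDimensional 𝕜 Y]

/-- Smooth curves in the cone over an orbit lift to the group. -/
theorem IsSmoothAction.exists_lift_smul [FiniteDimensional 𝕜 A] {H : Set A} {h : Submodule 𝕜 A}
    {R : A → Y →L[𝕜] Y} (hH : IsExpGroup H h) (hR : IsSmoothAction 𝕜 H R) {y : 𝕜 → Y} {U : Set 𝕜}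
    (hU : IsOpen U) (hy : ContDiffOn 𝕜 ∞ y U) {t : 𝕜} (ht : t ∈ U)
    (hyo : ∀ τ ∈ U, ∃ a ∈ H, ∃ c : 𝕜, c ≠ 0 ∧ y τ = c • R a (y t)) :
    ∃ O : Set 𝕜, IsOpen O ∧ t ∈ O ∧ O ⊆ U ∧ ∃ ξ : 𝕜 → A, ContDiffOn 𝕜 ∞ ξ O ∧
      ∀ τ ∈ O, ξ τ ∈ h ∧ ∃ c : 𝕜, c ≠ 0 ∧ y τ = c • R (exp (ξ τ)) (y t) := by
  -- The cone is one orbit of the group enlarged by the nonzero scalars. The symbol fixes only a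
  -- line, which is why a scalar factor has to be allowed.
  have hR' : IsSmoothAction 𝕜 (({0}ᶜ : Set 𝕜) ×ˢ H) (fun a : 𝕜 × A => a.1 • R a.2) := by
    refine ⟨?_, fun a ha b hb => ?_, fun a ha => ?_⟩
    · change (1 : 𝕜) • R 1 = 1
      rw [one_smul, hR.one]
    · change (a.1 * b.1) • R (a.2 * b.2) = (a.1 • R a.2) * (b.1 • R b.2)
      rw [hR.mul _ ha.2 _ hb.2, smul_mul_smul_comm]
    · exact contDiffAt_fst.smul ((hR.smooth _ ha.2).comp a contDiffAt_snd)
  obtain ⟨O, hO, htO, hOU, ξ, hξ, hξy⟩ := hR'.exists_lift (isExpGroup_units.prod hH) hU hy ht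
    fun τ hτ => by
      obtain ⟨a, ha, c, hc, h⟩ := hyo τ hτ
      exact ⟨(c, a), ⟨hc, ha⟩, h⟩
  refine ⟨O, hO, htO, hOU, fun τ => (ξ τ).2, contDiff_snd.comp_contDiffOn hξ, fun τ hτ => ?_⟩
  obtain ⟨h1, h2⟩ := hξy τ hτ
  have h3 : exp (ξ τ) = (exp (ξ τ).1, exp (ξ τ).2) := exp_prodMk 𝕜 (ξ τ).1 (ξ τ).2
  rw [h3] at h2
  exact ⟨h1.2, exp (ξ τ).1, isExpGroup_units.exp_mem _ (Submodule.mem_top (R := 𝕜)), h2⟩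

end ScaledLift

/-! ### Smooth frames adapted to the symbol -/

section FrameExistence

variable {𝕜 : Type*} [RCLike 𝕜]
variable {V : Type*} [NormedAddCommGroup V] [NormedSpace 𝕜 V]
variable {W : Type*} [NormedAddCommGroup W] [NormedSpace 𝕜 W]
variable {𝒱 : ℤ → Submodule 𝕜 V} {J : V ≃L[𝕜] W} {G : Subgroup (W ≃L[𝕜] W)}
variable {m : Submodule 𝕜 (V →L[𝕜] V)} {δ : V →L[𝕜] V}
variable {D : Set 𝕜} {Λ : 𝕜 → ℤ → Submodule 𝕜 W}
variable [FiniteDimensional 𝕜 V] [CompleteSpace V]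

theorem trans_symm_mem_modelGroup {A B : V ≃L[𝕜] W} (hA : J.symm.trans A ∈ G)
    (hB : J.symm.trans B ∈ G) : B.trans A.symm ∈ modelGroup J G := by
  have : (J.symm.trans (B.trans A.symm)).trans J = (J.symm.trans A)⁻¹ * (J.symm.trans B) := by
    rw [eq_inv_mul_iff_mul_eq]
    ext x
    change A (J.symm (J (A.symm (B (J.symm x))))) = B (J.symm x)
    rw [J.symm_apply_apply, A.apply_symm_apply]
  change _ ∈ G
  rw [this]
  exact G.mul_mem (G.inv_mem hA) hB

theorem trans_mem_of_mem_modelGroup {A : V ≃L[𝕜] W} {B : V ≃L[𝕜] V} (hA : J.symm.trans A ∈ G)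
    (hB : B ∈ modelGroup J G) : J.symm.trans (B.trans A) ∈ G := by
  have : J.symm.trans (B.trans A) = (J.symm.trans A) * ((J.symm.trans B).trans J) := by
    ext x
    change A (B (J.symm x)) = A (J.symm (J (B (J.symm x))))
    rw [J.symm_apply_apply]
  rw [this]
  exact G.mul_mem hA hB

theorem symm_comp_mem_plusSet {τ : 𝕜} {A B : V ≃L[𝕜] W} (hA : A ∈ bigFiber 𝒱 J G Λ τ)
    (hB : B ∈ bigFiber 𝒱 J G Λ τ) :
    (A.symm : W →L[𝕜] V) ∘L (B : V →L[𝕜] W) ∈ plusSet 𝒱 J G := by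
  refine ⟨⟨B.trans A.symm, trans_symm_mem_modelGroup hA.2 hB.2, rfl⟩, fun i v hv => ?_⟩
  have h1 : B v ∈ Λ τ i := by rw [← hB.1 i]; exact ⟨v, hv, rfl⟩
  rw [← hA.1 i] at h1
  obtain ⟨w, hw, hwv⟩ := h1
  have h2 : A w = B v := hwv
  rw [add_zero]
  change A.symm (B v) ∈ _
  rw [← h2, A.symm_apply_apply]
  exact hw

theorem trans_mem_bigFiber {τ : 𝕜} {A : V ≃L[𝕜] W} (hA : A ∈ bigFiber 𝒱 J G Λ τ) {B : V ≃L[𝕜] V}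
    (hB : (B : V →L[𝕜] V) ∈ plusSet 𝒱 J G) : B.trans A ∈ bigFiber 𝒱 J G Λ τ := by
  obtain ⟨B', hB', hBB⟩ := hB.1
  have : B' = B := ContinuousLinearEquiv.coe_injective hBB
  subst this
  refine ⟨fun i => ?_, trans_mem_of_mem_modelGroup hA.2 hB'⟩
  have h1 := (mem_homFilt_zero_iff_map 𝒱 B').1 hB.2 i
  rw [← hA.1 i]
  conv_rhs => rw [← h1]
  rw [← Submodule.map_comp]
  rfl

variable [DirectSum.Decomposition 𝒱]

/-- A smooth section of `P̂` over an open subset `U` of `D`. -/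
structure IsBigSection (𝒱 : ℤ → Submodule 𝕜 V) (J : V ≃L[𝕜] W) (G : Subgroup (W ≃L[𝕜] W))
    (D : Set 𝕜) (Λ : 𝕜 → ℤ → Submodule 𝕜 W) (U : Set 𝕜) (A : 𝕜 → V ≃L[𝕜] W) : Prop where
  isOpen : IsOpen U
  subset : U ⊆ D
  smooth : ContDiffOn 𝕜 ∞ (fun τ => (A τ : V →L[𝕜] W)) U
  mem : ∀ τ ∈ U, A τ ∈ bigFiber 𝒱 J G Λ τ

theorem IsSmoothOrbitCurve.exists_isBigSection (hΛ : IsSmoothOrbitCurve 𝒱 J G D Λ) {t : 𝕜}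
    (ht : t ∈ D) : ∃ U A, t ∈ U ∧ IsBigSection 𝒱 J G D Λ U A := by
  obtain ⟨U, hU, htU, hUD, g, hg, hgG⟩ := hΛ t ht
  refine ⟨U, fun τ => J.trans (g τ), htU, hU, hUD,
    hg.clm_comp (f := fun _ => (J : V →L[𝕜] W)) contDiffOn_const, fun τ hτ =>
    ⟨fun i => ?_, ?_⟩⟩
  · rw [(hgG τ hτ).2 i, ← Submodule.map_comp]
    rfl
  · have : J.symm.trans (J.trans (g τ)) = g τ := by ext x; simp
    rw [this]
    exact (hgG τ hτ).1

namespace IsBigSection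

variable {U : Set 𝕜} {A : 𝕜 → V ≃L[𝕜] W} (hA : IsBigSection 𝒱 J G D Λ U A)
include hA

theorem hasDerivAt {τ : 𝕜} (hτ : τ ∈ U) : HasDerivAt (fun τ => (A τ : V →L[𝕜] W))
    (deriv (fun τ => (A τ : V →L[𝕜] W)) τ) τ :=
  ((hA.smooth.contDiffAt (hA.isOpen.mem_nhds hτ)).differentiableAt (by simp)).hasDerivAt

theorem contDiffOn_symm : ContDiffOn 𝕜 ∞ (fun τ => ((A τ).symm : W →L[𝕜] V)) U := by
  have h1 : ContDiffOn 𝕜 ∞ (fun τ => ContinuousLinearMap.inverse (A τ : V →L[𝕜] W)) U :=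
    fun τ hτ => ContDiffAt.comp_contDiffWithinAt (g := ContinuousLinearMap.inverse) τ
      (contDiffAt_inverse (e := A τ) rfl) (hA.smooth τ hτ)
  simpa using h1

theorem contDiffOn_frameVelocity : ContDiffOn 𝕜 ∞ (frameVelocity A) U :=
  hA.contDiffOn_symm.clm_comp (hA.smooth.deriv_of_isOpen hA.isOpen (by simp))

/-- A(τ)⁻¹A(τ+s) is a curve in 𝒢 through 1, which gives membership in 𝔤. The bound on the degree is
compatibility applied to the vector curves A(τ)v. -/
theorem frameVelocity_mem (hcompat : IsCompatible D Λ) {τ : 𝕜} (hτ : τ ∈ U) :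
    frameVelocity A τ ∈ lieFilt J G 𝒱 (-1) := by
  constructor
  · have h1 : ContDiffAt 𝕜 ∞ (fun s : 𝕜 => ((A τ).symm : W →L[𝕜] V) ∘L (A (τ + s) : V →L[𝕜] W)) 0 := by
      have h2 : ContDiffAt 𝕜 ∞ (fun τ => (A τ : V →L[𝕜] W)) (τ + 0) := by
        rw [add_zero]; exact hA.smooth.contDiffAt (hA.isOpen.mem_nhds hτ)
      exact contDiffAt_const.clm_comp
        (h2.comp (0 : 𝕜) (contDiff_const.add contDiff_id).contDiffAt)
    have hs : HasDerivAt (fun s : 𝕜 => τ + s) 1 0 := (hasDerivAt_id (0 : 𝕜)).const_add τ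
    have h2 : HasDerivAt (fun s : 𝕜 => (A (τ + s) : V →L[𝕜] W))
        (deriv (fun τ => (A τ : V →L[𝕜] W)) τ) 0 := by
      have h3 : HasDerivAt (fun τ => (A τ : V →L[𝕜] W))
          (deriv (fun τ => (A τ : V →L[𝕜] W)) τ) (τ + 0) := by
        rw [add_zero]; exact hA.hasDerivAt hτ
      exact (h3.scomp (0 : 𝕜) hs).congr_deriv (one_smul _ _)
    have h4 := mem_tangentAt_of_curve (M := opSet (modelGroup J G)) h1 ?_
      ((ContinuousLinearMap.compL 𝕜 V W V ((A τ).symm : W →L[𝕜] V)).hasFDerivAt.comp_hasDerivAt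
        (0 : 𝕜) h2)
    · have h5 : ((A τ).symm : W →L[𝕜] V) ∘L (A (τ + 0) : V →L[𝕜] W) =
          ContinuousLinearMap.id 𝕜 V := by
        rw [add_zero]; ext x; simp
      rw [h5] at h4
      exact h4
    · have h5 : ∀ᶠ s : 𝕜 in 𝓝 0, τ + s ∈ U := by
        refine hs.continuousAt.eventually_mem ?_
        rw [add_zero]
        exact hA.isOpen.mem_nhds hτ
      exact h5.mono fun s hs => ⟨(A (τ + s)).trans (A τ).symm,
        trans_symm_mem_modelGroup (hA.mem τ hτ).2 (hA.mem _ hs).2, rfl⟩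
  · intro i v hv
    have h1 := hcompat i U hA.isOpen hA.subset (fun τ => A τ v)
      (hA.smooth.clm_apply contDiffOn_const) (fun σ hσ => by
        rw [← (hA.mem σ hσ).1 i]; exact ⟨v, hv, rfl⟩) τ hτ
    have h2 : HasDerivAt (fun τ => A τ v) (deriv (fun τ => (A τ : V →L[𝕜] W)) τ v) τ :=
      (ContinuousLinearMap.apply 𝕜 W v).hasFDerivAt.comp_hasDerivAt τ (hA.hasDerivAt hτ)
    rw [h2.deriv, ← (hA.mem τ hτ).1 (i - 1)] at h1
    obtain ⟨w, hw, hwv⟩ := h1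
    have h3 : A τ w = deriv (fun τ => (A τ : V →L[𝕜] W)) τ v := hwv
    change (A τ).symm (deriv (fun τ => (A τ : V →L[𝕜] W)) τ v) ∈ _
    rw [← h3, (A τ).symm_apply_apply]
    exact hw

/-- The test curves A(σ)(Bv) already determine the velocity. Conversely a curve l in Λ_i is A f with
f in V^i, so l' = A'f + A f' and the second term stays in Λ_i. -/
theorem isVelocityIn_iff (hcompat : IsCompatible D Λ) {τ : 𝕜} (hτ : τ ∈ U) {ψ : V ≃L[𝕜] W}
    (hψ : ψ ∈ bigFiber 𝒱 J G Λ τ) {B b : V →L[𝕜] V}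
    (hB : B = ((A τ).symm : W →L[𝕜] V) ∘L (ψ : V →L[𝕜] W))
    (hb : b = (ψ.symm : W →L[𝕜] V) ∘L (A τ : V →L[𝕜] W)) {x : V →L[𝕜] V} :
    IsVelocityIn 𝒱 Λ τ ψ x ↔ x = degPart 𝒱 (-1) (b * frameVelocity A τ * B) := by
  have hAτ := hA.mem τ hτ
  have hBp : B ∈ plusSet 𝒱 J G := hB ▸ symm_comp_mem_plusSet hAτ hψ
  have hbp : b ∈ plusSet 𝒱 J G := hb ▸ symm_comp_mem_plusSet hψ hAτ
  obtain ⟨hcf, -⟩ := homFilt_conj hBp.2 hbp.2 (hA.frameVelocity_mem hcompat hτ).2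
  set c := b * frameVelocity A τ * B with hc
  have hAB : ∀ v, A τ (B v) = ψ v := fun v => by rw [hB]; simp
  have hψc : ∀ v, ψ (c v) = deriv (fun τ => (A τ : V →L[𝕜] W)) τ (B v) := fun v => by
    rw [hc, hb]
    simp [frameVelocity]
  constructor
  · rintro ⟨hx, h⟩
    have h1 : c - x ∈ homFilt 𝒱 0 := by
      refine (homFilt_iff 𝒱).2 fun i v hv => ?_
      have hBv : B v ∈ filt 𝒱 i := by simpa using hBp.2 i v (le_filt 𝒱 le_rfl hv)
      have hd : HasDerivAt (fun τ => A τ (B v)) (deriv (fun τ => (A τ : V →L[𝕜] W)) τ (B v)) τ :=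
        (ContinuousLinearMap.apply 𝕜 W (B v)).hasFDerivAt.comp_hasDerivAt τ (hA.hasDerivAt hτ)
      have h2 := h i v hv (fun τ => A τ (B v))
        ((hA.smooth.contDiffAt (hA.isOpen.mem_nhds hτ)).clm_apply contDiffAt_const) (hAB v)
        (Filter.eventually_of_mem (hA.isOpen.mem_nhds hτ) fun σ hσ => by
          rw [← (hA.mem σ hσ).1 i]; exact ⟨B v, hBv, rfl⟩)
      rw [hd.deriv, ← hψc, ← map_sub, ← hψ.1 i] at h2
      obtain ⟨w, hw, hwv⟩ := h2
      rw [add_zero]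
      have h3 : w = c v - x v := ψ.injective hwv
      change c v - x v ∈ _
      rw [← h3]
      exact hw
    have h2 := degPart_of_homFilt 𝒱 h1 (j := -1) (by lia)
    rw [map_sub, sub_eq_zero, degPart_of_mem 𝒱 hx] at h2
    exact h2.symm
  · rintro rfl
    refine ⟨degPart_mem 𝒱 _ _, fun i v hv l hl hlv hlΛ => ?_⟩
    have h1 : c - degPart 𝒱 (-1) c ∈ homFilt 𝒱 0 := by
      simpa using sub_degPart_mem 𝒱 hcf
    let f : 𝕜 → V := fun σ => (A σ).symm (l σ)
    have hf : ContDiffAt 𝕜 ∞ f τ :=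
      (hA.contDiffOn_symm.contDiffAt (hA.isOpen.mem_nhds hτ)).clm_apply hl
    have hfd := (hf.differentiableAt (by simp)).hasDerivAt
    have hfi : deriv f τ ∈ filt 𝒱 i := by
      refine HasDerivAt.mem_submodule hfd ?_
      filter_upwards [hlΛ, hA.isOpen.mem_nhds hτ] with σ hσ hσU
      rw [← (hA.mem σ hσU).1 i] at hσ
      obtain ⟨w, hw, hwv⟩ := hσ
      have h2 : A σ w = l σ := hwv
      change (A σ).symm (l σ) ∈ _
      rw [← h2, (A σ).symm_apply_apply]
      exact hw
    have hfτ : f τ = B v := by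
      change (A τ).symm (l τ) = B v
      rw [hlv, ← hAB, (A τ).symm_apply_apply]
    have hld : HasDerivAt l (deriv (fun τ => (A τ : V →L[𝕜] W)) τ (f τ) + A τ (deriv f τ)) τ := by
      refine ((hA.hasDerivAt hτ).clm_apply hfd).congr_of_eventuallyEq
        (Filter.Eventually.of_forall fun σ => ?_)
      change l σ = A σ ((A σ).symm (l σ))
      rw [(A σ).apply_symm_apply]
    rw [hld.deriv, hfτ, ← hψc, add_sub_right_comm, ← map_sub]
    refine add_mem ?_ ?_
    · rw [← hψ.1 i]
      refine ⟨c v - degPart 𝒱 (-1) c v, ?_, rfl⟩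
      simpa using h1 i v (le_filt 𝒱 le_rfl hv)
    · rw [← hAτ.1 i]
      exact ⟨_, hfi, rfl⟩

end IsBigSection

variable (𝒱) in
/-- The action of `𝒢_+` on operators through its parts of degree `0`. -/
def degZeroAction (B : V →L[𝕜] V) : (V →L[𝕜] V) →L[𝕜] (V →L[𝕜] V) :=
  (ContinuousLinearMap.compL 𝕜 V V V (degPart 𝒱 0 B)) ∘L
    (ContinuousLinearMap.compL 𝕜 V V V).flip (degPart 𝒱 0 B.inverse)

theorem degZeroAction_apply (B y : V →L[𝕜] V) :
    degZeroAction 𝒱 B y = degPart 𝒱 0 B * (y * degPart 𝒱 0 B.inverse) := rfl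

theorem inverse_eq_of_mul_eq_one {a b : V →L[𝕜] V} (hab : a * b = 1) (hba : b * a = 1) :
    a.inverse = b :=
  ContinuousLinearMap.inverse_eq hab hba

theorem isSmoothAction_degZeroAction (hM : IsExpGroup (opSet (modelGroup J G)) (modelLie J G)) :
    IsSmoothAction 𝕜 (plusSet 𝒱 J G) (degZeroAction 𝒱) where
  one := by
    have h : (1 : V →L[𝕜] V).inverse = 1 := inverse_eq_of_mul_eq_one (one_mul 1) (one_mul 1)
    ext1 y
    rw [degZeroAction_apply, h, degPart_zero_one, one_mul, mul_one]
    rfl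
  mul a ha b hb := by
    obtain ⟨a', ha', h1, h2⟩ := (isExpGroup_plusSet (𝒱 := 𝒱) hM).inv_mem a ha
    obtain ⟨b', hb', h3, h4⟩ := (isExpGroup_plusSet (𝒱 := 𝒱) hM).inv_mem b hb
    have h5 : (a * b).inverse = b' * a' := inverse_eq_of_mul_eq_one
      (by rw [mul_assoc, ← mul_assoc b, h3, one_mul, h1])
      (by rw [mul_assoc, ← mul_assoc a', h2, one_mul, h4])
    ext1 y
    change degZeroAction 𝒱 (a * b) y = degZeroAction 𝒱 a (degZeroAction 𝒱 b y)
    simp only [degZeroAction_apply]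
    rw [h5, inverse_eq_of_mul_eq_one h1 h2, inverse_eq_of_mul_eq_one h3 h4,
      degPart_zero_mul 𝒱 ha.2 hb.2, degPart_zero_mul 𝒱 hb'.2 ha'.2]
    simp only [mul_assoc]
  smooth a ha := by
    obtain ⟨e, -, he⟩ := ha.1
    let d := LinearMap.toContinuousLinearMap (degPart 𝒱 (0 : ℤ))
    refine ContDiffAt.clm_comp ?_ ?_
    · exact ((ContinuousLinearMap.compL 𝕜 V V V).contDiff.comp d.contDiff).contDiffAt
    · exact (((ContinuousLinearMap.compL 𝕜 V V V).flip.contDiff.comp d.contDiff).contDiffAt).comp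
        a (contDiffAt_inverse he.symm)

theorem exists_equiv_exp (x : V →L[𝕜] V) : ∃ e : V ≃L[𝕜] V, (e : V →L[𝕜] V) = exp x :=
  ⟨ContinuousLinearEquiv.equivOfInverse' (exp x) (exp (-x)) (exp_mul_exp_neg 𝕜 x)
    (exp_neg_mul_exp 𝕜 x), rfl⟩

theorem IsBigSection.mem_frameFiber_iff {U : Set 𝕜} {A : 𝕜 → V ≃L[𝕜] W}
    (hA : IsBigSection 𝒱 J G D Λ U A) (hcompat : IsCompatible D Λ)
    (hspan : m = Submodule.span 𝕜 {δ}) {τ : 𝕜} (hτ : τ ∈ U) {ψ : V ≃L[𝕜] W}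
    (hψ : ψ ∈ bigFiber 𝒱 J G Λ τ) {B b : V →L[𝕜] V}
    (hB : B = ((A τ).symm : W →L[𝕜] V) ∘L (ψ : V →L[𝕜] W))
    (hb : b = (ψ.symm : W →L[𝕜] V) ∘L (A τ : V →L[𝕜] W)) :
    ψ ∈ frameFiber 𝒱 J G Λ m τ ↔ ∃ l : 𝕜, l ≠ 0 ∧
      degPart 𝒱 0 b * degPart 𝒱 (-1) (frameVelocity A τ) * degPart 𝒱 0 B = l • δ := by
  have hBp : B ∈ plusSet 𝒱 J G := hB ▸ symm_comp_mem_plusSet (hA.mem τ hτ) hψ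
  have hbp : b ∈ plusSet 𝒱 J G := hb ▸ symm_comp_mem_plusSet hψ (hA.mem τ hτ)
  rw [← (homFilt_conj hBp.2 hbp.2 (hA.frameVelocity_mem hcompat hτ).2).2]
  constructor
  · rintro ⟨-, x, hx, hmx⟩
    rw [hA.isVelocityIn_iff hcompat hτ hψ hB hb] at hx
    rw [hspan, Submodule.span_singleton_eq_span_singleton] at hmx
    obtain ⟨z, hz⟩ := hmx
    exact ⟨z, z.ne_zero, hx ▸ hz.symm⟩
  · rintro ⟨l, hl, h⟩
    refine ⟨hψ, _, (hA.isVelocityIn_iff hcompat hτ hψ hB hb).2 rfl, ?_⟩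
    rw [hspan, Submodule.span_singleton_eq_span_singleton]
    exact ⟨Units.mk0 l hl, h.symm⟩

/-- Relative to an adapted frame A, a frame A B has symbol spanned by B₀⁻¹δB₀. It is adapted exactly
when B₀ preserves the line of δ. -/
theorem IsBigSection.isFrameSection {O : Set 𝕜} {A : 𝕜 → V ≃L[𝕜] W}
    (hA : IsBigSection 𝒱 J G D Λ O A) (hcompat : IsCompatible D Λ)
    (hspan : m = Submodule.span 𝕜 {δ}) (h0 : δ ≠ 0)
    (hAf : ∀ τ ∈ O, A τ ∈ frameFiber 𝒱 J G Λ m τ) :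
    IsFrameSection 𝒱 J G δ (totalSpace (frameFiber 𝒱 J G Λ m) D) O A := by
  have hsymb : ∀ τ ∈ O, ∃ l : 𝕜, l ≠ 0 ∧ degPart 𝒱 (-1) (frameVelocity A τ) = l • δ := by
    intro τ hτ
    have h1 : (1 : V →L[𝕜] V) = ((A τ).symm : W →L[𝕜] V) ∘L (A τ : V →L[𝕜] W) := by
      ext x; simp
    have h2 := (hA.mem_frameFiber_iff hcompat hspan hτ (hA.mem τ hτ) h1 h1).1 (hAf τ hτ)
    simpa only [degPart_zero_one, one_mul, mul_one] using h2
  refine ⟨hA.isOpen, hA.smooth, fun q hq => ⟨fun hqS => ?_, fun hqB => ?_⟩,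
    fun τ hτ => hA.frameVelocity_mem hcompat hτ, hsymb⟩
  · obtain ⟨-, ψ, hψ, hψq⟩ := hqS
    have hψq : (ψ : V →L[𝕜] W) = q.2 := hψq
    have hBp := symm_comp_mem_plusSet (hA.mem _ hq) hψ.1
    have hbp := symm_comp_mem_plusSet hψ.1 (hA.mem _ hq)
    obtain ⟨l', hl', h⟩ := (hA.mem_frameFiber_iff hcompat hspan hq hψ.1 rfl rfl).1 hψ
    obtain ⟨l, hl, hv⟩ := hsymb _ hq
    rw [← hψq]
    refine ⟨hBp, l / l', ?_⟩
    have h1 := degPart_zero_mul_eq_one hBp.2 hbp.2 (by ext x; simp)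
    set B₀ := degPart 𝒱 0 (((A q.1).symm : W →L[𝕜] V) ∘L (ψ : V →L[𝕜] W))
    set b₀ := degPart 𝒱 0 ((ψ.symm : W →L[𝕜] V) ∘L (A q.1 : V →L[𝕜] W))
    rw [hv] at h
    have h2 : l • (δ * B₀) = l' • (B₀ * δ) := by
      have := congrArg (B₀ * ·) h
      simp only [← mul_assoc, h1, one_mul, mul_smul_comm, smul_mul_assoc] at this
      exact this
    rw [div_eq_inv_mul, ← smul_smul, h2, smul_smul, inv_mul_cancel₀ hl', one_smul]
  · obtain ⟨e, he⟩ := exists_equiv_of_mem_lineSet hqB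
    have hψ : e.trans (A q.1) ∈ bigFiber 𝒱 J G Λ q.1 :=
      trans_mem_bigFiber (hA.mem _ hq) (he ▸ hqB.1)
    have hq2 : ((e.trans (A q.1) : V ≃L[𝕜] W) : V →L[𝕜] W) = q.2 := by
      have : ((A q.1 : V ≃L[𝕜] W) : V →L[𝕜] W) ∘L (((A q.1).symm : W →L[𝕜] V) ∘L q.2) = q.2 := by
        ext x; simp
      rw [he] at this
      exact this
    refine ⟨hA.subset hq, e.trans (A q.1), ?_, hq2⟩
    have hBp := symm_comp_mem_plusSet (hA.mem _ hq) hψ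
    have hbp := symm_comp_mem_plusSet hψ (hA.mem _ hq)
    refine (hA.mem_frameFiber_iff hcompat hspan hq hψ rfl rfl).2 ?_
    obtain ⟨l, hl, hv⟩ := hsymb _ hq
    obtain ⟨r, hr⟩ := hqB.2
    rw [← hq2] at hr
    have h1 := degPart_zero_mul_eq_one hBp.2 hbp.2 (by ext x; simp)
    have h2 := degPart_zero_mul_eq_one hbp.2 hBp.2 (by ext x; simp)
    rw [hv]
    set B₀ := degPart 𝒱 0 (((A q.1).symm : W →L[𝕜] V) ∘L ((e.trans (A q.1) : V ≃L[𝕜] W) : V →L[𝕜] W))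
    set b₀ := degPart 𝒱 0 (((e.trans (A q.1)).symm : W →L[𝕜] V) ∘L (A q.1 : V →L[𝕜] W))
    have hr0 : r ≠ 0 := by
      rintro rfl
      rw [zero_smul] at hr
      exact h0 (by rw [← one_mul δ, ← h2, mul_assoc, hr, mul_zero])
    have h3 : δ * B₀ = r⁻¹ • (B₀ * δ) := by
      rw [hr, smul_smul, inv_mul_cancel₀ hr0, one_smul]
    refine ⟨l * r⁻¹, mul_ne_zero hl (inv_ne_zero hr0), ?_⟩
    rw [mul_smul_comm, smul_mul_assoc, mul_assoc, h3, mul_smul_comm, ← mul_assoc, h2, one_mul,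
      smul_smul]

/-- Over a neighbourhood of each point the bundle of frames adapted to the symbol has a smooth
section. -/
theorem exists_isFrameSection (hM : IsExpGroup (opSet (modelGroup J G)) (modelLie J G))
    (hΛ : IsSmoothOrbitCurve 𝒱 J G D Λ) (hcompat : IsCompatible D Λ)
    (hspan : m = Submodule.span 𝕜 {δ}) (h0 : δ ≠ 0)
    (hsymbol : ∀ t ∈ D, m ∈ symbolAt 𝒱 J G Λ t) {t : 𝕜} (ht : t ∈ D) :
    ∃ O A, t ∈ O ∧ O ⊆ D ∧
      IsFrameSection 𝒱 J G δ (totalSpace (frameFiber 𝒱 J G Λ m) D) O A := by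
  obtain ⟨U, A, htU, hA⟩ := hΛ.exists_isBigSection ht
  have hP := isExpGroup_plusSet (𝒱 := 𝒱) hM
  have hS := isSmoothAction_degZeroAction (𝒱 := 𝒱) hM
  let d := LinearMap.toContinuousLinearMap (degPart 𝒱 (-1 : ℤ))
  -- Constancy of the symbol puts this curve into the cone over the orbit of δ. A lift to 𝒢_+ is the
  -- correction that makes A adapted.
  let y : 𝕜 → (V →L[𝕜] V) := fun τ => degPart 𝒱 (-1) (frameVelocity A τ)
  have hy : ContDiffOn 𝕜 ∞ y U := d.contDiff.comp_contDiffOn hA.contDiffOn_frameVelocity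
  have hmodel : ∀ τ ∈ U, ∃ B ∈ plusSet 𝒱 J G, ∃ l : 𝕜, l ≠ 0 ∧ y τ = l • degZeroAction 𝒱 B δ := by
    intro τ hτ
    obtain ⟨ψ, hψ, x, hx, hmx⟩ := hsymbol τ (hA.subset hτ)
    obtain ⟨l, hl, h⟩ := (hA.mem_frameFiber_iff hcompat hspan hτ hψ rfl rfl).1 ⟨hψ, x, hx, hmx⟩
    have hBp := symm_comp_mem_plusSet (hA.mem _ hτ) hψ
    have hbp := symm_comp_mem_plusSet hψ (hA.mem _ hτ)
    refine ⟨_, hBp, l, hl, ?_⟩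
    have e1 : (((A τ).symm : W →L[𝕜] V) ∘L (ψ : V →L[𝕜] W)) *
        ((ψ.symm : W →L[𝕜] V) ∘L (A τ : V →L[𝕜] W)) = 1 := by ext x; simp
    have e2 : ((ψ.symm : W →L[𝕜] V) ∘L (A τ : V →L[𝕜] W)) *
        (((A τ).symm : W →L[𝕜] V) ∘L (ψ : V →L[𝕜] W)) = 1 := by ext x; simp
    have h1 := degPart_zero_mul_eq_one hBp.2 hbp.2 e1
    rw [degZeroAction_apply, inverse_eq_of_mul_eq_one e1 e2]
    set B₀ := degPart 𝒱 0 (((A τ).symm : W →L[𝕜] V) ∘L (ψ : V →L[𝕜] W))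
    set b₀ := degPart 𝒱 0 ((ψ.symm : W →L[𝕜] V) ∘L (A τ : V →L[𝕜] W))
    have h2 := congrArg (fun z => B₀ * z * b₀) h
    have h3 : B₀ * (b₀ * y τ * B₀) * b₀ = (B₀ * b₀) * y τ * (B₀ * b₀) := by noncomm_ring
    rw [h1, one_mul, mul_one] at h3
    replace h2 : y τ = B₀ * (l • δ) * b₀ := h3.symm.trans h2
    rw [h2, mul_smul_comm, smul_mul_assoc, mul_assoc]
  obtain ⟨Bt, hBt, lt, hlt, hyt⟩ := hmodel t htU
  obtain ⟨b, hb, hBb, hbB⟩ := hP.inv_mem Bt hBt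
  -- The lift is taken relative to y t and not to δ, so the model transformations B are composed
  -- with the inverse of Bt, and Bt reappears in the corrected frame.
  obtain ⟨O, hO, htO, hOU, ξ, hξ, hξy⟩ := hS.exists_lift_smul hP hA.isOpen hy htU fun τ hτ => by
    obtain ⟨B, hB, l, hl, h⟩ := hmodel τ hτ
    refine ⟨B * b, hP.mul_mem _ hB _ hb, l * lt⁻¹, mul_ne_zero hl (inv_ne_zero hlt), ?_⟩
    rw [h, hyt, hS.mul _ hB _ hb, map_smul, smul_smul, mul_assoc, inv_mul_cancel₀ hlt, mul_one]
    have h1 : degZeroAction 𝒱 b (degZeroAction 𝒱 Bt δ) = δ := by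
      change (degZeroAction 𝒱 b * degZeroAction 𝒱 Bt) δ = δ
      rw [← hS.mul _ hb _ hBt, hbB, hS.one]
      rfl
    change _ = l • degZeroAction 𝒱 B (degZeroAction 𝒱 b (degZeroAction 𝒱 Bt δ))
    rw [h1]
  obtain ⟨eB, -, heB⟩ := hBt.1
  have heB : (eB : V →L[𝕜] V) = Bt := heB
  choose e he using fun τ => exists_equiv_exp (𝕜 := 𝕜) (ξ τ)
  have hE : ∀ τ ∈ O, exp (ξ τ) * Bt ∈ plusSet 𝒱 J G := fun τ hτ =>
    hP.mul_mem _ (hP.exp_mem _ (hξy τ hτ).1) _ hBt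
  have hA' : IsBigSection 𝒱 J G D Λ O fun τ => (eB.trans (e τ)).trans (A τ) := by
    refine ⟨hO, hOU.trans hA.subset, ?_, fun τ hτ => trans_mem_bigFiber (hA.mem τ (hOU hτ)) ?_⟩
    · have h1 : ContDiffOn 𝕜 ∞ (fun τ => (A τ : V →L[𝕜] W) ∘L (exp (ξ τ) ∘L Bt)) O :=
        (hA.smooth.mono hOU).clm_comp
          (((contDiff_exp 𝕜).comp_contDiffOn hξ).clm_comp contDiffOn_const)
      refine h1.congr fun τ hτ => ?_
      rw [← he, ← heB]
      rfl
    · have := hE τ hτ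
      rw [← he, ← heB] at this
      exact this
  refine ⟨O, _, htO, hOU.trans hA.subset, hA'.isFrameSection hcompat hspan h0 fun τ hτ => ?_⟩
  obtain ⟨hξτ, c, hc, hyc⟩ := hξy τ hτ
  obtain ⟨b', hb', hEb, hbE⟩ := hP.inv_mem _ (hE τ hτ)
  have hcoe : ((eB.trans (e τ) : V ≃L[𝕜] V) : V →L[𝕜] V) = exp (ξ τ) * Bt := by
    rw [← he, ← heB]; rfl
  have hsymm : ((eB.trans (e τ)).symm : V →L[𝕜] V) = b' := by
    rw [← ContinuousLinearMap.inverse_equiv, hcoe, inverse_eq_of_mul_eq_one hEb hbE]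
  refine (hA.mem_frameFiber_iff hcompat hspan (hOU hτ) (hA'.mem τ hτ)
    (B := exp (ξ τ) * Bt) (b := b') ?_ ?_).2 ⟨c * lt, mul_ne_zero hc hlt, ?_⟩
  · rw [← hcoe]; ext x; simp
  · rw [← hsymm]; ext x; simp
  · have h1 : y τ = (c * lt) • degZeroAction 𝒱 (exp (ξ τ) * Bt) δ := by
      rw [hyc, hyt, map_smul, smul_smul, hS.mul _ (hP.exp_mem _ hξτ) _ hBt]
      rfl
    have h2 := degPart_zero_mul_eq_one hb'.2 (hE τ hτ).2 hbE
    change degPart 𝒱 0 b' * y τ * degPart 𝒱 0 (exp (ξ τ) * Bt) = _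
    rw [h1, degZeroAction_apply, inverse_eq_of_mul_eq_one hEb hbE, mul_smul_comm, smul_mul_assoc,
      mul_assoc, mul_assoc, mul_assoc, h2, mul_one, ← mul_assoc, h2, one_mul]

end FrameExistence

/-! ### Nested submanifolds with equal tangent spaces -/

section Nested

variable {𝕜 : Type*} [RCLike 𝕜]
variable {E : Type*} [NormedAddCommGroup E] [NormedSpace 𝕜 E]

/-- A submanifold contained in another one with the same tangent space at a point contains a
neighbourhood of the point in the larger submanifold. -/
theorem IsSubmanifold.mem_nhdsWithin_of_tangentAt_le [FiniteDimensional 𝕜 E] [CompleteSpace E]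
    {M M' : Set E} (hM : IsSubmanifold 𝕜 M) (hM' : IsSubmanifold 𝕜 M') (h : M' ⊆ M) {p : E}
    (hp : p ∈ M') (ht : tangentAt 𝕜 M p ≤ tangentAt 𝕜 M' p) : M' ∈ 𝓝[M] p := by
  obtain ⟨e, hpe, he, hes, S, hS⟩ := hM' p hp
  obtain ⟨π, hπS, hπ⟩ := exists_projection S
  have hpt := e.map_source hpe
  have hpS : e p ∈ S := (hS p hpe).1 hp
  -- This parametrizes the smaller submanifold near p. Its derivative covers the tangent space of
  -- the larger one, so f is open onto the larger one.
  let f : E → E := fun x => e.symm (π x)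
  have hfa : f (e p) = p := by
    change e.symm (π (e p)) = p
    rw [hπ _ hpS, e.left_inv hpe]
  have hπp : π (e p) = e p := hπ _ hpS
  have hsd : ContDiffAt 𝕜 ∞ e.symm (e p) := hes.contDiffAt (e.open_target.mem_nhds hpt)
  have hed : ContDiffAt 𝕜 ∞ e p := he.contDiffAt (e.open_source.mem_nhds hpe)
  have hfd : HasStrictFDerivAt f (fderiv 𝕜 e.symm (e p) ∘L π) (e p) := by
    have h1 : HasStrictFDerivAt e.symm (fderiv 𝕜 e.symm (e p)) (π (e p)) := by
      rw [hπp]; exact hsd.hasStrictFDerivAt (by simp)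
    exact h1.comp (e p) π.hasStrictFDerivAt
  have hfM : ∀ᶠ x in 𝓝 (e p), f x ∈ M' := by
    have h1 : ∀ᶠ x in 𝓝 (e p), π x ∈ e.target := by
      apply π.continuous.continuousAt.eventually_mem
      rw [hπp]; exact e.open_target.mem_nhds hpt
    filter_upwards [h1] with x hx
    rw [hS _ (e.map_target hx)]
    rw [e.right_inv hx]
    exact hπS x
  have hrange : tangentAt 𝕜 M' p ≤
      LinearMap.range (fderiv 𝕜 e.symm (e p) ∘L π).toLinearMap := by
    refine Submodule.span_le.2 ?_
    rintro w ⟨γ, hγ, hγ0, hγM, rfl⟩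
    subst hγ0
    have hγd := (hγ.differentiableAt (by simp)).hasDerivAt
    have h1 : HasDerivAt (fun s => e (γ s)) (fderiv 𝕜 e (γ 0) (deriv γ 0)) 0 :=
      (hed.differentiableAt (by simp)).hasFDerivAt.comp_hasDerivAt (0 : 𝕜) hγd
    have h2 : ∀ᶠ s in 𝓝 (0 : 𝕜), γ s ∈ e.source :=
      hγ.continuousAt.eventually_mem (e.open_source.mem_nhds hpe)
    have h3 : HasDerivAt (fun s => f (e (γ s)))
        ((fderiv 𝕜 e.symm (e (γ 0)) ∘L π) (fderiv 𝕜 e (γ 0) (deriv γ 0))) 0 :=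
      HasFDerivAt.comp_hasDerivAt (l := f) (f := fun s => e (γ s)) (0 : 𝕜) hfd.hasFDerivAt h1
    have h4 : (fun s => f (e (γ s))) =ᶠ[𝓝 0] γ := by
      filter_upwards [h2, hγM] with s hs hsM
      change e.symm (π (e (γ s))) = γ s
      rw [hπ _ ((hS _ hs).1 hsM), e.left_inv hs]
    exact ⟨_, (h3.congr_of_eventuallyEq h4.symm).unique hγd⟩
  have h1 := hM.nhdsWithin_le_map hfd (hfM.mono fun x hx => h hx)
    (by rw [hfa]; exact ht.trans hrange)
  rw [hfa] at h1
  exact h1 hfM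

end Nested

/-! ### The fibres of a reduction -/

section Frames

variable {𝕜 : Type*} [RCLike 𝕜]
variable {V : Type*} [NormedAddCommGroup V] [NormedSpace 𝕜 V]
variable {W : Type*} [NormedAddCommGroup W] [NormedSpace 𝕜 W]
variable {𝒱 : ℤ → Submodule 𝕜 V} {J : V ≃L[𝕜] W} {G : Subgroup (W ≃L[𝕜] W)}
variable {m : Submodule 𝕜 (V →L[𝕜] V)}
variable [DirectSum.Decomposition 𝒱] [FiniteDimensional 𝕜 V]
variable {δ : V →L[𝕜] V} {N : Submodule 𝕜 (V →L[𝕜] V)}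
variable {s : ℕ → Submodule 𝕜 (V →L[𝕜] V)}
variable {S R : Set (𝕜 × (V →L[𝕜] W))} {k : ℕ} {v : 𝕜 × (V →L[𝕜] W) → (V →L[𝕜] V)}

/-- The family of sets of frames with total space `R`. -/
def framesIn (R : Set (𝕜 × (V →L[𝕜] W))) (t : 𝕜) : Set (V ≃L[𝕜] W) :=
  {ψ | (t, (ψ : V →L[𝕜] W)) ∈ R}

omit [FiniteDimensional 𝕜 V] in
theorem mem_opSet_framesIn (hR : ∀ p ∈ R, ∃ ψ : V ≃L[𝕜] W, p.2 = ψ) {t : 𝕜} {a : V →L[𝕜] W} :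
    a ∈ opSet (framesIn R t) ↔ (t, a) ∈ R := by
  constructor
  · rintro ⟨ψ, hψ, rfl⟩
    exact hψ
  · intro h
    obtain ⟨ψ, hψ⟩ := hR _ h
    exact ⟨ψ, by change (t, (ψ : V →L[𝕜] W)) ∈ R; rw [← hψ]; exact h, hψ.symm⟩

theorem totalSpace_framesIn {D : Set 𝕜} (hR : ∀ p ∈ R, ∃ ψ : V ≃L[𝕜] W, p.2 = ψ)
    (hD : ∀ p ∈ R, p.1 ∈ D) : totalSpace (framesIn R) D = R := by
  ext p
  exact ⟨fun h => (mem_opSet_framesIn hR).1 h.2, fun h => ⟨hD p h, (mem_opSet_framesIn hR).2 h⟩⟩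

theorem mk_mem_tangentAt_of_fiber (hR : ∀ p ∈ R, ∃ ψ : V ≃L[𝕜] W, p.2 = ψ) {t : 𝕜}
    {a X : V →L[𝕜] W} (hX : X ∈ tangentAt 𝕜 (opSet (framesIn R t)) a) :
    ((0 : 𝕜), X) ∈ tangentAt 𝕜 R (t, a) := by
  have h1 : HasFDerivAt (𝕜 := 𝕜) (fun b : V →L[𝕜] W => (t, b)) _ a :=
    (hasFDerivAt_const t a).prodMk (hasFDerivAt_id a)
  have h2 := tangentAt_map (𝕜 := 𝕜) (f := fun b : V →L[𝕜] W => (t, b)) (M' := R)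
    (contDiffAt_const.prodMk contDiffAt_id)
    (eventually_nhdsWithin_of_forall fun b hb => (mem_opSet_framesIn hR).1 hb) hX
  rw [h1.fderiv] at h2
  exact h2

variable [CompleteSpace V]

namespace IsReduction

variable (hF : ∀ p ∈ S, ∃ O A, p.1 ∈ O ∧ IsFrameSection 𝒱 J G δ S O A)
  (hN : IsNormalForm 𝒱 J G m δ N s) (hS : IsFrameManifold 𝒱 J G m δ S)
  (hR : IsReduction 𝒱 J G m N s S R k v)
  (hM : IsExpGroup (opSet (modelGroup J G)) (modelLie J G))
  (hK : IsExpGroup (lineSet 𝒱 J G δ) (lineLie 𝒱 J G m))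

include hS hR in
theorem exists_equiv {p : 𝕜 × (V →L[𝕜] W)} (hp : p ∈ R) : ∃ ψ : V ≃L[𝕜] W, p.2 = ψ :=
  hS.exists_equiv p (hR.subset hp)

include hR in
theorem apply_rmul_exp_slice {p : 𝕜 × (V →L[𝕜] W)} (hp : p ∈ R) {w : V →L[𝕜] V}
    (hw : w ∈ sliceSum 𝒱 s k) (hpw : rmul p (exp w) ∈ S) : v (rmul p (exp w)) = -w := by
  refine ((hR.mem_iff _ hpw _ (neg_mem hw)).1 ?_).symm
  rw [rmul_rmul, exp_mul_exp_neg 𝕜]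
  exact hp

variable [FiniteDimensional 𝕜 W] [CompleteSpace W]

include hF hS hR hK in
-- A local retraction onto the fibre is the one onto the group coset of adapted frames followed by b
-- ↦ b exp(v b).
theorem isSubmanifold_framesIn (t : 𝕜) : IsSubmanifold 𝕜 (opSet (framesIn R t)) := by
  refine IsLocalRetract.isSubmanifold fun a ha => ?_
  have hR' := fun p => hR.exists_equiv hS (p := p)
  have haR := (mem_opSet_framesIn hR').1 ha
  obtain ⟨O, A, hO, hA⟩ := hF _ (hR.subset haR)
  let f : (V →L[𝕜] W) → (V →L[𝕜] V) := fun b => ((A t).symm : W →L[𝕜] V) ∘L b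
  have hf : ContDiff 𝕜 ∞ f := contDiff_const.clm_comp contDiff_id
  obtain ⟨M, hMo, hpM, r, hr, hrm, hrid⟩ :=
    hK.isLocalRetract _ ((hA.mem_iff _ hO).1 (hR.subset haR))
  let g : (V →L[𝕜] W) → 𝕜 × (V →L[𝕜] W) := fun b => (t, (A t : V →L[𝕜] W) ∘L r (f b))
  have hg : ContDiffOn 𝕜 ∞ g (f ⁻¹' M) := contDiffOn_const.prodMk
    (contDiffOn_const.clm_comp (hr.comp hf.contDiffOn fun b hb => hb))
  have hgS : ∀ b ∈ f ⁻¹' M, g b ∈ S := fun b hb => hA.mk_mem hO (hrm _ hb)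
  refine ⟨f ⁻¹' M, hMo.preimage hf.continuous, hpM, fun b => (g b).2 ∘L exp (v (g b)), ?_,
    fun b hb => ?_, fun b hb hbR => ?_⟩
  · exact (contDiff_snd.comp_contDiffOn hg).clm_comp
      ((contDiff_exp 𝕜).comp_contDiffOn (hR.smooth.comp hg hgS))
  · exact (mem_opSet_framesIn hR').2 (hR.rmul_exp_mem (hgS b hb))
  · have h1 := (mem_opSet_framesIn hR').1 hbR
    have h2 : r (f b) = f b := hrid _ hb ((hA.mem_iff (t, b) hO).1 (hR.subset h1))
    have h3 : g b = (t, b) := by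
      refine Prod.ext rfl ?_
      change (A t : V →L[𝕜] W) ∘L r (f b) = b
      rw [h2]
      ext x
      simp [f]
    change (g b).2 ∘L exp (v (g b)) = b
    rw [h3, (hR.mem_iff_eq_zero (hR.subset h1)).1 h1, NormedSpace.exp_zero]
    rfl

include hS hR in
-- Frames are carried between fibres by the section A and then moved back to `R` by exp(v). The two
-- maps are inverse to each other: the transport commutes with right translations, and the return
-- correction is -v by uniqueness.
theorem locTriv {D : Set 𝕜} (hD : ∀ t ∈ D, ∃ O A, t ∈ O ∧ O ⊆ D ∧ IsFrameSection 𝒱 J G δ S O A)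
    {t : 𝕜} (ht : t ∈ D) : ∃ U : Set 𝕜, IsOpen U ∧ t ∈ U ∧ U ⊆ D ∧
    ∃ φ χ : 𝕜 × (V →L[𝕜] W) → (V →L[𝕜] W),
      ContDiffOn 𝕜 ∞ φ (U ×ˢ opSet (framesIn R t)) ∧
      ContDiffOn 𝕜 ∞ χ (totalSpace (framesIn R) U) ∧
      ∀ τ ∈ U, Set.MapsTo (fun a => φ (τ, a)) (opSet (framesIn R t)) (opSet (framesIn R τ)) ∧
        Set.MapsTo (fun a => χ (τ, a)) (opSet (framesIn R τ)) (opSet (framesIn R t)) ∧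
        Set.InvOn (fun a => χ (τ, a)) (fun a => φ (τ, a))
          (opSet (framesIn R t)) (opSet (framesIn R τ)) := by
  obtain ⟨O, A, htO, hOD, hA⟩ := hD t ht
  have hR' := fun p => hR.exists_equiv hS (p := p)
  -- transport of a frame over `σ` to a frame over `τ`
  let T : 𝕜 → 𝕜 → (V →L[𝕜] W) → 𝕜 × (V →L[𝕜] W) := fun σ τ a =>
    (τ, (A τ : V →L[𝕜] W) ∘L (((A σ).symm : W →L[𝕜] V) ∘L a))
  have hTS : ∀ σ ∈ O, ∀ τ ∈ O, ∀ a, (σ, a) ∈ S → T σ τ a ∈ S := fun σ hσ τ hτ a ha =>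
    hA.mk_mem hτ ((hA.mem_iff (σ, a) hσ).1 ha)
  let F : 𝕜 → 𝕜 → (V →L[𝕜] W) → 𝕜 × (V →L[𝕜] W) := fun σ τ a =>
    rmul (T σ τ a) (exp (v (T σ τ a)))
  have hFR : ∀ σ ∈ O, ∀ τ ∈ O, ∀ a, (σ, a) ∈ S → F σ τ a ∈ R := fun σ hσ τ hτ a ha =>
    hR.rmul_exp_mem (hTS σ hσ τ hτ a ha)
  have hTT : ∀ σ τ a x, T τ σ (rmul (T σ τ a) x).2 = rmul (σ, a) x := by
    intro σ τ a x
    refine Prod.ext rfl ?_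
    ext y
    simp [T, rmul]
  have hFF : ∀ σ ∈ O, ∀ τ ∈ O, ∀ a, (σ, a) ∈ R → (F τ σ (F σ τ a).2).2 = a := by
    intro σ hσ τ hτ a ha
    have h1 := hTS τ hτ σ hσ _ (hR.subset (hFR σ hσ τ hτ a (hR.subset ha)))
    have h2 := hTT σ τ a (exp (v (T σ τ a)))
    have h3 : T τ σ (F σ τ a).2 = rmul (σ, a) (exp (v (T σ τ a))) := h2
    change T τ σ (F σ τ a).2 ∈ S at h1
    change (rmul (T τ σ (F σ τ a).2) (exp (v (T τ σ (F σ τ a).2)))).2 = a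
    rw [h3] at h1 ⊢
    rw [hR.apply_rmul_exp_slice ha (hR.mem_slice _ (hTS σ hσ τ hτ a (hR.subset ha))) h1, rmul_rmul,
      exp_mul_exp_neg 𝕜]
    rfl
  have hsmooth : ∀ (f g : 𝕜 × (V →L[𝕜] W) → 𝕜) (M : Set (𝕜 × (V →L[𝕜] W))),
      ContDiffOn 𝕜 ∞ f M → ContDiffOn 𝕜 ∞ g M → Set.MapsTo f M O → Set.MapsTo g M O →
      (∀ q ∈ M, (f q, q.2) ∈ S) → ContDiffOn 𝕜 ∞ (fun q => (F (f q) (g q) q.2).2) M := by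
    intro f g M hf hg hfM hgM hM
    have h1 : ContDiffOn 𝕜 ∞ (fun q => T (f q) (g q) q.2) M :=
      hg.prodMk ((hA.smooth.comp hg hgM).clm_comp
        ((hA.contDiffOn_symm.comp hf hfM).clm_comp contDiffOn_snd))
    exact (contDiff_snd.comp_contDiffOn h1).clm_comp ((contDiff_exp 𝕜).comp_contDiffOn
      (hR.smooth.comp h1 fun q hq => hTS _ (hfM hq) _ (hgM hq) _ (hM q hq)))
  refine ⟨O, hA.isOpen, htO, hOD, fun q => (F t q.1 q.2).2, fun q => (F q.1 t q.2).2,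
    hsmooth (fun _ => t) Prod.fst _ contDiffOn_const contDiffOn_fst (fun _ _ => htO)
      (fun q hq => hq.1) fun q hq => hR.subset ((mem_opSet_framesIn hR').1 hq.2),
    hsmooth Prod.fst (fun _ => t) _ contDiffOn_fst contDiffOn_const (fun q hq => hq.1)
      (fun _ _ => htO) fun q hq => hR.subset ((mem_opSet_framesIn hR').1 hq.2),
    fun τ hτ => ⟨fun a ha => ?_, fun a ha => ?_, fun a ha => ?_, fun a ha => ?_⟩⟩
  all_goals rw [mem_opSet_framesIn hR'] at ha
  · exact (mem_opSet_framesIn hR').2 (hFR t htO τ hτ a (hR.subset ha))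
  · exact (mem_opSet_framesIn hR').2 (hFR τ hτ t htO a (hR.subset ha))
  · exact hFF t htO τ hτ a ha
  · exact hFF τ hτ t htO a ha

end IsReduction

end Frames

/-! ### Associated graded subspaces -/

section Graded

variable {𝕜 : Type*} [RCLike 𝕜]
variable {V : Type*} [NormedAddCommGroup V] [NormedSpace 𝕜 V]
variable (𝒱 : ℤ → Submodule 𝕜 V)
variable [DirectSum.Decomposition 𝒱] [FiniteDimensional 𝕜 V]

theorem exists_of_mem_grSubspace {L : Submodule 𝕜 (V →L[𝕜] V)} {x : V →L[𝕜] V}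
    (hx : x ∈ grSubspace 𝒱 L) (j : ℤ) :
    ∃ z ∈ L, z ∈ homFilt 𝒱 j ∧ degPart 𝒱 j z = degPart 𝒱 j x := by
  have h : grSubspace 𝒱 L ≤ ((L ⊓ homFilt 𝒱 j).map (degPart 𝒱 j)).comap (degPart 𝒱 j) := by
    refine iSup_le fun i => ?_
    rintro _ ⟨z, hz, rfl⟩
    change degPart 𝒱 j (degPart 𝒱 i z) ∈ (L ⊓ homFilt 𝒱 j).map (degPart 𝒱 j)
    rw [degPart_degPart]
    split_ifs with hij
    · subst hij
      exact ⟨z, hz, rfl⟩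
    · exact zero_mem _
  obtain ⟨z, hz, h⟩ := h hx
  exact ⟨z, hz.1, hz.2, h⟩

theorem degPart_mem_grSubspace {L : Submodule 𝕜 (V →L[𝕜] V)} {z : V →L[𝕜] V} {j : ℤ} (hz : z ∈ L)
    (hzj : z ∈ homFilt 𝒱 j) : degPart 𝒱 j z ∈ grSubspace 𝒱 L :=
  le_iSup (fun k => (L ⊓ homFilt 𝒱 k).map (degPart 𝒱 k)) j ⟨z, ⟨hz, hzj⟩, rfl⟩

/-- A subspace is determined by its associated graded space among the larger ones. -/
theorem le_of_grSubspace_le {L L' : Submodule 𝕜 (V →L[𝕜] V)} (h : L' ≤ L)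
    (hgr : grSubspace 𝒱 L ≤ grSubspace 𝒱 L') : L ≤ L' := by
  obtain ⟨n, hn⟩ := exists_depth 𝒱
  -- Descending induction on the filtration degree, from n, where only 0 remains, down to -n, where
  -- nothing is excluded.
  have key : ∀ i : ℕ, ∀ z ∈ L, z ∈ homFilt 𝒱 (n - i) → z ∈ L' := by
    intro i
    induction i with
    | zero =>
      intro z _ hz
      rw [homFilt_eq_bot_of_le 𝒱 hn (by simp) hz]
      exact zero_mem _
    | succ i ih =>
      intro z hz hzi
      obtain ⟨z', hz', hzi', hzz⟩ :=
        exists_of_mem_grSubspace 𝒱 (hgr (degPart_mem_grSubspace 𝒱 hz hzi)) (n - (i + 1 : ℕ))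
      rw [degPart_degPart, if_pos rfl] at hzz
      have h1 := homFilt_succ 𝒱 (sub_mem hzi hzi') (by rw [map_sub, hzz, sub_self])
      have h2 := ih (z - z') (sub_mem hz (h hz')) (by
        rwa [show ((n : ℤ) - (i + 1 : ℕ) + 1) = n - i by push_cast; ring] at h1)
      simpa using add_mem h2 hz'
  intro z hz
  refine key (2 * n) z hz ?_
  have := mem_homFilt_of_le 𝒱 hn z
  rwa [show ((n : ℤ) - (2 * n : ℕ)) = -n by push_cast; ring]

end Graded

/-! ### Vertical spaces and the normalized connection -/

section Frames

variable {𝕜 : Type*} [RCLike 𝕜]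
variable {V : Type*} [NormedAddCommGroup V] [NormedSpace 𝕜 V]
variable {W : Type*} [NormedAddCommGroup W] [NormedSpace 𝕜 W]
variable {𝒱 : ℤ → Submodule 𝕜 V} {J : V ≃L[𝕜] W} {G : Subgroup (W ≃L[𝕜] W)}
variable {m : Submodule 𝕜 (V →L[𝕜] V)}
variable [DirectSum.Decomposition 𝒱] [FiniteDimensional 𝕜 V]
variable {δ : V →L[𝕜] V} {N : Submodule 𝕜 (V →L[𝕜] V)}
variable {s : ℕ → Submodule 𝕜 (V →L[𝕜] V)}
variable {S R : Set (𝕜 × (V →L[𝕜] W))} {k : ℕ} {v : 𝕜 × (V →L[𝕜] W) → (V →L[𝕜] V)}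
variable [CompleteSpace V]

namespace IsReduction

variable (hF : ∀ p ∈ S, ∃ O A, p.1 ∈ O ∧ IsFrameSection 𝒱 J G δ S O A)
  (hN : IsNormalForm 𝒱 J G m δ N s) (hS : IsFrameManifold 𝒱 J G m δ S)
  (hR : IsReduction 𝒱 J G m N s S R k v)
  (hM : IsExpGroup (opSet (modelGroup J G)) (modelLie J G))
  (hK : IsExpGroup (lineSet 𝒱 J G δ) (lineLie 𝒱 J G m))
  (hk : ∀ i : ℤ, (k : ℤ) ≤ |i| → ∀ x, degPart 𝒱 i x = 0)

include hF hS hR hK in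
theorem add_fderivWithin_mem_verticalSpace {t : 𝕜} {ψ : V ≃L[𝕜] W}
    (hψ : (t, (ψ : V →L[𝕜] W)) ∈ R) {x : V →L[𝕜] V} (hx : x ∈ lineLie 𝒱 J G m) :
    x + fderivWithin 𝕜 v S (t, (ψ : V →L[𝕜] W)) (0, (ψ : V →L[𝕜] W) ∘L x) ∈
      verticalSpace (framesIn R) t ψ := by
  obtain ⟨O, A, hO, hA⟩ := hF _ (hR.subset hψ)
  set p : 𝕜 × (V →L[𝕜] W) := (t, (ψ : V →L[𝕜] W))
  have hpS := hR.subset hψ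
  let γ : 𝕜 → 𝕜 × (V →L[𝕜] W) := fun r => rmul p (exp (r • x))
  have hγS : ∀ r, γ r ∈ S := fun r =>
    hA.rmul_mem hK hO hpS (hK.exp_mem _ (Submodule.smul_mem _ r hx))
  have hγ : ContDiff 𝕜 ∞ γ := contDiff_rmul.comp
    (contDiff_const.prodMk ((contDiff_exp 𝕜).comp (contDiff_id.smul contDiff_const)))
  have hγ0 : γ 0 = p := by
    change rmul p (exp ((0 : 𝕜) • x)) = p
    rw [zero_smul, NormedSpace.exp_zero, rmul_one]
  have hγd : HasDerivAt γ (0, p.2 ∘L x) 0 :=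
    (hasDerivAt_const _ _).prodMk
      ((ContinuousLinearMap.compL 𝕜 V V W p.2).hasFDerivAt.comp_hasDerivAt (0 : 𝕜)
        (hasDerivAt_exp_smul_zero x))
  have hvγ : ContDiff 𝕜 ∞ fun r => v (γ r) := by
    rw [← contDiffOn_univ]
    exact hR.smooth.comp hγ.contDiffOn fun r _ => hγS r
  have hvd : HasDerivAt (fun r => v (γ r)) (fderivWithin 𝕜 v S p (0, p.2 ∘L x)) 0 := by
    have h2 := hasFDerivWithinAt_of_contDiffOn hR.smooth hpS
    rw [← hγ0] at h2
    have h4 := h2.comp_hasDerivWithinAt (0 : 𝕜) hγd.hasDerivWithinAt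
      (fun r (_ : r ∈ Set.univ) => hγS r)
    rw [hγ0] at h4
    exact h4.hasDerivAt Filter.univ_mem
  have hv0 : v (γ 0) = 0 := by rw [hγ0]; exact (hR.mem_iff_eq_zero hpS).1 hψ
  have hexp : HasDerivAt (fun r => exp (v (γ r))) (fderivWithin 𝕜 v S p (0, p.2 ∘L x)) 0 := by
    have h2 : HasFDerivAt (NormedSpace.exp : (V →L[𝕜] V) → _)
        (1 : (V →L[𝕜] V) →L[𝕜] (V →L[𝕜] V)) (v (γ 0)) := by
      rw [hv0]; exact hasFDerivAt_exp_zero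
    exact h2.comp_hasDerivAt (0 : 𝕜) hvd
  have hγ2 : HasDerivAt (fun r => (γ r).2) (p.2 ∘L x) 0 :=
    (ContinuousLinearMap.compL 𝕜 V V W p.2).hasFDerivAt.comp_hasDerivAt (0 : 𝕜)
      (hasDerivAt_exp_smul_zero x)
  have hd := hγ2.clm_comp hexp
  have h1 := mem_tangentAt_of_curve (M := opSet (framesIn R t))
    (γ := fun r => (γ r).2 ∘L exp (v (γ r)))
    ((contDiff_snd.comp hγ).clm_comp ((contDiff_exp 𝕜).comp hvγ)).contDiffAt
    (Filter.Eventually.of_forall fun r =>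
      (mem_opSet_framesIn fun p => hR.exists_equiv hS (p := p)).2 (hR.rmul_exp_mem (hγS r))) hd
  have h2 : (γ 0).2 ∘L exp (v (γ 0)) = ψ := by
    rw [hv0, hγ0, NormedSpace.exp_zero]
    rfl
  rw [h2, hv0, hγ0, NormedSpace.exp_zero] at h1
  change (ψ : V →L[𝕜] W) ∘L (x + _) ∈ tangentAt 𝕜 _ _
  rw [ContinuousLinearMap.comp_add]
  exact h1

include hF hN hS hR hM hK hk in
-- Leading parts of vertical vectors lie in the prolongation. Conversely u ∈ 𝔲_j is the leading part
-- of the vertical vector u + dv(u): in positive degree j the degree j part of dv(u) lies in s_j ∩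
-- 𝔲_j = 0, and for j = 0 all of dv(u) has positive degree. Degrees beyond k do not occur by the
-- depth bound.
theorem grSubspace_verticalSpace {t : 𝕜} {ψ : V ≃L[𝕜] W} (hψ : (t, (ψ : V →L[𝕜] W)) ∈ R) :
    grSubspace 𝒱 (verticalSpace (framesIn R) t ψ) = uPlus 𝒱 J G m := by
  have hpS := hR.subset hψ
  refine le_antisymm (iSup_le fun i => ?_) (iSup_le fun j => ?_)
  · rintro _ ⟨z, ⟨hz, hzi⟩, rfl⟩
    have hz0 : ((0 : 𝕜), (ψ : V →L[𝕜] W) ∘L z) ∈ tangentAt 𝕜 R (t, (ψ : V →L[𝕜] W)) :=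
      mk_mem_tangentAt_of_fiber (fun p => hR.exists_equiv hS (p := p)) hz
    have hz1 := ((hS.tangent _ hpS 0 z (hR.tangentAt_le hz0)).2.2 rfl).1
    by_cases hi : 0 ≤ i
    · obtain ⟨j, rfl⟩ := Int.eq_ofNat_of_zero_le hi
      by_cases hj : j ≤ k
      · exact le_iSup (fun n : ℕ => prolong 𝒱 J G m (n + 1)) j
          (hR.degPart_mem_of_tangent hN hS hM hψ hz0 hj hzi)
      · rw [hk _ (by rw [abs_of_nonneg hi]; lia)]
        exact zero_mem _
    · rw [degPart_of_homFilt 𝒱 hz1 (by lia)]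
      exact zero_mem _
  · intro u hu
    have hul := prolong_le_lieDeg 𝒱 J G m j hu
    by_cases hj : j ≤ k
    swap
    · have h1 := degPart_of_mem 𝒱 hul.2
      rw [hk _ (by rw [abs_of_nonneg (by lia)]; lia)] at h1
      rw [← h1]
      exact zero_mem _
    have hux : u ∈ lineLie 𝒱 J G m := by
      refine ⟨lieFilt_antitone 𝒱 J G (by lia) (lieDeg_le_lieFilt 𝒱 J G j hul), ?_⟩
      change degPart 𝒱 0 u ∈ prolong 𝒱 J G m 1
      rcases Nat.eq_zero_or_pos j with rfl | hj0
      · rw [degPart_of_mem 𝒱 (by exact_mod_cast hul.2)]; exact hu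
      · rw [degPart_of_mem_ne 𝒱 hul.2 (by lia)]; exact zero_mem _
    have h1 := hR.add_fderivWithin_mem_verticalSpace hF hS hK hψ hux
    have h0 := hS.vertical _ hpS u hux.1 hux.2
    have h2 := hR.fderivWithin_mem_slice hψ h0
    set d := fderivWithin 𝕜 v S (t, (ψ : V →L[𝕜] W)) (0, (ψ : V →L[𝕜] W) ∘L u)
    have hd : d ∈ homFilt 𝒱 (j + 1) := by
      rcases Nat.eq_zero_or_pos j with rfl | hj0
      · exact_mod_cast sliceSum_le_homFilt k h2
      · obtain ⟨h3, h4⟩ := hR.fderivWithin_vertical hN hS hM hψ hj0 hj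
          (lieDeg_le_lieFilt 𝒱 J G j hul)
        rw [degPart_of_mem 𝒱 hul.2] at h4
        have h5 := (Submodule.add_mem_iff_right _ hu).1 h4
        exact homFilt_succ 𝒱 h3 (hN.disjoint j _ (h2.1 j hj0 hj) h5)
    have h3 := degPart_mem_grSubspace 𝒱 (j := j) h1
      (add_mem (homDeg_le_homFilt 𝒱 _ hul.2) (homFilt_antitone 𝒱 (by lia) hd))
    rwa [map_add, degPart_of_mem 𝒱 hul.2, degPart_of_homFilt 𝒱 hd (by lia), add_zero] at h3

include hN hS hR hM hk in
/-- The normalized connection on a complete normalization. -/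
theorem exists_normalized_connection :
    ∃ c : 𝕜 × (V →L[𝕜] W) → (V →L[𝕜] V), ContDiffOn 𝕜 ∞ c R ∧ ∀ p ∈ R,
      ((1 : 𝕜), p.2 ∘L c p) ∈ tangentAt 𝕜 R p ∧ (∀ j : ℕ, degPart 𝒱 (j : ℤ) (c p) ∈ N) ∧
        ∀ c' : V →L[𝕜] V, ((1 : 𝕜), p.2 ∘L c') ∈ tangentAt 𝕜 R p →
          (∀ j : ℕ, degPart 𝒱 (j : ℤ) c' ∈ s j) → c' = c p := by
  have huniq : ∀ p ∈ R, ∀ c c' : V →L[𝕜] V, ((1 : 𝕜), p.2 ∘L c) ∈ tangentAt 𝕜 R p →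
      ((1 : 𝕜), p.2 ∘L c') ∈ tangentAt 𝕜 R p → (∀ j : ℕ, degPart 𝒱 (j : ℤ) c ∈ s j) →
      (∀ j : ℕ, degPart 𝒱 (j : ℤ) c' ∈ s j) → c = c' := by
    intro p hp c c' hc hc' hcs hcs'
    have h1 := (hR.sub_mem_of_slice hN hS hM hp hc hc' le_rfl (fun j _ => hcs j)
      fun j _ => hcs' j).2
    exact sub_eq_zero.1 (homFilt_eq_bot_of_le 𝒱 hk (by push_cast; lia) h1)
  have hex : ∀ p, ∃ c : V →L[𝕜] V, p ∈ R → ((1 : 𝕜), p.2 ∘L c) ∈ tangentAt 𝕜 R p ∧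
      ∀ j : ℕ, degPart 𝒱 (j : ℤ) c ∈ s j := by
    intro p
    by_cases hp : p ∈ R
    · obtain ⟨O, -, hpO, f, -, hf⟩ := hR.exists_connection hN hS hM (hR.subset hp)
      exact ⟨f p, fun _ => hf p hpO hp⟩
    · exact ⟨0, fun h => absurd h hp⟩
  choose c hc using hex
  refine ⟨c, fun p hp => ?_, fun p hp => ⟨(hc p hp).1, fun j => ?_, fun c' h1 h2 =>
    huniq p hp _ _ h1 (hc p hp).1 h2 (hc p hp).2⟩⟩
  -- The field c is chosen pointwise; by uniqueness it coincides near p with a smooth local one.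
  · obtain ⟨O, hO, hpO, f, hf, hfR⟩ := hR.exists_connection hN hS hM (hR.subset hp)
    have h1 : ContDiffWithinAt 𝕜 ∞ f R p :=
      (hf p ⟨hR.subset hp, hpO⟩).mono_of_mem_nhdsWithin (Filter.inter_mem
        (Filter.mem_of_superset self_mem_nhdsWithin hR.subset)
        (mem_nhdsWithin_of_mem_nhds (hO.mem_nhds hpO)))
    refine h1.congr_of_eventuallyEq ?_ ?_
    · filter_upwards [self_mem_nhdsWithin, mem_nhdsWithin_of_mem_nhds (hO.mem_nhds hpO)]
        with q hq hqO
      exact huniq q hq _ _ (hc q hq).1 (hfR q hqO hq).1 (hc q hq).2 (hfR q hqO hq).2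
    · exact huniq p hp _ _ (hc p hp).1 (hfR p hpO hp).1 (hc p hp).2 (hfR p hpO hp).2
  -- Order k normalizes only the degrees below k; the depth bound kills those from k on.
  · by_cases hj : j < k
    · exact hR.mem_normal_of_slice hN hS hM hp (hc p hp).1 (fun j _ => (hc p hp).2 j) j hj
    · rw [hk _ (by rw [abs_of_nonneg (by lia)]; lia)]
      exact zero_mem _

end IsReduction

end Frames

/-! ### Normalized pairs: existence, uniqueness and completeness -/

section Normalized

variable {𝕜 : Type*} [RCLike 𝕜]
variable {V : Type*} [NormedAddCommGroup V] [NormedSpace 𝕜 V]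
variable {W : Type*} [NormedAddCommGroup W] [NormedSpace 𝕜 W]
variable {𝒱 : ℤ → Submodule 𝕜 V} {J : V ≃L[𝕜] W} {G : Subgroup (W ≃L[𝕜] W)}
variable {m : Submodule 𝕜 (V →L[𝕜] V)} {D : Set 𝕜} {Λ : 𝕜 → ℤ → Submodule 𝕜 W}
variable [DirectSum.Decomposition 𝒱] [FiniteDimensional 𝕜 V]
variable {δ : V →L[𝕜] V} {N : Submodule 𝕜 (m →ₗ[𝕜] (V →L[𝕜] V))}
variable {s : ℕ → Submodule 𝕜 (V →L[𝕜] V)}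
variable {S R : Set (𝕜 × (V →L[𝕜] W))} {k : ℕ} {v : 𝕜 × (V →L[𝕜] W) → (V →L[𝕜] V)}
variable [CompleteSpace V]

theorem preconnectedSpace_submodule {E : Type*} [NormedAddCommGroup E] [NormedSpace 𝕜 E]
    (L : Submodule 𝕜 E) : PreconnectedSpace L := by
  let := NormedSpace.restrictScalars ℝ 𝕜 L
  infer_instance

theorem mem_totalSpace {P : 𝕜 → Set (V ≃L[𝕜] W)} {t : 𝕜} {ψ : V ≃L[𝕜] W} :
    (t, (ψ : V →L[𝕜] W)) ∈ totalSpace P D ↔ t ∈ D ∧ ψ ∈ P t := by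
  refine and_congr_right fun _ => ⟨?_, fun h => ⟨ψ, h, rfl⟩⟩
  rintro ⟨φ, hφ, h⟩
  rwa [← ContinuousLinearEquiv.coe_injective h]

theorem exists_of_mem_totalSpace {P : 𝕜 → Set (V ≃L[𝕜] W)} {p : 𝕜 × (V →L[𝕜] W)}
    (hp : p ∈ totalSpace P D) : ∃ ψ ∈ P p.1, p = (p.1, (ψ : V →L[𝕜] W)) := by
  obtain ⟨ψ, hψ, h⟩ := hp.2
  exact ⟨ψ, hψ, Prod.ext rfl h.symm⟩

/-- The structure function at δ is a nonzero multiple of ψ⁻¹ times the horizontal lift of the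
coordinate field. As 𝒩 is a graded subspace, normalization transfers to this lift component by
component. -/
theorem IsNormalized.exists_normal {P : 𝕜 → Set (V ≃L[𝕜] W)}
    {H : 𝕜 → (V ≃L[𝕜] W) → Submodule 𝕜 (𝕜 × (V →L[𝕜] W))}
    (hP : IsNormalized 𝒱 J G D Λ m P H N) (hN : IsNormalization 𝒱 J G m N) (hδ : δ ∈ m)
    (h0 : δ ≠ 0) {t : 𝕜} (ht : t ∈ D)
    {ψ : V ≃L[𝕜] W} (hψ : ψ ∈ P t) : ∃ c : V →L[𝕜] V,
      ((1 : 𝕜), (ψ : V →L[𝕜] W) ∘L c) ∈ tangentAt 𝕜 (totalSpace P D) (t, (ψ : V →L[𝕜] W)) ∧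
      H t ψ = Submodule.span 𝕜 {((1 : 𝕜), (ψ : V →L[𝕜] W) ∘L c)} ∧
      ∀ j : ℕ, degPart 𝒱 (j : ℤ) c ∈ N.map (evalAt hδ) := by
  obtain ⟨h, -, hh⟩ := hP.ehresmann
  obtain ⟨h1, h2⟩ := hh t ht ψ hψ
  have h3 : (ψ : V →L[𝕜] W) ∘L ((ψ.symm : W →L[𝕜] V) ∘L h (t, (ψ : V →L[𝕜] W))) =
      h (t, (ψ : V →L[𝕜] W)) := by
    ext x; simp
  refine ⟨(ψ.symm : W →L[𝕜] V) ∘L h (t, (ψ : V →L[𝕜] W)), by rwa [h3], by rwa [h3], fun j => ?_⟩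
  obtain ⟨c, hc, hcN⟩ := hP.normalized t ht ψ hψ
  obtain ⟨x, hx, hxδ, hcx⟩ := hc ⟨δ, hδ⟩
  rw [h2] at hx
  obtain ⟨a, rfl⟩ := Submodule.mem_span_singleton.1 hx
  have h4 : (ψ.symm : W →L[𝕜] V) ∘L (a • ((1 : 𝕜), h (t, (ψ : V →L[𝕜] W)))).2 =
      a • ((ψ.symm : W →L[𝕜] V) ∘L h (t, (ψ : V →L[𝕜] W))) := by
    ext x; simp
  rw [h4] at hcx hxδ
  have ha : a ≠ 0 := by
    rintro rfl
    rw [zero_smul, map_zero] at hxδ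
    exact h0 hxδ.symm
  have h5 := Submodule.mem_map_of_mem (f := evalAt hδ) (hN.graded _ hcN j)
  rw [evalAt_apply] at h5
  change degPart 𝒱 (j : ℤ) (nonnegPart 𝒱 (c ⟨δ, hδ⟩)) ∈ N.map (evalAt hδ) at h5
  rw [degPart_nonnegPart, if_pos (by lia), hcx, map_smul] at h5
  exact (Submodule.smul_mem_iff _ ha).1 h5

/-- The horizontal lines of the connection with velocities `ψ ∘ c`. -/
def horizontalLine (c : 𝕜 × (V →L[𝕜] W) → (V →L[𝕜] V)) (t : 𝕜) (ψ : V ≃L[𝕜] W) :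
    Submodule 𝕜 (𝕜 × (V →L[𝕜] W)) :=
  Submodule.span 𝕜 {((1 : 𝕜), (ψ : V →L[𝕜] W) ∘L c (t, (ψ : V →L[𝕜] W)))}

section

variable (hF : ∀ t ∈ D, ∃ O A, t ∈ O ∧ O ⊆ D ∧
    IsFrameSection 𝒱 J G δ (totalSpace (frameFiber 𝒱 J G Λ m) D) O A)
  (hδ : δ ∈ m) (hspan : m = Submodule.span 𝕜 {δ}) (hN : IsNormalization 𝒱 J G m N)
  (hN' : IsNormalForm 𝒱 J G m δ (N.map (evalAt hδ)) s)
  (hS : IsFrameManifold 𝒱 J G m δ (totalSpace (frameFiber 𝒱 J G Λ m) D))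
  (hR : IsReduction 𝒱 J G m (N.map (evalAt hδ)) s (totalSpace (frameFiber 𝒱 J G Λ m) D) R k v)
  (hM : IsExpGroup (opSet (modelGroup J G)) (modelLie J G))
  (hK : IsExpGroup (lineSet 𝒱 J G δ) (lineLie 𝒱 J G m))
  (hk : ∀ i : ℤ, (k : ℤ) ≤ |i| → ∀ x, degPart 𝒱 i x = 0)

include hR hS in
theorem IsReduction.totalSpace_framesIn : totalSpace (framesIn R) D = R :=
  FlagCurve.totalSpace_framesIn (fun _ hp => hR.exists_equiv hS hp) fun _ hp => (hR.subset hp).1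

include hR in
theorem IsReduction.framesIn_subset (t : 𝕜) : framesIn R t ⊆ frameFiber 𝒱 J G Λ m t :=
  fun _ hψ => (mem_totalSpace.1 (hR.subset hψ)).2

include hF hδ hspan hN' hS hR hM hK hk in
theorem IsReduction.isNormalized [FiniteDimensional 𝕜 W] [CompleteSpace W]
    (hsymbol : ∀ t ∈ D, m ∈ symbolAt 𝒱 J G Λ t) {c : 𝕜 × (V →L[𝕜] W) → (V →L[𝕜] V)}
    (hc : ContDiffOn 𝕜 ∞ c R) (hcR : ∀ p ∈ R, ((1 : 𝕜), p.2 ∘L c p) ∈ tangentAt 𝕜 R p ∧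
      ∀ j : ℕ, degPart 𝒱 (j : ℤ) (c p) ∈ N.map (evalAt hδ)) :
    IsNormalized 𝒱 J G D Λ m (framesIn R) (horizontalLine c) N := by
  have hF' : ∀ p ∈ totalSpace (frameFiber 𝒱 J G Λ m) D, ∃ O A, p.1 ∈ O ∧
      IsFrameSection 𝒱 J G δ (totalSpace (frameFiber 𝒱 J G Λ m) D) O A := fun p hp => by
    obtain ⟨O, A, h1, -, h2⟩ := hF p.1 hp.1
    exact ⟨O, A, h1, h2⟩
  have htot := hR.totalSpace_framesIn hδ hS
  refine ⟨⟨⟨fun t _ => hR.framesIn_subset hδ t, fun t ht => ?_,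
    fun t _ => hR.isSubmanifold_framesIn hF' hS hK t, fun t ht => hR.locTriv hS hF ht⟩,
    fun t ht ψ hψ => hR.grSubspace_verticalSpace hF' hN' hS hM hK hk hψ⟩,
    ⟨fun p => p.2 ∘L c p, ?_, fun t ht ψ hψ => ⟨?_, rfl⟩⟩, fun t ht ψ hψ => ?_⟩
  · obtain ⟨A, hA, x, hx, hmx⟩ := hsymbol t ht
    have h1 : (t, (A : V →L[𝕜] W)) ∈ totalSpace (frameFiber 𝒱 J G Λ m) D :=
      mem_totalSpace.2 ⟨ht, hA, x, hx, hmx⟩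
    have h2 := hR.rmul_exp_mem h1
    obtain ⟨ψ, hψ⟩ := hR.exists_equiv hS h2
    refine ⟨ψ, ?_⟩
    change (t, (ψ : V →L[𝕜] W)) ∈ R
    rw [← hψ]
    exact h2
  · rw [htot]
    exact contDiffOn_snd.clm_comp hc
  · rw [htot]
    exact (hcR _ hψ).1
  · obtain ⟨h1, h2⟩ := hcR _ hψ
    set c₀ := c (t, (ψ : V →L[𝕜] W)) with hc₀
    obtain ⟨h3, ⟨l, hl, hl0⟩, -⟩ := hS.tangent _ (hR.subset hψ) 1 _ (hR.tangentAt_le h1)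
    have hl0 := hl0 one_ne_zero
    -- The velocity over the unit vector of the base has part lδ in degree -1, so the value of the
    -- structure function at δ is obtained by dividing by l.
    obtain ⟨c', hc'⟩ := evalAt_surjective hδ hspan hN'.ne_zero (l⁻¹ • c₀)
    refine ⟨c', fun x => ?_, ?_⟩
    · obtain ⟨a, ha⟩ := Submodule.mem_span_singleton.1 (hspan.le x.2)
      have hx : x = a • ⟨δ, hδ⟩ := Subtype.ext ha.symm
      have h4 : (ψ.symm : W →L[𝕜] V) ∘L
          ((a * l⁻¹) • ((1 : 𝕜), (ψ : V →L[𝕜] W) ∘L c₀)).2 = (a * l⁻¹) • c₀ := by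
        ext y; simp
      refine ⟨(a * l⁻¹) • ((1 : 𝕜), (ψ : V →L[𝕜] W) ∘L c₀),
        Submodule.smul_mem _ _ (Submodule.mem_span_singleton_self _), ?_, ?_⟩
      · rw [h4, map_smul, hl, smul_smul, mul_assoc, inv_mul_cancel₀ hl0, mul_one, ha]
      · rw [h4, hx, map_smul, mul_smul, ← hc']
        rfl
    · refine mem_of_evalAt_mem hδ hspan ?_
      change nonnegPart 𝒱 (evalAt hδ c') ∈ N.map (evalAt hδ)
      rw [hc', map_smul]
      refine Submodule.smul_mem _ _ (mem_of_forall_degPart 𝒱 fun i => ?_)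
      rw [degPart_nonnegPart]
      split_ifs with hi
      · obtain ⟨j, rfl⟩ := Int.eq_ofNat_of_zero_le hi
        exact h2 j
      · exact zero_mem _

include hS hR in
theorem IsReduction.continuousOn_apply_rmul_exp {t : 𝕜} (ht : t ∈ D) {ψ : V ≃L[𝕜] W}
    (hψ : ψ ∈ frameFiber 𝒱 J G Λ m t) :
    ContinuousOn (fun x => v (t, (ψ : V →L[𝕜] W) ∘L exp x)) (lieFilt J G 𝒱 1) := by
  refine hR.smooth.continuousOn.comp (Continuous.continuousOn ?_)
    fun x hx => hS.mul_exp _ (mem_totalSpace.2 ⟨ht, hψ⟩) x hx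
  exact continuous_const.prodMk
    ((ContinuousLinearMap.compL 𝕜 V V W (ψ : V →L[𝕜] W)).continuous.comp (continuous_exp 𝕜))

include hS hR in
-- The value v(ψ) gives a point of the set, and the set is the zero locus of the continuous function
-- x ↦ v(ψ e^x) on the closed subspace 𝔤_{>0}.
theorem IsReduction.isComplete [FiniteDimensional 𝕜 (V →L[𝕜] V)]
    (hN' : IsNormalForm 𝒱 J G m δ (N.map (evalAt hδ)) s) :
    IsComplete 𝒱 J G D Λ m (framesIn R) := by
  intro t ht ψ hψ
  have hp : (t, (ψ : V →L[𝕜] W)) ∈ totalSpace (frameFiber 𝒱 J G Λ m) D :=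
    mem_totalSpace.2 ⟨ht, hψ⟩
  have hR' := fun p => hR.exists_equiv hS (p := p)
  refine ⟨⟨v (t, (ψ : V →L[𝕜] W)), hN'.sliceSum_le k (hR.mem_slice _ hp),
    (mem_opSet_framesIn hR').2 (hR.rmul_exp_mem hp)⟩, ?_⟩
  have h1 : {x | x ∈ lieFilt J G 𝒱 1 ∧ (ψ : V →L[𝕜] W) ∘L exp x ∈ opSet (framesIn R t)} =
      (lieFilt J G 𝒱 1 : Set (V →L[𝕜] V)) ∩
        (fun x => v (t, (ψ : V →L[𝕜] W) ∘L exp x)) ⁻¹' {0} := by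
    ext x
    refine and_congr_right fun hx => ?_
    rw [mem_opSet_framesIn hR']
    exact hR.mem_iff_eq_zero (hS.mul_exp _ hp x hx)
  rw [h1]
  exact (hR.continuousOn_apply_rmul_exp hδ hS ht hψ).preimage_isClosed_of_isClosed
    (Submodule.closed_of_finiteDimensional _) isClosed_singleton

include hN hN' in
theorem totalSpace_subset
    (hRt : R = tower 𝒱 (N.map (evalAt hδ)) (totalSpace (frameFiber 𝒱 J G Λ m) D) k)
    {P : 𝕜 → Set (V ≃L[𝕜] W)} {H : 𝕜 → (V ≃L[𝕜] W) → Submodule 𝕜 (𝕜 × (V →L[𝕜] W))}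
    (hP : IsNormalized 𝒱 J G D Λ m P H N) : totalSpace P D ⊆ R := by
  rw [hRt]
  have h1 : totalSpace P D ⊆ totalSpace (frameFiber 𝒱 J G Λ m) D := by
    rintro p ⟨hpD, ψ, hψ, h⟩
    exact ⟨hpD, ψ, hP.quasiPrincipal.1.subset _ hpD hψ, h⟩
  refine subset_tower h1 (fun p hp => ?_) k
  obtain ⟨ψ, hψ, hpψ⟩ := exists_of_mem_totalSpace hp
  obtain ⟨c, h1, -, h2⟩ := hP.exists_normal hN hδ hN'.ne_zero hp.1 hψ
  rw [hpψ]
  exact ⟨c, h1, h2⟩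

include hδ hN hN' in
theorem IsNormalized.eq_horizontalLine {P : 𝕜 → Set (V ≃L[𝕜] W)}
    {H : 𝕜 → (V ≃L[𝕜] W) → Submodule 𝕜 (𝕜 × (V →L[𝕜] W))}
    (hP : IsNormalized 𝒱 J G D Λ m P H N) (hPR : totalSpace P D ⊆ R)
    {c : 𝕜 × (V →L[𝕜] W) → (V →L[𝕜] V)} (hcR : ∀ p ∈ R, ∀ c' : V →L[𝕜] V,
      ((1 : 𝕜), p.2 ∘L c') ∈ tangentAt 𝕜 R p → (∀ j : ℕ, degPart 𝒱 (j : ℤ) c' ∈ s j) → c' = c p)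
    {t : 𝕜} (ht : t ∈ D) {ψ : V ≃L[𝕜] W} (hψ : ψ ∈ P t) : H t ψ = horizontalLine c t ψ := by
  obtain ⟨c', h1, h2, h3⟩ := hP.exists_normal hN hδ hN'.ne_zero ht hψ
  have h4 := hcR _ (hPR (mem_totalSpace.2 ⟨ht, hψ⟩)) c'
    (tangentAt_mono (eventually_nhdsWithin_of_forall hPR) h1) fun j => by
      have := hN'.le_slice _ (h3 j) j
      rwa [degPart_degPart, if_pos rfl] at this
  rw [h2, h4]
  rfl

include hF hδ hN hN' hS hR hM hK hk in
-- Equality of the graded vertical spaces makes the smaller fibre open in the larger one, and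
-- completeness makes its trace on an exponential orbit closed and non-empty. Connectedness of
-- 𝔤_{>0} then carries membership to ψ.
theorem IsReduction.framesIn_eq [FiniteDimensional 𝕜 W] [CompleteSpace W]
    [FiniteDimensional 𝕜 (V →L[𝕜] W)]
    {P : 𝕜 → Set (V ≃L[𝕜] W)} {H : 𝕜 → (V ≃L[𝕜] W) → Submodule 𝕜 (𝕜 × (V →L[𝕜] W))}
    (hP : IsNormalized 𝒱 J G D Λ m P H N) (hcomplete : IsComplete 𝒱 J G D Λ m P)
    (hPR : totalSpace P D ⊆ R) {t : 𝕜} (ht : t ∈ D) : P t = framesIn R t := by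
  have hF' : ∀ p ∈ totalSpace (frameFiber 𝒱 J G Λ m) D, ∃ O A, p.1 ∈ O ∧
      IsFrameSection 𝒱 J G δ (totalSpace (frameFiber 𝒱 J G Λ m) D) O A := fun p hp => by
    obtain ⟨O, A, h1, -, h2⟩ := hF p.1 hp.1
    exact ⟨O, A, h1, h2⟩
  have hR' := fun p => hR.exists_equiv hS (p := p)
  have hsub : P t ⊆ framesIn R t := fun ψ hψ => hPR (mem_totalSpace.2 ⟨ht, hψ⟩)
  refine hsub.antisymm fun ψ hψ => ?_
  have hopen : ∀ φ ∈ P t, opSet (P t) ∈ 𝓝[opSet (framesIn R t)] (φ : V →L[𝕜] W) := by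
    intro φ hφ
    refine (hR.isSubmanifold_framesIn hF' hS hK t).mem_nhdsWithin_of_tangentAt_le
      (hP.quasiPrincipal.1.fiber t ht) (Set.image_mono hsub) ⟨φ, hφ, rfl⟩ fun X hX => ?_
    have h1 : verticalSpace (framesIn R) t φ ≤ verticalSpace P t φ := by
      refine le_of_grSubspace_le 𝒱 (fun z hz => ?_) ?_
      · exact tangentAt_mono (eventually_nhdsWithin_of_forall (Set.image_mono hsub)) hz
      · rw [hR.grSubspace_verticalSpace hF' hN' hS hM hK hk (hsub hφ),
          hP.quasiPrincipal.2 t ht φ hφ]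
    have h2 : (φ : V →L[𝕜] W) ∘L ((φ.symm : W →L[𝕜] V) ∘L X) = X := by ext x; simp
    have h3 : (φ.symm : W →L[𝕜] V) ∘L X ∈ verticalSpace (framesIn R) t φ := by
      change (φ : V →L[𝕜] W) ∘L ((φ.symm : W →L[𝕜] V) ∘L X) ∈ tangentAt 𝕜 _ _
      rwa [h2]
    have h4 : (φ : V →L[𝕜] W) ∘L ((φ.symm : W →L[𝕜] V) ∘L X) ∈ tangentAt 𝕜 _ _ := h1 h3
    rwa [h2] at h4
  have hψS : (t, (ψ : V →L[𝕜] W)) ∈ totalSpace (frameFiber 𝒱 J G Λ m) D := hR.subset hψ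
  have hψF := (mem_totalSpace.1 hψS).2
  obtain ⟨⟨x₀, hx₀, hx₀P⟩, hclosed⟩ := hcomplete t ht ψ hψF
  let p : lieFilt J G 𝒱 1 → 𝕜 × (V →L[𝕜] W) := fun y => (t, (ψ : V →L[𝕜] W) ∘L exp (y : V →L[𝕜] V))
  have hpS : ∀ y, p y ∈ totalSpace (frameFiber 𝒱 J G Λ m) D := fun y => hS.mul_exp _ hψS _ y.2
  have hvc : Continuous fun y => v (p y) :=
    continuousOn_iff_continuous_domRestrict.1 (hR.continuousOn_apply_rmul_exp hδ hS ht hψF)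
  -- The frame ψ e^y need not lie in `R`, so it is moved there by exp(v). This makes the connected
  -- space 𝔤_{>0} parametrize frames of the larger fibre.
  let ρ : lieFilt J G 𝒱 1 → (V →L[𝕜] W) := fun y =>
    (ψ : V →L[𝕜] W) ∘L (exp (y : V →L[𝕜] V) * exp (v (p y)))
  have hec : Continuous fun y : lieFilt J G 𝒱 1 => exp (y : V →L[𝕜] V) * exp (v (p y)) :=
    ((continuous_exp 𝕜).comp continuous_subtype_val).mul ((continuous_exp 𝕜).comp hvc)
  have hρc : Continuous ρ :=
    (ContinuousLinearMap.compL 𝕜 V V W (ψ : V →L[𝕜] W)).continuous.comp hec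
  have hρR : ∀ y, ρ y ∈ opSet (framesIn R t) := fun y =>
    (mem_opSet_framesIn hR').2 (hR.rmul_exp_mem (hpS y))
  have hlog : ∀ y : lieFilt J G 𝒱 1,
      unipLog 𝒱 (exp (y : V →L[𝕜] V) * exp (v (p y))) ∈ lieFilt J G 𝒱 1 ∧
      exp (unipLog 𝒱 (exp (y : V →L[𝕜] V) * exp (v (p y)))) =
        exp (y : V →L[𝕜] V) * exp (v (p y)) := by
    intro y
    have h1 := hN'.sliceSum_le k (hR.mem_slice _ (hpS y))
    obtain ⟨z, hz, hz1, h2⟩ := exists_exp_mul_exp_eq 𝒱 hM y.2.1 y.2.2 h1.1 h1.2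
    rw [h2, unipLog_exp 𝒱 hz1]
    exact ⟨⟨hz, hz1⟩, rfl⟩
  -- Completeness is a statement about logarithms x of ψ⁻¹ρ(y); it transfers to y because the
  -- unipotent logarithm is continuous.
  have hclopen : IsClopen {y | ρ y ∈ opSet (P t)} := by
    constructor
    · have h1 : {y | ρ y ∈ opSet (P t)} =
          (fun y : lieFilt J G 𝒱 1 => unipLog 𝒱 (exp (y : V →L[𝕜] V) * exp (v (p y)))) ⁻¹'
            {x | x ∈ lieFilt J G 𝒱 1 ∧ (ψ : V →L[𝕜] W) ∘L exp x ∈ opSet (P t)} := by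
        ext y
        change ρ y ∈ opSet (P t) ↔ _ ∧ (ψ : V →L[𝕜] W) ∘L exp _ ∈ opSet (P t)
        rw [(hlog y).2]
        exact ⟨fun h => ⟨(hlog y).1, h⟩, fun h => h.2⟩
      rw [h1]
      exact hclosed.preimage ((continuous_unipLog 𝒱).comp hec)
    · rw [isOpen_iff_mem_nhds]
      rintro y ⟨φ, hφ, hφy⟩
      have h1 := hopen φ hφ
      change (φ : V →L[𝕜] W) = ρ y at hφy
      rw [hφy] at h1
      exact tendsto_nhdsWithin_of_tendsto_nhds_of_eventually_within ρ hρc.continuousAt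
        (Filter.Eventually.of_forall hρR) h1
  have : PreconnectedSpace (lieFilt J G 𝒱 1) := preconnectedSpace_submodule _
  have huniv : {y | ρ y ∈ opSet (P t)} = Set.univ := by
    have hrmul : ∀ y : lieFilt J G 𝒱 1, p y ∈ R →
        ρ y = (ψ : V →L[𝕜] W) ∘L exp (y : V →L[𝕜] V) := by
      intro y hy
      change (ψ : V →L[𝕜] W) ∘L (exp (y : V →L[𝕜] V) * exp (v (p y))) = _
      rw [(hR.mem_iff_eq_zero (hpS y)).1 hy, NormedSpace.exp_zero, mul_one]
    refine hclopen.eq_univ ⟨⟨x₀, hx₀⟩, ?_⟩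
    change ρ ⟨x₀, hx₀⟩ ∈ opSet (P t)
    rw [hrmul]
    · exact hx₀P
    · exact (mem_opSet_framesIn hR').1 (Set.image_mono hsub hx₀P)
  have h0 : ρ 0 ∈ opSet (P t) := by
    have : (0 : lieFilt J G 𝒱 1) ∈ {y | ρ y ∈ opSet (P t)} := huniv ▸ Set.mem_univ _
    exact this
  have hp0 : p 0 = (t, (ψ : V →L[𝕜] W)) := by
    change (t, (ψ : V →L[𝕜] W) ∘L exp ((0 : lieFilt J G 𝒱 1) : V →L[𝕜] V)) = _
    rw [ZeroMemClass.coe_zero, NormedSpace.exp_zero]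
    rfl
  have h1 : ρ 0 = ψ := by
    change (ψ : V →L[𝕜] W) ∘L (exp ((0 : lieFilt J G 𝒱 1) : V →L[𝕜] V) * exp (v (p 0))) = ψ
    rw [hp0, (hR.mem_iff_eq_zero hψS).1 hψ, ZeroMemClass.coe_zero, NormedSpace.exp_zero, mul_one]
    rfl
  rw [h1] at h0
  obtain ⟨φ, hφ, h2⟩ := h0
  rwa [← ContinuousLinearEquiv.coe_injective h2]

end

end Normalized

/-! ### Differential inequalities and the adjoint action -/

section Calculus

variable {𝕜 : Type*} [RCLike 𝕜]

/-- A differential inequality with vanishing initial value forces a function of a real or complex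
variable to vanish. -/
theorem eq_zero_of_norm_deriv_le {E : Type*} [NormedAddCommGroup E] [NormedSpace 𝕜 E]
    {f f' : 𝕜 → E} {r K : ℝ} (hf : ∀ s ∈ Metric.ball (0 : 𝕜) r, HasDerivAt f (f' s) s)
    (hK : ∀ s ∈ Metric.ball (0 : 𝕜) r, ‖f' s‖ ≤ K * ‖f s‖) (h0 : f 0 = 0) {s : 𝕜}
    (hs : s ∈ Metric.ball (0 : 𝕜) r) : f s = 0 := by
  let := NormedSpace.restrictScalars ℝ 𝕜 E
  have htower : IsScalarTower ℝ 𝕜 E := ⟨fun a c x => by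
    rw [Algebra.smul_def, mul_smul]; rfl⟩
  -- Along the segment from 0 to s this is the real Grönwall inequality.
  have hmem : ∀ a ∈ Set.Icc (0 : ℝ) 1, (a : 𝕜) * s ∈ Metric.ball (0 : 𝕜) r := by
    intro a ha
    rw [mem_ball_zero_iff] at hs ⊢
    rw [norm_mul, RCLike.norm_ofReal, abs_of_nonneg ha.1]
    exact (mul_le_of_le_one_left (norm_nonneg s) ha.2).trans_lt hs
  have hline : ∀ a : ℝ, HasDerivAt (fun a : ℝ => (a : 𝕜) * s) s a := by
    intro a
    have h1 : HasDerivAt (fun a : ℝ => (a : 𝕜)) 1 a := by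
      simpa using (RCLike.ofRealCLM (K := 𝕜)).hasDerivAt (x := a)
    simpa using h1.mul_const s
  have hd : ∀ a ∈ Set.Icc (0 : ℝ) 1,
      HasDerivAt (fun a : ℝ => f ((a : 𝕜) * s)) (s • f' ((a : 𝕜) * s)) a := fun a ha =>
    HasDerivAt.scomp a (hf _ (hmem a ha)) (hline a)
  have h1 := eq_zero_of_abs_deriv_le_mul_abs_self_of_eq_zero_right (K := ‖s‖ * K)
    (f := fun a : ℝ => f ((a : 𝕜) * s)) (a := 0) (b := 1)
    (fun a ha => (hd a ha).continuousAt.continuousWithinAt)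
    (fun a ha => (hd a ⟨ha.1, ha.2.le⟩).hasDerivWithinAt) (by simp [h0])
    (fun a ha => by
      rw [norm_smul, mul_assoc]
      exact mul_le_mul_of_nonneg_left (hK _ (hmem a ⟨ha.1, ha.2.le⟩)) (norm_nonneg s))
    1 ⟨zero_le_one, le_rfl⟩
  simpa using h1

variable {A : Type*} [NormedRing A] [NormedAlgebra 𝕜 A] [CompleteSpace A]

theorem hasDerivAt_exp_neg_mul_mul_exp (a y : A) (s : 𝕜) :
    HasDerivAt (fun s : 𝕜 => exp (-(s • a)) * y * exp (s • a))
      (exp (-(s • a)) * y * exp (s • a) * a - a * (exp (-(s • a)) * y * exp (s • a))) s := by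
  have h1 := hasDerivAt_exp_smul_const' (𝕂 := 𝕜) (-a) s
  have h2 := hasDerivAt_exp_smul_const (𝕂 := 𝕜) a s
  have h3 := (h1.mul_const y).mul h2
  simp only [smul_neg] at h3
  refine h3.congr_deriv ?_
  noncomm_ring

/-- A subspace stable under `ad a` is stable under `Ad (exp a)`. -/
theorem exp_conj_mem_of_comm_mem [FiniteDimensional 𝕜 A] {L : Submodule 𝕜 A} {a : A}
    (ha : ∀ y ∈ L, a * y - y * a ∈ L) {y : A} (hy : y ∈ L) (s : 𝕜) :
    exp (-(s • a)) * y * exp (s • a) ∈ L := by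
  obtain ⟨π, hπL, hπ⟩ := exists_projection L
  let ν : A →L[𝕜] A := ContinuousLinearMap.id 𝕜 A - π
  have hν : ∀ x, ν x = x - π x := fun x => rfl
  let Y : 𝕜 → A := fun s => exp (-(s • a)) * y * exp (s • a)
  have hd : ∀ s, HasDerivAt (fun s => ν (Y s)) (ν (Y s * a - a * Y s)) s := fun s =>
    ν.hasFDerivAt.comp_hasDerivAt s (hasDerivAt_exp_neg_mul_mul_exp a y s)
  have hνL : ∀ x ∈ L, ν x = 0 := fun x hx => by rw [hν, hπ x hx, sub_self]
  -- The part of x in `L` contributes nothing modulo `L`, so the component transverse to `L`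
  -- satisfies a closed linear equation with zero initial value.
  have hνν : ∀ x, ν (x * a - a * x) = ν (ν x * a - a * ν x) := by
    intro x
    have h1 : x * a - a * x = (ν x * a - a * ν x) - (a * π x - π x * a) := by
      rw [hν, sub_mul, mul_sub]; abel
    rw [h1, map_sub, hνL _ (ha _ (hπL x)), sub_zero]
  have h1 : ν (Y s) = 0 := by
    refine eq_zero_of_norm_deriv_le (r := ‖s‖ + 1) (K := ‖ν‖ * (2 * ‖a‖)) (fun s _ => hd s)
      (fun s _ => ?_) ?_ (by rw [mem_ball_zero_iff]; linarith)
    · rw [hνν, mul_assoc]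
      refine (ν.le_opNorm _).trans (mul_le_mul_of_nonneg_left ?_ (norm_nonneg _))
      refine (norm_sub_le _ _).trans ?_
      have h2 := norm_mul_le (ν (Y s)) a
      have h3 := norm_mul_le a (ν (Y s))
      linarith
    · refine hνL _ ?_
      change exp (-((0 : 𝕜) • a)) * y * exp ((0 : 𝕜) • a) ∈ L
      rw [zero_smul, neg_zero, NormedSpace.exp_zero, one_mul, mul_one]
      exact hy
  rw [hν, sub_eq_zero] at h1
  change Y s ∈ L
  rw [h1]
  exact hπL _

end Calculus

/-! ### The universal prolongation and its brackets -/

section Prolongation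

variable {𝕜 : Type*} [RCLike 𝕜]
variable {V : Type*} [NormedAddCommGroup V] [NormedSpace 𝕜 V]
variable {W : Type*} [NormedAddCommGroup W] [NormedSpace 𝕜 W]
variable {𝒱 : ℤ → Submodule 𝕜 V} {J : V ≃L[𝕜] W} {G : Subgroup (W ≃L[𝕜] W)}
variable {m : Submodule 𝕜 (V →L[𝕜] V)} {δ : V →L[𝕜] V}
variable [DirectSum.Decomposition 𝒱] [FiniteDimensional 𝕜 V] [CompleteSpace V]

/-- By the Jacobi identity the bracket with ε is a sum of brackets of lower total degree, so
induction on i + j applies. When an index is already 0, its bracket with ε is in 𝔪 and the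
definition of the prolongation takes over. -/
theorem comm_mem_prolong (hM : IsExpGroup (opSet (modelGroup J G)) (modelLie J G))
    {i j : ℕ} {x y : V →L[𝕜] V} (hx : x ∈ prolong 𝒱 J G m (i + 1))
    (hy : y ∈ prolong 𝒱 J G m (j + 1)) : x * y - y * x ∈ prolong 𝒱 J G m (i + j + 1) := by
  obtain ⟨n, hn⟩ : ∃ n, n = i + j := ⟨_, rfl⟩
  induction n using Nat.strong_induction_on generalizing i j x y with
  | _ n ih =>
  refine ⟨⟨hM.lie_mem hx.1.1 hy.1.1, ?_⟩, fun ε hε => ?_⟩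
  · have h1 := homDeg_mul 𝒱 hx.1.2 hy.1.2
    have h2 := homDeg_mul 𝒱 hy.1.2 hx.1.2
    rw [add_comm] at h2
    push_cast
    exact sub_mem h1 h2
  · have h1 : (x * y - y * x) * ε - ε * (x * y - y * x) =
        ((x * ε - ε * x) * y - y * (x * ε - ε * x)) +
          (x * (y * ε - ε * y) - (y * ε - ε * y) * x) := by noncomm_ring
    rw [h1]
    have hxε := hx.2 ε hε
    have hyε := hy.2 ε hε
    refine add_mem ?_ ?_
    · rcases i with _ | i
      · have := neg_mem (hy.2 _ hxε)
        rw [neg_sub] at this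
        rwa [zero_add]
      · have := ih (i + j) (by lia) hxε hy rfl
        rwa [show i + 1 + j = i + j + 1 by ring]
    · rcases j with _ | j
      · exact hx.2 _ hyε
      · exact ih (i + j) (by lia) hx hyε rfl

variable (𝒱 J G m) in
/-- The universal prolongation `𝔪 ⊕ 𝔲_+(𝔪)`. -/
def fullProlong : Submodule 𝕜 (V →L[𝕜] V) where
  carrier := {x | x ∈ homFilt 𝒱 (-1) ∧ ∀ n : ℕ, degPart 𝒱 ((n : ℤ) - 1) x ∈ prolong 𝒱 J G m n}
  add_mem' hx hy := ⟨add_mem hx.1 hy.1, fun n => by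
    rw [map_add]; exact add_mem (hx.2 n) (hy.2 n)⟩
  zero_mem' := ⟨zero_mem _, fun n => by rw [map_zero]; exact zero_mem _⟩
  smul_mem' a x hx := ⟨Submodule.smul_mem _ a hx.1, fun n => by
    rw [map_smul]; exact Submodule.smul_mem _ a (hx.2 n)⟩

theorem mem_fullProlong_of_mem (hm : m ≤ homDeg 𝒱 (-1)) {x : V →L[𝕜] V} (hx : x ∈ m) :
    x ∈ fullProlong 𝒱 J G m := by
  refine ⟨homDeg_le_homFilt 𝒱 _ (hm hx), fun n => ?_⟩
  rcases n with _ | n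
  · rw [Nat.cast_zero, zero_sub, degPart_of_mem 𝒱 (hm hx)]
    exact hx
  · rw [degPart_of_mem_ne 𝒱 (hm hx) (by push_cast; lia)]
    exact zero_mem _

/-- No component of degree -2 arises because 𝔪 is a line and commutes with itself; the others are
handled by the definition of the prolongation. -/
theorem comm_mem_fullProlong_of_mem (hspan : m = Submodule.span 𝕜 {δ})
    (hδ : δ ∈ homDeg 𝒱 (-1)) {x : V →L[𝕜] V} (hx : x ∈ fullProlong 𝒱 J G m) :
    δ * x - x * δ ∈ fullProlong 𝒱 J G m := by
  have hδm : δ ∈ m := hspan.ge (Submodule.mem_span_singleton_self δ)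
  constructor
  · have h1 := homFilt_comm 𝒱 (homDeg_le_homFilt 𝒱 _ hδ) hx.1
    refine homFilt_antitone 𝒱 (by norm_num : (-1 : ℤ) ≤ -1 + -1 + 1) (homFilt_succ 𝒱 h1 ?_)
    rw [degPart_comm_of_mem 𝒱 hδ]
    have h2 := hx.2 0
    rw [Nat.cast_zero, zero_sub] at h2
    obtain ⟨a, ha⟩ := Submodule.mem_span_singleton.1 (hspan.le h2)
    rw [← ha, mul_smul_comm, smul_mul_assoc, sub_self]
  · intro n
    rw [sub_eq_neg_add (n : ℤ) 1, degPart_comm_of_mem 𝒱 hδ]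
    have h2 := hx.2 (n + 1)
    rw [Nat.cast_succ, add_sub_cancel_right] at h2
    have := neg_mem (h2.2 δ hδm)
    rwa [neg_sub] at this

theorem comm_mem_fullProlong (hM : IsExpGroup (opSet (modelGroup J G)) (modelLie J G))
    {j : ℕ} {u x : V →L[𝕜] V} (hu : u ∈ prolong 𝒱 J G m (j + 1))
    (hx : x ∈ fullProlong 𝒱 J G m) : u * x - x * u ∈ fullProlong 𝒱 J G m := by
  constructor
  · exact homFilt_antitone 𝒱 (by lia) (homFilt_comm 𝒱 (homDeg_le_homFilt 𝒱 _ hu.1.2) hx.1)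
  · intro n
    rw [show (n : ℤ) - 1 = j + (n - 1 - j) by ring, degPart_comm_of_mem 𝒱 hu.1.2]
    by_cases hnj : n < j
    · rw [degPart_of_homFilt 𝒱 hx.1 (by lia), mul_zero, zero_mul, sub_zero]
      exact zero_mem _
    · obtain ⟨i, rfl⟩ := Nat.exists_eq_add_of_le (not_lt.1 hnj)
      have h1 := hx.2 i
      rw [show ((j + i : ℕ) : ℤ) - 1 - j = i - 1 by push_cast; ring]
      rcases i with _ | i
      · exact hu.2 _ h1
      · exact comm_mem_prolong hM hu h1

end Prolongation

/-! ### Symmetries of the model curve of flags -/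

section Symmetry

variable {𝕜 : Type*} [RCLike 𝕜]
variable {V : Type*} [NormedAddCommGroup V] [NormedSpace 𝕜 V]
variable {W : Type*} [NormedAddCommGroup W] [NormedSpace 𝕜 W]
variable {𝒱 : ℤ → Submodule 𝕜 V} {J : V ≃L[𝕜] W} {G : Subgroup (W ≃L[𝕜] W)}
variable {m : Submodule 𝕜 (V →L[𝕜] V)} {δ : V →L[𝕜] V}
variable [DirectSum.Decomposition 𝒱] [FiniteDimensional 𝕜 V] [CompleteSpace V]

/-- The curves of flags `e^{sX} V^•` and `e^{sδ} V^•` agree up to a reparametrization when `X` is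
in the universal prolongation. -/
theorem exists_reparametrization (hspan : m = Submodule.span 𝕜 {δ}) (h0 : δ ≠ 0)
    (hδ : δ ∈ homDeg 𝒱 (-1)) {X : V →L[𝕜] V} (hX : X ∈ fullProlong 𝒱 J G m) :
    ∃ σ : 𝕜 → 𝕜, ContDiffAt 𝕜 ∞ σ 0 ∧ σ 0 = 0 ∧
      ∀ᶠ s in 𝓝 (0 : 𝕜), exp (-(σ s • δ)) * exp (s • X) ∈ homFilt 𝒱 0 := by
  obtain ⟨φ, hφ⟩ := SeparatingDual.exists_eq_one (R := 𝕜) h0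
  let ℓ : (V →L[𝕜] V) →L[𝕜] 𝕜 := φ ∘L LinearMap.toContinuousLinearMap (degPart 𝒱 (-1))
  have hℓ : ∀ x, ℓ x = φ (degPart 𝒱 (-1) x) := fun _ => rfl
  let np := LinearMap.toContinuousLinearMap (nonnegPart 𝒱)
  have hnp : ∀ x, np x = nonnegPart 𝒱 x := fun _ => rfl
  let ν : (V →L[𝕜] V) →L[𝕜] (V →L[𝕜] V) := ContinuousLinearMap.id 𝕜 _ - np
  have hν : ∀ x, ν x = x - nonnegPart 𝒱 x := fun _ => rfl
  have hℓ0 : ∀ x ∈ homFilt 𝒱 0, ℓ x = 0 := fun x hx => by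
    rw [hℓ, degPart_of_homFilt 𝒱 hx (by norm_num), map_zero]
  have hν0 : ∀ x ∈ homFilt 𝒱 0, ν x = 0 := fun x hx => by
    refine ext_degPart 𝒱 fun k => ?_
    rw [hν, map_sub, degPart_nonnegPart, map_zero]
    split_ifs with hk
    · rw [sub_self]
    · rw [degPart_of_homFilt 𝒱 hx (not_le.1 hk), sub_zero]
  have hνmem : ∀ x, ν x = 0 → x ∈ homFilt 𝒱 0 := fun x hx => by
    rw [hν, sub_eq_zero] at hx
    rw [hx]
    exact nonnegPart_mem 𝒱 x
  have hmul : ∀ w ∈ homFilt 𝒱 0, ∀ g, w * g - w * ν g ∈ homFilt 𝒱 0 := fun w hw g => by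
    rw [← mul_sub, hν, sub_sub_cancel]
    simpa using homFilt_mul 𝒱 hw (nonnegPart_mem 𝒱 g)
  -- One scalar equation, on the component of degree -1 along δ, determines σ by the implicit
  -- function theorem. The rest of the negative part of e^{-σδ}e^{sX} is then shown to vanish.
  let F : 𝕜 × 𝕜 → 𝕜 := fun z => ℓ (exp (-(z.2 • δ)) * exp (z.1 • X))
  have hF : ContDiff 𝕜 ∞ F := by
    refine ℓ.contDiff.comp (ContDiff.mul ?_ ?_)
    · exact (contDiff_exp 𝕜).comp (contDiff_snd.smul contDiff_const).neg
    · exact (contDiff_exp 𝕜).comp (contDiff_fst.smul contDiff_const)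
  have hF0 : F (0, 0) = 0 := by
    change ℓ (exp (-((0 : 𝕜) • δ)) * exp ((0 : 𝕜) • X)) = 0
    rw [zero_smul, neg_zero, zero_smul, NormedSpace.exp_zero, mul_one]
    exact hℓ0 _ (one_mem_homFilt 𝒱)
  have hinv : (fderiv 𝕜 F (0, 0) ∘L ContinuousLinearMap.inr 𝕜 𝕜 𝕜).IsInvertible := by
    refine ⟨ContinuousLinearEquiv.neg 𝕜, ?_⟩
    have h1 : HasFDerivAt (fun r : 𝕜 => F (0, r))
        (fderiv 𝕜 F (0, 0) ∘L ContinuousLinearMap.inr 𝕜 𝕜 𝕜) 0 :=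
      ((hF.differentiable (by simp)) (0, 0)).hasFDerivAt.comp (0 : 𝕜) (hasFDerivAt_prodMk_right 0 0)
    have h2 : HasDerivAt (fun r : 𝕜 => F (0, r)) (ℓ (-δ)) 0 := by
      have h3 := ℓ.hasFDerivAt.comp_hasDerivAt (0 : 𝕜) (hasDerivAt_exp_smul_zero (𝕜 := 𝕜) (-δ))
      refine h3.congr_of_eventuallyEq (Filter.Eventually.of_forall fun r => ?_)
      change ℓ (exp (-(r • δ)) * exp ((0 : 𝕜) • X)) = ℓ (exp (r • -δ))
      rw [zero_smul, NormedSpace.exp_zero, mul_one, smul_neg]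
    have h3 := h1.unique h2.hasFDerivAt
    have h4 : ℓ (-δ) = -1 := by
      rw [map_neg, hℓ, degPart_of_mem 𝒱 hδ, hφ]
    rw [h3, h4]
    ext
    simp
  obtain ⟨σ, hσ, hσ0, hσF⟩ : ∃ σ : 𝕜 → 𝕜, ContDiffAt 𝕜 ∞ σ 0 ∧ σ 0 = 0 ∧
      ∀ᶠ s in 𝓝 (0 : 𝕜), F (s, σ s) = 0 := by
    have hFc : ContDiffAt 𝕜 ∞ F ((0 : 𝕜), (0 : 𝕜)) := hF.contDiffAt
    refine ⟨hFc.implicitFunction (by simp) hinv, hFc.contDiffAt_implicitFunction (by simp) hinv,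
      hFc.implicitFunction_apply_self (by simp) hinv, ?_⟩
    have := hFc.eventually_apply_implicitFunction (by simp) hinv
    rwa [hF0] at this
  refine ⟨σ, hσ, hσ0, ?_⟩
  let g : 𝕜 → (V →L[𝕜] V) := fun s => exp (-(σ s • δ)) * exp (s • X)
  have hg0 : g 0 = 1 := by
    change exp (-(σ 0 • δ)) * exp ((0 : 𝕜) • X) = 1
    rw [hσ0, zero_smul, neg_zero, zero_smul, NormedSpace.exp_zero, mul_one]
  -- This conjugate stays in the universal prolongation, hence is a multiple of δ plus a filtered
  -- operator. So g' g⁻¹ is a multiple of δ up to a filtered operator.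
  let y : 𝕜 → (V →L[𝕜] V) := fun s => exp (-(σ s • δ)) * X * exp (σ s • δ)
  have hy : ∀ s, y s ∈ fullProlong 𝒱 J G m := fun s =>
    exp_conj_mem_of_comm_mem (fun x hx => comm_mem_fullProlong_of_mem hspan hδ hx) hX (σ s)
  have hyw : ∀ s, y s = ℓ (y s) • δ + np (y s) := by
    intro s
    have h1 := (hy s).2 0
    rw [Nat.cast_zero, zero_sub] at h1
    obtain ⟨a, ha⟩ := Submodule.mem_span_singleton.1 (hspan.le h1)
    have h2 : ℓ (y s) • δ = degPart 𝒱 (-1) (y s) := by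
      rw [hℓ, ← ha, map_smul, hφ, smul_eq_mul, mul_one]
    rw [h2]
    exact (degPart_neg_one_add_nonnegPart 𝒱 (hy s).1).symm
  have hσc : ContinuousAt σ 0 := hσ.continuousAt
  have hec : ContinuousAt (fun s => exp (-(σ s • δ))) 0 :=
    (continuous_exp 𝕜).continuousAt.comp (hσc.smul continuousAt_const).neg
  have hgc : ContinuousAt g 0 := hec.mul
    ((continuous_exp 𝕜).continuousAt.comp (continuousAt_id.smul continuousAt_const))
  have hyc : ContinuousAt y 0 := (hec.mul continuousAt_const).mul
    ((continuous_exp 𝕜).continuousAt.comp (hσc.smul continuousAt_const))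
  have hσd : ∀ᶠ s in 𝓝 (0 : 𝕜), DifferentiableAt 𝕜 σ s := by
    have h1 : ContDiffAt 𝕜 1 σ 0 := hσ.of_le (by norm_cast)
    filter_upwards [h1.eventually (by simp)] with s hs using hs.differentiableAt (by simp)
  have hgd : ∀ s, DifferentiableAt 𝕜 σ s →
      HasDerivAt g ((ℓ (y s) - deriv σ s) • (δ * g s) + np (y s) * g s) s := by
    intro s hs
    have h1 : HasDerivAt (fun s => exp (-(σ s • δ))) (deriv σ s • (-δ * exp (-(σ s • δ)))) s := by
      have h2 := HasDerivAt.scomp s (hasDerivAt_exp_smul_const' (𝕂 := 𝕜) (-δ) (σ s)) hs.hasDerivAt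
      simp only [smul_neg] at h2
      exact h2
    have h2 := h1.mul (hasDerivAt_exp_smul_const' (𝕂 := 𝕜) X s)
    refine h2.congr_deriv ?_
    have h3 : exp (-(σ s • δ)) * (X * exp (s • X)) = y s * g s := by
      change _ = exp (-(σ s • δ)) * X * exp (σ s • δ) * (exp (-(σ s • δ)) * exp (s • X))
      rw [mul_assoc _ (exp (σ s • δ)), ← mul_assoc (exp (σ s • δ)), exp_mul_exp_neg 𝕜, one_mul,
        mul_assoc]
    rw [h3]
    conv_lhs => rw [hyw s]
    simp only [g, sub_smul, add_mul, smul_mul_assoc, neg_mul, mul_assoc, smul_neg]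
    abel
  -- Differentiating ℓ(g) = 0 bounds the coefficient of δ by the negative part ν(g). Thus ν(g)
  -- satisfies a linear differential inequality with this constant and vanishes.
  let Kf : 𝕜 → ℝ := fun s => ‖ν (δ * g s)‖ * (‖ℓ‖ * ‖np (y s)‖) / ‖ℓ (δ * g s)‖ + ‖ν‖ * ‖np (y s)‖
  have hℓδ : ℓ (δ * g 0) ≠ 0 := by
    rw [hg0, mul_one, hℓ, degPart_of_mem 𝒱 hδ, hφ]
    exact one_ne_zero
  have hKc : ContinuousAt Kf 0 := by
    have h1 : ContinuousAt (fun s => δ * g s) 0 := continuousAt_const.mul hgc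
    have h2 : ContinuousAt (fun s => ‖np (y s)‖) 0 := (np.continuous.continuousAt.comp hyc).norm
    refine ContinuousAt.add (ContinuousAt.div ((ν.continuous.continuousAt.comp h1).norm.mul
      (continuousAt_const.mul h2)) (ℓ.continuous.continuousAt.comp h1).norm ?_)
      (continuousAt_const.mul h2)
    exact norm_ne_zero_iff.2 hℓδ
  have hℓne : ∀ᶠ s in 𝓝 (0 : 𝕜), ℓ (δ * g s) ≠ 0 :=
    (ℓ.continuous.continuousAt.comp (continuousAt_const.mul hgc)).eventually_ne hℓδ
  have hK : ∀ᶠ s in 𝓝 (0 : 𝕜), Kf s < Kf 0 + 1 :=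
    hKc.eventually_lt continuousAt_const (by linarith)
  obtain ⟨r, hr, hball⟩ := Metric.eventually_nhds_iff_ball.1
    ((hσd.and (hℓne.and (hK.and hσF.eventually_nhds))))
  filter_upwards [Metric.ball_mem_nhds (0 : 𝕜) hr] with s hs
  refine hνmem _ (eq_zero_of_norm_deriv_le (f := fun s => ν (g s)) (r := r) (K := Kf 0 + 1)
    (fun s hs => ν.hasFDerivAt.comp_hasDerivAt s (hgd s (hball s hs).1)) (fun s hs => ?_) ?_ hs)
  · obtain ⟨h1, h2, h3, h4⟩ := hball s hs
    have hw : np (y s) ∈ homFilt 𝒱 0 := nonnegPart_mem 𝒱 _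
    set w := np (y s)
    set κ := ℓ (y s) - deriv σ s
    have h5 : ℓ (w * g s) = ℓ (w * ν (g s)) := by
      rw [← sub_eq_zero, ← map_sub]
      exact hℓ0 _ (hmul w hw (g s))
    have h6 : ν (w * g s) = ν (w * ν (g s)) := by
      rw [← sub_eq_zero, ← map_sub]
      exact hν0 _ (hmul w hw (g s))
    have h7 : κ * ℓ (δ * g s) + ℓ (w * g s) = 0 := by
      have h8 := ℓ.hasFDerivAt.comp_hasDerivAt s (hgd s h1)
      have h9 : HasDerivAt (fun s => ℓ (g s)) 0 s :=
        (hasDerivAt_const s (0 : 𝕜)).congr_of_eventuallyEq h4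
      have := h8.unique h9
      rwa [map_add, map_smul, smul_eq_mul] at this
    have h8 : κ = -ℓ (w * ν (g s)) / ℓ (δ * g s) := by
      rw [eq_div_iff h2, ← h5]
      exact eq_neg_of_add_eq_zero_left h7
    have h9 : ‖w * ν (g s)‖ ≤ ‖w‖ * ‖ν (g s)‖ := norm_mul_le _ _
    have h10 : ‖κ‖ ≤ ‖ℓ‖ * (‖w‖ * ‖ν (g s)‖) / ‖ℓ (δ * g s)‖ := by
      rw [h8, norm_div, norm_neg]
      gcongr
      exact (ℓ.le_opNorm _).trans (by gcongr)
    rw [map_add, map_smul, h6]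
    calc ‖κ • ν (δ * g s) + ν (w * ν (g s))‖
        ≤ ‖κ‖ * ‖ν (δ * g s)‖ + ‖ν‖ * (‖w‖ * ‖ν (g s)‖) := by
          refine (norm_add_le _ _).trans ?_
          rw [norm_smul]
          gcongr
          exact (ν.le_opNorm _).trans (by gcongr)
      _ ≤ ‖ℓ‖ * (‖w‖ * ‖ν (g s)‖) / ‖ℓ (δ * g s)‖ * ‖ν (δ * g s)‖ + ‖ν‖ * (‖w‖ * ‖ν (g s)‖) := by
          gcongr
      _ = Kf s * ‖ν (g s)‖ := by
          simp only [Kf]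
          ring
      _ ≤ (Kf 0 + 1) * ‖ν (g s)‖ := by gcongr
  · change ν (g 0) = 0
    rw [hg0]
    exact hν0 _ (one_mem_homFilt 𝒱)

theorem map_filt_eq_iff {g h : V →L[𝕜] V} {i : ℤ} :
    (filt 𝒱 i).map g.toLinearMap = (filt 𝒱 i).map h.toLinearMap ↔
      (∀ v ∈ filt 𝒱 i, ∃ w ∈ filt 𝒱 i, h w = g v) ∧ ∀ v ∈ filt 𝒱 i, ∃ w ∈ filt 𝒱 i, g w = h v := by
  constructor
  · intro hgh
    exact ⟨fun v hv => hgh.le ⟨v, hv, rfl⟩, fun v hv => hgh.ge ⟨v, hv, rfl⟩⟩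
  · rintro ⟨h1, h2⟩
    refine le_antisymm ?_ ?_
    · rintro _ ⟨v, hv, rfl⟩
      exact h1 v hv
    · rintro _ ⟨v, hv, rfl⟩
      exact h2 v hv

/-- With X = (Ad B)δ one has B e^{sδ}V^i = e^{sX}BV^i = e^{sX}V^i, and the reparametrization lemma
identifies this with e^{σ(s)δ}V^i. -/
theorem mem_symGroup_of_conj_mem (hspan : m = Submodule.span 𝕜 {δ}) (h0 : δ ≠ 0)
    (hδ : δ ∈ homDeg 𝒱 (-1)) {B : V ≃L[𝕜] V} (hB : B ∈ modelPlus J G 𝒱) {X : V →L[𝕜] V}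
    (hX : X ∈ fullProlong 𝒱 J G m) (hBX : (B : V →L[𝕜] V) * δ = X * (B : V →L[𝕜] V)) :
    B ∈ symGroup 𝒱 J G m := by
  obtain ⟨σ, hσ, hσ0, hσX⟩ := exists_reparametrization hspan h0 hδ hX
  refine ⟨hB, fun ε hε => ?_⟩
  obtain ⟨a, rfl⟩ := Submodule.mem_span_singleton.1 (hspan.le hε)
  have hlin : ContDiff 𝕜 ∞ fun s : 𝕜 => a * s := contDiff_const.mul contDiff_id
  have hlin0 : a * (0 : 𝕜) = 0 := mul_zero a
  -- The parameter is rescaled for ε = aδ. For a = 0 the convention 0⁻¹ = 0 gives the zero function,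
  -- which suits the constant curve.
  refine ⟨fun s => a⁻¹ * σ (a * s), ?_, by simp [hσ0], ?_⟩
  · refine contDiffAt_const.mul (ContDiffAt.comp (0 : 𝕜) ?_ hlin.contDiffAt)
    rwa [hlin0]
  have h1 : ∀ᶠ s in 𝓝 (0 : 𝕜), exp (-(σ (a * s) • δ)) * exp ((a * s) • X) ∈ homFilt 𝒱 0 := by
    have h2 := hlin.continuous.tendsto 0
    rw [hlin0] at h2
    exact h2.eventually hσX
  filter_upwards [h1] with s hs i
  have h3 : (a⁻¹ * σ (a * s)) • a • δ = σ (a * s) • δ := by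
    rw [smul_smul]
    rcases eq_or_ne a 0 with rfl | ha
    · simp [hσ0]
    · rw [mul_comm, mul_inv_cancel_left₀ ha]
  have h4 : (B : V →L[𝕜] V) * exp (s • a • δ) = exp ((a * s) • X) * (B : V →L[𝕜] V) := by
    have e1 : (B : V →L[𝕜] V) * (B.symm : V →L[𝕜] V) = 1 := by ext x; simp
    have e2 : (B.symm : V →L[𝕜] V) * (B : V →L[𝕜] V) = 1 := by ext x; simp
    let U : (V →L[𝕜] V)ˣ := ⟨B, B.symm, e1, e2⟩
    have h5 : (U : V →L[𝕜] V) * (s • a • δ) * ((U⁻¹ : (V →L[𝕜] V)ˣ) : V →L[𝕜] V) = (a * s) • X := by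
      change (B : V →L[𝕜] V) * (s • a • δ) * (B.symm : V →L[𝕜] V) = (a * s) • X
      rw [smul_smul, mul_comm s a, mul_smul_comm, smul_mul_assoc, hBX, mul_assoc, e1, mul_one]
    let := NormedAlgebra.restrictScalars ℚ 𝕜 (V →L[𝕜] V)
    have h6 := NormedSpace.exp_units_conj U (s • a • δ)
    rw [h5] at h6
    rw [h6]
    change _ = (B : V →L[𝕜] V) * exp (s • a • δ) * (B.symm : V →L[𝕜] V) * (B : V →L[𝕜] V)
    rw [mul_assoc, e2, mul_one]
  rw [h3, ← Submodule.map_comp]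
  have h5 : (B : V →L[𝕜] V).toLinearMap ∘ₗ (exp (s • a • δ)).toLinearMap =
      (exp ((a * s) • X)).toLinearMap ∘ₗ (B : V →L[𝕜] V).toLinearMap :=
    congrArg ContinuousLinearMap.toLinearMap h4
  rw [h5, Submodule.map_comp, hB.2 i]
  set g := exp (-(σ (a * s) • δ)) * exp ((a * s) • X) with hg
  have hgi : exp (-((a * s) • X)) * exp (σ (a * s) • δ) * g = 1 := by
    rw [hg, mul_assoc, ← mul_assoc (exp (σ (a * s) • δ)), exp_mul_exp_neg 𝕜, one_mul,
      exp_neg_mul_exp 𝕜]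
  have hinv : exp (-((a * s) • X)) * exp (σ (a * s) • δ) ∈ homFilt 𝒱 0 :=
    mem_subalgebra_of_mul_eq_one (S := filtAlgebra 𝒱) hs hgi
  refine map_filt_eq_iff.2 ⟨fun v hv => ⟨g v, ?_, ?_⟩, fun v hv =>
    ⟨(exp (-((a * s) • X)) * exp (σ (a * s) • δ)) v, ?_, ?_⟩⟩
  · simpa using hs i v hv
  · have h6 : exp (σ (a * s) • δ) * g = exp ((a * s) • X) := by
      rw [hg, ← mul_assoc, exp_mul_exp_neg 𝕜, one_mul]
    exact DFunLike.congr_fun h6 v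
  · simpa using hinv i v hv
  · have h6 : exp ((a * s) • X) * (exp (-((a * s) • X)) * exp (σ (a * s) • δ)) =
        exp (σ (a * s) • δ) := by
      rw [← mul_assoc, exp_mul_exp_neg 𝕜, one_mul]
    exact DFunLike.congr_fun h6 v

theorem trans_mem_symGroup {A B : V ≃L[𝕜] V} (hA : A ∈ symGroup 𝒱 J G m)
    (hB : B ∈ symGroup 𝒱 J G m) : A.trans B ∈ symGroup 𝒱 J G m := by
  refine ⟨⟨trans_mem_modelGroup J G hA.1.1 hB.1.1, fun i => ?_⟩, fun ε hε => ?_⟩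
  · have h1 : ((A.trans B : V ≃L[𝕜] V) : V →L[𝕜] V).toLinearMap =
        (B : V →L[𝕜] V).toLinearMap ∘ₗ (A : V →L[𝕜] V).toLinearMap := rfl
    rw [h1, Submodule.map_comp, hA.1.2, hB.1.2]
  · obtain ⟨σ, hσ, hσ0, h1⟩ := hA.2 ε hε
    obtain ⟨τ, hτ, hτ0, h2⟩ := hB.2 ε hε
    refine ⟨τ ∘ σ, ContDiffAt.comp (0 : 𝕜) (by rwa [hσ0]) hσ, by simp [hσ0, hτ0], ?_⟩
    have h3 : ∀ᶠ s in 𝓝 (0 : 𝕜), ∀ i,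
        ((filt 𝒱 i).map (exp (σ s • ε)).toLinearMap).map (B : V →L[𝕜] V).toLinearMap =
          (filt 𝒱 i).map (exp (τ (σ s) • ε)).toLinearMap := by
      have h4 := hσ.continuousAt.tendsto
      rw [hσ0] at h4
      exact h4.eventually h2
    filter_upwards [h1, h3] with s h4 h5 i
    have h6 : ((A.trans B : V ≃L[𝕜] V) : V →L[𝕜] V).toLinearMap =
        (B : V →L[𝕜] V).toLinearMap ∘ₗ (A : V →L[𝕜] V).toLinearMap := rfl
    rw [h6, Submodule.map_comp, h4 i, h5 i]
    rfl

/-- The conjugate y(s) satisfies y' = [y, δ]. If its component of degree n-1 lies in 𝔲_{n-1} for all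
nearby s, then differentiation puts [y_n, δ] there, so y_n ∈ 𝔲_n. Hence the hypothesis on a
neighbourhood of s = 0. -/
theorem mem_fullProlong_of_eventually (hM : IsExpGroup (opSet (modelGroup J G)) (modelLie J G))
    (hgr : IsGradedLie J G 𝒱) (hspan : m = Submodule.span 𝕜 {δ}) (hδ : δ ∈ lieDeg J G 𝒱 (-1))
    {Y : V →L[𝕜] V} (hY : Y ∈ modelLie J G)
    (h : ∀ᶠ s in 𝓝 (0 : 𝕜), exp (-(s • δ)) * Y * exp (s • δ) ∈ homFilt 𝒱 (-1) ∧
      degPart 𝒱 (-1) (exp (-(s • δ)) * Y * exp (s • δ)) ∈ m) : Y ∈ fullProlong 𝒱 J G m := by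
  let y : 𝕜 → (V →L[𝕜] V) := fun s => exp (-(s • δ)) * Y * exp (s • δ)
  have hyl : ∀ s, y s ∈ modelLie J G := fun s => by
    have hs := Submodule.smul_mem _ s hδ.1
    exact hM.conj_mem (hM.exp_mem _ (neg_mem hs)) (hM.exp_mem _ hs) (exp_neg_mul_exp 𝕜 _) hY
  have hy0 : y 0 = Y := by
    change exp (-((0 : 𝕜) • δ)) * Y * exp ((0 : 𝕜) • δ) = Y
    rw [zero_smul, neg_zero, NormedSpace.exp_zero, one_mul, mul_one]
  have key : ∀ n : ℕ, ∀ᶠ s in 𝓝 (0 : 𝕜), degPart 𝒱 ((n : ℤ) - 1) (y s) ∈ prolong 𝒱 J G m n := by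
    intro n
    induction n with
    | zero =>
      filter_upwards [h] with s hs
      rw [Nat.cast_zero, zero_sub]
      exact hs.2
    | succ n ih =>
      filter_upwards [ih.eventually_nhds] with s hs
      let d := LinearMap.toContinuousLinearMap (degPart 𝒱 ((n : ℤ) - 1))
      have h1 := d.hasFDerivAt.comp_hasDerivAt s (hasDerivAt_exp_neg_mul_mul_exp δ Y s)
      have h2 := HasDerivAt.mem_submodule h1 hs
      change degPart 𝒱 ((n : ℤ) - 1) (y s * δ - δ * y s) ∈ _ at h2
      rw [← neg_sub (δ * y s) (y s * δ), map_neg, sub_eq_neg_add (n : ℤ) 1,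
        degPart_comm_of_mem 𝒱 hδ.2, neg_sub] at h2
      rw [Nat.cast_succ, add_sub_cancel_right]
      refine ⟨degPart_mem_lieDeg 𝒱 hgr (hyl s) n, fun ε hε => ?_⟩
      obtain ⟨a, rfl⟩ := Submodule.mem_span_singleton.1 (hspan.le hε)
      have h3 := Submodule.smul_mem _ a h2
      rwa [smul_sub, ← mul_smul_comm, ← smul_mul_assoc] at h3
  rw [← hy0]
  exact ⟨h.self_of_nhds.1, fun n => (key n).self_of_nhds⟩

/-- For small s the operator g = e^{-sδ}B⁻¹e^{σ(s)δ} and its inverse preserve the filtration, hence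
so does g' g⁻¹ = σ'y - δ with y = Ad(e^{-sδ}B⁻¹)δ. Here σ' ≠ 0, as δ itself is not filtered, and so
y is δ/σ' modulo filtered operators. -/
theorem conj_mem_of_mem_symGroup (hM : IsExpGroup (opSet (modelGroup J G)) (modelLie J G))
    (hgr : IsGradedLie J G 𝒱) (hspan : m = Submodule.span 𝕜 {δ}) (h0 : δ ≠ 0)
    (hδ : δ ∈ lieDeg J G 𝒱 (-1)) {B : V ≃L[𝕜] V} (hB : B ∈ symGroup 𝒱 J G m) :
    (B.symm : V →L[𝕜] V) * δ * (B : V →L[𝕜] V) ∈ fullProlong 𝒱 J G m := by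
  obtain ⟨σ, hσ, hσ0, hσB⟩ := hB.2 δ (hspan.ge (Submodule.mem_span_singleton_self δ))
  set b : V →L[𝕜] V := (B.symm : V →L[𝕜] V)
  set B' : V →L[𝕜] V := (B : V →L[𝕜] V)
  have e1 : B' * b = 1 := by ext x; simp [B', b]
  have e2 : b * B' = 1 := by ext x; simp [B', b]
  refine mem_fullProlong_of_eventually hM hgr hspan hδ
    (hM.conj_mem ⟨B.symm, symm_mem_modelGroup J G hB.1.1, rfl⟩ ⟨B, hB.1.1, rfl⟩ e2 hδ.1) ?_
  let g : 𝕜 → (V →L[𝕜] V) := fun s => exp (-(s • δ)) * b * exp (σ s • δ)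
  let y : 𝕜 → (V →L[𝕜] V) := fun s => exp (-(s • δ)) * (b * δ * B') * exp (s • δ)
  have hg : ∀ᶠ s in 𝓝 (0 : 𝕜), g s ∈ homFilt 𝒱 0 ∧
      exp (-(σ s • δ)) * B' * exp (s • δ) ∈ homFilt 𝒱 0 := by
    filter_upwards [hσB] with s hs
    have h1 : ∀ x : V →L[𝕜] V, ∀ v, exp (-x) (exp x v) = v := fun x v =>
      DFunLike.congr_fun (exp_neg_mul_exp 𝕜 x) v
    constructor
    · intro i v hv
      rw [add_zero]
      have h2 : exp (σ s • δ) v ∈ (filt 𝒱 i).map (exp (σ s • δ)).toLinearMap := ⟨v, hv, rfl⟩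
      rw [← hs i] at h2
      obtain ⟨_, ⟨w, hw, rfl⟩, hwv⟩ := h2
      have h3 : g s v = w := by
        change exp (-(s • δ)) (B.symm (exp (σ s • δ) v)) = w
        rw [← hwv]
        change exp (-(s • δ)) (B.symm (B (exp (s • δ) w))) = w
        rw [B.symm_apply_apply, h1]
      rwa [h3]
    · intro i v hv
      rw [add_zero]
      have h2 : B (exp (s • δ) v) ∈ ((filt 𝒱 i).map (exp (s • δ)).toLinearMap).map
          (B : V →L[𝕜] V).toLinearMap := ⟨_, ⟨v, hv, rfl⟩, rfl⟩
      rw [hs i] at h2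
      obtain ⟨w, hw, hwv⟩ := h2
      change exp (-(σ s • δ)) (B (exp (s • δ) v)) ∈ _
      rw [← hwv]
      change exp (-(σ s • δ)) (exp (σ s • δ) w) ∈ _
      rwa [h1]
  have hσd : ∀ᶠ s in 𝓝 (0 : 𝕜), DifferentiableAt 𝕜 σ s := by
    have h1 : ContDiffAt 𝕜 1 σ 0 := hσ.of_le (by norm_cast)
    filter_upwards [h1.eventually (by simp)] with s hs using hs.differentiableAt (by simp)
  filter_upwards [hg.eventually_nhds, hσd] with s hs hsd
  have h1 : HasDerivAt g ((deriv σ s • y s - δ) * g s) s := by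
    have h2 := HasDerivAt.scomp s (hasDerivAt_exp_smul_const' (𝕂 := 𝕜) δ (σ s)) hsd.hasDerivAt
    have h3 := hasDerivAt_exp_smul_const' (𝕂 := 𝕜) (-δ) s
    simp only [smul_neg] at h3
    refine ((h3.mul_const b).mul h2).congr_deriv ?_
    have h4 : exp (-(s • δ)) * b * (δ * exp (σ s • δ)) = y s * g s := by
      have h5 : y s * g s = exp (-(s • δ)) * b * δ *
          (B' * (exp (s • δ) * exp (-(s • δ))) * b) * exp (σ s • δ) := by
        simp only [y, g, mul_assoc]
      rw [h5, exp_mul_exp_neg 𝕜, mul_one, e1, mul_one, mul_assoc _ δ]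
    rw [mul_smul_comm]
    change -δ * exp (-(s • δ)) * b * exp (σ s • δ) +
      deriv σ s • (exp (-(s • δ)) * b * (δ * exp (σ s • δ))) = _
    rw [h4, sub_mul, smul_mul_assoc, neg_mul, neg_mul, neg_mul, add_comm, ← sub_eq_add_neg]
    simp only [g, mul_assoc]
  have h2 := HasDerivAt.mem_submodule h1 (hs.mono fun s hs => hs.1)
  obtain ⟨-, h3⟩ := hs.self_of_nhds
  have h4 := homFilt_mul 𝒱 h2 h3
  have h5 : g s * (exp (-(σ s • δ)) * B' * exp (s • δ)) = 1 := by
    have h6 : g s * (exp (-(σ s • δ)) * B' * exp (s • δ)) = exp (-(s • δ)) *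
        (b * (exp (σ s • δ) * exp (-(σ s • δ))) * B') * exp (s • δ) := by
      simp only [g, mul_assoc]
    rw [h6, exp_mul_exp_neg 𝕜, mul_one, e2, mul_one, exp_neg_mul_exp 𝕜]
  rw [mul_assoc, h5, mul_one, add_zero] at h4
  have hδ1 : δ ∈ homFilt 𝒱 (-1) := homDeg_le_homFilt 𝒱 _ hδ.2
  have hσ' : deriv σ s ≠ 0 := by
    intro h6
    rw [h6, zero_smul, zero_sub] at h4
    have h7 := degPart_of_homFilt 𝒱 h4 (by norm_num : (-1 : ℤ) < 0)
    rw [map_neg, degPart_of_mem 𝒱 hδ.2, neg_eq_zero] at h7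
    exact h0 h7
  have h6 : y s = (deriv σ s)⁻¹ • (δ + (deriv σ s • y s - δ)) := by
    rw [add_sub_cancel, smul_smul, inv_mul_cancel₀ hσ', one_smul]
  change y s ∈ _ ∧ degPart 𝒱 (-1) (y s) ∈ m
  rw [h6]
  refine ⟨Submodule.smul_mem _ _ (add_mem hδ1 (homFilt_antitone 𝒱 (by norm_num) h4)), ?_⟩
  rw [map_smul, map_add, degPart_of_mem 𝒱 hδ.2, degPart_of_homFilt 𝒱 h4 (by norm_num), add_zero]
  exact Submodule.smul_mem _ _ (hspan.ge (Submodule.mem_span_singleton_self δ))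

end Symmetry

/-! ### The action of U_+(𝔪) on frames and cochains -/

section Principal

variable {𝕜 : Type*} [RCLike 𝕜]
variable {V : Type*} [NormedAddCommGroup V] [NormedSpace 𝕜 V]
variable {W : Type*} [NormedAddCommGroup W] [NormedSpace 𝕜 W]
variable {𝒱 : ℤ → Submodule 𝕜 V} {J : V ≃L[𝕜] W} {G : Subgroup (W ≃L[𝕜] W)}
variable {m : Submodule 𝕜 (V →L[𝕜] V)} {δ : V →L[𝕜] V}
variable [DirectSum.Decomposition 𝒱] [FiniteDimensional 𝕜 V] [CompleteSpace V]

theorem coe_mul_coe_symm (B : V ≃L[𝕜] V) :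
    (B : V →L[𝕜] V) * (B.symm : V →L[𝕜] V) = 1 := by ext x; simp

theorem coe_symm_mul_coe (B : V ≃L[𝕜] V) :
    (B.symm : V →L[𝕜] V) * (B : V →L[𝕜] V) = 1 := by ext x; simp

theorem mem_plusSet_of_mem_modelPlus {B : V ≃L[𝕜] V} (hB : B ∈ modelPlus J G 𝒱) :
    (B : V →L[𝕜] V) ∈ plusSet 𝒱 J G := by
  rw [← opSet_modelPlus]
  exact ⟨B, hB, rfl⟩

theorem mem_modelPlus_of_mem_plusSet {B : V ≃L[𝕜] V} (hB : (B : V →L[𝕜] V) ∈ plusSet 𝒱 J G) :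
    B ∈ modelPlus J G 𝒱 := by
  rw [← opSet_modelPlus] at hB
  obtain ⟨B', hB', h⟩ := hB
  rwa [← ContinuousLinearEquiv.coe_injective h]

theorem symm_mem_homFilt_zero {B : V ≃L[𝕜] V} (hB : (B : V →L[𝕜] V) ∈ homFilt 𝒱 0) :
    (B.symm : V →L[𝕜] V) ∈ homFilt 𝒱 0 :=
  mem_subalgebra_of_mul_eq_one (S := filtAlgebra 𝒱) hB (coe_symm_mul_coe B)

variable (hM : IsExpGroup (opSet (modelGroup J G)) (modelLie J G))
  (hgr : IsGradedLie J G 𝒱) (hspan : m = Submodule.span 𝕜 {δ}) (h0 : δ ≠ 0)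
  (hδ : δ ∈ lieDeg J G 𝒱 (-1))

include hM hspan h0 hδ in
-- The universal prolongation is stable under the bracket with u, hence under Ad(e^u), so it
-- contains Ad(e^u)δ.
theorem exp_mem_symGroup {j : ℕ} {u : V →L[𝕜] V} (hu : u ∈ prolong 𝒱 J G m (j + 1))
    {e : V ≃L[𝕜] V} (he : (e : V →L[𝕜] V) = exp u) : e ∈ symGroup 𝒱 J G m := by
  have hul : u ∈ lieFilt J G 𝒱 0 :=
    lieFilt_antitone 𝒱 J G (by lia) (lieDeg_le_lieFilt 𝒱 J G j hu.1)
  refine mem_symGroup_of_conj_mem hspan h0 hδ.2 (X := exp u * δ * exp (-u))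
    (mem_modelPlus_of_mem_plusSet ?_) ?_ ?_
  · rw [he]
    exact (isExpGroup_plusSet (𝒱 := 𝒱) hM).exp_mem _ hul
  · have hδm : δ ∈ m := hspan.ge (Submodule.mem_span_singleton_self δ)
    have h1 : δ ∈ fullProlong 𝒱 J G m :=
      mem_fullProlong_of_mem (by rw [hspan, Submodule.span_singleton_le_iff_mem]; exact hδ.2) hδm
    have h2 := exp_conj_mem_of_comm_mem (fun x hx => comm_mem_fullProlong hM hu hx) h1 (-1 : 𝕜)
    rwa [neg_smul, one_smul, neg_neg] at h2
  · rw [he, mul_assoc, exp_neg_mul_exp 𝕜, mul_one]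

include hM hgr hspan h0 hδ in
theorem exists_degPart_conj {B : V ≃L[𝕜] V} (hB : B ∈ symGroup 𝒱 J G m) : ∃ l : 𝕜, l ≠ 0 ∧
    degPart 𝒱 (-1) ((B.symm : V →L[𝕜] V) * δ * (B : V →L[𝕜] V)) = l • δ ∧
    (B : V →L[𝕜] V) ∈ lineSet 𝒱 J G δ := by
  have h1 := (conj_mem_of_mem_symGroup hM hgr hspan h0 hδ hB).2 0
  rw [Nat.cast_zero, zero_sub] at h1
  obtain ⟨l, hl⟩ := Submodule.mem_span_singleton.1 (hspan.le h1)
  have hBp := mem_plusSet_of_mem_modelPlus hB.1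
  have hbp := symm_mem_homFilt_zero hBp.2
  have h2 := hl
  rw [(homFilt_conj hBp.2 hbp (homDeg_le_homFilt 𝒱 _ hδ.2)).2, degPart_of_mem 𝒱 hδ.2] at h2
  have h3 := degPart_zero_mul_eq_one hBp.2 hbp (coe_mul_coe_symm B)
  set B₀ := degPart 𝒱 0 (B : V →L[𝕜] V)
  set b₀ := degPart 𝒱 0 (B.symm : V →L[𝕜] V)
  have h4 : δ * B₀ = l • (B₀ * δ) := by
    rw [← mul_smul_comm, h2, ← mul_assoc, ← mul_assoc, h3, one_mul]
  have hl0 : l ≠ 0 := by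
    rintro rfl
    rw [zero_smul] at h4
    exact h0 (by rw [← mul_one δ, ← h3, ← mul_assoc, h4, zero_mul])
  refine ⟨l, hl0, hl.symm, hBp, l⁻¹, ?_⟩
  rw [h4, smul_smul, inv_mul_cancel₀ hl0, one_smul]

include hM hgr hspan h0 hδ in
/-- An invariant normalization condition is preserved by the adjoint action. -/
theorem IsInvariant.conj_mem {N : Submodule 𝕜 (m →ₗ[𝕜] (V →L[𝕜] V))}
    (hN : IsInvariant 𝒱 J G m N) (hδm : δ ∈ m) {B : V ≃L[𝕜] V} (hB : B ∈ symGroup 𝒱 J G m)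
    {x : V →L[𝕜] V} (hx : x ∈ N.map (evalAt hδm)) :
    (B.symm : V →L[𝕜] V) * x * (B : V →L[𝕜] V) ∈ N.map (evalAt hδm) := by
  obtain ⟨l, hl0, hl, -⟩ := exists_degPart_conj hM hgr hspan h0 hδ hB
  let C : (V →L[𝕜] V) →ₗ[𝕜] (V →L[𝕜] V) :=
    LinearMap.mulLeft 𝕜 (B : V →L[𝕜] V) ∘ₗ LinearMap.mulRight 𝕜 (B.symm : V →L[𝕜] V)
  have hC : ∀ x, C x = (B : V →L[𝕜] V) * (x * (B.symm : V →L[𝕜] V)) := fun _ => rfl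
  have hCinv : ∀ x, (B.symm : V →L[𝕜] V) * C x * (B : V →L[𝕜] V) = x := fun x => by
    rw [hC, ← mul_assoc, coe_symm_mul_coe, one_mul, mul_assoc, coe_symm_mul_coe, mul_one]
  have hinj : Function.Injective C := fun x y h => by rw [← hCinv x, h, hCinv y]
  -- On values at δ the action of B is Ad B times the factor l by which (Ad B⁻¹)δ rescales δ in
  -- degree -1.
  have hle : (N.map (evalAt hδm)).map C ≤ N.map (evalAt hδm) := by
    rintro _ ⟨_, ⟨c, hc, rfl⟩, rfl⟩
    have h1 : l • (C ∘ₗ c) ∈ N := by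
      refine hN B hB c hc _ fun ε => ?_
      obtain ⟨a, ha⟩ := Submodule.mem_span_singleton.1 (hspan.le ε.2)
      refine ⟨l • ε, ?_, ?_⟩
      · change l • (ε : V →L[𝕜] V) =
          degPart 𝒱 (-1) ((B.symm : V →L[𝕜] V) * ((ε : V →L[𝕜] V) * (B : V →L[𝕜] V)))
        rw [← ha, smul_mul_assoc, mul_smul_comm, ← mul_assoc, map_smul, hl, smul_comm]
      · rw [map_smul]
        change l • C (c ε) = C (l • c ε)
        rw [map_smul]
    have h2 := Submodule.mem_map_of_mem (f := evalAt hδm) h1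
    rw [map_smul] at h2
    exact (Submodule.smul_mem_iff _ hl0).1 h2
  -- By dimension the inclusion is an equality, which gives the statement for B⁻¹ without asking
  -- whether it belongs to the group.
  have heq := Submodule.eq_of_le_of_finrank_eq hle
    (Submodule.equivMapOfInjective C hinj _).finrank_eq.symm
  rw [← heq] at hx
  obtain ⟨y, hy, rfl⟩ := hx
  rw [hCinv]
  exact hy

theorem rmul_mem_tangentAt {R : Set (𝕜 × (V →L[𝕜] W))} {B : V →L[𝕜] V}
    (hB : ∀ p ∈ R, rmul p B ∈ R) {p ξ : 𝕜 × (V →L[𝕜] W)} (hξ : ξ ∈ tangentAt 𝕜 R p) :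
    (ξ.1, ξ.2 ∘L B) ∈ tangentAt 𝕜 R (rmul p B) := by
  let L : 𝕜 × (V →L[𝕜] W) →L[𝕜] 𝕜 × (V →L[𝕜] W) :=
    (ContinuousLinearMap.fst 𝕜 𝕜 (V →L[𝕜] W)).prod
      ((ContinuousLinearMap.compL 𝕜 V V W).flip B ∘L ContinuousLinearMap.snd 𝕜 𝕜 (V →L[𝕜] W))
  have h1 := tangentAt_map (f := L) (M' := R) L.contDiff.contDiffAt
    (eventually_nhdsWithin_of_forall fun q hq => hB q hq) hξ
  rw [L.fderiv] at h1
  exact h1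

end Principal

/-! ### Stability under U_+(𝔪) and transitivity on fibres -/

section Principal

variable {𝕜 : Type*} [RCLike 𝕜]
variable {V : Type*} [NormedAddCommGroup V] [NormedSpace 𝕜 V]
variable {W : Type*} [NormedAddCommGroup W] [NormedSpace 𝕜 W]
variable {𝒱 : ℤ → Submodule 𝕜 V} {J : V ≃L[𝕜] W} {G : Subgroup (W ≃L[𝕜] W)}
variable {m : Submodule 𝕜 (V →L[𝕜] V)} {δ : V →L[𝕜] V}
variable [DirectSum.Decomposition 𝒱] [FiniteDimensional 𝕜 V] [CompleteSpace V]
variable {s : ℕ → Submodule 𝕜 (V →L[𝕜] V)}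
variable {S R : Set (𝕜 × (V →L[𝕜] W))} {k : ℕ} {v : 𝕜 × (V →L[𝕜] W) → (V →L[𝕜] V)}
variable {N : Submodule 𝕜 (m →ₗ[𝕜] (V →L[𝕜] V))}
variable (hδm : δ ∈ m) (hM : IsExpGroup (opSet (modelGroup J G)) (modelLie J G))
  (hgr : IsGradedLie J G 𝒱) (hS : IsFrameManifold 𝒱 J G m δ S)
  (hN : IsNormalForm 𝒱 J G m δ (N.map (evalAt hδm)) s)
  (hinv : IsInvariant 𝒱 J G m N)

include hM hN in
theorem mk_mem_tangentAt_of_mem_uPlus {R : Set (𝕜 × (V →L[𝕜] W))}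
    (hRB : ∀ p ∈ R, ∀ B ∈ symGroup 𝒱 J G m, rmul p (B : V →L[𝕜] V) ∈ R)
    {p : 𝕜 × (V →L[𝕜] W)} (hp : p ∈ R) {j : ℕ} {u : V →L[𝕜] V}
    (hu : u ∈ prolong 𝒱 J G m (j + 1)) : ((0 : 𝕜), p.2 ∘L u) ∈ tangentAt 𝕜 R p := by
  have h1 := mem_tangentAt_of_curve (M := R) (γ := fun r : 𝕜 => rmul p (exp (r • u)))
    (contDiff_rmul.comp (contDiff_const.prodMk
      ((contDiff_exp 𝕜).comp (contDiff_id.smul contDiff_const)))).contDiffAt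
    (Filter.Eventually.of_forall fun r => by
      obtain ⟨e, he⟩ := exists_equiv_exp (𝕜 := 𝕜) (r • u)
      rw [← he]
      exact hRB p hp e (exp_mem_symGroup hM hN.span hN.ne_zero hN.mem_lie
        (Submodule.smul_mem _ r hu) he))
    ((hasDerivAt_const (0 : 𝕜) p.1).prodMk
      ((ContinuousLinearMap.compL 𝕜 V V W p.2).hasFDerivAt.comp_hasDerivAt (0 : 𝕜)
        (hasDerivAt_exp_smul_zero u)))
  have h2 : rmul p (exp ((0 : 𝕜) • u)) = p := by
    rw [zero_smul, NormedSpace.exp_zero, rmul_one]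
  rw [h2] at h1
  exact h1

include hM hgr hS hN hinv in
/-- The successive normalizations are stable under `U_+(𝔪)` when the normalization condition is
invariant. -/
theorem rmul_mem_tower (hSB : ∀ p ∈ S, ∀ B ∈ lineSet 𝒱 J G δ, rmul p B ∈ S) (k : ℕ) :
    ∀ p ∈ tower 𝒱 (N.map (evalAt hδm)) S k, ∀ B ∈ symGroup 𝒱 J G m,
      rmul p (B : V →L[𝕜] V) ∈ tower 𝒱 (N.map (evalAt hδm)) S k := by
  have hδ := hN.mem_lie
  have hδ1 : δ ∈ homFilt 𝒱 (-1) := homDeg_le_homFilt 𝒱 _ hδ.2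
  induction k with
  | zero =>
    intro p hp B hB
    obtain ⟨-, -, -, h⟩ := exists_degPart_conj hM hgr hN.span hN.ne_zero hδ hB
    exact hSB p hp _ h
  | succ k ih =>
    rintro p ⟨hp, c, hc, hcN⟩ B hB
    obtain ⟨v, hv⟩ := exists_isReduction_tower hN hS hM hgr k
    have hq := ih p hp B hB
    refine ⟨hq, ?_⟩
    obtain ⟨μ, hμ0, hμ, -⟩ := exists_degPart_conj hM hgr hN.span hN.ne_zero hδ hB
    have hX := conj_mem_of_mem_symGroup hM hgr hN.span hN.ne_zero hδ hB
    obtain ⟨hcl, ⟨l, hl, -⟩, -⟩ := hS.tangent p (hv.subset hp) 1 c (hv.tangentAt_le hc)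
    have hBf := (mem_plusSet_of_mem_modelPlus hB.1).2
    have hbf := symm_mem_homFilt_zero hBf
    set b : V →L[𝕜] V := (B.symm : V →L[𝕜] V)
    set B' : V →L[𝕜] V := (B : V →L[𝕜] V)
    set X := b * δ * B'
    have e1 : B' * b = 1 := coe_mul_coe_symm B
    -- the velocity at the translated point
    have hcq : ((1 : 𝕜), (rmul p B').2 ∘L (b * c * B')) ∈
        tangentAt 𝕜 (tower 𝒱 (N.map (evalAt hδm)) S k) (rmul p B') := by
      have h1 := rmul_mem_tangentAt (fun q hq => ih q hq B hB) hc
      have h2 : (rmul p B').2 ∘L (b * c * B') = (p.2 ∘L c) ∘L B' := by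
        change p.2 ∘L (B' * (b * c * B')) = p.2 ∘L (c * B')
        rw [← mul_assoc, ← mul_assoc, e1, one_mul]
      rw [h2]
      exact h1
    let T : Submodule 𝕜 (V →L[𝕜] V) :=
      (tangentAt 𝕜 (tower 𝒱 (N.map (evalAt hδm)) S k) (rmul p B')).comap
        (LinearMap.inr 𝕜 𝕜 (V →L[𝕜] W) ∘ₗ
          (ContinuousLinearMap.compL 𝕜 V V W (rmul p B').2).toLinearMap)
    -- The components of X = (Ad B⁻¹)δ of non-negative degree are in the 𝔲_j, whose exponentials are
    -- symmetries and keep the stage stable; so they are vertical tangent vectors.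
    have hwT : nonnegPart 𝒱 X ∈ T := by
      refine mem_of_forall_degPart 𝒱 fun i => ?_
      rw [degPart_nonnegPart]
      split_ifs with hi
      · obtain ⟨j, rfl⟩ := Int.eq_ofNat_of_zero_le hi
        have h1 := hX.2 (j + 1)
        rw [Nat.cast_succ, add_sub_cancel_right] at h1
        exact mk_mem_tangentAt_of_mem_uPlus hδm hM hN ih hq h1
      · exact zero_mem _
    have hwT' : ((0 : 𝕜), (rmul p B').2 ∘L nonnegPart 𝒱 X) ∈
        tangentAt 𝕜 (tower 𝒱 (N.map (evalAt hδm)) S k) (rmul p B') := hwT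
    let n := ∑ i ∈ Finset.range (k + 1), degPart 𝒱 (i : ℤ) c
    have hn : n ∈ N.map (evalAt hδm) := Submodule.sum_mem _ fun i hi =>
      hcN i (Nat.lt_succ_iff.1 (Finset.mem_range.1 hi))
    have hndeg : ∀ j : ℤ, degPart 𝒱 j n = if 0 ≤ j ∧ j ≤ k then degPart 𝒱 j c else 0 := by
      intro j
      simp only [n, map_sum, degPart_degPart]
      split_ifs with hj
      · obtain ⟨i, rfl⟩ := Int.eq_ofNat_of_zero_le hj.1
        rw [Finset.sum_eq_single_of_mem i (Finset.mem_range.2 (by lia))]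
        · rw [if_pos rfl]
        · intro i' _ hne
          rw [if_neg (by lia)]
      · refine Finset.sum_eq_zero fun i hi => if_neg ?_
        have := Finset.mem_range.1 hi
        lia
    have hr : c - l • δ - n ∈ homFilt 𝒱 (k + 1) := by
      refine (mem_homFilt_iff 𝒱).2 fun j hj => ?_
      rw [map_sub, map_sub, map_smul, hndeg]
      rcases lt_trichotomy j (-1) with h | rfl | h
      · rw [degPart_of_homFilt 𝒱 hcl.2 h, degPart_of_homFilt 𝒱 hδ1 h, if_neg (by lia)]
        simp
      · rw [hl, degPart_of_mem 𝒱 hδ.2, if_neg (by lia)]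
        simp
      · rw [degPart_of_mem_ne 𝒱 hδ.2 h.ne, if_pos (by lia)]
        simp
    refine ⟨b * c * B' - l • nonnegPart 𝒱 X, ?_, fun j hj => ?_⟩
    · have h1 := sub_mem hcq (Submodule.smul_mem _ l hwT')
      rw [Prod.smul_mk, Prod.mk_sub_mk, smul_zero, sub_zero, ← ContinuousLinearMap.comp_smul,
        ← ContinuousLinearMap.comp_sub] at h1
      exact h1
    -- With c = lδ + n + terms of degree above k, conjugation gives lX, a conjugate of n that is in
    -- 𝒩 by invariance, and terms still above k. Subtracting the vertical part of lX leaves only its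
    -- component of degree -1.
    · have h1 : b * c * B' - l • nonnegPart 𝒱 X =
          l • degPart 𝒱 (-1) X + b * n * B' + b * (c - l • δ - n) * B' := by
        have h2 : degPart 𝒱 (-1) X = X - nonnegPart 𝒱 X :=
          eq_sub_of_add_eq (degPart_neg_one_add_nonnegPart 𝒱 hX.1)
        have h3 : b * (c - l • δ - n) * B' = b * c * B' - l • X - b * n * B' := by
          simp only [mul_sub, sub_mul, mul_smul_comm, smul_mul_assoc, X]
        rw [h2, h3, smul_sub]
        abel
      have h4 := (homFilt_conj hBf hbf hr).1
      rw [h1, map_add, map_add, map_smul, degPart_degPart, if_neg (by lia), smul_zero, zero_add,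
        degPart_of_homFilt 𝒱 h4 (by lia), add_zero]
      exact hN.graded _ (hinv.conj_mem hM hgr hN.span hN.ne_zero hδ hδm hB hn) _

include hM hN hS hgr in
/-- Positive elements that move a point of a normalization to another one are symmetries. -/
theorem IsReduction.exists_symGroup_of_rmul_exp_mem
    (hR : IsReduction 𝒱 J G m (N.map (evalAt hδm)) s S R k v)
    (hk : ∀ i : ℤ, (k : ℤ) ≤ |i| → ∀ x, degPart 𝒱 i x = 0)
    (hRB : ∀ p ∈ R, ∀ B ∈ symGroup 𝒱 J G m, rmul p (B : V →L[𝕜] V) ∈ R)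
    {p : 𝕜 × (V →L[𝕜] W)} (hp : p ∈ R) {x : V →L[𝕜] V} (hx : x ∈ lieFilt J G 𝒱 1)
    (hpx : rmul p (exp x) ∈ R) : ∃ e ∈ symGroup 𝒱 J G m, (e : V →L[𝕜] V) = exp x := by
  have hδ := hN.mem_lie
  -- Induction on the number i of degrees left. The leading component of x is in 𝔲_j, so its
  -- exponential is a symmetry and can be split off on the left, leaving a factor of degree at least
  -- j+1.
  have key : ∀ i j : ℕ, 1 ≤ j → k + 1 ≤ j + i → ∀ p ∈ R, ∀ x ∈ lieFilt J G 𝒱 j,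
      rmul p (exp x) ∈ R → ∃ e ∈ symGroup 𝒱 J G m, (e : V →L[𝕜] V) = exp x := by
    intro i
    induction i with
    | zero =>
      intro j _ hj p _ x hx _
      have h1 := homFilt_eq_bot_of_le 𝒱 hk (by lia) hx.2
      obtain ⟨e, he⟩ := exists_equiv_exp (𝕜 := 𝕜) x
      refine ⟨e, exp_mem_symGroup (j := 0) hM hN.span hN.ne_zero hδ ?_ he, he⟩
      rw [h1]
      exact zero_mem _
    | succ i ih =>
      intro j hj hij p hp x hx hpx
      by_cases hjk : j ≤ k
      swap
      · exact ih j hj (by lia) p hp x hx hpx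
      have hxj := hR.lead p hp j hj hjk x hx hpx
      obtain ⟨e₁, he₁⟩ := exists_equiv_exp (𝕜 := 𝕜) (degPart 𝒱 (j : ℤ) x)
      have he₁s := exp_mem_symGroup hM hN.span hN.ne_zero hδ hxj he₁
      have hxjf := homDeg_le_homFilt 𝒱 _ hxj.1.2
      obtain ⟨y, hy, hy1, hxy, -⟩ := exists_exp_eq_exp_mul 𝒱 hM (j := (j : ℤ) + 1) (by lia)
        hxj.1.1 (homFilt_antitone 𝒱 (by lia) hxjf) hx.1 (homFilt_antitone 𝒱 (by lia) hx.2)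
        (sub_degPart_mem 𝒱 hx.2)
      have hp₁ := hRB p hp e₁ he₁s
      rw [he₁] at hp₁
      obtain ⟨e₂, he₂s, he₂⟩ := ih (j + 1) (by lia) (by lia) _ hp₁ y ⟨hy, by exact_mod_cast hy1⟩
        (by rw [rmul_rmul, ← hxy]; exact hpx)
      refine ⟨e₂.trans e₁, trans_mem_symGroup he₂s he₁s, ?_⟩
      change (e₁ : V →L[𝕜] V) * (e₂ : V →L[𝕜] V) = exp x
      rw [he₁, he₂, hxy]
  exact key k 1 le_rfl (by lia) p hp x (by exact_mod_cast hx) hpx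

include hM hN hS hgr in
-- Two frames of a fibre differ by B whose degree 0 part preserves the line of δ. In the splitting B
-- = B₀e^x that part is B₀, which sends δ to a multiple of itself and is a symmetry; then e^x moves
-- one point of `R` to another and is a symmetry as well.
theorem IsReduction.framesIn_eq_orbit {D : Set 𝕜}
    (hF : ∀ t ∈ D, ∃ O A, t ∈ O ∧ O ⊆ D ∧ IsFrameSection 𝒱 J G δ S O A)
    (hK : IsExpGroup (lineSet 𝒱 J G δ) (lineLie 𝒱 J G m))
    (hR : IsReduction 𝒱 J G m (N.map (evalAt hδm)) s S R k v)
    (hk : ∀ i : ℤ, (k : ℤ) ≤ |i| → ∀ x, degPart 𝒱 i x = 0)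
    (hRB : ∀ p ∈ R, ∀ B ∈ symGroup 𝒱 J G m, rmul p (B : V →L[𝕜] V) ∈ R)
    (hsplit : PlusSplits J G 𝒱) : IsPrincipal 𝒱 J G D m (framesIn R) := by
  intro t ht ψ hψ
  have hδ := hN.mem_lie
  ext ψ'
  constructor
  swap
  · rintro ⟨B, hB, rfl⟩
    exact hRB _ hψ B hB
  intro hψ'
  obtain ⟨O, A, htO, -, hA⟩ := hF t ht
  have h1 := (hA.mem_iff _ htO).1 (hR.subset hψ)
  have h2 := (hA.mem_iff _ htO).1 (hR.subset hψ')
  obtain ⟨b, hb, hb1, hb2⟩ := hK.inv_mem _ h1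
  let B : V ≃L[𝕜] V := ψ'.trans ψ.symm
  have hBl : (B : V →L[𝕜] V) ∈ lineSet 𝒱 J G δ := by
    have h3 := hK.mul_mem _ hb _ h2
    have h4 : b * (((A t).symm : W →L[𝕜] V) ∘L (ψ' : V →L[𝕜] W)) = B := by
      have h5 : ((A t).symm : W →L[𝕜] V) ∘L (ψ' : V →L[𝕜] W) =
          (((A t).symm : W →L[𝕜] V) ∘L (ψ : V →L[𝕜] W)) * (B : V →L[𝕜] V) := by
        ext x; simp [B]
      rw [h5, ← mul_assoc]
      change b * (((A t).symm : W →L[𝕜] V) ∘L (ψ : V →L[𝕜] W)) * _ = _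
      rw [hb2, one_mul]
    rw [← h4]
    exact h3
  obtain ⟨B₀, hB₀, hB₀V, x, hx, hBx⟩ := hsplit B (mem_modelPlus_of_mem_plusSet hBl.1)
  have hB₀d : (B₀ : V →L[𝕜] V) ∈ homDeg 𝒱 0 := fun i y hy => by
    rw [add_zero, ← hB₀V i]
    exact ⟨y, hy, rfl⟩
  have hB₀0 : degPart 𝒱 0 (B : V →L[𝕜] V) = B₀ := by
    have hx0 := homFilt_antitone 𝒱 (by norm_num : (0 : ℤ) ≤ 1) hx.2
    rw [hBx]
    change degPart 𝒱 0 ((B₀ : V →L[𝕜] V) * exp x) = B₀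
    rw [degPart_zero_mul 𝒱 (homDeg_le_homFilt 𝒱 _ hB₀d) (exp_mem_homFilt_zero 𝒱 hx0),
      degPart_zero_exp 𝒱 hx0, degPart_of_homFilt 𝒱 hx.2 (by norm_num), NormedSpace.exp_zero,
      mul_one, degPart_of_mem 𝒱 hB₀d]
  obtain ⟨l, hl⟩ := hBl.2
  rw [hB₀0] at hl
  have hB₀m : B₀ ∈ modelPlus J G 𝒱 := ⟨hB₀,
    (mem_homFilt_zero_iff_map 𝒱 B₀).1 (homDeg_le_homFilt 𝒱 _ hB₀d)⟩
  have hX : l • δ ∈ fullProlong 𝒱 J G m := by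
    refine Submodule.smul_mem _ l (mem_fullProlong_of_mem ?_ hδm)
    rw [hN.span, Submodule.span_singleton_le_iff_mem]
    exact hδ.2
  have hB₀s : B₀ ∈ symGroup 𝒱 J G m :=
    mem_symGroup_of_conj_mem hN.span hN.ne_zero hδ.2 hB₀m hX (by rw [hl, smul_mul_assoc])
  have hψB : rmul (rmul (t, (ψ : V →L[𝕜] W)) (B₀ : V →L[𝕜] V)) (exp x) =
      (t, (ψ' : V →L[𝕜] W)) := by
    rw [rmul_rmul]
    refine Prod.ext rfl ?_
    change (ψ : V →L[𝕜] W) ∘L ((B₀ : V →L[𝕜] V) ∘L exp x) = ψ'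
    rw [← hBx]
    ext y
    simp [B]
  obtain ⟨e, he, hex⟩ := hR.exists_symGroup_of_rmul_exp_mem hδm hM hgr hS hN hk hRB
    (hRB _ hψ B₀ hB₀s) hx (by rw [hψB]; exact hψ')
  refine ⟨e.trans B₀, trans_mem_symGroup he hB₀s, ContinuousLinearEquiv.coe_injective ?_⟩
  have h3 : ((e.trans B₀ : V ≃L[𝕜] V) : V →L[𝕜] V) = B := by
    rw [hBx, ← hex]
    rfl
  change _ = (ψ : V →L[𝕜] W) ∘L ((e.trans B₀ : V ≃L[𝕜] V) : V →L[𝕜] V)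
  rw [h3]
  ext y
  simp [B]

end Principal

end FlagCurve

end

/-! ### The theorem on normalized moving frames -/

theorem theorem4p1 {𝕜 : Type*} [RCLike 𝕜]
    {V : Type*} [NormedAddCommGroup V] [NormedSpace 𝕜 V] [FiniteDimensional 𝕜 V]
    {W : Type*} [NormedAddCommGroup W] [NormedSpace 𝕜 W]
    (𝒱 : ℤ → Submodule 𝕜 V) [DirectSum.Decomposition 𝒱]
    (J : V ≃L[𝕜] W) (G : Subgroup (W ≃L[𝕜] W))
    (hG : FlagCurve.IsLieSubgroup G)
    (hgraded : FlagCurve.IsGradedLie J G 𝒱)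
    (D : Set 𝕜) (hD : IsOpen D) (Λ : 𝕜 → ℤ → Submodule 𝕜 W)
    (hΛ : FlagCurve.IsSmoothOrbitCurve 𝒱 J G D Λ)
    (hcompat : FlagCurve.IsCompatible D Λ)
    (m : Submodule 𝕜 (V →L[𝕜] V))
    (hm : Module.finrank 𝕜 m = 1) (hmdeg : m ≤ FlagCurve.lieDeg J G 𝒱 (-1))
    (hsymbol : ∀ t ∈ D, m ∈ FlagCurve.symbolAt 𝒱 J G Λ t)
    (N : Submodule 𝕜 (m →ₗ[𝕜] (V →L[𝕜] V)))
    (hN : FlagCurve.IsNormalization 𝒱 J G m N) :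
    ∃ (P : 𝕜 → Set (V ≃L[𝕜] W))
      (H : 𝕜 → (V ≃L[𝕜] W) → Submodule 𝕜 (𝕜 × (V →L[𝕜] W))),
      FlagCurve.IsNormalized 𝒱 J G D Λ m P H N ∧
      FlagCurve.IsComplete 𝒱 J G D Λ m P ∧
      (∀ P' H', FlagCurve.IsNormalized 𝒱 J G D Λ m P' H' N →
        ∀ t ∈ D, P' t ⊆ P t ∧ ∀ ψ ∈ P' t, H' t ψ = H t ψ) ∧
      (∀ P' H', FlagCurve.IsNormalized 𝒱 J G D Λ m P' H' N →
        FlagCurve.IsComplete 𝒱 J G D Λ m P' → ∀ t ∈ D, P' t = P t) ∧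
      (FlagCurve.IsInvariant 𝒱 J G m N → FlagCurve.PlusSplits J G 𝒱 →
        FlagCurve.IsPrincipal 𝒱 J G D m P) := by
  have := FiniteDimensional.complete 𝕜 V
  have : FiniteDimensional 𝕜 W := J.toLinearEquiv.finiteDimensional
  have := FiniteDimensional.complete 𝕜 W
  obtain ⟨⟨δ, hδ⟩, hδ0, hδm⟩ := finrank_eq_one_iff'.1 hm
  have h0 : δ ≠ 0 := fun h => hδ0 (Subtype.ext h)
  have hspan : m = Submodule.span 𝕜 {δ} := by
    refine le_antisymm (fun x hx => ?_) ((Submodule.span_singleton_le_iff_mem _ _).2 hδ)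
    obtain ⟨a, ha⟩ := hδm ⟨x, hx⟩
    exact Submodule.mem_span_singleton.2 ⟨a, congrArg Subtype.val ha⟩
  have hM := FlagCurve.isExpGroup_modelGroup J G hG
  have hK := FlagCurve.isExpGroup_lineSet hM hspan h0 hgraded
  have hF := fun t (ht : t ∈ D) =>
    FlagCurve.exists_isFrameSection hM hΛ hcompat hspan h0 hsymbol ht
  have hS := FlagCurve.isFrameManifold_of_sections hM hK
    (S := FlagCurve.totalSpace (FlagCurve.frameFiber 𝒱 J G Λ m) D) fun p hp => by
      obtain ⟨O, A, h1, -, h2⟩ := hF p.1 hp.1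
      exact ⟨O, A, h1, h2⟩
  obtain ⟨s, hN'⟩ := hN.exists_isNormalForm hδ hspan h0 hgraded hmdeg
  obtain ⟨R, n, v, hR, hn, hRt⟩ := FlagCurve.exists_isReduction_normal hN' hS hM hgraded
  obtain ⟨c, hc, hcR⟩ := hR.exists_normalized_connection hN' hS hM hn
  refine ⟨FlagCurve.framesIn R, FlagCurve.horizontalLine c,
    hR.isNormalized hF hδ hspan hN' hS hM hK hn hsymbol hc fun p hp =>
      ⟨(hcR p hp).1, (hcR p hp).2.1⟩,
    hR.isComplete hδ hS hN', fun P' H' hP' t ht => ?_, fun P' H' hP' hc' t ht => ?_,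
    fun hinv hsplit => ?_⟩
  · have hPR := FlagCurve.totalSpace_subset hδ hN hN' hRt hP'
    exact ⟨fun ψ hψ => hPR (FlagCurve.mem_totalSpace.2 ⟨ht, hψ⟩), fun ψ hψ =>
      hP'.eq_horizontalLine hδ hN hN' hPR (fun p hp => (hcR p hp).2.2) ht hψ⟩
  · exact hR.framesIn_eq hF hδ hN hN' hS hM hK hn hP' hc'
      (FlagCurve.totalSpace_subset hδ hN hN' hRt hP') ht
  · have hRB : ∀ p ∈ R, ∀ B ∈ FlagCurve.symGroup 𝒱 J G m,
        FlagCurve.rmul p (B : V →L[𝕜] V) ∈ R := by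
      rw [hRt]
      refine FlagCurve.rmul_mem_tower hδ hM hgraded hS hN' hinv (fun p hp B hB => ?_) n
      obtain ⟨O, A, hO, -, hA⟩ := hF p.1 hp.1
      exact hA.rmul_mem hK hO hp hB
    exact hR.framesIn_eq_orbit hδ hM hgraded hS hN' hF hK hn hRB hsplit
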